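/- Let $\Bbbk$ be a commutative ring. For a graded $\Bbbk$-quiver $\mathcal C$ write $s\mathcal C=\mathcal C[1]$, $T^ns\mathcal C(X,Y)=\bigoplus_{C_1,\dots,C_{n-1}}s\mathcal C(X,C_1)\otimes\dots\otimes s\mathcal C(C_{n-1},Y)$, $Ts\mathcal C=\bigoplus_{n\ge0}T^ns\mathcal C$ and $T^+s\mathcal C=\bigoplus_{n\ge1}T^ns\mathcal C$. Maps are written on the right, with the Koszul rule $(x\otimes y)(f\otimes g)=(-1)^{\deg y\deg f}xf\otimes yg$. An $A_\infty$-category is a graded quiver $\mathcal C$ with a coderivation $b$ of $Ts\mathcal C$ of degree $1$ with components $b_n:T^ns\mathcal C\to s\mathcal C$, $b_0=0$, such that $b^2=0$. An $A_\infty$-functor is a degree $0$ cocategory homomorphism $f:Ts\mathcal A\to Ts\mathcal B$ with $f_0=0$ and $fb=bf$; it is strict if $f_n=0$ for $n>1$. A natural $A_\infty$-transformation $r:f\to g$ is an $(f,g)$-coderivation of degree $-1$ with $rb+br=0$. We write $r\equiv r'$ if $r-r'=vb-bv$ for some $(f,g)$-coderivation $v$ of degree $-2$. For $r:f\to g$ and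 $q:g\to h$, $(r\otimes q)B_2$ is the transformation $f\to h$ with components $\sum(f_{a_1}\otimes\dots\otimes f_{a_\alpha}\otimes r_i\otimes g_{c_1}\otimes\dots\otimes g_{c_\beta}\otimes q_j\otimes h_{e_1}\otimes\dots\otimes h_{e_\gamma})b_{\alpha+\beta+\gamma+2}$. A unit transformation of $\mathcal C$ is a natural $A_\infty$-transformation $\mathbf i^{\mathcal C}:\mathrm{id}\to\mathrm{id}$ with $(\mathbf i^{\mathcal C}\otimes\mathbf i^{\mathcal C})B_2\equiv\mathbf i^{\mathcal C}$ such that the maps $({}_X\mathbf i^{\mathcal C}_0\otimes1)b_2$ and $(1\otimes{}_Y\mathbf i^{\mathcal C}_0)b_2$ on $(s\mathcal C(X,Y),b_1)$ are homotopy invertible for all objects $X,Y$; $\mathcal C$ is unital if it has one. An $A_\infty$-functor $f:\mathcal A\to\mathcal B$ between unital $A_\infty$-categories is unital if $\mathbf i^{\mathcal A}f\equiv f\mathbf i^{\mathcal B}$. Two $A_\infty$-functors $f,g:\mathcal A\to\mathcal B$ to a unital $A_\infty$-category are isomorphic if there are natural $A_\infty$-transformations $r:f\to g$ and $q:g\to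 f$ with $(r\otimes q)B_2\equiv f\mathbf i^{\mathcal B}$ and $(q\otimes r)B_2\equiv g\mathbf i^{\mathcal B}$. Unital $A_\infty$-functors $f:\mathcal A\to\mathcal B$, $g:\mathcal B\to\mathcal A$ are quasi-inverse if $fg\cong\mathrm{id}_{\mathcal A}$ and $gf\cong\mathrm{id}_{\mathcal B}$, and unital $A_\infty$-categories are equivalent if such $f,g$ exist. An $A_\infty$-category is contractible if all complexes $(s\mathcal C(X,Y),b_1)$ are contractible. For a full subcategory $\mathcal F$ of an $A_\infty$-category $\mathcal E$ let $\mathsf D(\mathcal E|\mathcal F)$ have the objects of $\mathcal E$, the morphisms $$s\mathsf D(\mathcal E|\mathcal F)(X,Y)=\bigoplus_{n\ge1}\ \bigoplus_{C_1,\dots,C_{n-1}\in\mathcal F}s\mathcal E(X,C_1)\otimes s\mathcal E(C_1,C_2)\otimes\dots\otimes s\mathcal E(C_{n-1},Y)\subset T^+s\mathcal E(X,Y)$$ and the operations obtained by restricting $$\bar b_n=\mu^{(n)}b-(1\otimes\mu^{(n-1)}b)\mu-(\mu^{(n-1)}b\otimes1)\mu+(1\otimes\mu^{(n-2)}b\otimes1)\mu^{(3)}:(T^+s\mathcal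 E)^{\otimes n}\to T^+s\mathcal E\quad(n\ge2),\qquad\bar b_1=b,$$ where $\mu^{(n)}$ is the $n$-fold multiplication of the tensor algebra $T^+s\mathcal E$ and $\mu^{(0)}=0$. Let $\mathrm{ju}:\mathcal E\to\mathsf D(\mathcal E|\mathcal F)$ be the strict $A_\infty$-functor which is the identity on objects and whose first component is the direct summand embedding $s\mathcal E=T^1s\mathcal E\hookrightarrow s\mathsf D(\mathcal E|\mathcal F)$. **Proposition.** Let $\mathcal F$ be a contractible full subcategory of a unital $A_\infty$-category $\mathcal E$. Then $\mathsf D(\mathcal E|\mathcal F)$ is a unital $A_\infty$-category, $\mathrm{ju}$ is a unital $A_\infty$-functor, and there exists a unital $A_\infty$-functor $\pi:\mathsf D(\mathcal E|\mathcal F)\to\mathcal E$ quasi-inverse to $\mathrm{ju}$ such that $\mathrm{ju}\,\pi=\mathrm{id}_{\mathcal E}$ (first $\mathrm{ju}$, then $\pi$). In particular, $\mathsf D(\mathcal E|\mathcal F)$ is equivalent to $\mathcal E$. -/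

import Mathlib

universe w u v u₁ v₁ u₂ v₂ u₃ v₃

noncomputable section

namespace AInf

open scoped TensorProduct DirectSum

/-! ### Graded modules -/

section Graded

variable {k : Type w} [CommRing k] {M : Type v} [AddCommGroup M] [Module k M]
  {N : Type v₁} [AddCommGroup N] [Module k N]

/-- The map `x ↦ (x_d)_d` sending an element of a graded module to the family of its homogeneous
components. -/
def homComponents {𝒜 : ℤ → Submodule k M} (h : DirectSum.IsInternal 𝒜) :
    M →ₗ[k] ⨁ _ : ℤ, M :=
  (DirectSum.lmap fun d => (𝒜 d).subtype) ∘ₗ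
    (LinearEquiv.ofBijective (DirectSum.coeLinearMap 𝒜)
      (show Function.Bijective (DirectSum.coeLinearMap 𝒜) from h)).symm.toLinearMap

theorem homComponents_of_mem {𝒜 : ℤ → Submodule k M} (h : DirectSum.IsInternal 𝒜) {d : ℤ} {x : M}
    (hx : x ∈ 𝒜 d) : homComponents h x = DirectSum.lof k ℤ (fun _ => M) d x := by
  have : (LinearEquiv.ofBijective (DirectSum.coeLinearMap 𝒜)
      (show Function.Bijective (DirectSum.coeLinearMap 𝒜) from h)).symm x =
      DirectSum.lof k ℤ (fun i => 𝒜 i) d ⟨x, hx⟩ := by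
    rw [LinearEquiv.symm_apply_eq, LinearEquiv.ofBijective_apply, DirectSum.coeLinearMap_lof]
  simp [homComponents, this]

theorem isInternal_of_components {𝒜 : ℤ → Submodule k M} (htop : iSup 𝒜 = ⊤)
    (δ : M →ₗ[k] ⨁ _ : ℤ, M)
    (hδ : ∀ d, ∀ x ∈ 𝒜 d, δ x = DirectSum.lof k ℤ (fun _ => M) d x) :
    DirectSum.IsInternal 𝒜 := by
  constructor
  · have hcomp : δ ∘ₗ DirectSum.coeLinearMap 𝒜 = DirectSum.lmap fun d => (𝒜 d).subtype := by
      ext d x : 2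
      simp [hδ d x x.2]
    intro x y hxy
    have h2 : (DirectSum.lmap fun d => (𝒜 d).subtype) x =
        (DirectSum.lmap fun d => (𝒜 d).subtype) y := by
      rw [← hcomp]
      exact congrArg δ hxy
    refine DFinsupp.ext fun d => Subtype.ext ?_
    have h3 : (DirectSum.lmap fun d => (𝒜 d).subtype) x d =
        (DirectSum.lmap fun d => (𝒜 d).subtype) y d := by rw [h2]
    rw [DirectSum.lmap_apply, DirectSum.lmap_apply] at h3
    exact h3
  · have : LinearMap.range (DirectSum.coeLinearMap 𝒜) = ⊤ := by
      rw [← htop, Submodule.iSup_eq_range_dfinsupp_lsum]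
      rfl
    exact LinearMap.range_eq_top.mp this

/-- The Koszul sign operator `x ↦ (-1)^{p · deg x} x`. -/
def signMap {𝒜 : ℤ → Submodule k M} (h : DirectSum.IsInternal 𝒜) (p : ℤ) : M →ₗ[k] M :=
  (DirectSum.toModule k ℤ M fun d => ((((p * d).negOnePow : ℤˣ) : ℤ) • LinearMap.id)) ∘ₗ
    homComponents h

theorem signMap_of_mem {𝒜 : ℤ → Submodule k M} (h : DirectSum.IsInternal 𝒜) (p : ℤ) {d : ℤ} {x : M}
    (hx : x ∈ 𝒜 d) : signMap h p x = (((p * d).negOnePow : ℤˣ) : ℤ) • x := by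
  rw [signMap, LinearMap.comp_apply, homComponents_of_mem h hx, DirectSum.toModule_lof]
  rfl

theorem signMap_mem {𝒜 : ℤ → Submodule k M} (h : DirectSum.IsInternal 𝒜) (p : ℤ) {d : ℤ} {x : M}
    (hx : x ∈ 𝒜 d) : signMap h p x ∈ 𝒜 d := by
  rw [signMap_of_mem h p hx]
  exact zsmul_mem hx _

/-- The grading of a tensor product of graded modules. -/
def tensorGrade (𝒜 : ℤ → Submodule k M) (ℬ : ℤ → Submodule k N) (d : ℤ) :
    Submodule k (M ⊗[k] N) :=
  ⨆ e : ℤ, Submodule.map₂ (TensorProduct.mk k M N) (𝒜 e) (ℬ (d - e))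

theorem tmul_mem_tensorGrade {𝒜 : ℤ → Submodule k M} {ℬ : ℤ → Submodule k N} {d e : ℤ} {x : M}
    {y : N} (hx : x ∈ 𝒜 d) (hy : y ∈ ℬ e) : x ⊗ₜ[k] y ∈ tensorGrade 𝒜 ℬ (d + e) := by
  refine Submodule.mem_iSup_of_mem d (Submodule.apply_mem_map₂ _ hx ?_)
  simpa using hy

theorem isInternal_tensorGrade {𝒜 : ℤ → Submodule k M} {ℬ : ℤ → Submodule k N}
    (hA : DirectSum.IsInternal 𝒜) (hB : DirectSum.IsInternal ℬ) :
    DirectSum.IsInternal (tensorGrade 𝒜 ℬ) := by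
  let δ : M ⊗[k] N →ₗ[k] ⨁ _ : ℤ, M ⊗[k] N :=
    (DirectSum.toModule k (ℤ × ℤ) _ fun ij => DirectSum.lof k ℤ (fun _ => M ⊗[k] N) (ij.1 + ij.2)) ∘ₗ
      (TensorProduct.directSum k k (fun _ : ℤ => M) (fun _ : ℤ => N)).toLinearMap ∘ₗ
      TensorProduct.map (homComponents hA) (homComponents hB)
  refine isInternal_of_components ?_ δ ?_
  · rw [eq_top_iff, ← TensorProduct.span_tmul_eq_top, Submodule.span_le]
    rintro _ ⟨x, y, rfl⟩
    have hx : x ∈ iSup 𝒜 := by rw [hA.submodule_iSup_eq_top]; trivial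
    have hy : y ∈ iSup ℬ := by rw [hB.submodule_iSup_eq_top]; trivial
    have h := Submodule.apply_mem_map₂ (TensorProduct.mk k M N) hx hy
    rw [Submodule.map₂_iSup_left] at h
    simp only [Submodule.map₂_iSup_right] at h
    refine (show (⨆ i, ⨆ j, Submodule.map₂ (TensorProduct.mk k M N) (𝒜 i) (ℬ j)) ≤ _ from
      iSup_le fun i => iSup_le fun j => ?_) h
    rw [Submodule.map₂_le]
    intro a ha b hb
    exact Submodule.mem_iSup_of_mem (i + j) (tmul_mem_tensorGrade ha hb)
  · intro d x hx
    suffices H : tensorGrade 𝒜 ℬ d ≤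
        LinearMap.eqLocus δ (DirectSum.lof k ℤ (fun _ => M ⊗[k] N) d) from H hx
    refine iSup_le fun e => ?_
    rw [Submodule.map₂_le]
    intro a ha b hb
    simp [δ, homComponents_of_mem hA ha, homComponents_of_mem hB hb,
      TensorProduct.directSum_lof_tmul_lof]

/-- The grading of a direct sum of graded modules. -/
def sumGrade {ι : Type u} {L : ι → Type v} [∀ i, AddCommGroup (L i)] [∀ i, Module k (L i)]
    (𝒜 : ∀ i, ℤ → Submodule k (L i)) (d : ℤ) : Submodule k (⨁ i, L i) where
  carrier := {x | ∀ i, x i ∈ 𝒜 i d}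
  add_mem' hx hy i := by simpa using add_mem (hx i) (hy i)
  zero_mem' i := by simp
  smul_mem' c x hx i := by
    rw [DirectSum.smul_apply]
    exact Submodule.smul_mem _ c (hx i)

section Sum

variable {ι : Type u} [DecidableEq ι] {L : ι → Type v} [∀ i, AddCommGroup (L i)]
  [∀ i, Module k (L i)] {𝒜 : ∀ i, ℤ → Submodule k (L i)}

theorem lof_mem_sumGrade {i : ι} {d : ℤ} {x : L i} (hx : x ∈ 𝒜 i d) :
    DirectSum.lof k ι L i x ∈ sumGrade 𝒜 d := by
  intro j
  rw [DirectSum.lof_eq_of]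
  by_cases h : i = j
  · subst h
    simpa using hx
  · rw [DirectSum.of_eq_of_ne _ _ _ (Ne.symm h)]
    exact zero_mem _

theorem sumGrade_le {d : ℤ} {S : Submodule k (⨁ i, L i)}
    (h : ∀ i, ∀ x ∈ 𝒜 i d, DirectSum.lof k ι L i x ∈ S) : sumGrade 𝒜 d ≤ S := by
  classical
  intro x hx
  rw [← DirectSum.sum_support_of x]
  exact Submodule.sum_mem _ fun i _ => h i _ (hx i)

theorem isInternal_sumGrade (h : ∀ i, DirectSum.IsInternal (𝒜 i)) :
    DirectSum.IsInternal (sumGrade 𝒜) := by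
  let δ : (⨁ i, L i) →ₗ[k] ⨁ _ : ℤ, ⨁ i, L i :=
    DirectSum.toModule k ι _ fun i =>
      (DirectSum.lmap fun _ => DirectSum.lof k ι L i) ∘ₗ homComponents (h i)
  refine isInternal_of_components ?_ δ ?_
  · rw [eq_top_iff]
    intro x _
    induction x using DirectSum.induction_on with
    | zero => exact zero_mem _
    | add x y hx hy => exact add_mem (hx trivial) (hy trivial)
    | of i x =>
      have hx : x ∈ iSup (𝒜 i) := by rw [(h i).submodule_iSup_eq_top]; trivial
      rw [← DirectSum.lof_eq_of k]
      induction hx using Submodule.iSup_induction' with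
      | mem d x hx => exact Submodule.mem_iSup_of_mem d (lof_mem_sumGrade hx)
      | zero => rw [map_zero]; exact zero_mem _
      | add x y _ _ hx hy => rw [map_add]; exact add_mem (hx trivial) (hy trivial)
  · intro d x hx
    suffices H : sumGrade 𝒜 d ≤
        LinearMap.eqLocus δ (DirectSum.lof k ℤ (fun _ => ⨁ i, L i) d) from H hx
    refine sumGrade_le fun i x hx => ?_
    simp [δ, homComponents_of_mem (h i) hx]

end Sum

end Graded

/-! ### Graded quivers and chains of composable elements -/

/-- A graded `k`-linear quiver, presented through its suspension: `shom X Y` is the graded module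
`s𝒞(X, Y) = 𝒞(X, Y)[1]`, so that `grade X Y d = (s𝒞)^d(X, Y) = 𝒞^{d+1}(X, Y)`. -/
structure GradedQuiver (k : Type w) [CommRing k] where
  Obj : Type u
  shom : Obj → Obj → Type v
  [instAddCommGroup : ∀ X Y, AddCommGroup (shom X Y)]
  [instModule : ∀ X Y, Module k (shom X Y)]
  grade : ∀ X Y, ℤ → Submodule k (shom X Y)
  isInternal : ∀ X Y, DirectSum.IsInternal (grade X Y)

attribute [instance] GradedQuiver.instAddCommGroup GradedQuiver.instModule

variable {k : Type w} [CommRing k]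

/-- The operator `x ↦ (-1)^{p · deg x} x` on `s𝒞(X, Y)`. -/
def GradedQuiver.sgn (Q : GradedQuiver.{w, u, v} k) (p : ℤ) (X Y : Q.Obj) :
    Q.shom X Y →ₗ[k] Q.shom X Y :=
  signMap (Q.isInternal X Y) p

/-- Chains `x₁ ⊗ x₂ ⊗ ⋯ ⊗ xₙ`, `n ≥ 0`, of composable elements of `s𝒞`: the pure tensors of
`Ts𝒞(X, Y)`. -/
inductive Chain (Q : GradedQuiver.{w, u, v} k) : Q.Obj → Q.Obj → Type (max u v)
  | nil (X : Q.Obj) : Chain Q X X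
  | cons {X Y Z : Q.Obj} (x : Q.shom X Y) (c : Chain Q Y Z) : Chain Q X Z

namespace Chain

variable {Q : GradedQuiver.{w, u, v} k} {R : GradedQuiver.{w, u₁, v₁} k}

/-- The chain with one element. -/
def single {X Y : Q.Obj} (x : Q.shom X Y) : Chain Q X Y := cons x (nil Y)

/-- Concatenation of chains. -/
def append : ∀ {X Y Z : Q.Obj}, Chain Q X Y → Chain Q Y Z → Chain Q X Z
  | _, _, _, nil _, c => c
  | _, _, _, cons x p, c => cons x (append p c)

/-- Applying a map of quivers to every element of a chain. -/
def map (φ : Q.Obj → R.Obj) (g : ∀ X Y, Q.shom X Y → R.shom (φ X) (φ Y)) :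
    ∀ {X Y : Q.Obj}, Chain Q X Y → Chain R (φ X) (φ Y)
  | _, _, nil X => nil (φ X)
  | _, _, cons x c => cons (g _ _ x) (map φ g c)

/-- `x₁ ⊗ ⋯ ⊗ xₙ ↦ (-1)^{p (deg x₁ + ⋯ + deg xₙ)} x₁ ⊗ ⋯ ⊗ xₙ`, the Koszul sign which appears when a
map of degree `p` passes the chain. -/
def sgn (p : ℤ) {X Y : Q.Obj} (c : Chain Q X Y) : Chain Q X Y :=
  map (fun X => X) (fun X Y => Q.sgn p X Y) c

/-- The chain consists of homogeneous elements of total degree `d`. -/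
inductive HasDegree : ∀ {X Y : Q.Obj}, Chain Q X Y → ℤ → Prop
  | nil (X : Q.Obj) : HasDegree (nil X) 0
  | cons {X Y Z : Q.Obj} {x : Q.shom X Y} {c : Chain Q Y Z} {d e : ℤ}
      (hx : x ∈ Q.grade X Y d) (hc : HasDegree c e) : HasDegree (cons x c) (d + e)

/-- All presentations of a chain as a concatenation of two chains (possibly empty). -/
def splits : ∀ {X Y : Q.Obj}, Chain Q X Y → List (Σ Z : Q.Obj, Chain Q X Z × Chain Q Z Y)
  | _, _, nil X => [⟨X, nil X, nil X⟩]
  | X, _, cons x c =>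
      ⟨X, nil X, cons x c⟩ :: (splits c).map fun s => ⟨s.1, cons x s.2.1, s.2.2⟩

@[simp] theorem nil_append {X Y : Q.Obj} (c : Chain Q X Y) : append (nil X) c = c := rfl

@[simp] theorem cons_append {X Y Z W : Q.Obj} (x : Q.shom X Y) (p : Chain Q Y Z)
    (c : Chain Q Z W) : append (cons x p) c = cons x (append p c) := rfl

@[simp] theorem append_nil {X Y : Q.Obj} (c : Chain Q X Y) : append c (nil Y) = c := by
  induction c with
  | nil => rfl
  | cons x c ih => simp [ih]

theorem append_assoc {X Y Z W : Q.Obj} (p : Chain Q X Y) (q : Chain Q Y Z) (r : Chain Q Z W) :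
    append (append p q) r = append p (append q r) := by
  induction p with
  | nil => rfl
  | cons x c ih => simp [ih]

theorem map_append (φ : Q.Obj → R.Obj) (g : ∀ X Y, Q.shom X Y → R.shom (φ X) (φ Y))
    {X Y Z : Q.Obj} (p : Chain Q X Y) (q : Chain Q Y Z) :
    map φ g (append p q) = append (map φ g p) (map φ g q) := by
  induction p with
  | nil => rfl
  | cons x c ih => simp [map, ih]

theorem HasDegree.append {X Y Z : Q.Obj} {p : Chain Q X Y} {q : Chain Q Y Z} {d e : ℤ}
    (hp : p.HasDegree d) (hq : q.HasDegree e) : (p.append q).HasDegree (d + e) := by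
  induction hp with
  | nil => simpa using hq
  | cons hx _ ih =>
    rw [add_assoc]
    exact .cons hx (ih hq)

theorem HasDegree.map {φ : Q.Obj → R.Obj} {g : ∀ X Y, Q.shom X Y → R.shom (φ X) (φ Y)}
    (hg : ∀ X Y d, ∀ x ∈ Q.grade X Y d, g X Y x ∈ R.grade _ _ d)
    {X Y : Q.Obj} {p : Chain Q X Y} {d : ℤ} (hp : p.HasDegree d) :
    (Chain.map φ g p).HasDegree d := by
  induction hp with
  | nil => exact .nil _
  | cons hx _ ih => exact .cons (hg _ _ _ _ hx) ih

theorem HasDegree.sgn (p : ℤ) {X Y : Q.Obj} {c : Chain Q X Y} {d : ℤ} (hc : c.HasDegree d) :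
    (c.sgn p).HasDegree d :=
  hc.map fun _ _ _ _ hx => signMap_mem _ p hx

theorem HasDegree.single {X Y : Q.Obj} {x : Q.shom X Y} {d : ℤ} (hx : x ∈ Q.grade X Y d) :
    (single x).HasDegree d := by
  have h := HasDegree.cons hx (.nil Y)
  rw [add_zero] at h
  exact h

theorem HasDegree.of_mem_splits {X Y : Q.Obj} {c : Chain Q X Y} {d : ℤ} (hc : c.HasDegree d) :
    ∀ s ∈ c.splits, ∃ e f, s.2.1.HasDegree e ∧ s.2.2.HasDegree f ∧ e + f = d := by
  induction hc with
  | nil X => simpa [splits] using ⟨0, HasDegree.nil X, 0, HasDegree.nil X, rfl⟩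
  | @cons X Y Z x c d e hx hc ih =>
    intro s hs
    simp only [splits, List.mem_cons, List.mem_map] at hs
    rcases hs with rfl | ⟨t, ht, rfl⟩
    · exact ⟨0, d + e, .nil _, .cons hx hc, by simp⟩
    · obtain ⟨a, b, ha, hb, hab⟩ := ih t ht
      exact ⟨d + a, b, .cons hx ha, hb, by rw [add_assoc, hab]⟩

theorem splits_append_cons {X Y Z W : Q.Obj} (p : Chain Q X Y) (x : Q.shom Y Z) (q : Chain Q Z W) :
    splits (append p (cons x q)) =
      ((splits p).map fun s => ⟨s.1, s.2.1, append s.2.2 (cons x q)⟩) ++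
      ((splits q).map fun s => ⟨s.1, append p (cons x s.2.1), s.2.2⟩) := by
  induction p with
  | nil => simp [splits]
  | cons y p ih => simp [splits, ih, Function.comp_def]

end Chain

/-- The `k`-module of functions on chains from `X` to `Y` which are `k`-linear in each element of
the chain, that is, the module of `k`-linear maps `Ts𝒞(X, Y) → M`. -/
def MultiFun (Q : GradedQuiver.{w, u, v} k) (X Y : Q.Obj) (M : Type v₁) [AddCommGroup M]
    [Module k M] : Submodule k (Chain Q X Y → M) where
  carrier := {φ | ∀ ⦃Z W : Q.Obj⦄ (p : Chain Q X Z) (q : Chain Q W Y) (a : k) (x y : Q.shom Z W),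
    φ (p.append (.cons (a • x + y) q)) =
      a • φ (p.append (.cons x q)) + φ (p.append (.cons y q))}
  add_mem' {φ ψ} hφ hψ Z W p q a x y := by
    simp only [Pi.add_apply, hφ p q a x y, hψ p q a x y, smul_add]
    abel
  zero_mem' Z W p q a x y := by simp
  smul_mem' c φ hφ Z W p q a x y := by
    simp only [Pi.smul_apply, hφ p q a x y, smul_add, smul_comm c a]

section MultiFun

variable {Q : GradedQuiver.{w, u, v} k} {M : Type v₁} [AddCommGroup M] [Module k M]
  {N : Type v₂} [AddCommGroup N] [Module k N]

theorem sum_map_smul_add {α : Type*} (l : List α) (a : k) (f g : α → M) :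
    (l.map fun s => a • f s + g s).sum = a • (l.map f).sum + (l.map g).sum := by
  induction l with
  | nil => simp
  | cons s l ih =>
    simp only [List.map_cons, List.sum_cons, ih, smul_add]
    abel

theorem MultiFun.prepend {X Y Z : Q.Obj} {φ : Chain Q X Y → M} (hφ : φ ∈ MultiFun Q X Y M)
    (p : Chain Q X Z) : (fun c => φ (p.append c)) ∈ MultiFun Q Z Y M := by
  intro A B p' q a x y
  simpa only [Chain.append_assoc] using hφ (p.append p') q a x y

theorem MultiFun.postpend {X Y Z : Q.Obj} {φ : Chain Q X Y → M} (hφ : φ ∈ MultiFun Q X Y M)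
    (p : Chain Q Z Y) : (fun c : Chain Q X Z => φ (c.append p)) ∈ MultiFun Q X Z M := by
  intro A B p' q a x y
  simpa only [Chain.append_assoc, Chain.cons_append] using hφ p' (q.append p) a x y

theorem MultiFun.comp_linear {X Y : Q.Obj} {φ : Chain Q X Y → M} (hφ : φ ∈ MultiFun Q X Y M)
    (g : M →ₗ[k] N) : (fun c => g (φ c)) ∈ MultiFun Q X Y N := by
  intro A B p' q a x y
  simp only [hφ p' q a x y, map_add, map_smul]

theorem MultiFun.comp_map {R : GradedQuiver.{w, u₁, v₂} k} {X Y : Q.Obj} (F : Q.Obj → R.Obj)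
    (g : ∀ X Y, Q.shom X Y →ₗ[k] R.shom (F X) (F Y))
    {φ : Chain R (F X) (F Y) → M} (hφ : φ ∈ MultiFun R (F X) (F Y) M) :
    (fun c => φ (Chain.map F (fun X Y => g X Y) c)) ∈ MultiFun Q X Y M := by
  intro A B p q a x y
  simp only [Chain.map_append, Chain.map, map_add, map_smul]
  exact hφ _ _ _ _ _

theorem MultiFun.sum_splits {X Y : Q.Obj} (G : ∀ Z, Chain Q X Z → Chain Q Z Y → M)
    (h₁ : ∀ Z q, (fun p => G Z p q) ∈ MultiFun Q X Z M)
    (h₂ : ∀ Z p, G Z p ∈ MultiFun Q Z Y M) :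
    (fun c : Chain Q X Y => (c.splits.map fun s => G s.1 s.2.1 s.2.2).sum) ∈ MultiFun Q X Y M := by
  intro A B p q a x y
  have e₁ : ∀ s : Σ Z, Chain Q X Z × Chain Q Z A, _ := fun s => h₂ s.1 s.2.1 s.2.2 q a x y
  have e₂ : ∀ s : Σ Z, Chain Q B Z × Chain Q Z Y, _ := fun s => h₁ s.1 s.2.2 p s.2.1 a x y
  simp only [Chain.splits_append_cons, List.map_append, List.map_map, List.sum_append,
    Function.comp_def]
  simp only [e₁, e₂, sum_map_smul_add, smul_add]
  abel

end MultiFun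

/-! ### `A∞`-categories -/

/-- A graded quiver `𝒞` with a `(1,1)`-coderivation `b : Ts𝒞 → Ts𝒞` of degree `1` with `b₀ = 0`,
given by its components `bₙ : Tⁿs𝒞 → s𝒞`. -/
structure PreAInfCat (k : Type w) [CommRing k] extends GradedQuiver.{w, u, v} k where
  b : ∀ {X Y : Obj}, Chain toGradedQuiver X Y → shom X Y
  b_multilinear : ∀ X Y, (b : Chain toGradedQuiver X Y → shom X Y) ∈
    MultiFun toGradedQuiver X Y (shom X Y)
  b_nil : ∀ X, b (.nil X) = 0
  b_degree : ∀ {X Y : Obj} (c : Chain toGradedQuiver X Y) (d : ℤ), c.HasDegree d →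
    b c ∈ grade X Y (d + 1)

/-- The terms of `(x₁ ⊗ ⋯ ⊗ xₙ)b = ∑ (x₁ ⊗ ⋯ ⊗ xₙ)(1^{⊗r} ⊗ b_m ⊗ 1^{⊗t})`, summed over
`r + m + t = n`. Since maps are written on the right, `b` produces the sign `(-1)^{deg}` of the
last `t` factors. -/
def PreAInfCat.bTerms (A : PreAInfCat.{w, u, v} k) {X Y : A.Obj} (c : Chain A.toGradedQuiver X Y) :
    List (Chain A.toGradedQuiver X Y) :=
  c.splits.flatMap fun s => s.2.2.splits.map fun t =>
    s.2.1.append (.cons (A.b t.2.1) (t.2.2.sgn 1))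

/-- `b² = 0`, that is, `∑ (1^{⊗r} ⊗ b_m ⊗ 1^{⊗t}) b_{r+1+t} = 0`: the data form an
`A∞`-category. -/
def PreAInfCat.IsAInfCat (A : PreAInfCat.{w, u, v} k) : Prop :=
  ∀ (X Y : A.Obj) (c : Chain A.toGradedQuiver X Y), ((A.bTerms c).map A.b).sum = 0

/-- The differential `b₁` of the complex `s𝒞(X, Y)`. -/
def PreAInfCat.b₁ (A : PreAInfCat.{w, u, v} k) {X Y : A.Obj} (x : A.shom X Y) : A.shom X Y :=
  A.b (.single x)

/-! ### Cocategory homomorphisms and `A∞`-functors -/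

/-- A homomorphism of graded cocategories `Ts𝒜 → Tsℬ` of degree `0`, given by its components
`fₙ : Tⁿs𝒜(X, Y) → sℬ(Xf, Yf)`, with `f₀ = 0`. -/
structure CocatHom (A : PreAInfCat.{w, u₁, v₁} k) (B : PreAInfCat.{w, u₂, v₂} k) where
  obj : A.Obj → B.Obj
  app : ∀ {X Y : A.Obj}, Chain A.toGradedQuiver X Y → B.shom (obj X) (obj Y)
  app_multilinear : ∀ X Y, (app : Chain A.toGradedQuiver X Y → B.shom (obj X) (obj Y)) ∈
    MultiFun A.toGradedQuiver X Y (B.shom (obj X) (obj Y))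
  app_nil : ∀ X, app (.nil X) = 0
  app_degree : ∀ {X Y : A.Obj} (c : Chain A.toGradedQuiver X Y) (d : ℤ), c.HasDegree d →
    app c ∈ B.grade (obj X) (obj Y) d

namespace CocatHom

variable {A : PreAInfCat.{w, u₁, v₁} k} {B : PreAInfCat.{w, u₂, v₂} k}
  {C : PreAInfCat.{w, u₃, v₃} k}

/-- All chains `f(p y₁) ⊗ f(y₂) ⊗ ⋯ ⊗ f(y_l)`, where the (nonempty) chain `p ⊗ c` is cut into
nonempty pieces `p y₁, y₂, …, y_l` and `p` (nonempty) is contained in the first of them. -/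
def blocksFrom (f : CocatHom A B) : ∀ {X Y Z : A.Obj}, Chain A.toGradedQuiver X Y →
    Chain A.toGradedQuiver Y Z → List (Chain B.toGradedQuiver (f.obj X) (f.obj Z))
  | _, _, _, p, .nil _ => [.single (f.app p)]
  | _, _, _, p, .cons x c =>
      f.blocksFrom (p.append (.single x)) c ++ (f.blocksFrom (.single x) c).map (.cons (f.app p))

/-- The terms of `(x₁ ⊗ ⋯ ⊗ xₙ)f = ∑ (x₁ ⊗ ⋯ ⊗ xₙ)(f_{i₁} ⊗ ⋯ ⊗ f_{i_l})`, summed over all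
`i₁ + ⋯ + i_l = n` with `i_j > 0`. -/
def blocks (f : CocatHom A B) : ∀ {X Y : A.Obj}, Chain A.toGradedQuiver X Y →
    List (Chain B.toGradedQuiver (f.obj X) (f.obj Y))
  | _, _, .nil X => [.nil (f.obj X)]
  | _, _, .cons x c => f.blocksFrom (.single x) c

/-- `fb = bf`: the cocategory homomorphism is an `A∞`-functor. -/
def IsAInfFunctor (f : CocatHom A B) : Prop :=
  ∀ (X Y : A.Obj) (c : Chain A.toGradedQuiver X Y),
    ((f.blocks c).map B.b).sum = ((A.bTerms c).map f.app).sum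

theorem sum_blocksFrom_left (f : CocatHom A B) {M : Type v} [AddCommGroup M] [Module k M]
    {X Y Z W V : A.Obj} (φ : Chain B.toGradedQuiver (f.obj X) (f.obj V) → M)
    (hφ : φ ∈ MultiFun B.toGradedQuiver (f.obj X) (f.obj V) M)
    (p : Chain A.toGradedQuiver X Y) (q : Chain A.toGradedQuiver Z W)
    (c : Chain A.toGradedQuiver W V) (a : k) (x y : A.shom Y Z) :
    ((f.blocksFrom (p.append (.cons (a • x + y) q)) c).map φ).sum =
      a • ((f.blocksFrom (p.append (.cons x q)) c).map φ).sum +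
        ((f.blocksFrom (p.append (.cons y q)) c).map φ).sum := by
  induction c with
  | nil =>
    simp only [blocksFrom, List.map_cons, List.map_nil, List.sum_cons, List.sum_nil, add_zero,
      f.app_multilinear _ _ p q a x y]
    exact hφ (.nil _) (.nil _) _ _ _
  | cons z c ih =>
    have e : ∀ r, φ (.cons (f.app (p.append (.cons (a • x + y) q))) r) =
        a • φ (.cons (f.app (p.append (.cons x q))) r) +
          φ (.cons (f.app (p.append (.cons y q))) r) := by
      intro r
      rw [f.app_multilinear _ _ p q a x y]
      exact hφ (.nil _) r _ _ _
    simp only [blocksFrom, List.map_append, List.sum_append, List.map_map, Function.comp_def,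
      Chain.append_assoc, Chain.cons_append, e, sum_map_smul_add, ih φ hφ (q.append (.single z)),
      smul_add]
    abel

theorem sum_blocksFrom_right (f : CocatHom A B) {M : Type v} [AddCommGroup M] [Module k M]
    {X Y V : A.Obj} (φ : Chain B.toGradedQuiver (f.obj X) (f.obj V) → M)
    (hφ : φ ∈ MultiFun B.toGradedQuiver (f.obj X) (f.obj V) M)
    (p : Chain A.toGradedQuiver X Y) :
    (fun c => ((f.blocksFrom p c).map φ).sum) ∈ MultiFun A.toGradedQuiver Y V M := by
  intro Z W r q a x y
  induction r generalizing X with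
  | nil =>
    have h := f.sum_blocksFrom_left _ (MultiFun.prepend hφ (.single (f.app p))) (.nil _) (.nil _) q a x y
    have h' := f.sum_blocksFrom_left φ hφ p (.nil _) q a x y
    simp only [Chain.single, Chain.nil_append, Chain.cons_append] at h h'
    simp only [blocksFrom, Chain.nil_append, Chain.single, List.map_append, List.sum_append,
      List.map_map, Function.comp_def, h, h', smul_add]
    abel
  | cons z r ih =>
    have h := ih _ (MultiFun.prepend hφ (.single (f.app p))) (.single z)
    have h' := ih φ hφ (p.append (.single z))
    simp only [Chain.single, Chain.nil_append, Chain.cons_append] at h h'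
    simp only [blocksFrom, Chain.cons_append, Chain.single, List.map_append, List.sum_append,
      List.map_map, Function.comp_def, h, h', smul_add]
    abel

theorem sum_blocks (f : CocatHom A B) {M : Type v} [AddCommGroup M] [Module k M]
    {X Y : A.Obj} (φ : Chain B.toGradedQuiver (f.obj X) (f.obj Y) → M)
    (hφ : φ ∈ MultiFun B.toGradedQuiver (f.obj X) (f.obj Y) M) :
    (fun c => ((f.blocks c).map φ).sum) ∈ MultiFun A.toGradedQuiver X Y M := by
  intro Z W p q a x y
  cases p with
  | nil => exact f.sum_blocksFrom_left φ hφ (.nil _) (.nil _) q a x y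
  | cons z p => exact f.sum_blocksFrom_right φ hφ (.single z) p q a x y

theorem blocksFrom_degree (f : CocatHom A B) {X Y Z : A.Obj} {p : Chain A.toGradedQuiver X Y}
    {c : Chain A.toGradedQuiver Y Z} {d e : ℤ} (hp : p.HasDegree d) (hc : c.HasDegree e) :
    ∀ r ∈ f.blocksFrom p c, r.HasDegree (d + e) := by
  induction hc generalizing X d with
  | nil =>
    intro r hr
    simp only [blocksFrom, List.mem_singleton] at hr
    subst hr
    rw [add_zero]
    exact .single (f.app_degree _ _ hp)
  | cons hx hc ih =>
    intro r hr
    simp only [blocksFrom, List.mem_append, List.mem_map] at hr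
    rcases hr with hr | ⟨s, hs, rfl⟩
    · rw [← add_assoc]
      exact ih (hp.append (.single hx)) r hr
    · exact .cons (f.app_degree _ _ hp) (ih (.single hx) s hs)

theorem blocks_degree (f : CocatHom A B) {X Y : A.Obj} {c : Chain A.toGradedQuiver X Y} {d : ℤ}
    (hc : c.HasDegree d) : ∀ r ∈ f.blocks c, r.HasDegree d := by
  cases hc with
  | nil =>
    intro r hr
    simp only [blocks, List.mem_singleton] at hr
    subst hr
    exact .nil _
  | cons hx hc => exact f.blocksFrom_degree (.single hx) hc

/-- The composition `fg` (first `f`, then `g`), with components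
`(fg)ₙ = ∑ (f_{i₁} ⊗ ⋯ ⊗ f_{i_l}) g_l`. -/
def comp (f : CocatHom A B) (g : CocatHom B C) : CocatHom A C where
  obj X := g.obj (f.obj X)
  app c := ((f.blocks c).map g.app).sum
  app_multilinear X Y := f.sum_blocks g.app (g.app_multilinear _ _)
  app_nil X := by simp [blocks, g.app_nil]
  app_degree c d hc := by
    refine list_sum_mem fun z hz => ?_
    obtain ⟨r, hr, rfl⟩ := List.mem_map.mp hz
    exact g.app_degree _ _ (f.blocks_degree hc r hr)

/-- The components of the identity: `id₁ = 1` and `idₙ = 0` for `n ≠ 1`. -/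
def idApp (A : PreAInfCat.{w, u₁, v₁} k) : ∀ {X Y : A.Obj}, Chain A.toGradedQuiver X Y → A.shom X Y
  | _, _, .nil _ => 0
  | _, _, .cons x (.nil _) => x
  | _, _, .cons _ (.cons _ _) => 0

/-- The identity homomorphism. -/
def id (A : PreAInfCat.{w, u₁, v₁} k) : CocatHom A A where
  obj X := X
  app c := idApp A c
  app_multilinear X Y := by
    intro Z W p q a x y
    cases p with
    | nil => cases q <;> simp [idApp]
    | cons z p => cases p <;> simp [idApp]
  app_nil X := rfl
  app_degree c d hc := by
    cases hc with
    | nil => exact zero_mem _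
    | cons hx hc =>
      cases hc with
      | nil => simpa [idApp] using hx
      | cons => exact zero_mem _

end CocatHom

/-! ### `A∞`-transformations -/

/-- Components of a (not necessarily homogeneous or linear) map `Ts𝒜 → sℬ` over a pair of maps of
objects. -/
abbrev Components (A : PreAInfCat.{w, u₁, v₁} k) (B : PreAInfCat.{w, u₂, v₂} k)
    (φ ψ : A.Obj → B.Obj) : Type _ :=
  ∀ ⦃X Y : A.Obj⦄, Chain A.toGradedQuiver X Y → B.shom (φ X) (ψ Y)

/-- An `(f, g)`-coderivation `r : Ts𝒜 → Tsℬ` of degree `p` (an `A∞`-transformation `f → g`), given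
by its components `rₙ : Tⁿs𝒜(X, Y) → sℬ(Xf, Yg)`, `n ≥ 0`. -/
structure Coder {A : PreAInfCat.{w, u₁, v₁} k} {B : PreAInfCat.{w, u₂, v₂} k}
    (f g : CocatHom A B) (p : ℤ) where
  app : Components A B f.obj g.obj
  app_multilinear : ∀ X Y, (fun c => app c) ∈
    MultiFun A.toGradedQuiver X Y (B.shom (f.obj X) (g.obj Y))
  app_degree : ∀ {X Y : A.Obj} (c : Chain A.toGradedQuiver X Y) (d : ℤ), c.HasDegree d →
    app c ∈ B.grade (f.obj X) (g.obj Y) (d + p)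

namespace Coder

variable {A : PreAInfCat.{w, u₁, v₁} k} {B : PreAInfCat.{w, u₂, v₂} k}
  {C : PreAInfCat.{w, u₃, v₃} k}

/-- The terms of `(x₁ ⊗ ⋯ ⊗ xₙ)r = ∑ (x₁ ⊗ ⋯ ⊗ xₙ)(f_{a₁} ⊗ ⋯ ⊗ f_{a_α} ⊗ r_j ⊗ g_{c₁} ⊗ ⋯ ⊗ g_{c_β})`,
with the Koszul sign of `r` passing the arguments of the `g`'s. -/
def terms {f g : CocatHom A B} {p : ℤ} (r : Coder f g p) {X Y : A.Obj}
    (c : Chain A.toGradedQuiver X Y) : List (Chain B.toGradedQuiver (f.obj X) (g.obj Y)) :=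
  c.splits.flatMap fun s => s.2.2.splits.flatMap fun t =>
    (f.blocks s.2.1).flatMap fun y => (g.blocks (t.2.2.sgn p)).map fun z =>
      y.append (.cons (r.app t.2.1) z)

/-- The terms of `(x₁ ⊗ ⋯ ⊗ xₙ)[(r ⊗ q)θ]`, where
`(r ⊗ q)θ = ∑ f_{a₁} ⊗ ⋯ ⊗ f_{a_α} ⊗ r_j ⊗ g_{c₁} ⊗ ⋯ ⊗ g_{c_β} ⊗ q_t ⊗ h_{e₁} ⊗ ⋯ ⊗ h_{e_γ}`. -/
def thetaTerms {f g h : CocatHom A B} {p p' : ℤ} (r : Coder f g p) (q : Coder g h p')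
    {X Y : A.Obj} (c : Chain A.toGradedQuiver X Y) :
    List (Chain B.toGradedQuiver (f.obj X) (h.obj Y)) :=
  c.splits.flatMap fun s => s.2.2.splits.flatMap fun t =>
    (f.blocks s.2.1).flatMap fun y => (q.terms (t.2.2.sgn p)).map fun z =>
      y.append (.cons (r.app t.2.1) z)

/-- The components of `rB₁ = rb - (-1)^p br`. -/
def B₁ {f g : CocatHom A B} {p : ℤ} (r : Coder f g p) : Components A B f.obj g.obj :=
  fun _ _ c => ((r.terms c).map B.b).sum -
    ((p.negOnePow : ℤˣ) : ℤ) • ((A.bTerms c).map fun z => r.app z).sum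

/-- The components of `(r ⊗ q)B₂`, which are `∑_l [(r ⊗ q)θ]_{nl} b_l`. -/
def B₂ {f g h : CocatHom A B} {p p' : ℤ} (r : Coder f g p) (q : Coder g h p') :
    Components A B f.obj h.obj :=
  fun _ _ c => ((r.thetaTerms q c).map B.b).sum

/-- The components of the transformation `rh : fh → gh`, for `r : f → g : 𝒜 → ℬ` and
`h : ℬ → 𝒞`. -/
def whiskerRight {f g : CocatHom A B} {p : ℤ} (r : Coder f g p) (h : CocatHom B C) :
    Components A C (f.comp h).obj (g.comp h).obj :=
  fun _ _ c => ((r.terms c).map h.app).sum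

/-- The components of the transformation `hr : hf → hg`, for `h : 𝒜 → ℬ` and
`r : f → g : ℬ → 𝒞`. -/
def whiskerLeft (h : CocatHom A B) {f g : CocatHom B C} {p : ℤ} (r : Coder f g p) :
    Components A C (h.comp f).obj (h.comp g).obj :=
  fun _ _ c => ((h.blocks c).map fun z => r.app z).sum

/-- A natural `A∞`-transformation: an `(f, g)`-coderivation of degree `-1` with
`rb + br = 0`. -/
def IsNatural {f g : CocatHom A B} (r : Coder f g (-1)) : Prop :=
  ∀ ⦃X Y : A.Obj⦄ (c : Chain A.toGradedQuiver X Y), r.B₁ c = 0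

end Coder

section Unital

variable {A : PreAInfCat.{w, u₁, v₁} k} {B : PreAInfCat.{w, u₂, v₂} k}

/-- Equivalence `r ≡ q` of natural transformations `f → g`: there is an `(f, g)`-coderivation `v`
of degree `-2` with `r - q = vB₁ = vb - bv`. -/
def TransEquiv (f g : CocatHom A B) (r q : Components A B f.obj g.obj) : Prop :=
  ∃ v : Coder f g (-2), ∀ ⦃X Y : A.Obj⦄ (c : Chain A.toGradedQuiver X Y), r c - q c = v.B₁ c

/-- A `k`-linear map is homogeneous of degree `p`. -/
def HasMapDegree (A : PreAInfCat.{w, u₁, v₁} k) {X Y : A.Obj} (p : ℤ)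
    (g : A.shom X Y →ₗ[k] A.shom X Y) : Prop :=
  ∀ d, ∀ x ∈ A.grade X Y d, g x ∈ A.grade X Y (d + p)

/-- `φ` is a homotopy invertible endomorphism of the complex `(s𝒜(X, Y), b₁)`. -/
def IsHomotopyInvertible (A : PreAInfCat.{w, u₁, v₁} k) {X Y : A.Obj}
    (φ : A.shom X Y → A.shom X Y) : Prop :=
  ∃ ψ h h' : A.shom X Y →ₗ[k] A.shom X Y,
    HasMapDegree A 0 ψ ∧ HasMapDegree A (-1) h ∧ HasMapDegree A (-1) h' ∧
    (∀ x, A.b₁ (ψ x) = ψ (A.b₁ x)) ∧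
    (∀ x, ψ (φ x) = x + A.b₁ (h x) + h (A.b₁ x)) ∧
    (∀ x, φ (ψ x) = x + A.b₁ (h' x) + h' (A.b₁ x))

/-- A unit transformation of `𝒜`: a natural transformation `i : id → id` with `(i ⊗ i)B₂ ≡ i` such
that the maps `(Xi₀ ⊗ 1)b₂` and `(1 ⊗ Yi₀)b₂ : s𝒜(X, Y) → s𝒜(X, Y)` are homotopy invertible. -/
structure IsUnitTransformation (i : Coder (CocatHom.id A) (CocatHom.id A) (-1)) : Prop where
  natural : i.IsNatural
  idempotent : TransEquiv (CocatHom.id A) (CocatHom.id A) (i.B₂ i) i.app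
  left : ∀ X Y : A.Obj, IsHomotopyInvertible A fun x : A.shom X Y =>
    A.b (.cons (i.app (.nil X)) (.single (A.sgn (-1) X Y x)))
  right : ∀ X Y : A.Obj, IsHomotopyInvertible A fun x : A.shom X Y =>
    A.b (.cons x (.single (i.app (.nil Y))))

/-- A unital `A∞`-category. -/
def PreAInfCat.IsUnital (A : PreAInfCat.{w, u₁, v₁} k) : Prop :=
  A.IsAInfCat ∧ ∃ i : Coder (CocatHom.id A) (CocatHom.id A) (-1), IsUnitTransformation i

/-- A unital `A∞`-functor `f : 𝒜 → ℬ` between unital `A∞`-categories: an `A∞`-functor with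
`i^𝒜 f ≡ f i^ℬ` for unit transformations `i^𝒜`, `i^ℬ` (these are unique up to equivalence). -/
def CocatHom.IsUnitalFunctor (f : CocatHom A B) : Prop :=
  A.IsAInfCat ∧ B.IsAInfCat ∧ f.IsAInfFunctor ∧
  ∃ (i : Coder (CocatHom.id A) (CocatHom.id A) (-1))
    (j : Coder (CocatHom.id B) (CocatHom.id B) (-1)),
    IsUnitTransformation i ∧ IsUnitTransformation j ∧
    TransEquiv f f (i.whiskerRight f) (Coder.whiskerLeft f j)

/-- Two `A∞`-functors `f, g : 𝒜 → ℬ` to a unital `A∞`-category are isomorphic: there are natural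
transformations `r : f → g` and `q : g → f`, mutually inverse up to equivalence, where the identity
of `f` is `f i^ℬ`. -/
def CocatHom.Isomorphic (f g : CocatHom A B) : Prop :=
  ∃ (i : Coder (CocatHom.id B) (CocatHom.id B) (-1)) (r : Coder f g (-1)) (q : Coder g f (-1)),
    IsUnitTransformation i ∧ r.IsNatural ∧ q.IsNatural ∧
    TransEquiv f f (r.B₂ q) (Coder.whiskerLeft f i) ∧
    TransEquiv g g (q.B₂ r) (Coder.whiskerLeft g i)

/-- `f : 𝒜 → ℬ` and `g : ℬ → 𝒜` are quasi-inverse unital `A∞`-functors: `fg ≅ id` and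
`gf ≅ id`. -/
structure IsQuasiInverse (f : CocatHom A B) (g : CocatHom B A) : Prop where
  unital_left : f.IsUnitalFunctor
  unital_right : g.IsUnitalFunctor
  iso_left : (f.comp g).Isomorphic (CocatHom.id A)
  iso_right : (g.comp f).Isomorphic (CocatHom.id B)

/-- Equivalence of unital `A∞`-categories. -/
def AInfEquivalent (A : PreAInfCat.{w, u₁, v₁} k) (B : PreAInfCat.{w, u₂, v₂} k) : Prop :=
  ∃ (f : CocatHom A B) (g : CocatHom B A), IsQuasiInverse f g

/-- The full subcategory of `𝒜` on the set of objects `F` is contractible: each complex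
`(s𝒜(X, Y), b₁)` with `X, Y ∈ F` is contractible. -/
def PreAInfCat.IsContractibleOn (A : PreAInfCat.{w, u₁, v₁} k) (F : Set A.Obj) : Prop :=
  ∀ X ∈ F, ∀ Y ∈ F, ∃ h : A.shom X Y →ₗ[k] A.shom X Y, HasMapDegree A (-1) h ∧
    ∀ x, A.b₁ (h x) + h (A.b₁ x) = x

end Unital

/-! ### The tensor quivers -/

section Tensor

variable (Q : GradedQuiver.{w, u, v} k)

/-- The graded module `s𝒞(X, C₁) ⊗ s𝒞(C₁, C₂) ⊗ ⋯ ⊗ s𝒞(C_{n-1}, Y)` for the list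
`C₁, …, C_{n-1}` of objects. For the empty list it is `s𝒞(X, Y)`. -/
def tens (Y : Q.Obj) : List Q.Obj → Q.Obj → ModuleCat.{v} k
  | [], X => ModuleCat.of k (Q.shom X Y)
  | Z :: l, X => ModuleCat.of k (Q.shom X Z ⊗[k] tens Y l Z)

/-- The grading of the tensor product by total degree. -/
def tensGrade (Y : Q.Obj) : ∀ (l : List Q.Obj) (X : Q.Obj), ℤ → Submodule k (tens Q Y l X)
  | [], X => Q.grade X Y
  | Z :: l, X => tensorGrade (Q.grade X Z) (tensGrade Y l Z)

theorem isInternal_tensGrade (Y : Q.Obj) : ∀ (l : List Q.Obj) (X : Q.Obj),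
    DirectSum.IsInternal (tensGrade Q Y l X)
  | [], X => Q.isInternal X Y
  | Z :: l, X => isInternal_tensorGrade (Q.isInternal X Z) (isInternal_tensGrade Y l Z)

/-- The direct sum `⨁ s𝒞(X, C₁) ⊗ s𝒞(C₁, C₂) ⊗ ⋯ ⊗ s𝒞(C_{n-1}, Y)` over all finite sequences
`(C₁, …, C_{n-1})`, `n ≥ 1`, of objects which belong to the set `F`. -/
abbrev TensorHom (F : Set Q.Obj) (X Y : Q.Obj) : Type (max u v) :=
  ⨁ l : {l : List Q.Obj // ∀ Z ∈ l, Z ∈ F}, tens Q Y l.1 X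

open Classical in
/-- The graded quiver with the same objects as `𝒞` whose (suspended) morphisms are the graded
modules `TensorHom`. -/
@[reducible] def tensorQuiver (F : Set Q.Obj) : GradedQuiver.{w, u, max u v} k where
  Obj := Q.Obj
  shom X Y := TensorHom Q F X Y
  instAddCommGroup _ _ := inferInstance
  instModule _ _ := inferInstance
  grade X Y := sumGrade fun l => tensGrade Q Y l.1 X
  isInternal X Y := isInternal_sumGrade fun l => isInternal_tensGrade Q Y l.1 X

/-- `T⁺s𝒞 = ⨁_{n > 0} Tⁿs𝒞`. -/
abbrev TPlus : GradedQuiver.{w, u, max u v} k := tensorQuiver Q Set.univ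

variable {Q} {F : Set Q.Obj}

open Classical in
/-- The embedding of a direct summand. -/
def tensorIncl {X Y : Q.Obj} (l : List Q.Obj) (hl : ∀ Z ∈ l, Z ∈ F) :
    tens Q Y l X →ₗ[k] TensorHom Q F X Y :=
  DirectSum.lof k {l : List Q.Obj // ∀ Z ∈ l, Z ∈ F} (fun l => tens Q Y l.1 X) ⟨l, hl⟩

open Classical in
/-- A linear map from `⨁` is given by its restrictions to the summands. -/
def tensorLift {X Y : Q.Obj} {M : Type v₁} [AddCommGroup M] [Module k M]
    (g : ∀ l : List Q.Obj, (∀ Z ∈ l, Z ∈ F) → (tens Q Y l X →ₗ[k] M)) :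
    TensorHom Q F X Y →ₗ[k] M :=
  DirectSum.toModule k {l : List Q.Obj // ∀ Z ∈ l, Z ∈ F} M fun l => g l.1 l.2

/-- The direct summand embedding of the tensor quiver into `T⁺s𝒞`. -/
def toTPlus (F : Set Q.Obj) (X Y : Q.Obj) :
    TensorHom Q F X Y →ₗ[k] TensorHom Q Set.univ X Y :=
  tensorLift fun l _ => tensorIncl l fun _ _ => trivial

open Classical in
/-- The projection of `T⁺s𝒞` onto its direct summand. -/
def ofTPlus (F : Set Q.Obj) (X Y : Q.Obj) :
    TensorHom Q Set.univ X Y →ₗ[k] TensorHom Q F X Y :=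
  tensorLift fun l _ => if hl : ∀ Z ∈ l, Z ∈ F then tensorIncl l hl else 0

/-- The embedding `s𝒞 = T¹s𝒞 → T⁺s𝒞`. -/
def ofLetter (F : Set Q.Obj) (X Y : Q.Obj) : Q.shom X Y →ₗ[k] TensorHom Q F X Y :=
  tensorIncl (X := X) (Y := Y) [] (by simp)

/-- The multiplication `s𝒞(X, Z) ⊗ T⁺s𝒞(Z, Y) → T⁺s𝒞(X, Y)`. -/
def consT (X Z Y : Q.Obj) : Q.shom X Z →ₗ[k] TensorHom Q Set.univ Z Y →ₗ[k] TensorHom Q Set.univ X Y :=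
  LinearMap.flip <| tensorLift fun l _ => LinearMap.flip <|
    (LinearMap.compr₂ (TensorProduct.mk k (Q.shom X Z) (tens Q Y l Z))
      (tensorIncl (X := X) (Y := Y) (F := Set.univ) (Z :: l) fun _ _ => trivial))

/-- The multiplication `Tⁿs𝒞(X, Z) ⊗ T⁺s𝒞(Z, Y) → T⁺s𝒞(X, Y)`. -/
def mulTens (Z Y : Q.Obj) : ∀ (l : List Q.Obj) (X : Q.Obj),
    tens Q Z l X →ₗ[k] TensorHom Q Set.univ Z Y →ₗ[k] TensorHom Q Set.univ X Y
  | [], X => consT X Z Y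
  | W :: l, X => TensorProduct.lift <| LinearMap.mk₂ k
      (fun x u => (consT X W Y x) ∘ₗ (mulTens Z Y l W u))
      (fun x x' u => by rw [map_add, LinearMap.add_comp])
      (fun a x u => by rw [map_smul, LinearMap.smul_comp])
      (fun x u u' => by rw [map_add, LinearMap.comp_add])
      (fun a x u => by rw [map_smul, LinearMap.comp_smul])

/-- The multiplication `μ : T⁺s𝒞(X, Z) ⊗ T⁺s𝒞(Z, Y) → T⁺s𝒞(X, Y)` of the tensor algebra. -/
def mulT {X Z Y : Q.Obj} :
    TensorHom Q Set.univ X Z →ₗ[k] TensorHom Q Set.univ Z Y →ₗ[k] TensorHom Q Set.univ X Y :=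
  tensorLift fun l _ => mulTens Z Y l X

/-- The pure tensor `x₁ ⊗ ⋯ ⊗ xₙ ∈ T⁺s𝒞(X, Y)` of a nonempty chain. -/
def pureT : ∀ {X Y : Q.Obj}, Chain Q X Y → TensorHom Q Set.univ X Y
  | _, _, .nil _ => 0
  | X, Y, .cons x (.nil _) => ofLetter Set.univ X Y x
  | _, _, .cons x (.cons y c) => consT _ _ _ x (pureT (.cons y c))

theorem pureT_cons_append {X Y Z W V : Q.Obj} (z : Q.shom X Y) (p : Chain Q Y Z) (x : Q.shom Z W)
    (q : Chain Q W V) : pureT (.cons z (p.append (.cons x q))) =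
      consT _ _ _ z (pureT (p.append (.cons x q))) := by
  cases p <;> rfl

theorem pureT_mem_multiFun (X Y : Q.Obj) :
    (pureT : Chain Q X Y → TensorHom Q Set.univ X Y) ∈ MultiFun Q X Y _ := by
  intro Z W p q a x y
  induction p with
  | nil =>
    cases q with
    | nil => simp [pureT]
    | cons z q => simp [pureT]
  | cons z p ih =>
    simp only [Chain.cons_append, pureT_cons_append, ih, map_add, map_smul]

/-- Fixing the first element of the argument of a multilinear function. -/
def MultiFun.curry {M : Type v₁} [AddCommGroup M] [Module k M] (X Y Z : Q.Obj) :
    MultiFun Q X Y M →ₗ[k] Q.shom X Z →ₗ[k] MultiFun Q Z Y M :=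
  LinearMap.mk₂ k (fun φ x => ⟨fun c => φ.1 (.cons x c), MultiFun.prepend φ.2 (.single x)⟩)
    (fun _ _ _ => rfl) (fun _ _ _ => rfl)
    (fun φ x y => Subtype.ext <| funext fun c => by
      simpa using φ.2 (.nil X) c 1 x y)
    (fun a φ x => Subtype.ext <| funext fun c => by
      have h₀ : φ.1 (.cons 0 c) = 0 := by simpa using φ.2 (.nil X) c 1 0 0
      simpa [h₀] using φ.2 (.nil X) c a x 0)

/-- Multilinear functions restricted to chains of length one. -/
def MultiFun.linear {M : Type v₁} [AddCommGroup M] [Module k M] (X Y : Q.Obj) :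
    MultiFun Q X Y M →ₗ[k] Q.shom X Y →ₗ[k] M :=
  LinearMap.mk₂ k (fun φ x => φ.1 (.single x))
    (fun _ _ _ => rfl) (fun _ _ _ => rfl)
    (fun φ x y => by simpa [Chain.single] using φ.2 (.nil X) (.nil Y) 1 x y)
    (fun a φ x => by
      have h₀ : φ.1 (.cons 0 (.nil Y)) = 0 := by simpa using φ.2 (.nil X) (.nil Y) 1 0 0
      simpa [h₀, Chain.single] using φ.2 (.nil X) (.nil Y) a x 0)

/-- The linear map on `Tⁿs𝒞(X, Y)` corresponding to a multilinear function on chains. -/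
def liftTens (M : Type v₁) [AddCommGroup M] [Module k M] (Y : Q.Obj) :
    ∀ (l : List Q.Obj) (X : Q.Obj), MultiFun Q X Y M →ₗ[k] tens Q Y l X →ₗ[k] M
  | [], X => MultiFun.linear X Y
  | Z :: l, X =>
      TensorProduct.uncurry (RingHom.id k) (Q.shom X Z) (tens Q Y l Z) M ∘ₗ
        (LinearMap.llcomp k _ _ _ (liftTens M Y l Z)) ∘ₗ MultiFun.curry X Y Z

/-- The linear map on `T⁺s𝒞(X, Y)` corresponding to a multilinear function on chains. -/
def liftT {M : Type v₁} [AddCommGroup M] [Module k M] {X Y : Q.Obj} (φ : MultiFun Q X Y M) :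
    TensorHom Q Set.univ X Y →ₗ[k] M :=
  tensorLift fun l _ => liftTens M Y l X φ

theorem tensGrade_le {M : Type v₁} [AddCommGroup M] [Module k M] (S : Submodule k M) {Y : Q.Obj} :
    ∀ (l : List Q.Obj) {X : Q.Obj} (d : ℤ) (φ : MultiFun Q X Y M),
      (∀ c, c.HasDegree d → φ.1 c ∈ S) → tensGrade Q Y l X d ≤ S.comap (liftTens M Y l X φ)
  | [], X, d, φ, h => fun x hx => h _ (Chain.HasDegree.single hx)
  | Z :: l, X, d, φ, h => by
    refine iSup_le fun e => Submodule.map₂_le.mpr fun x hx u hu => ?_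
    refine tensGrade_le S l (d - e) (MultiFun.curry X Y Z φ x) (fun c hc => ?_) hu
    have h' := h (.cons x c) (by simpa using Chain.HasDegree.cons hx hc)
    exact h'

theorem tensorLift_incl {X Y : Q.Obj} {M : Type v₁} [AddCommGroup M] [Module k M]
    (g : ∀ l : List Q.Obj, (∀ Z ∈ l, Z ∈ F) → (tens Q Y l X →ₗ[k] M)) (l : List Q.Obj)
    (hl : ∀ Z ∈ l, Z ∈ F) (x : tens Q Y l X) :
    tensorLift g (tensorIncl l hl x) = g l hl x := by
  classical
  exact DirectSum.toModule_lof (M := fun l : {l : List Q.Obj // ∀ Z ∈ l, Z ∈ F} => tens Q Y l.1 X)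
    k ⟨l, hl⟩ x

theorem tensorIncl_mem {X Y : Q.Obj} (l : List Q.Obj) (hl : ∀ Z ∈ l, Z ∈ F) {d : ℤ}
    {x : tens Q Y l X} (hx : x ∈ tensGrade Q Y l X d) :
    tensorIncl l hl x ∈ (tensorQuiver Q F).grade X Y d := by
  classical
  exact lof_mem_sumGrade (i := (⟨l, hl⟩ : {l : List Q.Obj // ∀ Z ∈ l, Z ∈ F})) hx

theorem tensorQuiver_grade_le {X Y : Q.Obj} {M : Type v₁} [AddCommGroup M] [Module k M]
    (S : Submodule k M) (d : ℤ)
    (g : ∀ l : List Q.Obj, (∀ Z ∈ l, Z ∈ F) → (tens Q Y l X →ₗ[k] M))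
    (h : ∀ l hl, ∀ x ∈ tensGrade Q Y l X d, g l hl x ∈ S) :
    (tensorQuiver Q F).grade X Y d ≤ S.comap (tensorLift g) := by
  classical
  refine sumGrade_le fun l x hx => ?_
  have h' := h l.1 l.2 x hx
  rw [← tensorLift_incl g l.1 l.2 x] at h'
  exact h'

theorem liftT_mem {M : Type v₁} [AddCommGroup M] [Module k M] {S : Submodule k M} {X Y : Q.Obj}
    {d : ℤ} {φ : MultiFun Q X Y M} (h : ∀ c, c.HasDegree d → φ.1 c ∈ S)
    {x : TensorHom Q Set.univ X Y} (hx : x ∈ (TPlus Q).grade X Y d) : liftT φ x ∈ S :=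
  tensorQuiver_grade_le S d _ (fun l _ _ hy => tensGrade_le S l d φ h hy) hx

theorem toTPlus_mem {X Y : Q.Obj} {d : ℤ} {x : TensorHom Q F X Y}
    (hx : x ∈ (tensorQuiver Q F).grade X Y d) : toTPlus F X Y x ∈ (TPlus Q).grade X Y d :=
  tensorQuiver_grade_le _ d _ (fun l _ _ hy => tensorIncl_mem l _ hy) hx

theorem ofTPlus_mem {X Y : Q.Obj} {d : ℤ} {x : TensorHom Q Set.univ X Y}
    (hx : x ∈ (TPlus Q).grade X Y d) : ofTPlus F X Y x ∈ (tensorQuiver Q F).grade X Y d := by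
  classical
  refine tensorQuiver_grade_le (F := Set.univ) (M := TensorHom Q F X Y)
    ((tensorQuiver Q F).grade X Y d) d
    (fun l _ => if hl : ∀ Z ∈ l, Z ∈ F then tensorIncl l hl else 0) (fun l _ y hy => ?_) hx
  split_ifs with hl
  · exact tensorIncl_mem l hl hy
  · exact zero_mem _

theorem ofLetter_mem {X Y : Q.Obj} {d : ℤ} {x : Q.shom X Y} (hx : x ∈ Q.grade X Y d) :
    ofLetter F X Y x ∈ (tensorQuiver Q F).grade X Y d :=
  tensorIncl_mem (X := X) (Y := Y) [] _ hx

theorem consT_mem {X Z Y : Q.Obj} {d e : ℤ} {x : Q.shom X Z} {y : TensorHom Q Set.univ Z Y}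
    (hx : x ∈ Q.grade X Z d) (hy : y ∈ (TPlus Q).grade Z Y e) :
    consT X Z Y x y ∈ (TPlus Q).grade X Y (d + e) := by
  classical
  suffices H : (TPlus Q).grade Z Y e ≤ ((TPlus Q).grade X Y (d + e)).comap (consT X Z Y x) from H hy
  refine sumGrade_le fun l u hu => ?_
  have h : consT X Z Y x (tensorIncl l.1 l.2 u) =
      tensorIncl (X := X) (Y := Y) (F := Set.univ) (Z :: l.1) (fun _ _ => trivial)
        (x ⊗ₜ[k] u : Q.shom X Z ⊗[k] tens Q Y l.1 Z) := by
    rw [consT, LinearMap.flip_apply, tensorLift_incl]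
    rfl
  have h' := tensorIncl_mem (F := Set.univ) (X := X) (Y := Y) (Z :: l.1) (fun _ _ => trivial)
    (tmul_mem_tensorGrade hx hu)
  rw [← h] at h'
  exact h'

theorem mulTens_mem {Z Y : Q.Obj} : ∀ (l : List Q.Obj) (X : Q.Obj) {d e : ℤ}
    {x : tens Q Z l X} {y : TensorHom Q Set.univ Z Y}, x ∈ tensGrade Q Z l X d →
    y ∈ (TPlus Q).grade Z Y e → mulTens Z Y l X x y ∈ (TPlus Q).grade X Y (d + e)
  | [], X, d, e, x, y, hx, hy => consT_mem hx hy
  | W :: l, X, d, e, x, y, hx, hy => by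
    suffices H : tensGrade Q Z (W :: l) X d ≤
        ((TPlus Q).grade X Y (d + e)).comap ((LinearMap.applyₗ y) ∘ₗ mulTens Z Y (W :: l) X) from
      H hx
    refine iSup_le fun i => Submodule.map₂_le.mpr fun a ha u hu => ?_
    have h := consT_mem ha (mulTens_mem l W hu hy)
    have e' : i + (d - i + e) = d + e := by ring
    rw [e'] at h
    exact h

theorem mulT_mem {X Z Y : Q.Obj} {d e : ℤ} {x : TensorHom Q Set.univ X Z}
    {y : TensorHom Q Set.univ Z Y} (hx : x ∈ (TPlus Q).grade X Z d)
    (hy : y ∈ (TPlus Q).grade Z Y e) : mulT x y ∈ (TPlus Q).grade X Y (d + e) := by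
  classical
  suffices H : (TPlus Q).grade X Z d ≤
      ((TPlus Q).grade X Y (d + e)).comap (mulT.flip y) from H hx
  refine sumGrade_le fun l u hu => ?_
  have h : mulT (tensorIncl l.1 l.2 u) y = mulTens Z Y l.1 X u y := by
    rw [mulT, tensorLift_incl]
  have h' := mulTens_mem l.1 X hu hy
  rw [← h] at h'
  exact h'

theorem pureT_mem {X Y : Q.Obj} {c : Chain Q X Y} {d : ℤ} (hc : c.HasDegree d) :
    pureT c ∈ (TPlus Q).grade X Y d := by
  induction hc with
  | nil => exact zero_mem _
  | @cons X Y Z x c d e hx hc ih =>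
    cases hc with
    | nil => rw [add_zero]; exact ofLetter_mem hx
    | cons hy hc => exact consT_mem hx ih

end Tensor

/-! ### Operations obtained from an associative multiplication and a differential -/

section Bar

variable (R : GradedQuiver.{w, u, v} k)
  (μ : ∀ X Y Z : R.Obj, R.shom X Y →ₗ[k] R.shom Y Z →ₗ[k] R.shom X Z)
  (β : ∀ X Y : R.Obj, R.shom X Y →ₗ[k] R.shom X Y)

/-- For `w₁ ⊗ ⋯ ⊗ wₙ`, `n ≥ 1`, the map
`a ↦ (a w₁ ⋯ wₙ)β - (a w₁ ⋯ w_{n-1} ⊗ wₙ)(β ⊗ 1)μ`. -/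
def barTail (X : R.Obj) : ∀ {Z Y : R.Obj}, Chain R Z Y → (R.shom X Z →ₗ[k] R.shom X Y)
  | _, _, .nil _ => 0
  | Z, Y, .cons w (.nil _) => β X Y ∘ₗ (μ X Z Y).flip w - (μ X Z Y).flip (R.sgn 1 Z Y w) ∘ₗ β X Z
  | _, _, .cons w (.cons w' W) => barTail X (.cons w' W) ∘ₗ (μ _ _ _).flip w

/-- `μ⁽ⁿ⁾β - (μ⁽ⁿ⁻¹⁾β ⊗ 1)μ`, where `μ⁽ⁿ⁾` is the product of `n` factors and `μ⁽⁰⁾ = 0`. -/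
def barRight : ∀ {X Y : R.Obj}, Chain R X Y → R.shom X Y
  | _, _, .nil _ => 0
  | X, Y, .cons w (.nil _) => β X Y w
  | X, _, .cons w (.cons w' W) => barTail R μ β X (.cons w' W) w

/-- `μ⁽ⁿ⁾β - (μ⁽ⁿ⁻¹⁾β ⊗ 1)μ - (1 ⊗ μ⁽ⁿ⁻¹⁾β)μ + (1 ⊗ μ⁽ⁿ⁻²⁾β ⊗ 1)μ⁽³⁾`, which is `β` for `n = 1`. -/
def barB : ∀ {X Y : R.Obj}, Chain R X Y → R.shom X Y
  | _, _, .nil _ => 0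
  | _, _, .cons w W => barRight R μ β (.cons w W) - μ _ _ _ w (barRight R μ β W)

theorem barTail_cons_append (X : R.Obj) {Y Z W V U : R.Obj} (z : R.shom Y Z) (p : Chain R Z W)
    (x : R.shom W V) (q : Chain R V U) : barTail R μ β X (.cons z (p.append (.cons x q))) =
      barTail R μ β X (p.append (.cons x q)) ∘ₗ (μ X Y Z).flip z := by
  cases p <;> rfl

theorem barTail_multilinear (X Z Y : R.Obj) :
    (barTail R μ β X : Chain R Z Y → _) ∈ MultiFun R Z Y (R.shom X Z →ₗ[k] R.shom X Y) := by
  intro Z W p q a x y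
  induction p with
  | nil =>
    cases q with
    | nil =>
      simp only [Chain.nil_append, barTail, map_add, map_smul, LinearMap.comp_add,
        LinearMap.comp_smul, LinearMap.add_comp, LinearMap.smul_comp, smul_sub]
      abel
    | cons z q =>
      simp only [Chain.nil_append, barTail, map_add, map_smul, LinearMap.comp_add,
        LinearMap.comp_smul]
  | cons z p ih =>
    simp only [Chain.cons_append, barTail_cons_append, ih, LinearMap.add_comp, LinearMap.smul_comp]

theorem barRight_cons_append {Y Z W V U : R.Obj} (z : R.shom Y Z) (p : Chain R Z W)
    (x : R.shom W V) (q : Chain R V U) : barRight R μ β (.cons z (p.append (.cons x q))) =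
      barTail R μ β Y (p.append (.cons x q)) z := by
  cases p <;> rfl

theorem barRight_multilinear (X Y : R.Obj) :
    (barRight R μ β : Chain R X Y → _) ∈ MultiFun R X Y (R.shom X Y) := by
  intro Z W p q a x y
  cases p with
  | nil =>
    cases q with
    | nil => simp only [Chain.nil_append, barRight, map_add, map_smul]
    | cons z q => simp only [Chain.nil_append, barRight, map_add, map_smul]
  | cons z p =>
    simp only [Chain.cons_append, barRight_cons_append, barTail_multilinear R μ β _ _ _ p q a x y,
      LinearMap.add_apply, LinearMap.smul_apply]

theorem barB_multilinear (X Y : R.Obj) :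
    (barB R μ β : Chain R X Y → _) ∈ MultiFun R X Y (R.shom X Y) := by
  intro Z W p q a x y
  have h := barRight_multilinear R μ β X Y p q a x y
  cases p with
  | nil =>
    simp only [Chain.nil_append] at h
    simp only [Chain.nil_append, barB, h, map_add, map_smul, LinearMap.add_apply,
      LinearMap.smul_apply, smul_sub]
    abel
  | cons z p =>
    have h' := barRight_multilinear R μ β _ Y p q a x y
    simp only [Chain.cons_append] at h
    simp only [Chain.cons_append, barB, h, h', map_add, map_smul, smul_sub]
    abel

variable {R μ β}

theorem barTail_mem
    (hμ : ∀ {X Y Z : R.Obj} {d e : ℤ} {x : R.shom X Y} {y : R.shom Y Z}, x ∈ R.grade X Y d →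
      y ∈ R.grade Y Z e → μ X Y Z x y ∈ R.grade X Z (d + e))
    (hβ : ∀ {X Y : R.Obj} {d : ℤ} {x : R.shom X Y}, x ∈ R.grade X Y d →
      β X Y x ∈ R.grade X Y (d + 1))
    {X Z Y : R.Obj} {W : Chain R Z Y} {d e : ℤ} (hW : W.HasDegree e)
    {a : R.shom X Z} (ha : a ∈ R.grade X Z d) :
    barTail R μ β X W a ∈ R.grade X Y (d + e + 1) := by
  induction hW generalizing d with
  | nil => exact zero_mem _
  | @cons Z V Y w W f e hw hW ih =>
    cases hW with
    | nil =>
      rw [add_zero]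
      refine sub_mem (hβ (hμ ha hw)) ?_
      have h := hμ (hβ ha) (signMap_mem (R.isInternal Z V) 1 hw)
      have e' : d + 1 + f = d + f + 1 := by ring
      rw [e'] at h
      exact h
    | cons hw' hW =>
      have h := ih (hμ ha hw)
      rw [add_assoc d] at h
      exact h

theorem barRight_mem
    (hμ : ∀ {X Y Z : R.Obj} {d e : ℤ} {x : R.shom X Y} {y : R.shom Y Z}, x ∈ R.grade X Y d →
      y ∈ R.grade Y Z e → μ X Y Z x y ∈ R.grade X Z (d + e))
    (hβ : ∀ {X Y : R.Obj} {d : ℤ} {x : R.shom X Y}, x ∈ R.grade X Y d →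
      β X Y x ∈ R.grade X Y (d + 1))
    {X Y : R.Obj} {W : Chain R X Y} {d : ℤ} (hW : W.HasDegree d) :
    barRight R μ β W ∈ R.grade X Y (d + 1) := by
  cases hW with
  | nil => exact zero_mem _
  | cons hw hW =>
    cases hW with
    | nil => rw [add_zero]; exact hβ hw
    | cons hw' hW => exact barTail_mem hμ hβ (.cons hw' hW) hw

theorem barB_mem
    (hμ : ∀ {X Y Z : R.Obj} {d e : ℤ} {x : R.shom X Y} {y : R.shom Y Z}, x ∈ R.grade X Y d →
      y ∈ R.grade Y Z e → μ X Y Z x y ∈ R.grade X Z (d + e))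
    (hβ : ∀ {X Y : R.Obj} {d : ℤ} {x : R.shom X Y}, x ∈ R.grade X Y d →
      β X Y x ∈ R.grade X Y (d + 1))
    {X Y : R.Obj} {W : Chain R X Y} {d : ℤ} (hW : W.HasDegree d) :
    barB R μ β W ∈ R.grade X Y (d + 1) := by
  have h := barRight_mem hμ hβ hW
  cases hW with
  | nil => exact zero_mem _
  | @cons _ _ _ _ _ d e hw hW =>
    refine sub_mem h ?_
    rw [add_assoc]
    exact hμ hw (barRight_mem hμ hβ hW)

end Bar

/-! ### The quotient `D(𝒞|ℬ)` -/

section Quotient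

theorem sum_map_flatMap {α β : Type*} {M : Type v₁} [AddCommGroup M] (l : List α)
    (f : α → List β) (g : β → M) :
    ((l.flatMap f).map g).sum = (l.map fun a => ((f a).map g).sum).sum := by
  induction l with
  | nil => simp
  | cons a l ih => simp [ih]

theorem MultiFun.list_sum {Q : GradedQuiver.{w, u, v} k} {M : Type v₁} [AddCommGroup M] [Module k M]
    {α : Type*} {X Y : Q.Obj} (l : List α) (G : α → Chain Q X Y → M)
    (hG : ∀ s, G s ∈ MultiFun Q X Y M) :
    (fun c => (l.map fun s => G s c).sum) ∈ MultiFun Q X Y M := by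
  intro Z W p q a x y
  simp only [fun s => hG s p q a x y, sum_map_smul_add]

variable (A : PreAInfCat.{w, u, v} k)

theorem sum_bTerms {M : Type v₁} [AddCommGroup M] [Module k M] {X Y : A.Obj}
    {φ : Chain A.toGradedQuiver X Y → M} (hφ : φ ∈ MultiFun A.toGradedQuiver X Y M) :
    (fun c => ((A.bTerms c).map φ).sum) ∈ MultiFun A.toGradedQuiver X Y M := by
  simp only [PreAInfCat.bTerms, sum_map_flatMap, List.map_map, Function.comp_def]
  refine MultiFun.sum_splits (fun Z p q => (q.splits.map fun t =>
    φ (p.append (.cons (A.b t.2.1) (t.2.2.sgn 1)))).sum) (fun Z q => ?_) (fun Z p => ?_)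
  · exact MultiFun.list_sum _ _ fun t => MultiFun.postpend hφ (.cons (A.b t.2.1) (t.2.2.sgn 1))
  · refine MultiFun.sum_splits (fun W m q => φ (p.append (.cons (A.b m) (q.sgn 1))))
      (fun W q => ?_) (fun W m => ?_)
    · intro U V r s a x y
      simp only [A.b_multilinear _ _ r s a x y]
      exact hφ p (q.sgn 1) a _ _
    · have h := MultiFun.prepend (MultiFun.prepend hφ p) (.single (A.b m))
      exact MultiFun.comp_map (R := A.toGradedQuiver) (fun X => X) (fun X Y => A.sgn 1 X Y) h

theorem bTerms_degree {X Y : A.Obj} {c : Chain A.toGradedQuiver X Y} {d : ℤ} (hc : c.HasDegree d) :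
    ∀ z ∈ A.bTerms c, z.HasDegree (d + 1) := by
  intro z hz
  simp only [PreAInfCat.bTerms, List.mem_flatMap, List.mem_map] at hz
  obtain ⟨s, hs, t, ht, rfl⟩ := hz
  obtain ⟨e, f, he, hf, rfl⟩ := hc.of_mem_splits s hs
  obtain ⟨g, h, hg, hh, rfl⟩ := hf.of_mem_splits t ht
  have := he.append (.cons (A.b_degree _ _ hg) (hh.sgn 1))
  have e' : e + (g + 1 + h) = e + (g + h) + 1 := by ring
  rwa [e'] at this

/-- The coderivation `b : T⁺s𝒞 → T⁺s𝒞` of the `A∞`-category `𝒞`. -/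
def bT (X Y : A.Obj) :
    TensorHom A.toGradedQuiver Set.univ X Y →ₗ[k] TensorHom A.toGradedQuiver Set.univ X Y :=
  liftT ⟨fun c => ((A.bTerms c).map pureT).sum, sum_bTerms A (pureT_mem_multiFun X Y)⟩

theorem bT_mem {X Y : A.Obj} {d : ℤ} {x : TensorHom A.toGradedQuiver Set.univ X Y}
    (hx : x ∈ (TPlus A.toGradedQuiver).grade X Y d) :
    bT A X Y x ∈ (TPlus A.toGradedQuiver).grade X Y (d + 1) := by
  refine liftT_mem (fun c hc => ?_) hx
  refine list_sum_mem fun z hz => ?_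
  obtain ⟨r, hr, rfl⟩ := List.mem_map.mp hz
  exact pureT_mem (bTerms_degree A hc r hr)

/-- The components
`b̄ₙ = μ⁽ⁿ⁾b - (μ⁽ⁿ⁻¹⁾b ⊗ 1)μ - (1 ⊗ μ⁽ⁿ⁻¹⁾b)μ + (1 ⊗ μ⁽ⁿ⁻²⁾b ⊗ 1)μ⁽³⁾ : (T⁺s𝒞)^{⊗n} → T⁺s𝒞`,
with `μ⁽⁰⁾ = 0`; in particular `b̄₁ = b`. -/
def barT (X Y : A.Obj) (W : Chain (TPlus A.toGradedQuiver) X Y) :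
    TensorHom A.toGradedQuiver Set.univ X Y :=
  barB (TPlus A.toGradedQuiver) (fun _ _ _ => mulT) (bT A) W

/-- The quiver `D(𝒞|ℬ)`, where `ℬ` is the full subcategory on the set of objects `F`, with the
operations `b̄ₙ`. These preserve the direct summand `sD(𝒞|ℬ) ⊆ T⁺s𝒞`, and they are restricted to it
with the help of the embedding and the projection of the direct summand. -/
def quotientD (F : Set A.Obj) : PreAInfCat.{w, u, max u v} k where
  toGradedQuiver := tensorQuiver A.toGradedQuiver F
  b {X Y} W := ofTPlus F X Y (barT A X Y (Chain.map (Q := tensorQuiver A.toGradedQuiver F)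
    (R := TPlus A.toGradedQuiver) (fun X => X) (fun X Y => toTPlus F X Y) W))
  b_multilinear X Y := MultiFun.comp_linear
    (MultiFun.comp_map (Q := tensorQuiver A.toGradedQuiver F) (R := TPlus A.toGradedQuiver)
      (fun X => X) (fun X Y => toTPlus F X Y)
      (barB_multilinear (TPlus A.toGradedQuiver) (fun _ _ _ => mulT) (bT A) X Y)) (ofTPlus F X Y)
  b_nil X := map_zero (ofTPlus F X X)
  b_degree _ _ hc := ofTPlus_mem (barB_mem (R := TPlus A.toGradedQuiver) mulT_mem (bT_mem A)
    (hc.map fun _ _ _ _ hx => toTPlus_mem (F := F) hx))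

/-- The canonical strict embedding `𝒞 → D(𝒞|ℬ)`: the identity on objects, with first component the
direct summand embedding `s𝒞 = T¹s𝒞 → sD(𝒞|ℬ)` and with vanishing higher components. -/
def embeddingD (F : Set A.Obj) : CocatHom A (quotientD A F) where
  obj X := X
  app {X Y} c := ofLetter F X Y (CocatHom.idApp A c)
  app_multilinear X Y :=
    MultiFun.comp_linear ((CocatHom.id A).app_multilinear X Y) (ofLetter F X Y)
  app_nil X := map_zero (ofLetter F X X)
  app_degree c d hc := ofLetter_mem ((CocatHom.id A).app_degree c d hc)

end Quotient

end AInf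

end

/-! The category `𝓔` sits in `D(𝓔|𝓕)` as the one-letter words. When `𝓕` is contractible, the letters
are a strong deformation retract of `D(𝓔|𝓕)`, and the embedding is strictly compatible with all
operations. The rest is obstruction theory along this retraction.

The retraction. For `Y ∈ 𝓕` the unit cycle in `s𝓔(Y,Y)` is a boundary, so right multiplication by it
on `s𝓔(X,Y)` is null-homotopic; it is also homotopy invertible, and therefore `s𝓔(X,Y)` is
contractible for every `X` (`exists_contraction`). In a word `x₁ ⊗ ⋯ ⊗ xₙ` with `n ≥ 2` the first
letter ends in an object of `𝓕`, so the contraction `h` may be applied to it. The map `1 - (bh +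
hb)` then shortens the word, since only terms in which `b` merges the first two letters survive
(`bT_headT`, `shorten_mem_words`), and it fixes letters. Iterating it as often as the word has
letters gives a projection `P` onto letters, homotopic to the identity by some `H` with `HP = 0`
(`homF_homotopy`, `retractD`).

Obstruction theory. Filter families of components by the length of chains. The leading part of the
differential `B₁` is `linDiff`, which involves only `b₁`. The tensor homotopy `∑ P ⊗ ⋯ ⊗ P ⊗ H ⊗ 1 ⊗
⋯ ⊗ 1` induces an operator `K` between the identity and restriction to the image of `P`
(`linDiff_homotopyOp`), and `HP = 0` makes `K` vanish on that image. An equation with prescribed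
values on the image of `P` thus becomes a fixed point problem that improves by one length at each
step (`exists_fixedPoint`). The error of the fixed point is a `B₁`-cycle `w` with `w = K(linDiff
w)`, and such a cycle vanishes by induction on length (`Coder.app_eq_zero`). This yields two
statements: cycles vanishing on the image of `P` are boundaries of coderivations vanishing there
(`Retract.exists_coder`), and a map which is strict on the image of `P` extends to an `A∞`-functor
(`Retract.exists_functor`).

Conclusion. Let `σ` be the projection to letters. The functor `π` extends `σ`, and `ju π = id` holds
exactly because `σ` is a left inverse of the embedding. The unit transformation of `𝓔` lifts from
the image of `P` to a unit of `D(𝓔|𝓕)`. Relations between lifts hold up to `≡` as soon as they hold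
in `𝓔` (`Over.transEquiv`). Since `π ju` and the identity agree on the image of `P`, the unit also
lifts to mutually inverse transformations between them.

That `D(𝓔|𝓕)` is an `A∞`-category at all rests on two facts. The product map of the tensor algebra
carries the coderivation `b̄` to `b` (`lsum_bTerms_chainProd`), so `b̄² = 0` follows from `b² = 0`
by induction on length. And on pure tensors `b̄` keeps only the terms in which `b` covers everything
from the last letter of the first factor to the first letter of the last one (`bar_pureT`), so no
new intermediate object appears. -/

noncomputable section

namespace AInf

open scoped TensorProduct DirectSum

variable {k : Type w} [CommRing k]

/-! ### Signs -/

/-- The sign `(-1)^p` as an integer. -/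
def koszul (p : ℤ) : ℤ := ((p.negOnePow : ℤˣ) : ℤ)

theorem koszul_add (p q : ℤ) : koszul (p + q) = koszul p * koszul q := by
  simp [koszul, Int.negOnePow_add]

theorem koszul_even {p : ℤ} (h : Even p) : koszul p = 1 := by
  simp [koszul, Int.negOnePow_even p h]

theorem koszul_mul_self (p : ℤ) : koszul p * koszul p = 1 := by
  rw [← koszul_add]
  exact koszul_even ⟨p, rfl⟩

@[simp] theorem koszul_one : koszul 1 = -1 := by simp [koszul]

@[simp] theorem koszul_zero : koszul 0 = 1 := by simp [koszul]

@[simp] theorem koszul_neg (p : ℤ) : koszul (-p) = koszul p := by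
  simp [koszul]

section Quiver

variable {Q : GradedQuiver.{w, u, v} k} {R : GradedQuiver.{w, u₁, v₁} k}

theorem GradedQuiver.induction_homogeneous {X Y : Q.Obj} (S : Submodule k (Q.shom X Y))
    (h : ∀ d, ∀ x ∈ Q.grade X Y d, x ∈ S) (x : Q.shom X Y) : x ∈ S := by
  have hx : x ∈ iSup (Q.grade X Y) := by
    rw [(Q.isInternal X Y).submodule_iSup_eq_top]; trivial
  exact (iSup_le h : iSup (Q.grade X Y) ≤ S) hx

theorem GradedQuiver.hom_ext {X Y : Q.Obj} {M : Type*} [AddCommGroup M] [Module k M]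
    {f g : Q.shom X Y →ₗ[k] M} (h : ∀ d, ∀ x ∈ Q.grade X Y d, f x = g x) : f = g :=
  LinearMap.ext fun x => Q.induction_homogeneous (LinearMap.eqLocus f g) h x

theorem GradedQuiver.sgn_of_mem (p : ℤ) {X Y : Q.Obj} {d : ℤ} {x : Q.shom X Y}
    (hx : x ∈ Q.grade X Y d) : Q.sgn p X Y x = koszul (p * d) • x :=
  signMap_of_mem _ p hx

theorem GradedQuiver.sgn_mem (p : ℤ) {X Y : Q.Obj} {d : ℤ} {x : Q.shom X Y}
    (hx : x ∈ Q.grade X Y d) : Q.sgn p X Y x ∈ Q.grade X Y d :=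
  signMap_mem _ p hx

theorem GradedQuiver.sgn_sgn (p q : ℤ) {X Y : Q.Obj} (x : Q.shom X Y) :
    Q.sgn p X Y (Q.sgn q X Y x) = Q.sgn (p + q) X Y x := by
  have : Q.sgn p X Y ∘ₗ Q.sgn q X Y = Q.sgn (p + q) X Y := Q.hom_ext fun d x hx => by
    rw [LinearMap.comp_apply, Q.sgn_of_mem q hx, map_zsmul, Q.sgn_of_mem p hx, Q.sgn_of_mem _ hx,
      smul_smul, add_mul, koszul_add, mul_comm]
  exact LinearMap.congr_fun this x

theorem GradedQuiver.sgn_even {p : ℤ} (h : Even p) {X Y : Q.Obj} (x : Q.shom X Y) :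
    Q.sgn p X Y x = x := by
  have : Q.sgn p X Y = LinearMap.id := Q.hom_ext fun d x hx => by
    rw [Q.sgn_of_mem p hx, koszul_even (h.mul_right d), one_smul, LinearMap.id_apply]
  exact LinearMap.congr_fun this x

/-- A homogeneous map of degree `p'` commutes with the sign operators up to `(-1)^{pp'}`. -/
theorem GradedQuiver.map_sgn {X Y : Q.Obj} {X' Y' : R.Obj} (g : Q.shom X Y →ₗ[k] R.shom X' Y')
    (p' : ℤ) (hg : ∀ d, ∀ x ∈ Q.grade X Y d, g x ∈ R.grade X' Y' (d + p')) (p : ℤ)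
    (x : Q.shom X Y) : g (Q.sgn p X Y x) = koszul (p * p') • R.sgn p X' Y' (g x) := by
  have : g ∘ₗ Q.sgn p X Y = koszul (p * p') • (R.sgn p X' Y' ∘ₗ g) := Q.hom_ext fun d x hx => by
    rw [LinearMap.comp_apply, Q.sgn_of_mem p hx, LinearMap.smul_apply, LinearMap.comp_apply,
      R.sgn_of_mem p (hg d x hx), smul_smul, mul_add, koszul_add, map_zsmul, mul_left_comm,
      koszul_mul_self, mul_one]
  exact LinearMap.congr_fun this x

/-! ### Sums over the splittings of a chain -/

namespace Chain

/-- The number of elements of a chain. -/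
def length : ∀ {X Y : Q.Obj}, Chain Q X Y → ℕ
  | _, _, nil _ => 0
  | _, _, cons _ c => c.length + 1

@[simp] theorem length_nil (X : Q.Obj) : (nil X : Chain Q X X).length = 0 := rfl

@[simp] theorem length_cons {X Y Z : Q.Obj} (x : Q.shom X Y) (c : Chain Q Y Z) :
    (cons x c).length = c.length + 1 := rfl

@[simp] theorem length_append {X Y Z : Q.Obj} (p : Chain Q X Y) (q : Chain Q Y Z) :
    (p.append q).length = p.length + q.length := by
  induction p with
  | nil => simp
  | cons x p ih => simp [ih]; omega

@[simp] theorem length_map (φ : Q.Obj → R.Obj) (g : ∀ X Y, Q.shom X Y → R.shom (φ X) (φ Y))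
    {X Y : Q.Obj} (p : Chain Q X Y) : (map φ g p).length = p.length := by
  induction p with
  | nil => rfl
  | cons x p ih => simp [map, ih]

@[simp] theorem length_sgn (p : ℤ) {X Y : Q.Obj} (c : Chain Q X Y) :
    (c.sgn p).length = c.length := length_map _ _ c

@[simp] theorem length_single {X Y : Q.Obj} (x : Q.shom X Y) : (single x).length = 1 := rfl

@[simp] theorem sgn_nil (p : ℤ) (X : Q.Obj) : (nil X : Chain Q X X).sgn p = nil X := rfl

@[simp] theorem sgn_cons (p : ℤ) {X Y Z : Q.Obj} (x : Q.shom X Y) (c : Chain Q Y Z) :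
    (cons x c).sgn p = cons (Q.sgn p X Y x) (c.sgn p) := rfl

theorem sgn_append (p : ℤ) {X Y Z : Q.Obj} (c : Chain Q X Y) (d : Chain Q Y Z) :
    (c.append d).sgn p = (c.sgn p).append (d.sgn p) := map_append _ _ c d

theorem sgn_sgn (p q : ℤ) {X Y : Q.Obj} (c : Chain Q X Y) :
    (c.sgn q).sgn p = c.sgn (p + q) := by
  induction c with
  | nil => rfl
  | cons x c ih => simp [ih, Q.sgn_sgn]

theorem sgn_even {p : ℤ} (h : Even p) {X Y : Q.Obj} (c : Chain Q X Y) : c.sgn p = c := by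
  induction c with
  | nil => rfl
  | cons x c ih => simp [ih, Q.sgn_even h]

theorem map_sgn (φ : Q.Obj → R.Obj) (g : ∀ X Y, Q.shom X Y →ₗ[k] R.shom (φ X) (φ Y))
    (hg : ∀ X Y d, ∀ x ∈ Q.grade X Y d, g X Y x ∈ R.grade _ _ d) (p : ℤ) {X Y : Q.Obj}
    (c : Chain Q X Y) :
    map φ (fun X Y => g X Y) (c.sgn p) = (map φ (fun X Y => g X Y) c).sgn p := by
  induction c with
  | nil => rfl
  | @cons X Y Z x c ih =>
    have := Q.map_sgn (g X Y) 0 (by simpa using hg X Y) p x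
    simp only [mul_zero, koszul_zero, one_smul] at this
    simp [map, ih, this]

/-- The sum of `G` over all presentations of `c` as a concatenation of two chains. -/
def sumSplits {M : Type*} [AddCommMonoid M] {X Y : Q.Obj} (c : Chain Q X Y)
    (G : ∀ Z, Chain Q X Z → Chain Q Z Y → M) : M :=
  (c.splits.map fun s => G s.1 s.2.1 s.2.2).sum

section

variable {M : Type*} [AddCommMonoid M] {N : Type*} [AddCommMonoid N]

@[simp] theorem sumSplits_nil (X : Q.Obj) (G : ∀ Z, Chain Q X Z → Chain Q Z X → M) :
    (nil X).sumSplits G = G X (nil X) (nil X) := by simp [sumSplits, splits]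

@[simp] theorem sumSplits_cons {X Y W : Q.Obj} (x : Q.shom X W) (c : Chain Q W Y)
    (G : ∀ Z, Chain Q X Z → Chain Q Z Y → M) :
    (cons x c).sumSplits G =
      G X (nil X) (cons x c) + c.sumSplits fun Z p q => G Z (cons x p) q := by
  simp [sumSplits, splits, Function.comp_def]

theorem sumSplits_append_cons {X Y Z W : Q.Obj} (p : Chain Q X Y) (x : Q.shom Y Z)
    (q : Chain Q Z W) (G : ∀ Z, Chain Q X Z → Chain Q Z W → M) :
    (p.append (cons x q)).sumSplits G =
      (p.sumSplits fun _ a b => G _ a (b.append (cons x q))) +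
      q.sumSplits fun _ a b => G _ (p.append (cons x a)) b := by
  simp [sumSplits, splits_append_cons, Function.comp_def]

/-- The equation `p.append q = c` is kept because inductions on length or on suffixes need to know
that the pieces come from `c`. -/
theorem sumSplits_congr' {X Y : Q.Obj} (c : Chain Q X Y)
    {G G' : ∀ Z, Chain Q X Z → Chain Q Z Y → M}
    (h : ∀ Z p q, p.append q = c → G Z p q = G' Z p q) : c.sumSplits G = c.sumSplits G' := by
  induction c with
  | nil => simp [h _ (nil _) (nil _) rfl]
  | cons x c ih =>
    rw [sumSplits_cons, sumSplits_cons, h _ _ _ rfl]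
    congr 1
    exact ih fun Z p q e => h _ _ _ (by rw [cons_append, e])

theorem sumSplits_congr {X Y : Q.Obj} (c : Chain Q X Y)
    {G G' : ∀ Z, Chain Q X Z → Chain Q Z Y → M}
    (h : ∀ Z p q, G Z p q = G' Z p q) : c.sumSplits G = c.sumSplits G' :=
  c.sumSplits_congr' fun Z p q _ => h Z p q

theorem sumSplits_add {X Y : Q.Obj} (c : Chain Q X Y)
    (G G' : ∀ Z, Chain Q X Z → Chain Q Z Y → M) :
    (c.sumSplits fun Z p q => G Z p q + G' Z p q) = c.sumSplits G + c.sumSplits G' := by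
  induction c with
  | nil => simp
  | cons x c ih => simp only [sumSplits_cons, ih]; abel

@[simp] theorem sumSplits_zero {X Y : Q.Obj} (c : Chain Q X Y) :
    (c.sumSplits fun _ _ _ => (0 : M)) = 0 := by
  induction c with
  | nil => simp
  | cons x c ih => simp only [sumSplits_cons, ih, add_zero]

theorem map_sumSplits (g : M →+ N) {X Y : Q.Obj} (c : Chain Q X Y)
    (G : ∀ Z, Chain Q X Z → Chain Q Z Y → M) :
    g (c.sumSplits G) = c.sumSplits fun Z p q => g (G Z p q) := by
  induction c with
  | nil => simp
  | cons x c ih => simp only [sumSplits_cons, map_add, ih]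

theorem sumSplits_comm {X Y : Q.Obj} {X' Y' : R.Obj} (c : Chain Q X Y) (d : Chain R X' Y')
    (G : ∀ Z, Chain Q X Z → Chain Q Z Y → ∀ W, Chain R X' W → Chain R W Y' → M) :
    (c.sumSplits fun Z p q => d.sumSplits (G Z p q)) =
      d.sumSplits fun W a b => c.sumSplits fun Z p q => G Z p q W a b := by
  induction c with
  | nil => simp
  | cons x c ih => simp only [sumSplits_cons, ih, sumSplits_add]

/-- Coassociativity of the cut comultiplication: both sides run over all cuts of `c` into three
chains. -/
theorem sumSplits_assoc {X Y : Q.Obj} (c : Chain Q X Y)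
    (G : ∀ Z W, Chain Q X Z → Chain Q Z W → Chain Q W Y → M) :
    (c.sumSplits fun W p q => p.sumSplits fun Z a b => G Z W a b q) =
      c.sumSplits fun Z a q' => q'.sumSplits fun W b q => G Z W a b q := by
  induction c with
  | nil => simp
  | cons x c ih =>
    simp only [sumSplits_cons, sumSplits_nil, sumSplits_add, ih]
    abel

theorem sumSplits_map (φ : Q.Obj → R.Obj) (g : ∀ X Y, Q.shom X Y → R.shom (φ X) (φ Y))
    {X Y : Q.Obj} (c : Chain Q X Y) (G : ∀ Z, Chain R (φ X) Z → Chain R Z (φ Y) → M) :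
    (map φ g c).sumSplits G = c.sumSplits fun Z p q => G (φ Z) (map φ g p) (map φ g q) := by
  induction c with
  | nil => simp [map]
  | cons x c ih => simp [map, ih]

theorem sumSplits_sgn (p : ℤ) {X Y : Q.Obj} (c : Chain Q X Y)
    (G : ∀ Z, Chain Q X Z → Chain Q Z Y → M) :
    (c.sgn p).sumSplits G = c.sumSplits fun Z a b => G Z (a.sgn p) (b.sgn p) :=
  sumSplits_map (fun X => X) _ c G

/-- Only the splitting with empty first chain contributes. -/
theorem sumSplits_eq_left {X Y : Q.Obj} (c : Chain Q X Y)
    (G : ∀ Z, Chain Q X Z → Chain Q Z Y → M)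
    (h : ∀ Z p q, p.length ≠ 0 → p.append q = c → G Z p q = 0) :
    c.sumSplits G = G X (nil X) c := by
  cases c with
  | nil => simp
  | cons x c =>
    rw [sumSplits_cons, sumSplits_congr' (G' := fun _ _ _ => 0) c
      (fun Z p q e => h Z (cons x p) q (by simp) (by rw [cons_append, e])), sumSplits_zero,
      add_zero]

/-- Only the splitting with empty second chain contributes. -/
theorem sumSplits_eq_right {X Y : Q.Obj} (c : Chain Q X Y)
    (G : ∀ Z, Chain Q X Z → Chain Q Z Y → M)
    (h : ∀ Z p q, q.length ≠ 0 → p.append q = c → G Z p q = 0) :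
    c.sumSplits G = G Y c (nil Y) := by
  induction c with
  | nil => simp
  | cons x c ih =>
    rw [sumSplits_cons, h _ (nil _) (cons x c) (by simp) rfl, zero_add]
    exact ih _ fun Z p q hq e => h Z (cons x p) q hq (by rw [cons_append, e])

end

end Chain

/-! ### Multilinear functions -/

section MultiFun

variable {M : Type*} [AddCommGroup M] [Module k M] {N : Type*} [AddCommGroup N] [Module k N]

/-- A multilinear function as a linear function of one of the letters. -/
def MultiFun.slot {X Y Z W : Q.Obj} {φ : Chain Q X Y → M} (hφ : φ ∈ MultiFun Q X Y M)
    (p : Chain Q X Z) (q : Chain Q W Y) : Q.shom Z W →ₗ[k] M where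
  toFun x := φ (p.append (.cons x q))
  map_add' x y := by simpa using hφ p q 1 x y
  map_smul' a x := by
    have h₀ : φ (p.append (.cons 0 q)) = 0 := by simpa using hφ p q 1 0 0
    simpa [h₀] using hφ p q a x 0

@[simp] theorem MultiFun.slot_apply {X Y Z W : Q.Obj} {φ : Chain Q X Y → M}
    (hφ : φ ∈ MultiFun Q X Y M) (p : Chain Q X Z) (q : Chain Q W Y) (x : Q.shom Z W) :
    MultiFun.slot hφ p q x = φ (p.append (.cons x q)) := rfl

theorem MultiFun.slot_zero {X Y Z W : Q.Obj} {φ : Chain Q X Y → M} (hφ : φ ∈ MultiFun Q X Y M)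
    (p : Chain Q X Z) (q : Chain Q W Y) : φ (p.append (.cons 0 q)) = 0 :=
  map_zero (slot hφ p q)

theorem MultiFun.cons_zero {X Y Z : Q.Obj} {φ : Chain Q X Y → M} (hφ : φ ∈ MultiFun Q X Y M)
    (q : Chain Q Z Y) : φ (.cons 0 q) = 0 :=
  slot_zero hφ (.nil X) q

theorem MultiFun.prepend_cons {X Y Z : Q.Obj} {φ : Chain Q X Y → M} (hφ : φ ∈ MultiFun Q X Y M)
    (x : Q.shom X Z) : (fun c => φ (.cons x c)) ∈ MultiFun Q Z Y M :=
  MultiFun.prepend hφ (.single x)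

theorem MultiFun.prepend_append_cons {X Y Z W : Q.Obj} {φ : Chain Q X Y → M}
    (hφ : φ ∈ MultiFun Q X Y M) (p : Chain Q X Z) (x : Q.shom Z W) :
    (fun c => φ (p.append (.cons x c))) ∈ MultiFun Q W Y M :=
  MultiFun.prepend_cons (MultiFun.prepend hφ p) x

theorem MultiFun.sgn {X Y : Q.Obj} {φ : Chain Q X Y → M} (hφ : φ ∈ MultiFun Q X Y M) (p : ℤ) :
    (fun c : Chain Q X Y => φ (c.sgn p)) ∈ MultiFun Q X Y M :=
  MultiFun.comp_map (R := Q) (fun X => X) (fun X Y => Q.sgn p X Y) hφ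

/-- Multilinear functions which agree on chains of homogeneous elements are equal. -/
theorem MultiFun.ext_homogeneous {X Y : Q.Obj} {φ ψ : Chain Q X Y → M}
    (hφ : φ ∈ MultiFun Q X Y M) (hψ : ψ ∈ MultiFun Q X Y M)
    (h : ∀ c d, c.HasDegree d → φ c = ψ c) (c : Chain Q X Y) : φ c = ψ c := by
  induction c with
  | nil X => exact h _ _ (.nil X)
  | @cons X Y Z x c ih =>
    have : MultiFun.slot hφ (.nil _) c = MultiFun.slot hψ (.nil _) c :=
      Q.hom_ext fun d x hx => ih (prepend_cons hφ x) (prepend_cons hψ x)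
        fun c e hc => h _ _ (.cons hx hc)
    exact LinearMap.congr_fun this x

/-- Each letter contributes its own sign, and the exponents add up to `p` times the total degree. -/
theorem Chain.HasDegree.sgn_eq {X Y : Q.Obj} {φ : Chain Q X Y → M} (hφ : φ ∈ MultiFun Q X Y M)
    (p : ℤ) {c : Chain Q X Y} {d : ℤ} (hc : c.HasDegree d) :
    φ (c.sgn p) = koszul (p * d) • φ c := by
  induction hc with
  | nil => simp
  | @cons X Y Z x c d e hx hc ih =>
    have h₁ := ih (MultiFun.prepend_cons hφ (Q.sgn p X Y x))
    have h₂ : φ (.cons (Q.sgn p X Y x) c) = koszul (p * d) • φ (.cons x c) := by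
      rw [Q.sgn_of_mem p hx]
      exact map_zsmul (MultiFun.slot hφ (.nil _) c) _ _
    rw [Chain.sgn_cons, h₁, h₂, smul_smul, mul_add, koszul_add, mul_comm]

/-- A multilinear function of degree `p'` commutes with the sign operators up to `(-1)^{pp'}`. -/
theorem MultiFun.app_sgn {X Y : Q.Obj} {X' Y' : R.Obj} {φ : Chain Q X Y → R.shom X' Y'}
    (hφ : φ ∈ MultiFun Q X Y (R.shom X' Y')) (p' : ℤ)
    (hd : ∀ c d, c.HasDegree d → φ c ∈ R.grade X' Y' (d + p')) (p : ℤ) (c : Chain Q X Y) :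
    φ (c.sgn p) = koszul (p * p') • R.sgn p X' Y' (φ c) := by
  refine MultiFun.ext_homogeneous (MultiFun.sgn hφ p) (ψ := fun c => koszul (p * p') •
    R.sgn p X' Y' (φ c)) ?_ (fun c d hc => ?_) c
  · simpa using MultiFun.comp_linear hφ (koszul (p * p') • R.sgn p X' Y')
  · rw [hc.sgn_eq hφ, R.sgn_of_mem p (hd c d hc), smul_smul, mul_add, koszul_add, mul_comm (koszul (p * d)),
      ← mul_assoc, koszul_mul_self, one_mul]

theorem MultiFun.sumSplits {X Y : Q.Obj} (G : ∀ Z, Chain Q X Z → Chain Q Z Y → M)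
    (h₁ : ∀ Z q, (fun p => G Z p q) ∈ MultiFun Q X Z M)
    (h₂ : ∀ Z p, G Z p ∈ MultiFun Q Z Y M) :
    (fun c : Chain Q X Y => c.sumSplits G) ∈ MultiFun Q X Y M :=
  MultiFun.sum_splits G h₁ h₂

end MultiFun

end Quiver

end AInf
end

noncomputable section

namespace AInf

open scoped TensorProduct DirectSum

variable {k : Type w} [CommRing k]

/-! ### Sums over lists -/

section LSum

variable {α β : Type*} {M N : Type*} [AddCommGroup M] [AddCommGroup N]

/-- The sum of the values of a function on a list. -/
def lsum (l : List α) (φ : α → M) : M := (l.map φ).sum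

@[simp] theorem lsum_nil (φ : α → M) : lsum [] φ = 0 := rfl

@[simp] theorem lsum_cons (a : α) (l : List α) (φ : α → M) :
    lsum (a :: l) φ = φ a + lsum l φ := by simp [lsum]

@[simp] theorem lsum_append (l l' : List α) (φ : α → M) :
    lsum (l ++ l') φ = lsum l φ + lsum l' φ := by simp [lsum]

theorem lsum_map (l : List α) (g : α → β) (φ : β → M) :
    lsum (l.map g) φ = lsum l fun a => φ (g a) := by simp [lsum, Function.comp_def]

theorem lsum_flatMap (l : List α) (g : α → List β) (φ : β → M) :
    lsum (l.flatMap g) φ = lsum l fun a => lsum (g a) φ := by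
  induction l with
  | nil => rfl
  | cons a l ih => simp [ih]

theorem lsum_add (l : List α) (φ ψ : α → M) :
    (lsum l fun a => φ a + ψ a) = lsum l φ + lsum l ψ := by
  induction l with
  | nil => simp
  | cons a l ih => simp only [lsum_cons, ih]; abel

@[simp] theorem lsum_zero (l : List α) : (lsum l fun _ => (0 : M)) = 0 := by
  induction l with
  | nil => simp
  | cons a l ih => simp [ih]

theorem map_lsum (g : M →+ N) (l : List α) (φ : α → M) :
    g (lsum l φ) = lsum l fun a => g (φ a) := by
  induction l with
  | nil => simp
  | cons a l ih => simp [ih]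

theorem lsum_zsmul (l : List α) (n : ℤ) (φ : α → M) :
    (lsum l fun a => n • φ a) = n • lsum l φ := by
  induction l with
  | nil => simp
  | cons a l ih => simp [ih]

theorem lsum_sub (l : List α) (φ ψ : α → M) :
    (lsum l fun a => φ a - ψ a) = lsum l φ - lsum l ψ := by
  induction l with
  | nil => simp
  | cons a l ih => simp only [lsum_cons, ih]; abel

theorem lsum_comm (l : List α) (l' : List β) (φ : α → β → M) :
    (lsum l fun a => lsum l' (φ a)) = lsum l' fun b => lsum l fun a => φ a b := by
  induction l with
  | nil => simp
  | cons a l ih => simp [ih, lsum_add]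

theorem lsum_congr {l : List α} {φ ψ : α → M} (h : ∀ a ∈ l, φ a = ψ a) :
    lsum l φ = lsum l ψ := by
  rw [lsum, lsum, List.map_congr_left h]

variable {Q : GradedQuiver.{w, u, v} k}

theorem lsum_sumSplits (l : List α) {X Y : Q.Obj} (c : Chain Q X Y)
    (G : α → ∀ Z, Chain Q X Z → Chain Q Z Y → M) :
    (lsum l fun a => c.sumSplits (G a)) = c.sumSplits fun Z p q => lsum l fun a => G a Z p q := by
  induction l with
  | nil => simp
  | cons a l ih => simp [ih, Chain.sumSplits_add]

theorem lsum_splits {X Y : Q.Obj} (c : Chain Q X Y) (G : (Σ Z, Chain Q X Z × Chain Q Z Y) → M) :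
    lsum c.splits G = c.sumSplits fun Z p q => G ⟨Z, p, q⟩ := rfl

theorem Chain.sumSplits_zsmul {X Y : Q.Obj} (c : Chain Q X Y) (n : ℤ)
    (G : ∀ Z, Chain Q X Z → Chain Q Z Y → M) :
    (c.sumSplits fun Z p q => n • G Z p q) = n • c.sumSplits G :=
  lsum_zsmul _ _ _

theorem Chain.sumSplits_sub {X Y : Q.Obj} (c : Chain Q X Y)
    (G G' : ∀ Z, Chain Q X Z → Chain Q Z Y → M) :
    (c.sumSplits fun Z p q => G Z p q - G' Z p q) = c.sumSplits G - c.sumSplits G' :=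
  lsum_sub _ _ _

end LSum

/-- Recursion over blocks cuts off a first block of arbitrary length and continues with the rest, so
the induction hypothesis has to cover every suffix of the tail and not the tail alone. -/
theorem Chain.suffix_induction {Q : GradedQuiver.{w, u, v} k}
    {motive : ∀ {X Y : Q.Obj}, Chain Q X Y → Prop} (nil : ∀ X, motive (.nil X))
    (cons : ∀ {X Z Y : Q.Obj} (x : Q.shom X Z) (c : Chain Q Z Y),
      (∀ W (p : Chain Q Z W) (q : Chain Q W Y), p.append q = c → motive q) → motive (.cons x c))
    {X Y : Q.Obj} (c : Chain Q X Y) : motive c := by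
  suffices H : ∀ W (p : Chain Q X W) (q : Chain Q W Y), p.append q = c → motive q from
    H X (.nil X) c rfl
  induction c with
  | nil X =>
    intro W p q e
    cases p with
    | nil => rw [Chain.nil_append] at e; subst e; exact nil _
    | cons => cases e
  | @cons X Z Y x c ih =>
    intro W p q e
    cases p with
    | nil => rw [Chain.nil_append] at e; subst e; exact cons x c ih
    | cons y p =>
      rw [Chain.cons_append] at e
      cases e
      exact ih _ p q rfl

theorem MultiFun.lsum_mem {Q : GradedQuiver.{w, u, v} k} {M : Type*} [AddCommGroup M] [Module k M]
    {α : Type*} {X Y : Q.Obj} (l : List α) (G : α → Chain Q X Y → M)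
    (hG : ∀ s, G s ∈ MultiFun Q X Y M) : (fun c => lsum l fun s => G s c) ∈ MultiFun Q X Y M :=
  MultiFun.list_sum l G hG

variable {A : PreAInfCat.{w, u₁, v₁} k} {B : PreAInfCat.{w, u₂, v₂} k}
  {C : PreAInfCat.{w, u₃, v₃} k}

/-! ### The coderivation `b` -/

section BSum

variable {M : Type*} [AddCommGroup M]

theorem lsum_bTerms {X Y : A.Obj} (c : Chain A.toGradedQuiver X Y)
    (φ : Chain A.toGradedQuiver X Y → M) :
    lsum (A.bTerms c) φ = c.sumSplits fun _ p c' => c'.sumSplits fun _ m q =>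
      φ (p.append (.cons (A.b m) (q.sgn 1))) := by
  simp only [PreAInfCat.bTerms, lsum_flatMap, lsum_map, lsum_splits]

/-- The terms of `(y ⊗ x ⊗ z)b` in which `b` is applied to a chain containing `x`. -/
def midSum {X Z W Y : A.Obj} (φ : Chain A.toGradedQuiver X Y → M) (y : Chain A.toGradedQuiver X Z)
    (x : A.shom Z W) (z : Chain A.toGradedQuiver W Y) : M :=
  y.sumSplits fun _ y₁ y₂ => z.sumSplits fun _ z₁ z₂ =>
    φ (y₁.append (.cons (A.b (y₂.append (.cons x z₁))) (z₂.sgn 1)))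

/-- Relative to the marked letter `x`, the factor `b` stands to its left, absorbs it, or stands to
its right. In the first case it passes `x` and `z`, whence the sign operators on them. -/
theorem lsum_bTerms_append_cons {X Z W Y : A.Obj} (φ : Chain A.toGradedQuiver X Y → M)
    (y : Chain A.toGradedQuiver X Z) (x : A.shom Z W) (z : Chain A.toGradedQuiver W Y) :
    lsum (A.bTerms (y.append (.cons x z))) φ =
      (lsum (A.bTerms y) fun y' => φ (y'.append (.cons (A.sgn 1 Z W x) (z.sgn 1)))) +
      midSum φ y x z + lsum (A.bTerms z) fun z' => φ (y.append (.cons x z')) := by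
  simp only [lsum_bTerms, Chain.sumSplits_append_cons, Chain.sumSplits_add, midSum,
    Chain.append_assoc, Chain.cons_append, Chain.sgn_append, Chain.sgn_cons]

theorem b_sgn (p : ℤ) {X Y : A.Obj} (c : Chain A.toGradedQuiver X Y) :
    A.b (c.sgn p) = koszul p • A.sgn p X Y (A.b c) := by
  have := MultiFun.app_sgn (A.b_multilinear X Y) 1 (fun c d h => A.b_degree c d h) p c
  rwa [mul_one] at this

variable [Module k M]

theorem lsum_bTerms_multilinear {X Y : A.Obj} {φ : Chain A.toGradedQuiver X Y → M}
    (hφ : φ ∈ MultiFun A.toGradedQuiver X Y M) :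
    (fun c => lsum (A.bTerms c) φ) ∈ MultiFun A.toGradedQuiver X Y M :=
  sum_bTerms A hφ

theorem lsum_bTerms_sgn (p : ℤ) {X Y : A.Obj} {φ : Chain A.toGradedQuiver X Y → M}
    (hφ : φ ∈ MultiFun A.toGradedQuiver X Y M) (c : Chain A.toGradedQuiver X Y) :
    lsum (A.bTerms (c.sgn p)) φ = koszul p • lsum (A.bTerms c) fun z => φ (z.sgn p) := by
  simp only [lsum_bTerms, Chain.sumSplits_sgn, ← Chain.sumSplits_zsmul]
  refine Chain.sumSplits_congr _ fun Z a c' => Chain.sumSplits_congr _ fun W m q => ?_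
  rw [b_sgn, Chain.sgn_sgn, Chain.sgn_append, Chain.sgn_cons, Chain.sgn_sgn, add_comm 1 p]
  exact map_zsmul (MultiFun.slot hφ (a.sgn p) (q.sgn (p + 1))) _ _

end BSum

/-! ### Cocategory homomorphisms -/

section Blocks

variable {M : Type*} [AddCommGroup M] (f : CocatHom A B)

/-- The recursion for `blocksFrom` either enlarges the first block or closes it; unrolled, it is a
sum over the place where the first block ends. -/
theorem lsum_blocksFrom {X Y Z : A.Obj} (p : Chain A.toGradedQuiver X Y)
    (c : Chain A.toGradedQuiver Y Z) (φ : Chain B.toGradedQuiver (f.obj X) (f.obj Z) → M) :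
    lsum (f.blocksFrom p c) φ = c.sumSplits fun _ a q =>
      lsum (f.blocks q) fun y => φ (.cons (f.app (p.append a)) y) := by
  induction c generalizing X with
  | nil => simp [CocatHom.blocksFrom, CocatHom.blocks, Chain.single]
  | cons x c ih =>
    simp only [CocatHom.blocksFrom, lsum_append, lsum_map, ih, Chain.sumSplits_cons,
      CocatHom.blocks, Chain.append_nil, Chain.append_assoc, Chain.single, Chain.cons_append,
      Chain.nil_append]
    rw [add_comm]

@[simp] theorem lsum_blocks_nil (X : A.Obj)
    (φ : Chain B.toGradedQuiver (f.obj X) (f.obj X) → M) :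
    lsum (f.blocks (.nil X)) φ = φ (.nil _) := by simp [CocatHom.blocks]

theorem lsum_blocks_cons {X Y Z : A.Obj} (x : A.shom X Y)
    (c : Chain A.toGradedQuiver Y Z) (φ : Chain B.toGradedQuiver (f.obj X) (f.obj Z) → M) :
    lsum (f.blocks (.cons x c)) φ = c.sumSplits fun _ a q =>
      lsum (f.blocks q) fun y => φ (.cons (f.app (.cons x a)) y) :=
  lsum_blocksFrom f (.single x) c φ

theorem CocatHom.app_sgn (p : ℤ) {X Y : A.Obj} (c : Chain A.toGradedQuiver X Y) :
    f.app (c.sgn p) = B.sgn p _ _ (f.app c) := by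
  have := MultiFun.app_sgn (f.app_multilinear X Y) 0
    (fun c d h => by simpa using f.app_degree c d h) p c
  simpa using this

theorem lsum_blocks_sgn (p : ℤ) {X Y : A.Obj} (c : Chain A.toGradedQuiver X Y)
    (φ : Chain B.toGradedQuiver (f.obj X) (f.obj Y) → M) :
    lsum (f.blocks (c.sgn p)) φ = lsum (f.blocks c) fun y => φ (y.sgn p) := by
  induction c using Chain.suffix_induction with
  | nil => simp
  | cons x c ih =>
    simp only [Chain.sgn_cons, lsum_blocks_cons, Chain.sumSplits_sgn]
    refine Chain.sumSplits_congr' _ fun W a q e => ?_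
    rw [ih W a q e, ← Chain.sgn_cons, f.app_sgn]

/-- A cocategory homomorphism commutes with the cut comultiplication. -/
theorem lsum_blocks_sumSplits {X Y : A.Obj} (c : Chain A.toGradedQuiver X Y)
    (G : ∀ Z, Chain B.toGradedQuiver (f.obj X) Z → Chain B.toGradedQuiver Z (f.obj Y) → M) :
    (lsum (f.blocks c) fun y => y.sumSplits G) =
      c.sumSplits fun Z p q => lsum (f.blocks p) fun y => lsum (f.blocks q) fun z =>
        G (f.obj Z) y z := by
  induction c using Chain.suffix_induction with
  | nil => simp
  | cons x c ih =>
    simp only [lsum_blocks_cons, Chain.sumSplits_cons, lsum_blocks_nil, lsum_add,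
      Chain.sumSplits_add]
    congr 1
    rw [Chain.sumSplits_assoc (G := fun Z W a b q => lsum (f.blocks b) fun y =>
      lsum (f.blocks q) fun z => G (f.obj W) (.cons (f.app (.cons x a)) y) z)]
    exact Chain.sumSplits_congr' _ fun W a q e => ih W a q e _

/-- The marked letter lies in exactly one block; `p₂` and `q₁` are the parts of that block before
and after it. -/
theorem lsum_blocks_append_cons {X Y Z W : A.Obj} (p : Chain A.toGradedQuiver X Y)
    (x : A.shom Y Z) (q : Chain A.toGradedQuiver Z W)
    (φ : Chain B.toGradedQuiver (f.obj X) (f.obj W) → M) :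
    lsum (f.blocks (p.append (.cons x q))) φ =
      p.sumSplits fun _ p₁ p₂ => q.sumSplits fun _ q₁ q₂ => lsum (f.blocks p₁) fun y =>
        lsum (f.blocks q₂) fun z =>
          φ (y.append (.cons (f.app (p₂.append (.cons x q₁))) z)) := by
  induction p using Chain.suffix_induction with
  | nil => simp [lsum_blocks_cons]
  | cons z p ih =>
    rw [Chain.cons_append, lsum_blocks_cons, Chain.sumSplits_append_cons, Chain.sumSplits_cons,
      add_comm]
    congr 1
    · simp
    · rw [Chain.sumSplits_congr' p fun V a p' e => ih V a p' e x _]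
      simp only [lsum_blocks_cons, Chain.cons_append]
      rw [← Chain.sumSplits_assoc]
      refine Chain.sumSplits_congr _ fun V p₁ p₂ => ?_
      rw [Chain.sumSplits_comm]

variable [Module k M]

theorem lsum_blocks_multilinear {X Y : A.Obj}
    {φ : Chain B.toGradedQuiver (f.obj X) (f.obj Y) → M}
    (hφ : φ ∈ MultiFun B.toGradedQuiver (f.obj X) (f.obj Y) M) :
    (fun c => lsum (f.blocks c) φ) ∈ MultiFun A.toGradedQuiver X Y M :=
  f.sum_blocks φ hφ

/-- The identity kills every block of length other than one, so only the cut into single letters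
contributes. -/
theorem lsum_blocks_id {X Y : A.Obj} (c : Chain A.toGradedQuiver X Y)
    {φ : Chain A.toGradedQuiver X Y → M} (hφ : φ ∈ MultiFun A.toGradedQuiver X Y M) :
    lsum ((CocatHom.id A).blocks c) φ = φ c := by
  induction c with
  | nil => exact lsum_blocks_nil _ _ _
  | cons x c ih =>
    refine (lsum_blocks_cons (CocatHom.id A) x c φ).trans ?_
    rw [Chain.sumSplits_eq_left]
    · exact ih (MultiFun.prepend_cons hφ x)
    · intro Z a q ha e
      cases a with
      | nil => exact absurd rfl ha
      | cons y a =>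
        refine (lsum_congr fun z _ => ?_).trans (lsum_zero _)
        exact MultiFun.cons_zero hφ z

/-- The values on the empty chain and on a chain with a first letter determine a sum over blocks.
The operator `T` is any one obeying the recursion of the composite, so that the argument uses only
these two rules. -/
theorem lsum_blocks_comp_aux (g : CocatHom B C) {M : Type*} [AddCommGroup M] [Module k M]
    (T : ∀ {X Y : A.Obj}, Chain A.toGradedQuiver X Y →
      (Chain C.toGradedQuiver (g.obj (f.obj X)) (g.obj (f.obj Y)) → M) → M)
    (hnil : ∀ X φ, T (.nil X) φ = φ (.nil _))
    (hcons : ∀ {X Z Y : A.Obj} (x : A.shom X Z) (c : Chain A.toGradedQuiver Z Y) φ,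
      T (.cons x c) φ = c.sumSplits fun _ a q =>
        T q fun y => φ (.cons (lsum (f.blocks (.cons x a)) g.app) y))
    {X Y : A.Obj} (c : Chain A.toGradedQuiver X Y)
    {φ : Chain C.toGradedQuiver (g.obj (f.obj X)) (g.obj (f.obj Y)) → M}
    (hφ : φ ∈ MultiFun C.toGradedQuiver _ _ M) :
    T c φ = lsum (f.blocks c) fun y => lsum (g.blocks y) φ := by
  induction c using Chain.suffix_induction with
  | nil => simp [hnil]
  | @cons X Z Y x c ih =>
    -- The first factor of the composite is itself a sum over the `f`-blocks of `x a`; linearity in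
    -- the first slot moves that sum outside.
    have h1 : ∀ W (a : Chain A.toGradedQuiver Z W) (q : Chain A.toGradedQuiver W Y), a.append q = c →
        (T q fun y => φ (.cons (lsum (f.blocks (.cons x a)) g.app) y)) =
        a.sumSplits fun _ a₁ a₂ => lsum (f.blocks a₂) fun y => lsum (f.blocks q) fun z =>
          lsum (g.blocks z) fun z' => φ (.cons (g.app (.cons (f.app (.cons x a₁)) y)) z') := by
      intro W a q e
      have h2 : ∀ z', φ (.cons (lsum (f.blocks (.cons x a)) g.app) z') =
          lsum (f.blocks (.cons x a)) fun y => φ (.cons (g.app y) z') := fun z' =>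
        map_lsum (MultiFun.slot hφ (.nil _) z').toAddMonoidHom _ _
      rw [ih W a q e (MultiFun.prepend_cons hφ _)]
      simp only [h2]
      simp only [lsum_blocks_cons, lsum_sumSplits]
      refine Chain.sumSplits_congr _ fun V a₁ a₂ => ?_
      rw [lsum_comm (f.blocks a₂)]
      exact lsum_congr fun z _ => lsum_comm _ _ _
    rw [hcons, Chain.sumSplits_congr' c h1]
    simp only [lsum_blocks_cons, lsum_blocks_sumSplits]
    rw [Chain.sumSplits_assoc]

theorem lsum_blocks_comp (g : CocatHom B C) {X Y : A.Obj} (c : Chain A.toGradedQuiver X Y)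
    {φ : Chain C.toGradedQuiver (g.obj (f.obj X)) (g.obj (f.obj Y)) → M}
    (hφ : φ ∈ MultiFun C.toGradedQuiver _ _ M) :
    lsum ((f.comp g).blocks c) φ = lsum (f.blocks c) fun y => lsum (g.blocks y) φ :=
  lsum_blocks_comp_aux f g (fun c φ => lsum ((f.comp g).blocks c) φ)
    (fun X φ => lsum_blocks_nil (f.comp g) X φ) (fun x c φ => lsum_blocks_cons (f.comp g) x c φ)
    c hφ

end Blocks

end AInf
end

noncomputable section

namespace AInf

open scoped TensorProduct DirectSum

variable {k : Type w} [CommRing k]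

/-! ### Reindexing of iterated cuts. -/

namespace Chain

variable {Q : GradedQuiver.{w, u, v} k} {M : Type*} [AddCommMonoid M]

/-- Both sides run over all cuts of `c` into five consecutive chains and differ only in the order of
cutting. Here the block `m` sits inside the second of three larger pieces. -/
theorem sumSplits_insert_mid {X Y : Q.Obj} (c : Chain Q X Y)
    (G : ∀ Z V W U, Chain Q X Z → Chain Q Z V → Chain Q V W → Chain Q W U → Chain Q U Y → M) :
    (c.sumSplits fun V p c' => c'.sumSplits fun W m q => p.sumSplits fun Z p₁ p₂ =>
      q.sumSplits fun U q₁ q₂ => G Z V W U p₁ p₂ m q₁ q₂) =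
    c.sumSplits fun Z c₁ c' => c'.sumSplits fun U c₂ c₃ => c₂.sumSplits fun V p₂ c₂' =>
      c₂'.sumSplits fun W m q₁ => G Z V W U c₁ p₂ m q₁ c₃ := by
  have h : ∀ V (p : Chain Q X V) (c' : Chain Q V Y),
      (c'.sumSplits fun W m q => p.sumSplits fun Z p₁ p₂ =>
        q.sumSplits fun U q₁ q₂ => G Z V W U p₁ p₂ m q₁ q₂) =
      p.sumSplits fun Z p₁ p₂ => c'.sumSplits fun W m q =>
        q.sumSplits fun U q₁ q₂ => G Z V W U p₁ p₂ m q₁ q₂ := fun V p c' => sumSplits_comm _ _ _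
  simp only [h]
  rw [sumSplits_assoc c (fun Z V p₁ p₂ c' => c'.sumSplits fun W m q =>
        q.sumSplits fun U q₁ q₂ => G Z V W U p₁ p₂ m q₁ q₂)]
  refine sumSplits_congr _ fun Z c₁ c' => ?_
  rw [sumSplits_assoc c' (fun V U p₂ c₂' c₃ => c₂'.sumSplits fun W m q₁ =>
    G Z V W U c₁ p₂ m q₁ c₃)]
  refine sumSplits_congr _ fun V p₂ c'' => ?_
  rw [sumSplits_assoc c'' (fun W U m q₁ c₃ => G Z V W U c₁ p₂ m q₁ c₃)]

/-- The same regrouping when the block `m` sits inside the first of the three larger pieces. -/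
theorem sumSplits_insert_left {X Y : Q.Obj} (c : Chain Q X Y)
    (G : ∀ Z V W U, Chain Q X Z → Chain Q Z V → Chain Q V W → Chain Q W U → Chain Q U Y → M) :
    (c.sumSplits fun Z p c' => c'.sumSplits fun V m q => q.sumSplits fun W q₁ q' =>
      q'.sumSplits fun U q₂ q₃ => G Z V W U p m q₁ q₂ q₃) =
    c.sumSplits fun W c₁ c' => c'.sumSplits fun U c₂ c₃ => c₁.sumSplits fun Z p d =>
      d.sumSplits fun V m q₁ => G Z V W U p m q₁ c₂ c₃ := by
  have h : ∀ W (c₁ : Chain Q X W) (c' : Chain Q W Y),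
      (c'.sumSplits fun U c₂ c₃ => c₁.sumSplits fun Z p d =>
        d.sumSplits fun V m q₁ => G Z V W U p m q₁ c₂ c₃) =
      c₁.sumSplits fun Z p d => d.sumSplits fun V m q₁ => c'.sumSplits fun U c₂ c₃ =>
        G Z V W U p m q₁ c₂ c₃ := by
    intro W c₁ c'
    rw [sumSplits_comm]
    exact sumSplits_congr _ fun Z p d => sumSplits_comm _ _ _
  simp only [h]
  rw [sumSplits_assoc c (fun Z W p d c' => d.sumSplits fun V m q₁ => c'.sumSplits fun U c₂ c₃ =>
        G Z V W U p m q₁ c₂ c₃)]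
  refine sumSplits_congr _ fun Z p c'' => ?_
  rw [sumSplits_assoc c'' (fun V W m q₁ c' => c'.sumSplits fun U c₂ c₃ =>
        G Z V W U p m q₁ c₂ c₃)]

/-- The same regrouping when the block `m` sits inside the last of the three larger pieces. -/
theorem sumSplits_insert_right {X Y : Q.Obj} (c : Chain Q X Y)
    (G : ∀ Z V W U, Chain Q X Z → Chain Q Z V → Chain Q V W → Chain Q W U → Chain Q U Y → M) :
    (c.sumSplits fun W p c' => c'.sumSplits fun U m q => p.sumSplits fun Z c₁ p' =>
      p'.sumSplits fun V c₂ p₃ => G Z V W U c₁ c₂ p₃ m q) =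
    c.sumSplits fun Z c₁ c' => c'.sumSplits fun V c₂ c₃ => c₃.sumSplits fun W p₃ d =>
      d.sumSplits fun U m q => G Z V W U c₁ c₂ p₃ m q := by
  have h : ∀ W (p : Chain Q X W) (c' : Chain Q W Y),
      (c'.sumSplits fun U m q => p.sumSplits fun Z c₁ p' =>
        p'.sumSplits fun V c₂ p₃ => G Z V W U c₁ c₂ p₃ m q) =
      p.sumSplits fun Z c₁ p' => p'.sumSplits fun V c₂ p₃ => c'.sumSplits fun U m q =>
        G Z V W U c₁ c₂ p₃ m q := by
    intro W c₁ c'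
    rw [sumSplits_comm]
    exact sumSplits_congr _ fun Z p d => sumSplits_comm _ _ _
  simp only [h]
  rw [sumSplits_assoc c (fun Z W c₁ p' c' => p'.sumSplits fun V c₂ p₃ => c'.sumSplits fun U m q =>
        G Z V W U c₁ c₂ p₃ m q)]
  refine sumSplits_congr _ fun Z p c'' => ?_
  rw [sumSplits_assoc c'' (fun V W c₂ p₃ c' => c'.sumSplits fun U m q =>
        G Z V W U p c₂ p₃ m q)]

theorem sumSplits₃_append_cons {X Y Z W : Q.Obj} (p : Chain Q X Y) (x : Q.shom Y Z)
    (q : Chain Q Z W) (G : ∀ U V, Chain Q X U → Chain Q U V → Chain Q V W → M) :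
    ((p.append (cons x q)).sumSplits fun U c₁ c' => c'.sumSplits fun V c₂ c₃ => G U V c₁ c₂ c₃) =
      (p.sumSplits fun _ c₁ p' => p'.sumSplits fun _ c₂ p₃ =>
        G _ _ c₁ c₂ (p₃.append (cons x q))) +
      (p.sumSplits fun _ c₁ p₂ => q.sumSplits fun _ q₁ q₂ =>
        G _ _ c₁ (p₂.append (cons x q₁)) q₂) +
      q.sumSplits fun _ q₁ q' => q'.sumSplits fun _ q₂ q₃ =>
        G _ _ (p.append (cons x q₁)) q₂ q₃ := by
  simp only [sumSplits_append_cons, sumSplits_add]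

end Chain

variable {A : PreAInfCat.{w, u₁, v₁} k} {B : PreAInfCat.{w, u₂, v₂} k}
  {C : PreAInfCat.{w, u₃, v₃} k}

/-! ### Cocategory homomorphisms and the coderivations `b` -/

section FunctorB

variable {M : Type*} [AddCommGroup M] [Module k M] (f : CocatHom A B)

/-- Every cut of a chain of `f`-blocks comes from a cut of `c`, so the blocks swallowed by `b`
collect into a component of `fb`. -/
theorem lsum_blocks_bTerms {X Y : A.Obj} (c : Chain A.toGradedQuiver X Y)
    {φ : Chain B.toGradedQuiver (f.obj X) (f.obj Y) → M}
    (hφ : φ ∈ MultiFun B.toGradedQuiver _ _ M) :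
    (lsum (f.blocks c) fun y => lsum (B.bTerms y) φ) =
      c.sumSplits fun _ c₁ c' => c'.sumSplits fun _ c₂ c₃ => lsum (f.blocks c₁) fun y =>
        lsum (f.blocks (c₃.sgn 1)) fun z =>
          φ (y.append (.cons (lsum (f.blocks c₂) B.b) z)) := by
  simp only [lsum_bTerms, lsum_blocks_sumSplits, lsum_sumSplits, lsum_blocks_sgn]
  refine Chain.sumSplits_congr _ fun Z c₁ c' => Chain.sumSplits_congr _ fun W c₂ c₃ =>
    lsum_congr fun y _ => ?_
  rw [lsum_comm]
  refine lsum_congr fun z _ => ?_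
  exact (map_lsum (MultiFun.slot hφ y (z.sgn 1)).toAddMonoidHom _ _).symm

/-- The letter produced by `b` lies in exactly one block, and all possibilities inside that block
collect into a component of `bf`. In this shape the sum matches the one for `fb` term by term. -/
theorem lsum_bTerms_blocks {X Y : A.Obj} (c : Chain A.toGradedQuiver X Y)
    {φ : Chain B.toGradedQuiver (f.obj X) (f.obj Y) → M}
    (hφ : φ ∈ MultiFun B.toGradedQuiver _ _ M) :
    (lsum (A.bTerms c) fun c' => lsum (f.blocks c') φ) =
      c.sumSplits fun _ c₁ c' => c'.sumSplits fun _ c₂ c₃ => lsum (f.blocks c₁) fun y =>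
        lsum (f.blocks (c₃.sgn 1)) fun z =>
          φ (y.append (.cons (lsum (A.bTerms c₂) f.app) z)) := by
  simp only [lsum_bTerms, lsum_blocks_append_cons, Chain.sumSplits_sgn]
  rw [Chain.sumSplits_insert_mid c (fun Z V W U p₁ p₂ m q₁ q₂ => lsum (f.blocks p₁) fun y =>
    lsum (f.blocks (q₂.sgn 1)) fun z =>
      φ (y.append (.cons (f.app (p₂.append (.cons (A.b m) (q₁.sgn 1)))) z)))]
  refine Chain.sumSplits_congr _ fun Z c₁ c' => Chain.sumSplits_congr _ fun W c₂ c₃ => ?_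
  simp only [← lsum_sumSplits]
  refine lsum_congr fun y _ => lsum_congr fun z _ => ?_
  refine Eq.symm ((Chain.map_sumSplits (MultiFun.slot hφ y z).toAddMonoidHom _ _).trans ?_)
  exact Chain.sumSplits_congr _ fun V p₂ d =>
    Chain.map_sumSplits (MultiFun.slot hφ y z).toAddMonoidHom _ _

variable {f}

/-- Both `fb` and `bf` are extended from their components by the same formula, so equality of
components gives equality on the whole tensor coalgebra. -/
theorem CocatHom.IsAInfFunctor.lsum_comm (hf : f.IsAInfFunctor) {X Y : A.Obj}
    (c : Chain A.toGradedQuiver X Y) {φ : Chain B.toGradedQuiver (f.obj X) (f.obj Y) → M}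
    (hφ : φ ∈ MultiFun B.toGradedQuiver _ _ M) :
    (lsum (f.blocks c) fun y => lsum (B.bTerms y) φ) =
      lsum (A.bTerms c) fun c' => lsum (f.blocks c') φ := by
  have h : ∀ {U V : A.Obj} (c : Chain A.toGradedQuiver U V),
    lsum (f.blocks c) B.b = lsum (A.bTerms c) f.app := fun c => hf _ _ c
  rw [lsum_blocks_bTerms f c hφ, lsum_bTerms_blocks f c hφ]
  simp only [h]

theorem lsum_blocks_id_app {X Y : A.Obj} (c : Chain A.toGradedQuiver X Y) :
    lsum ((CocatHom.id A).blocks c) A.b = A.b c :=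
  lsum_blocks_id c (A.b_multilinear X Y)

/-- The identity sees only one-letter chains, so `b` must have swallowed the entire chain. -/
theorem lsum_bTerms_id_app {X Y : A.Obj} (c : Chain A.toGradedQuiver X Y) :
    lsum (A.bTerms c) (CocatHom.id A).app = A.b c := by
  rw [lsum_bTerms, Chain.sumSplits_eq_left]
  · rw [Chain.sumSplits_eq_right]
    · rfl
    · intro Z p q hq e
      cases q with
      | nil => exact absurd rfl hq
      | cons x q => rfl
  · intro Z p q hp e
    cases p with
    | nil => exact absurd rfl hp
    | cons x p =>
      refine (Chain.sumSplits_congr _ fun W m q => ?_).trans (Chain.sumSplits_zero q)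
      cases p <;> rfl

theorem CocatHom.isAInfFunctor_id : (CocatHom.id A).IsAInfFunctor := fun _ _ c =>
  (lsum_blocks_id_app c).trans (lsum_bTerms_id_app c).symm

theorem CocatHom.IsAInfFunctor.comp {g : CocatHom B C} (hf : f.IsAInfFunctor)
    (hg : g.IsAInfFunctor) : (f.comp g).IsAInfFunctor := by
  intro X Y c
  refine (lsum_blocks_comp f g c (C.b_multilinear _ _)).trans ?_
  refine Eq.trans ?_ (hf.lsum_comm c (g.app_multilinear _ _))
  exact lsum_congr fun y _ => hg _ _ y

variable (A) in
/-- `b²` is the coderivation with components `b²b₁`. -/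
theorem lsum_bTerms_bTerms {X Y : A.Obj} (c : Chain A.toGradedQuiver X Y)
    {φ : Chain A.toGradedQuiver X Y → M} (hφ : φ ∈ MultiFun A.toGradedQuiver X Y M) :
    (lsum (A.bTerms c) fun c' => lsum (A.bTerms c') φ) =
      c.sumSplits fun _ c₁ c' => c'.sumSplits fun _ c₂ c₃ =>
        φ (c₁.append (.cons (lsum (A.bTerms c₂) A.b) c₃)) := by
  have hq : ∀ {X Y : A.Obj} (q : Chain A.toGradedQuiver X Y), (q.sgn 1).sgn 1 = q := fun q => by
    rw [Chain.sgn_sgn]; exact Chain.sgn_even ⟨1, rfl⟩ q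
  rw [lsum_bTerms]
  simp only [lsum_bTerms_append_cons, Chain.sumSplits_add]
  -- Two applications of `b` to disjoint segments occur in both orders, and they cancel because one
  -- odd map passes the other.
  have hI : (c.sumSplits fun _ p c' => c'.sumSplits fun _ m q => lsum (A.bTerms p) fun y' =>
        φ (y'.append (.cons (A.sgn 1 _ _ (A.b m)) ((q.sgn 1).sgn 1)))) +
      (c.sumSplits fun _ p c' => c'.sumSplits fun _ m q => lsum (A.bTerms (q.sgn 1)) fun z' =>
        φ (p.append (.cons (A.b m) z'))) = 0 := by
    simp only [lsum_bTerms, hq, Chain.sumSplits_sgn]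
    rw [Chain.sumSplits_insert_right c (fun Z V W U c₁ c₂ p₃ m q =>
      φ ((c₁.append (.cons (A.b c₂) (p₃.sgn 1))).append (.cons (A.sgn 1 _ _ (A.b m)) q)))]
    simp only [← Chain.sumSplits_add]
    refine (Chain.sumSplits_congr _ fun Z p c' => ?_).trans (Chain.sumSplits_zero c)
    refine (Chain.sumSplits_congr _ fun W m q => ?_).trans (Chain.sumSplits_zero c')
    refine (Chain.sumSplits_congr _ fun V a q' => ?_).trans (Chain.sumSplits_zero q)
    refine (Chain.sumSplits_congr _ fun U n r => ?_).trans (Chain.sumSplits_zero q')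
    rw [b_sgn, koszul_one, neg_one_smul, Chain.append_assoc, Chain.cons_append]
    have h := map_neg (MultiFun.slot hφ (p.append (.cons (A.b m) (a.sgn 1))) r)
      (A.sgn 1 _ _ (A.b n))
    simp only [MultiFun.slot_apply, Chain.append_assoc, Chain.cons_append] at h
    rw [h, add_neg_cancel]
  rw [add_right_comm, hI, zero_add]
  -- What remains is nested: the outer `b` swallows the output of the inner one.
  simp only [midSum, Chain.sumSplits_sgn, hq]
  rw [Chain.sumSplits_insert_mid c (fun Z V W U p₁ p₂ m q₁ q₂ =>
    φ (p₁.append (.cons (A.b (p₂.append (.cons (A.b m) (q₁.sgn 1)))) q₂)))]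
  refine Chain.sumSplits_congr _ fun Z c₁ c' => Chain.sumSplits_congr _ fun W c₂ c₃ => ?_
  simp only [lsum_bTerms]
  refine Eq.symm ((Chain.map_sumSplits (MultiFun.slot hφ c₁ c₃).toAddMonoidHom _ _).trans ?_)
  exact Chain.sumSplits_congr _ fun V p₂ d =>
    Chain.map_sumSplits (MultiFun.slot hφ c₁ c₃).toAddMonoidHom _ _

/-- `b² = 0` on `Ts𝒜`. -/
theorem PreAInfCat.IsAInfCat.lsum_bTerms_bTerms (hA : A.IsAInfCat) {X Y : A.Obj}
    (c : Chain A.toGradedQuiver X Y) {φ : Chain A.toGradedQuiver X Y → M}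
    (hφ : φ ∈ MultiFun A.toGradedQuiver X Y M) :
    (lsum (A.bTerms c) fun c' => lsum (A.bTerms c') φ) = 0 := by
  have h : ∀ {U V : A.Obj} (c : Chain A.toGradedQuiver U V), lsum (A.bTerms c) A.b = 0 := fun c => hA _ _ c
  rw [AInf.lsum_bTerms_bTerms A c hφ]
  simp only [h, MultiFun.slot_zero hφ, Chain.sumSplits_zero]

end FunctorB

/-! ### Extension of components to coderivations -/

/-- A family of maps sending a chain to a formal sum of chains. -/
abbrev ListMap (A : PreAInfCat.{w, u₁, v₁} k) (B : PreAInfCat.{w, u₂, v₂} k)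
    (ψ χ : A.Obj → B.Obj) : Type _ :=
  ∀ ⦃X Y : A.Obj⦄, Chain A.toGradedQuiver X Y → List (Chain B.toGradedQuiver (ψ X) (χ Y))

/-- The map of degree `e` commutes with `b` up to sign. -/
structure ListMap.IsChainMap {ψ χ : A.Obj → B.Obj} (R : ListMap A B ψ χ) (e : ℤ)
    (M : Type*) [AddCommGroup M] [Module k M] : Prop where
  multilinear : ∀ {X Y : A.Obj} {φ : Chain B.toGradedQuiver (ψ X) (χ Y) → M},
    φ ∈ MultiFun B.toGradedQuiver _ _ M → (fun c => lsum (R c) φ) ∈ MultiFun A.toGradedQuiver X Y M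
  sgn : ∀ {X Y : A.Obj} {φ : Chain B.toGradedQuiver (ψ X) (χ Y) → M},
    φ ∈ MultiFun B.toGradedQuiver _ _ M → ∀ c (p : ℤ),
      lsum (R (c.sgn p)) φ = koszul (p * e) • lsum (R c) fun z => φ (z.sgn p)
  comm : ∀ {X Y : A.Obj} {φ : Chain B.toGradedQuiver (ψ X) (χ Y) → M},
    φ ∈ MultiFun B.toGradedQuiver _ _ M → ∀ c,
      (lsum (R c) fun z => lsum (B.bTerms z) φ) =
        koszul e • lsum (A.bTerms c) fun c' => lsum (R c') φ

/-- The terms of `∑ f_{a₁} ⊗ ⋯ ⊗ f_{a_α} ⊗ u_j ⊗ R`, where `u` has degree `p`. -/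
def extTerms (f : CocatHom A B) {ψ χ : A.Obj → B.Obj} (u : Components A B f.obj ψ)
    (R : ListMap A B ψ χ) (p : ℤ) : ListMap A B f.obj χ := fun _ _ c =>
  c.splits.flatMap fun s => s.2.2.splits.flatMap fun t =>
    (f.blocks s.2.1).flatMap fun y => (R (t.2.2.sgn p)).map fun z =>
      y.append (.cons (u t.2.1) z)

section Ext

variable {M : Type*} [AddCommGroup M] (f : CocatHom A B) {ψ χ : A.Obj → B.Obj}
  (u : Components A B f.obj ψ) (R : ListMap A B ψ χ) (p e : ℤ)

theorem lsum_extTerms {X Y : A.Obj} (c : Chain A.toGradedQuiver X Y)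
    (φ : Chain B.toGradedQuiver (f.obj X) (χ Y) → M) :
    lsum (extTerms f u R p c) φ = c.sumSplits fun _ c₁ c' => c'.sumSplits fun _ c₂ c₃ =>
      lsum (f.blocks c₁) fun y => lsum (R (c₃.sgn p)) fun z =>
        φ (y.append (.cons (u c₂) z)) := by
  simp only [extTerms, lsum_flatMap, lsum_map, lsum_splits]

variable [Module k M] {f u R p e}

theorem lsum_extTerms_multilinear
    (hu : ∀ X Y, (fun c => u c) ∈ MultiFun A.toGradedQuiver X Y (B.shom (f.obj X) (ψ Y)))
    (hR : ∀ {X Y : A.Obj} {φ : Chain B.toGradedQuiver (ψ X) (χ Y) → M},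
      φ ∈ MultiFun B.toGradedQuiver _ _ M → (fun c => lsum (R c) φ) ∈ MultiFun A.toGradedQuiver X Y M)
    {X Y : A.Obj} {φ : Chain B.toGradedQuiver (f.obj X) (χ Y) → M}
    (hφ : φ ∈ MultiFun B.toGradedQuiver _ _ M) :
    (fun c => lsum (extTerms f u R p c) φ) ∈ MultiFun A.toGradedQuiver X Y M := by
  simp only [lsum_extTerms]
  refine MultiFun.sumSplits _ (fun Z q => ?_) (fun Z c₁ => ?_)
  · simp only [← lsum_sumSplits]
    refine lsum_blocks_multilinear f (φ := fun y => q.sumSplits fun _ c₂ c₃ => lsum (R (c₃.sgn p)) fun z =>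
        φ (y.append (.cons (u c₂) z))) ?_
    exact MultiFun.lsum_mem _ _ fun s => MultiFun.lsum_mem _ _ fun z => MultiFun.postpend hφ _
  · refine MultiFun.sumSplits _ (fun W c₃ => ?_) (fun W c₂ => ?_)
    · refine MultiFun.lsum_mem _ _ fun y => MultiFun.lsum_mem _ _ fun z => ?_
      exact MultiFun.comp_linear (hu Z W) (MultiFun.slot hφ y z)
    · refine MultiFun.lsum_mem _ _ fun y => ?_
      exact MultiFun.sgn (hR (MultiFun.prepend_append_cons hφ y (u c₂))) p

/-- The sign operator passes both `u` and `R`, so their degrees add. -/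
theorem lsum_extTerms_sgn
    (hu : ∀ {X Y : A.Obj} (c : Chain A.toGradedQuiver X Y) (q : ℤ),
      u (c.sgn q) = koszul (q * p) • B.sgn q _ _ (u c))
    (hR : ∀ {X Y : A.Obj} {φ : Chain B.toGradedQuiver (ψ X) (χ Y) → M},
      φ ∈ MultiFun B.toGradedQuiver _ _ M → ∀ c (p : ℤ),
        lsum (R (c.sgn p)) φ = koszul (p * e) • lsum (R c) fun z => φ (z.sgn p))
    {X Y : A.Obj} {φ : Chain B.toGradedQuiver (f.obj X) (χ Y) → M}
    (hφ : φ ∈ MultiFun B.toGradedQuiver _ _ M) (c : Chain A.toGradedQuiver X Y) (q : ℤ) :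
    lsum (extTerms f u R p (c.sgn q)) φ =
      koszul (q * (p + e)) • lsum (extTerms f u R p c) fun z => φ (z.sgn q) := by
  simp only [lsum_extTerms, Chain.sumSplits_sgn, lsum_blocks_sgn, ← Chain.sumSplits_zsmul,
    ← lsum_zsmul]
  refine Chain.sumSplits_congr _ fun Z c₁ c' => Chain.sumSplits_congr _ fun W c₂ c₃ =>
    lsum_congr fun y _ => ?_
  have h : ∀ z, φ ((y.sgn q).append (.cons (u (c₂.sgn q)) z)) =
      koszul (q * p) • φ ((y.sgn q).append (.cons (B.sgn q _ _ (u c₂)) z)) := fun z => by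
    rw [hu]
    exact map_zsmul (MultiFun.slot hφ (y.sgn q) z) _ _
  simp only [h, Chain.sgn_append, Chain.sgn_cons, lsum_zsmul]
  rw [Chain.sgn_sgn, add_comm, ← Chain.sgn_sgn, hR (MultiFun.prepend_append_cons hφ _ _), smul_smul,
    mul_add, koszul_add]

end Ext

end AInf
end

/-! ### The commutator of an extension of components with `b`. -/

noncomputable section

namespace AInf

open scoped TensorProduct DirectSum

variable {k : Type w} [CommRing k]

variable {A : PreAInfCat.{w, u₁, v₁} k} {B : PreAInfCat.{w, u₂, v₂} k}
  {C : PreAInfCat.{w, u₃, v₃} k}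

section Ext

variable {M : Type*} [AddCommGroup M] [Module k M] {f : CocatHom A B} {ψ χ : A.Obj → B.Obj}
  {u : Components A B f.obj ψ} {R : ListMap A B ψ χ} {p e : ℤ}

/-- The commutator of an extension `f̂ ⊗ u ⊗ R` with `b`: only the terms in which `b` meets `u`
remain. -/
theorem lsum_extTerms_bTerms (hf : f.IsAInfFunctor)
    (hus : ∀ {X Y : A.Obj} (c : Chain A.toGradedQuiver X Y) (q : ℤ),
      u (c.sgn q) = koszul (q * p) • B.sgn q _ _ (u c))
    (hR : R.IsChainMap e M) {X Y : A.Obj} (c : Chain A.toGradedQuiver X Y)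
    {φ : Chain B.toGradedQuiver (f.obj X) (χ Y) → M} (hφ : φ ∈ MultiFun B.toGradedQuiver _ _ M) :
    (lsum (extTerms f u R p c) fun z => lsum (B.bTerms z) φ) -
      koszul (p + e) • (lsum (A.bTerms c) fun c' => lsum (extTerms f u R p c') φ) =
    (c.sumSplits fun _ c₁ c' => c'.sumSplits fun _ c₂ c₃ =>
      lsum (f.blocks c₁) fun y => lsum (R (c₃.sgn p)) fun z => midSum φ y (u c₂) z) -
    koszul (p + e) • c.sumSplits fun _ c₁ c' => c'.sumSplits fun _ c₂ c₃ =>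
      lsum (f.blocks c₁) fun y => lsum (R (c₃.sgn (p + 1))) fun z =>
        φ (y.append (.cons (lsum (A.bTerms c₂) fun c => u c) z)) := by
  -- The sign that `b` produces in passing `u` and `R` is moved onto their arguments at the cost of
  -- `(-1)^(p+e)`, the sign of the total degree.
  have key : ∀ {Z W : A.Obj} (c₂ : Chain A.toGradedQuiver Z W) (c₃ : Chain A.toGradedQuiver W Y)
      (y : Chain B.toGradedQuiver (f.obj X) (f.obj Z)),
      (lsum (R (c₃.sgn p)) fun z => φ (y.append (.cons (B.sgn 1 _ _ (u c₂)) (z.sgn 1)))) =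
      koszul (p + e) • lsum (R ((c₃.sgn 1).sgn p)) fun z =>
        φ (y.append (.cons (u (c₂.sgn 1)) z)) := by
    intro Z W c₂ c₃ y
    have h := fun z => map_zsmul (MultiFun.slot hφ y z) (koszul (1 * p)) (B.sgn 1 _ _ (u c₂))
    simp only [MultiFun.slot_apply] at h
    rw [Chain.sgn_sgn, add_comm p 1, ← Chain.sgn_sgn,
      hR.sgn (MultiFun.prepend_append_cons hφ y _), hus]
    simp only [h, lsum_zsmul]
    rw [smul_smul, smul_smul, one_mul, one_mul, ← koszul_add, ← koszul_add,
      koszul_even ⟨p + e, by ring⟩, one_smul]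
  -- Here `b` acts to the left of `u` and is carried over to the source because `f` is an
  -- `A∞`-functor.
  have h1 : (c.sumSplits fun _ c₁ c' => c'.sumSplits fun _ c₂ c₃ =>
      lsum (f.blocks c₁) fun y => lsum (R (c₃.sgn p)) fun z =>
        lsum (B.bTerms y) fun y' => φ (y'.append (.cons (B.sgn 1 _ _ (u c₂)) (z.sgn 1)))) =
      koszul (p + e) • c.sumSplits fun _ a c' => c'.sumSplits fun _ m q =>
        (q.sgn 1).sumSplits fun _ q₁ q' => q'.sumSplits fun _ q₂ q₃ =>
          lsum (f.blocks (a.append (.cons (A.b m) q₁))) fun y => lsum (R (q₃.sgn p)) fun z =>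
            φ (y.append (.cons (u q₂) z)) := by
    simp only [Chain.sumSplits_sgn]
    rw [Chain.sumSplits_insert_left c (fun Z V W U a m q₁ q₂ q₃ =>
      lsum (f.blocks (a.append (.cons (A.b m) (q₁.sgn 1)))) fun y =>
        lsum (R ((q₃.sgn 1).sgn p)) fun z => φ (y.append (.cons (u (q₂.sgn 1)) z)))]
    simp only [← Chain.sumSplits_zsmul]
    refine Chain.sumSplits_congr _ fun Z c₁ c' => Chain.sumSplits_congr _ fun W c₂ c₃ => ?_
    simp only [lsum_comm (R (c₃.sgn p))]
    rw [hf.lsum_comm c₁ (φ := fun y' => lsum (R (c₃.sgn p)) fun z =>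
      φ (y'.append (.cons (B.sgn 1 _ _ (u c₂)) (z.sgn 1))))
      (MultiFun.lsum_mem _ _ fun z => MultiFun.postpend hφ _), lsum_bTerms]
    refine Chain.sumSplits_congr _ fun V a d => Chain.sumSplits_congr _ fun U m q₁ => ?_
    rw [← lsum_zsmul]
    refine lsum_congr fun y _ => ?_
    exact key c₂ c₃ y
  -- Here `b` acts to the right of `u` and is carried over to the source because `R` commutes with
  -- `b` up to sign.
  have h3 : (c.sumSplits fun _ c₁ c' => c'.sumSplits fun _ c₂ c₃ =>
      lsum (f.blocks c₁) fun y => lsum (R (c₃.sgn p)) fun z =>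
        lsum (B.bTerms z) fun z' => φ (y.append (.cons (u c₂) z'))) =
      koszul (p + e) • c.sumSplits fun _ a c' => c'.sumSplits fun _ m q =>
        a.sumSplits fun _ a₁ a' => a'.sumSplits fun _ a₂ a₃ =>
          lsum (f.blocks a₁) fun y => lsum (R ((a₃.append (.cons (A.b m) (q.sgn 1))).sgn p)) fun z =>
            φ (y.append (.cons (u a₂) z)) := by
    rw [Chain.sumSplits_insert_right c (fun Z V W U a₁ a₂ a₃ m q =>
      lsum (f.blocks a₁) fun y => lsum (R ((a₃.append (.cons (A.b m) (q.sgn 1))).sgn p)) fun z =>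
            φ (y.append (.cons (u a₂) z)))]
    simp only [← Chain.sumSplits_zsmul]
    refine Chain.sumSplits_congr _ fun Z c₁ c' => Chain.sumSplits_congr _ fun W c₂ c₃ => ?_
    simp only [Chain.sumSplits_zsmul, ← lsum_sumSplits]
    rw [← lsum_zsmul]
    refine lsum_congr fun y _ => ?_
    have hφ' := MultiFun.prepend_append_cons hφ y (u c₂)
    rw [hR.comm hφ', lsum_bTerms_sgn p (hR.multilinear hφ'), smul_smul, ← koszul_add, add_comm e p,
      lsum_bTerms]
  -- On the source side, the applications of `b` inside the argument of `u` collect into a component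
  -- of `bu`.
  have h2 : (c.sumSplits fun _ a c' => c'.sumSplits fun _ m q =>
        a.sumSplits fun _ a₁ a₂ => (q.sgn 1).sumSplits fun _ q₁ q₂ =>
          lsum (f.blocks a₁) fun y => lsum (R (q₂.sgn p)) fun z =>
            φ (y.append (.cons (u (a₂.append (.cons (A.b m) q₁))) z))) =
      c.sumSplits fun _ c₁ c' => c'.sumSplits fun _ c₂ c₃ =>
      lsum (f.blocks c₁) fun y => lsum (R (c₃.sgn (p + 1))) fun z =>
        φ (y.append (.cons (lsum (A.bTerms c₂) fun c => u c) z)) := by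
    simp only [Chain.sumSplits_sgn]
    rw [Chain.sumSplits_insert_mid c (fun Z V W U p₁ p₂ m q₁ q₂ => lsum (f.blocks p₁) fun y =>
      lsum (R ((q₂.sgn 1).sgn p)) fun z =>
        φ (y.append (.cons (u (p₂.append (.cons (A.b m) (q₁.sgn 1)))) z)))]
    refine Chain.sumSplits_congr _ fun Z c₁ c' => Chain.sumSplits_congr _ fun W c₂ c₃ => ?_
    simp only [← lsum_sumSplits, Chain.sgn_sgn]
    refine lsum_congr fun y _ => lsum_congr fun z _ => ?_
    refine Eq.symm ((map_lsum (MultiFun.slot hφ y z).toAddMonoidHom _ _).trans ?_)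
    rw [lsum_bTerms]
    rfl
  have e1 : (lsum (extTerms f u R p c) fun z => lsum (B.bTerms z) φ) =
      (c.sumSplits fun _ c₁ c' => c'.sumSplits fun _ c₂ c₃ =>
      lsum (f.blocks c₁) fun y => lsum (R (c₃.sgn p)) fun z =>
        lsum (B.bTerms y) fun y' => φ (y'.append (.cons (B.sgn 1 _ _ (u c₂)) (z.sgn 1)))) +
      (c.sumSplits fun _ c₁ c' => c'.sumSplits fun _ c₂ c₃ =>
      lsum (f.blocks c₁) fun y => lsum (R (c₃.sgn p)) fun z => midSum φ y (u c₂) z) +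
      (c.sumSplits fun _ c₁ c' => c'.sumSplits fun _ c₂ c₃ =>
      lsum (f.blocks c₁) fun y => lsum (R (c₃.sgn p)) fun z =>
        lsum (B.bTerms z) fun z' => φ (y.append (.cons (u c₂) z'))) := by
    simp only [lsum_extTerms, lsum_bTerms_append_cons, lsum_add, Chain.sumSplits_add]
  rw [e1, h1, h3, ← h2]
  rw [lsum_bTerms c (fun c' => lsum (extTerms f u R p c') φ)]
  simp only [lsum_extTerms]
  simp only [Chain.sumSplits₃_append_cons _ _ _ (fun U V c₁ c₂ c₃ =>
    lsum (f.blocks c₁) fun y => lsum (R (c₃.sgn p)) fun z => φ (y.append (.cons (u c₂) z))),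
    Chain.sumSplits_add, smul_add]
  abel

end Ext

end AInf
end

noncomputable section

namespace AInf

open scoped TensorProduct DirectSum

variable {k : Type w} [CommRing k]

variable {A : PreAInfCat.{w, u₁, v₁} k} {B : PreAInfCat.{w, u₂, v₂} k}
  {C : PreAInfCat.{w, u₃, v₃} k}

/-! ### The differential of a coderivation -/

section Cosplit

variable {M : Type*} [AddCommGroup M] {f : CocatHom A B} {ψ χ ω : A.Obj → B.Obj}
  {u : Components A B f.obj ψ} {p : ℤ}

/-- An operation that meets `u` absorbs some `f`-blocks before it and some `S`-blocks after it; the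
cuts recombine into an extension of `u` by `S`, evaluated by `β`, between the remaining blocks. The
additive map `K` stands for the treatment of these outer parts, so that the same identity serves
both for `b` and for whiskering by a functor. -/
theorem sumSplits_extTerms {N : B.Obj → B.Obj → Type*} [∀ U V, AddCommGroup (N U V)]
    (β : ∀ ⦃U V⦄, Chain B.toGradedQuiver U V → N U V) (S : ListMap A B ψ χ) (T : ListMap A B χ ω)
    {X Y : A.Obj} (c : Chain A.toGradedQuiver X Y)
    (K : ∀ {U V : B.Obj}, Chain B.toGradedQuiver (f.obj X) U → Chain B.toGradedQuiver V (ω Y) →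
      N U V →+ M) :
    (c.sumSplits fun _ c₁ c' => c'.sumSplits fun _ c₂ c₃ =>
      lsum (f.blocks c₁) fun y => y.sumSplits fun _ y₁ y₂ => (c₃.sgn p).sumSplits fun _ d e =>
        lsum (S d) fun z₁ => lsum (T e) fun z₂ => K y₁ z₂ (β (y₂.append (.cons (u c₂) z₁)))) =
    c.sumSplits fun _ c₁ c' => c'.sumSplits fun _ c₂ c₃ =>
      lsum (f.blocks c₁) fun y => lsum (T (c₃.sgn p)) fun z =>
        K y z (lsum (extTerms f u S p c₂) fun w => β w) := by
  simp only [lsum_blocks_sumSplits, Chain.sumSplits_sgn, lsum_sumSplits]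
  rw [Chain.sumSplits_insert_mid c (fun Z V W U c₁ y₂ c₂ d e => lsum (f.blocks c₁) fun y₁ =>
    lsum (f.blocks y₂) fun y₂ => lsum (S (d.sgn p)) fun z₁ => lsum (T (e.sgn p)) fun z₂ =>
      K y₁ z₂ (β (y₂.append (.cons (u c₂) z₁))))]
  refine Chain.sumSplits_congr _ fun Z c₁ c' => Chain.sumSplits_congr _ fun W c₂ c₃ => ?_
  simp only [← lsum_sumSplits]
  refine lsum_congr fun y _ => ?_
  have h : ∀ z₂ : Chain B.toGradedQuiver (χ W) (ω Y),
      K y z₂ (lsum (extTerms f u S p c₂) fun w => β w) =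
      c₂.sumSplits fun _ a c' => c'.sumSplits fun _ b d => lsum (f.blocks a) fun y₂ =>
        lsum (S (d.sgn p)) fun z₁ => K y z₂ (β (y₂.append (.cons (u b) z₁))) := fun z₂ => by
    rw [map_lsum, lsum_extTerms]
  simp only [h, lsum_sumSplits]
  refine Chain.sumSplits_congr _ fun Z a c' => Chain.sumSplits_congr _ fun W b d => ?_
  rw [lsum_comm (T (c₃.sgn p))]
  refine lsum_congr fun z _ => ?_
  rw [lsum_comm]

variable [Module k M]

theorem sumSplits_midSum (S : ListMap A B ψ χ) (T : ListMap A B χ ω)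
    {X Y : A.Obj} (c : Chain A.toGradedQuiver X Y)
    {φ : Chain B.toGradedQuiver (f.obj X) (ω Y) → M} (hφ : φ ∈ MultiFun B.toGradedQuiver _ _ M) :
    (c.sumSplits fun _ c₁ c' => c'.sumSplits fun _ c₂ c₃ =>
      lsum (f.blocks c₁) fun y => y.sumSplits fun _ y₁ y₂ => (c₃.sgn p).sumSplits fun _ d e =>
        lsum (S d) fun z₁ => lsum (T e) fun z₂ =>
          φ (y₁.append (.cons (B.b (y₂.append (.cons (u c₂) z₁))) (z₂.sgn 1)))) =
    c.sumSplits fun _ c₁ c' => c'.sumSplits fun _ c₂ c₃ =>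
      lsum (f.blocks c₁) fun y => lsum (T (c₃.sgn p)) fun z =>
        φ (y.append (.cons (lsum (extTerms f u S p c₂) B.b) (z.sgn 1))) :=
  sumSplits_extTerms (fun _ _ w => B.b w) S T c fun y z =>
    (MultiFun.slot hφ y (z.sgn 1)).toAddMonoidHom

end Cosplit

theorem CocatHom.IsAInfFunctor.isChainMap {f : CocatHom A B} (hf : f.IsAInfFunctor)
    (M : Type*) [AddCommGroup M] [Module k M] :
    ListMap.IsChainMap (fun _ _ c => f.blocks c) 0 M where
  multilinear hφ := lsum_blocks_multilinear f hφ
  sgn hφ c p := by simp [lsum_blocks_sgn]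
  comm hφ c := by rw [koszul_zero, one_smul]; exact hf.lsum_comm c hφ

namespace Coder

variable {f g h : CocatHom A B} {p p' : ℤ}

theorem app_sgn (r : Coder f g p) {X Y : A.Obj} (c : Chain A.toGradedQuiver X Y) (q : ℤ) :
    r.app (c.sgn q) = koszul (q * p) • B.sgn q _ _ (r.app c) :=
  MultiFun.app_sgn (r.app_multilinear X Y) p (fun c d h => r.app_degree c d h) q c

section

variable {M : Type*} [AddCommGroup M]

theorem terms_eq (r : Coder f g p) {X Y : A.Obj} (c : Chain A.toGradedQuiver X Y) :
    r.terms c = extTerms f r.app (fun _ _ c => g.blocks c) p c := rfl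

theorem lsum_terms (r : Coder f g p) {X Y : A.Obj} (c : Chain A.toGradedQuiver X Y)
    (φ : Chain B.toGradedQuiver (f.obj X) (g.obj Y) → M) :
    lsum (r.terms c) φ = c.sumSplits fun _ c₁ c' => c'.sumSplits fun _ c₂ c₃ =>
      lsum (f.blocks c₁) fun y => lsum (g.blocks (c₃.sgn p)) fun z =>
        φ (y.append (.cons (r.app c₂) z)) := by
  rw [terms_eq, lsum_extTerms]

variable [Module k M]

theorem lsum_terms_multilinear (r : Coder f g p) {X Y : A.Obj}
    {φ : Chain B.toGradedQuiver (f.obj X) (g.obj Y) → M} (hφ : φ ∈ MultiFun B.toGradedQuiver _ _ M) :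
    (fun c => lsum (r.terms c) φ) ∈ MultiFun A.toGradedQuiver X Y M :=
  lsum_extTerms_multilinear r.app_multilinear (lsum_blocks_multilinear g) hφ

theorem lsum_thetaTerms_multilinear (r : Coder f g p) (q : Coder g h p') {X Y : A.Obj}
    {φ : Chain B.toGradedQuiver (f.obj X) (h.obj Y) → M} (hφ : φ ∈ MultiFun B.toGradedQuiver _ _ M) :
    (fun c => lsum (r.thetaTerms q c) φ) ∈ MultiFun A.toGradedQuiver X Y M :=
  lsum_extTerms_multilinear r.app_multilinear q.lsum_terms_multilinear hφ

theorem lsum_terms_sgn (r : Coder f g p) {X Y : A.Obj}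
    {φ : Chain B.toGradedQuiver (f.obj X) (g.obj Y) → M} (hφ : φ ∈ MultiFun B.toGradedQuiver _ _ M)
    (c : Chain A.toGradedQuiver X Y) (q : ℤ) :
    lsum (r.terms (c.sgn q)) φ = koszul (q * p) • lsum (r.terms c) fun z => φ (z.sgn q) := by
  have := lsum_extTerms_sgn (e := 0) (fun c q => r.app_sgn c q)
    (R := fun _ _ c => g.blocks c) (fun {X Y φ} _ c q => by simp [lsum_blocks_sgn]) hφ c q
  rwa [add_zero] at this

end

theorem degree_of_mem_extTerms (r : Coder f g p) {χ : A.Obj → B.Obj} {R : ListMap A B g.obj χ} {e : ℤ}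
    (hR : ∀ {X Y : A.Obj} {c : Chain A.toGradedQuiver X Y} {d : ℤ}, c.HasDegree d →
      ∀ z ∈ R c, z.HasDegree (d + e)) {X Y : A.Obj} {c : Chain A.toGradedQuiver X Y} {d : ℤ}
    (hc : c.HasDegree d) : ∀ z ∈ extTerms f r.app R p c, z.HasDegree (d + (p + e)) := by
  intro z hz
  simp only [extTerms, List.mem_flatMap, List.mem_map] at hz
  obtain ⟨s, hs, t, ht, y, hy, z, hz, rfl⟩ := hz
  obtain ⟨a, d', ha, hd', rfl⟩ := hc.of_mem_splits s hs
  obtain ⟨m, n, hm, hn, rfl⟩ := hd'.of_mem_splits t ht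
  have := (f.blocks_degree ha y hy).append (.cons (r.app_degree _ _ hm) (hR (hn.sgn p) z hz))
  convert this using 1
  ring

theorem degree_of_mem_terms (r : Coder f g p) {X Y : A.Obj} {c : Chain A.toGradedQuiver X Y} {d : ℤ}
    (hc : c.HasDegree d) : ∀ z ∈ r.terms c, z.HasDegree (d + p) := by
  have := r.degree_of_mem_extTerms (e := 0) (R := fun _ _ c => g.blocks c)
    (fun hc z hz => by simpa using g.blocks_degree hc z hz) hc
  rwa [add_zero] at this

theorem degree_of_mem_thetaTerms (r : Coder f g p) (q : Coder g h p') {X Y : A.Obj}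
    {c : Chain A.toGradedQuiver X Y} {d : ℤ}
    (hc : c.HasDegree d) : ∀ z ∈ r.thetaTerms q c, z.HasDegree (d + (p + p')) :=
  r.degree_of_mem_extTerms (R := fun _ _ c => q.terms c) (fun hc => q.degree_of_mem_terms hc) hc

theorem _root_.AInf.lsum_mem {α : Type*} {M : Type*} [AddCommGroup M] [Module k M] {S : Submodule k M}
    {l : List α} {φ : α → M} (h : ∀ a ∈ l, φ a ∈ S) : lsum l φ ∈ S :=
  list_sum_mem fun x hx => by
    obtain ⟨a, ha, rfl⟩ := List.mem_map.mp hx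
    exact h a ha

theorem B₁_eq (r : Coder f g p) {X Y : A.Obj} (c : Chain A.toGradedQuiver X Y) :
    r.B₁ c = lsum (r.terms c) B.b - koszul p • lsum (A.bTerms c) fun z => r.app z := rfl

/-- The coderivation `rB₁`. -/
def d (r : Coder f g p) : Coder f g (p + 1) where
  app := r.B₁
  app_multilinear X Y := by
    simp only [B₁_eq]
    exact sub_mem (r.lsum_terms_multilinear (B.b_multilinear _ _))
      (zsmul_mem (lsum_bTerms_multilinear (r.app_multilinear X Y)) _)
  app_degree c d hc := by
    refine sub_mem (lsum_mem fun z hz => ?_) (zsmul_mem (lsum_mem fun z hz => ?_) _)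
    · rw [← add_assoc]
      exact B.b_degree _ _ (r.degree_of_mem_terms hc z hz)
    · rw [add_comm p, ← add_assoc]
      exact r.app_degree _ _ (bTerms_degree A hc z hz)

theorem d_app (r : Coder f g p) {X Y : A.Obj} (c : Chain A.toGradedQuiver X Y) :
    r.d.app c = r.B₁ c := rfl

variable {M : Type*} [AddCommGroup M] [Module k M]

/-- Terms of the commutator in which `b` does not meet `r` cancel. In the others, `b` together with
the blocks it absorbs is a component of `rB₁`, so the commutator is again the coderivation given by
its components. -/
theorem lsum_d_terms (r : Coder f g p) (hf : f.IsAInfFunctor) (hg : g.IsAInfFunctor) {X Y : A.Obj}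
    (c : Chain A.toGradedQuiver X Y) {φ : Chain B.toGradedQuiver (f.obj X) (g.obj Y) → M}
    (hφ : φ ∈ MultiFun B.toGradedQuiver _ _ M) :
    lsum (r.d.terms c) φ = (lsum (r.terms c) fun z => lsum (B.bTerms z) φ) -
      koszul p • lsum (A.bTerms c) fun c' => lsum (r.terms c') φ := by
  have h1 := lsum_extTerms_bTerms hf (fun c q => r.app_sgn c q) (hg.isChainMap M) c hφ
  rw [add_zero] at h1
  refine Eq.trans ?_ h1.symm
  have h2 : ∀ {Z W : A.Obj} (c₁ : Chain A.toGradedQuiver X Z) (c₂ : Chain A.toGradedQuiver Z W)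
      (c₃ : Chain A.toGradedQuiver W Y), (lsum (f.blocks c₁) fun y => lsum (g.blocks (c₃.sgn p)) fun z =>
        midSum φ y (r.app c₂) z) =
      lsum (f.blocks c₁) fun y => y.sumSplits fun _ y₁ y₂ => (c₃.sgn p).sumSplits fun _ d e =>
        lsum (g.blocks d) fun z₁ => lsum (g.blocks e) fun z₂ =>
          φ (y₁.append (.cons (B.b (y₂.append (.cons (r.app c₂) z₁))) (z₂.sgn 1))) := by
    intro Z W c₁ c₂ c₃
    simp only [midSum, lsum_sumSplits]
    exact lsum_congr fun y _ => Chain.sumSplits_congr _ fun U y₁ y₂ =>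
      lsum_blocks_sumSplits g (c₃.sgn p) fun _ z₁ z₂ =>
        φ (y₁.append (.cons (B.b (y₂.append (.cons (r.app c₂) z₁))) (z₂.sgn 1)))
  simp only [h2]
  rw [sumSplits_midSum (fun _ _ c => g.blocks c) (fun _ _ c => g.blocks c) c hφ]
  rw [lsum_terms]
  simp only [d_app, B₁_eq, ← Chain.sumSplits_zsmul, ← Chain.sumSplits_sub,
    ← lsum_zsmul, ← lsum_sub]
  refine Chain.sumSplits_congr _ fun Z c₁ c' => Chain.sumSplits_congr _ fun W c₂ c₃ => ?_
  rw [lsum_zsmul (A.bTerms c₂)]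
  refine lsum_congr fun y _ => ?_
  have h3 : c₃.sgn (p + 1) = (c₃.sgn p).sgn 1 := by rw [Chain.sgn_sgn, add_comm]
  rw [h3, lsum_blocks_sgn g 1 (c₃.sgn p), lsum_blocks_sgn g 1 (c₃.sgn p), ← lsum_sub]
  refine lsum_congr fun z _ => ?_
  have h4 := map_sub (MultiFun.slot hφ y (z.sgn 1))
    (lsum (r.terms c₂) B.b)
    (koszul p • lsum (A.bTerms c₂) fun c => r.app c)
  rw [map_zsmul] at h4
  exact h4

/-- `B₁² = 0`. -/
theorem d_B₁ (r : Coder f g p) (hA : A.IsAInfCat) (hB : B.IsAInfCat) (hf : f.IsAInfFunctor)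
    (hg : g.IsAInfFunctor) {X Y : A.Obj} (c : Chain A.toGradedQuiver X Y) : r.d.B₁ c = 0 := by
  have hB' : ∀ {X Y : B.Obj} (c : Chain B.toGradedQuiver X Y), lsum (B.bTerms c) B.b = 0 :=
    fun c => hB _ _ c
  rw [B₁_eq, r.lsum_d_terms hf hg c (B.b_multilinear _ _)]
  simp only [d_app, B₁_eq, hB', lsum_zero, lsum_sub, lsum_zsmul]
  rw [hA.lsum_bTerms_bTerms c (r.app_multilinear X Y), koszul_add]
  simp

end Coder

end AInf
end

noncomputable section

namespace AInf

open scoped TensorProduct DirectSum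

variable {k : Type w} [CommRing k]

variable {A : PreAInfCat.{w, u₁, v₁} k} {B : PreAInfCat.{w, u₂, v₂} k}
  {C : PreAInfCat.{w, u₃, v₃} k}

/-! ### The defect of a cocategory homomorphism -/

namespace CocatHom

variable (f : CocatHom A B)

/-- The components of `fb - bf`. -/
def defect : Coder f f 1 where
  app _ _ c := lsum (f.blocks c) B.b - lsum (A.bTerms c) f.app
  app_multilinear X Y := sub_mem (lsum_blocks_multilinear f (B.b_multilinear _ _))
    (lsum_bTerms_multilinear (f.app_multilinear X Y))
  app_degree _ _ hc := sub_mem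
    (lsum_mem fun z hz => B.b_degree _ _ (f.blocks_degree hc z hz))
    (lsum_mem fun z hz => f.app_degree _ _ (bTerms_degree A hc z hz))

theorem defect_app {X Y : A.Obj} (c : Chain A.toGradedQuiver X Y) :
    f.defect.app c = lsum (f.blocks c) B.b - lsum (A.bTerms c) f.app := rfl

variable {M : Type*} [AddCommGroup M] [Module k M]

/-- Both composites extend their components by `f`-blocks on either side, so their difference
extends the difference of the components. -/
theorem lsum_defect_terms {X Y : A.Obj} (c : Chain A.toGradedQuiver X Y)
    {φ : Chain B.toGradedQuiver (f.obj X) (f.obj Y) → M} (hφ : φ ∈ MultiFun B.toGradedQuiver _ _ M) :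
    lsum (f.defect.terms c) φ = (lsum (f.blocks c) fun y => lsum (B.bTerms y) φ) -
      lsum (A.bTerms c) fun c' => lsum (f.blocks c') φ := by
  rw [lsum_blocks_bTerms f c hφ, lsum_bTerms_blocks f c hφ, Coder.lsum_terms]
  simp only [← Chain.sumSplits_sub, ← lsum_sub]
  refine Chain.sumSplits_congr _ fun Z c₁ c' => Chain.sumSplits_congr _ fun W c₂ c₃ =>
    lsum_congr fun y _ => lsum_congr fun z _ => ?_
  exact map_sub (MultiFun.slot hφ y z) _ _

/-- In the graded commutator of `fb - bf` with `b` the terms `bfb` cancel, and each remaining term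
contains a `b²`. -/
theorem defect_B₁ (hA : A.IsAInfCat) (hB : B.IsAInfCat) {X Y : A.Obj}
    (c : Chain A.toGradedQuiver X Y) : f.defect.B₁ c = 0 := by
  have hB' : ∀ {X Y : B.Obj} (c : Chain B.toGradedQuiver X Y), lsum (B.bTerms c) B.b = 0 :=
    fun c => hB _ _ c
  rw [Coder.B₁_eq, lsum_defect_terms f c (B.b_multilinear _ _)]
  simp only [hB', lsum_zero, defect_app, lsum_sub]
  rw [hA.lsum_bTerms_bTerms c (f.app_multilinear X Y)]
  simp

end CocatHom

/-! ### Natural transformations -/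

namespace Coder

variable {f g h : CocatHom A B}

/-- The coderivation `rB₁` has zero components, hence is zero; so `r` anticommutes with `b` on the
whole tensor coalgebra and not only after projection to one letter. -/
theorem IsNatural.isChainMap {r : Coder f g (-1)} (hr : r.IsNatural) (hf : f.IsAInfFunctor)
    (hg : g.IsAInfFunctor) (M : Type*) [AddCommGroup M] [Module k M] :
    ListMap.IsChainMap (fun _ _ c => r.terms c) (-1) M where
  multilinear hφ := r.lsum_terms_multilinear hφ
  sgn hφ c p := r.lsum_terms_sgn hφ c p
  comm hφ c := by
    have h := r.lsum_d_terms hf hg c hφ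
    rw [lsum_terms] at h
    have h0 : ∀ {X Y : A.Obj} (c : Chain A.toGradedQuiver X Y), r.d.app c = 0 := fun c => hr c
    simp only [h0, MultiFun.slot_zero hφ, lsum_zero, Chain.sumSplits_zero] at h
    exact (sub_eq_zero.mp h.symm)

/-- The comultiplication of an extension. -/
theorem lsum_terms_sumSplits {p : ℤ} (q : Coder f g p) {M : Type*} [AddCommGroup M] {X Y : A.Obj}
    (c : Chain A.toGradedQuiver X Y)
    (G : ∀ Z, Chain B.toGradedQuiver (f.obj X) Z → Chain B.toGradedQuiver Z (g.obj Y) → M) :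
    (lsum (q.terms c) fun y => y.sumSplits G) =
      (c.sumSplits fun _ d e => lsum (f.blocks d) fun y => lsum (q.terms e) fun z => G _ y z) +
      c.sumSplits fun _ d e => lsum (q.terms d) fun y => lsum (g.blocks (e.sgn p)) fun z =>
        G _ y z := by
  simp only [lsum_terms, Chain.sumSplits_append_cons, lsum_add, Chain.sumSplits_add]
  congr 1
  · have h : ∀ {Z W : A.Obj} (c₁ : Chain A.toGradedQuiver X Z) (c₂ : Chain A.toGradedQuiver Z W)
        (c₃ : Chain A.toGradedQuiver W Y), (lsum (f.blocks c₁) fun y =>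
          lsum (g.blocks (c₃.sgn p)) fun z => y.sumSplits fun U a b => G U a (b.append (.cons (q.app c₂) z))) =
        c₁.sumSplits fun _ a b => lsum (f.blocks a) fun y => lsum (f.blocks b) fun y' =>
          lsum (g.blocks (c₃.sgn p)) fun z => G _ y (y'.append (.cons (q.app c₂) z)) := by
      intro Z W c₁ c₂ c₃
      simp only [lsum_sumSplits]
      exact lsum_blocks_sumSplits f c₁ fun U a b => lsum (g.blocks (c₃.sgn p)) fun z =>
        G U a (b.append (.cons (q.app c₂) z))
    simp only [h]
    simp only [lsum_sumSplits]
    rw [← Chain.sumSplits_assoc c (fun Z W a b q' => q'.sumSplits fun _ c₂ c₃ =>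
      lsum (f.blocks a) fun y => lsum (f.blocks b) fun y' => lsum (g.blocks (c₃.sgn p)) fun z =>
        G (f.obj Z) y (y'.append (.cons (q.app c₂) z)))]
    refine Chain.sumSplits_congr _ fun Z c₁ c' => ?_
    rw [Chain.sumSplits_comm c₁ c']
  · have h : ∀ {Z W : A.Obj} (c₁ : Chain A.toGradedQuiver X Z) (c₂ : Chain A.toGradedQuiver Z W)
        (c₃ : Chain A.toGradedQuiver W Y), (lsum (f.blocks c₁) fun y =>
          lsum (g.blocks (c₃.sgn p)) fun z => z.sumSplits fun U a b => G U (y.append (.cons (q.app c₂) a)) b) =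
        c₃.sumSplits fun _ a b => lsum (f.blocks c₁) fun y => lsum (g.blocks (a.sgn p)) fun z =>
          lsum (g.blocks (b.sgn p)) fun z' => G _ (y.append (.cons (q.app c₂) z)) z' := by
      intro Z W c₁ c₂ c₃
      rw [← lsum_sumSplits]
      refine lsum_congr fun y _ => ?_
      rw [lsum_blocks_sumSplits g, Chain.sumSplits_sgn]
    simp only [h]
    rw [Chain.sumSplits_assoc c (fun Z W c₁ d e => d.sumSplits fun _ c₂ c₃ =>
      lsum (f.blocks c₁) fun y => lsum (g.blocks (c₃.sgn p)) fun z =>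
        lsum (g.blocks (e.sgn p)) fun z' => G (g.obj W) (y.append (.cons (q.app c₂) z)) z')]
    refine Chain.sumSplits_congr _ fun Z c₁ c' => ?_
    rw [Chain.sumSplits_assoc c' (fun V W c₂ c₃ e =>
      lsum (f.blocks c₁) fun y => lsum (g.blocks (c₃.sgn p)) fun z =>
        lsum (g.blocks (e.sgn p)) fun z' => G (g.obj W) (y.append (.cons (q.app c₂) z)) z')]

/-- The coderivation `(r ⊗ q)B₂`. -/
def mul (r : Coder f g (-1)) (q : Coder g h (-1)) : Coder f h (-1) where
  app := r.B₂ q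
  app_multilinear X Y := r.lsum_thetaTerms_multilinear q (B.b_multilinear _ _)
  app_degree c d hc := lsum_mem fun z hz => by
    have := B.b_degree _ _ (r.degree_of_mem_thetaTerms q hc z hz)
    rwa [show d + (-1 + -1) + 1 = d + -1 by ring] at this

theorem mul_app (r : Coder f g (-1)) (q : Coder g h (-1)) {X Y : A.Obj}
    (c : Chain A.toGradedQuiver X Y) : (r.mul q).app c = lsum (r.thetaTerms q c) B.b := rfl

/-- In the commutator of `(r ⊗ q)θ` with `b`, a `b` that meets `r` either stops before `q` or
swallows it. Naturality of `r` cancels the first kind against the terms with `b` inside the argument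
of `r`; the second kind is the extension of `(r ⊗ q)B₂`. -/
theorem lsum_mul_terms {r : Coder f g (-1)} {q : Coder g h (-1)} (hr : r.IsNatural)
    (hq : q.IsNatural) (hf : f.IsAInfFunctor) (hg : g.IsAInfFunctor) (hh : h.IsAInfFunctor)
    {M : Type*} [AddCommGroup M] [Module k M] {X Y : A.Obj} (c : Chain A.toGradedQuiver X Y)
    {φ : Chain B.toGradedQuiver (f.obj X) (h.obj Y) → M} (hφ : φ ∈ MultiFun B.toGradedQuiver _ _ M) :
    lsum ((r.mul q).terms c) φ = (lsum (r.thetaTerms q c) fun z => lsum (B.bTerms z) φ) -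
      lsum (A.bTerms c) fun c' => lsum (r.thetaTerms q c') φ := by
  have h1 := lsum_extTerms_bTerms hf (fun c q => r.app_sgn c q) (hq.isChainMap hg hh M) c hφ
  rw [show koszul (-1 + -1) = 1 from koszul_even ⟨-1, rfl⟩, one_smul, one_smul] at h1
  refine Eq.trans ?_ h1.symm
  have h2 : ∀ {Z W : A.Obj} (c₁ : Chain A.toGradedQuiver X Z) (c₂ : Chain A.toGradedQuiver Z W)
      (c₃ : Chain A.toGradedQuiver W Y), (lsum (f.blocks c₁) fun y =>
        lsum (q.terms (c₃.sgn (-1))) fun z => midSum φ y (r.app c₂) z) =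
      (lsum (f.blocks c₁) fun y => y.sumSplits fun _ y₁ y₂ => (c₃.sgn (-1)).sumSplits fun _ d e =>
        lsum (g.blocks d) fun z₁ => lsum (q.terms e) fun z₂ =>
          φ (y₁.append (.cons (B.b (y₂.append (.cons (r.app c₂) z₁))) (z₂.sgn 1)))) +
      (lsum (f.blocks c₁) fun y => y.sumSplits fun _ y₁ y₂ => (c₃.sgn (-1)).sumSplits fun _ d e =>
        lsum (q.terms d) fun z₁ => lsum (h.blocks (e.sgn (-1))) fun z₂ =>
          φ (y₁.append (.cons (B.b (y₂.append (.cons (r.app c₂) z₁))) (z₂.sgn 1)))) := by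
    intro Z W c₁ c₂ c₃
    simp only [midSum, lsum_sumSplits, ← lsum_add, ← Chain.sumSplits_add]
    exact lsum_congr fun y _ => Chain.sumSplits_congr _ fun U y₁ y₂ =>
      (lsum_terms_sumSplits q (c₃.sgn (-1)) fun _ z₁ z₂ =>
        φ (y₁.append (.cons (B.b (y₂.append (.cons (r.app c₂) z₁))) (z₂.sgn 1)))).trans
        (Chain.sumSplits_add _ _ _).symm
  simp only [h2, Chain.sumSplits_add]
  rw [sumSplits_midSum (fun _ _ c => g.blocks c) (fun _ _ c => q.terms c) c hφ,
    sumSplits_midSum (fun _ _ c => q.terms c) (fun _ _ c => h.blocks (c.sgn (-1))) c hφ]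
  have h3 : ∀ {Z W : A.Obj} (c₂ : Chain A.toGradedQuiver Z W),
      lsum (extTerms f r.app (fun _ _ c => g.blocks c) (-1) c₂) B.b =
        - lsum (A.bTerms c₂) fun c => r.app c := by
    intro Z W c₂
    have := hr c₂
    rw [B₁_eq, koszul_neg, koszul_one, neg_one_smul, sub_neg_eq_add] at this
    exact eq_neg_of_add_eq_zero_left this
  have h4 : ∀ {Z : A.Obj} (c₃ : Chain A.toGradedQuiver Z Y), (c₃.sgn (-1)).sgn (-1) = c₃ :=
    fun c₃ => by rw [Chain.sgn_sgn]; exact Chain.sgn_even ⟨-1, rfl⟩ _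
  have h5 : ∀ {Z : A.Obj} (c₃ : Chain A.toGradedQuiver Z Y), c₃.sgn (-1) = c₃.sgn 1 :=
    fun c₃ => by
      rw [← Chain.sgn_even (p := 2) ⟨1, rfl⟩ c₃, Chain.sgn_sgn, Chain.sgn_even (p := 2) ⟨1, rfl⟩ c₃]
      rfl
  have h6 : ∀ {Z : A.Obj} (c₃ : Chain A.toGradedQuiver Z Y), (c₃.sgn 1).sgn 1 = c₃ :=
    fun c₃ => by rw [Chain.sgn_sgn]; exact Chain.sgn_even ⟨1, rfl⟩ _
  have h7 : (c.sumSplits fun _ c₁ c' => c'.sumSplits fun _ c₂ c₃ =>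
      lsum (f.blocks c₁) fun y => lsum (q.terms (c₃.sgn (-1))) fun z =>
        φ (y.append (.cons (lsum (extTerms f r.app (fun _ _ c => g.blocks c) (-1) c₂) B.b)
          (z.sgn 1)))) =
      c.sumSplits fun _ c₁ c' => c'.sumSplits fun _ c₂ c₃ =>
      lsum (f.blocks c₁) fun y => lsum (q.terms (c₃.sgn (-1 + 1))) fun z =>
        φ (y.append (.cons (lsum (A.bTerms c₂) fun c => r.app c) z)) := by
    refine Chain.sumSplits_congr _ fun Z c₁ c' => Chain.sumSplits_congr _ fun W c₂ c₃ =>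
      lsum_congr fun y _ => ?_
    rw [h3, h5, q.lsum_terms_sgn (MultiFun.sgn (MultiFun.prepend_append_cons hφ y _) 1),
      neg_add_cancel, Chain.sgn_even (show Even (0 : ℤ) from ⟨0, rfl⟩) c₃, ← lsum_zsmul]
    refine lsum_congr fun z _ => ?_
    have e1 : (z.sgn 1).sgn 1 = z := by rw [Chain.sgn_sgn]; exact Chain.sgn_even ⟨1, rfl⟩ _
    have e2 := map_neg (MultiFun.slot hφ y z) (lsum (A.bTerms c₂) fun c => r.app c)
    simp only [MultiFun.slot_apply] at e2
    rw [e1, e2]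
    simp
  rw [h7, lsum_terms, add_sub_cancel_left]
  refine Chain.sumSplits_congr _ fun Z c₁ c' => Chain.sumSplits_congr _ fun W c₂ c₃ =>
    lsum_congr fun y _ => ?_
  rw [h5, lsum_blocks_sgn]
  simp only [← h5, h4]
  rfl

/-- After substituting the commutator formula, one term contains `b²` and the other cancels against
`b` followed by the components of `(r ⊗ q)B₂`. -/
theorem IsNatural.mul {r : Coder f g (-1)} {q : Coder g h (-1)} (hr : r.IsNatural)
    (hq : q.IsNatural) (hB : B.IsAInfCat) (hf : f.IsAInfFunctor)
    (hg : g.IsAInfFunctor) (hh : h.IsAInfFunctor) : (r.mul q).IsNatural := by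
  intro X Y c
  have hB' : ∀ {X Y : B.Obj} (c : Chain B.toGradedQuiver X Y), lsum (B.bTerms c) B.b = 0 :=
    fun c => hB _ _ c
  rw [B₁_eq, lsum_mul_terms hr hq hf hg hh c (B.b_multilinear _ _)]
  simp only [hB', lsum_zero, mul_app]
  simp

end Coder

end AInf
end

noncomputable section

namespace AInf

open scoped TensorProduct DirectSum

variable {k : Type w} [CommRing k]

variable {A : PreAInfCat.{w, u₁, v₁} k} {B : PreAInfCat.{w, u₂, v₂} k}
  {C : PreAInfCat.{w, u₃, v₃} k}

/-! ### Whiskering -/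

namespace Coder

variable {M : Type*} [AddCommGroup M] [Module k M]

section Right

variable {f g : CocatHom A B} {p : ℤ} (r : Coder f g p) (h : CocatHom B C)

/-- The coderivation `rh`. -/
def whiskRight : Coder (f.comp h) (g.comp h) p where
  app := r.whiskerRight h
  app_multilinear _ _ := r.lsum_terms_multilinear (h.app_multilinear _ _)
  app_degree _ _ hc := lsum_mem fun z hz => h.app_degree _ _ (r.degree_of_mem_terms hc z hz)

/-- The factor `r_j` lies in a single argument of `h`. The `f`- and `g`-blocks sharing that argument
with it assemble a component of `rh`; the others go into the blocks of `fh` and `gh`. -/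
theorem lsum_whiskRight_terms {X Y : A.Obj} (c : Chain A.toGradedQuiver X Y)
    {φ : Chain C.toGradedQuiver (h.obj (f.obj X)) (h.obj (g.obj Y)) → M}
    (hφ : φ ∈ MultiFun C.toGradedQuiver _ _ M) :
    lsum ((r.whiskRight h).terms c) φ = lsum (r.terms c) fun z => lsum (h.blocks z) φ := by
  have h1 := sumSplits_extTerms (f := f) (u := r.app) (p := p)
    (N := fun U V => C.shom (h.obj U) (h.obj V))
    (fun _ _ w => h.app w) (fun _ _ c => g.blocks c) (fun _ _ c => g.blocks c) c
    (fun y z => ({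
      toFun := fun n => lsum (h.blocks y) fun y' => lsum (h.blocks z) fun z' =>
        MultiFun.slot hφ y' z' n
      map_zero' := by simp only [map_zero, lsum_zero]
      map_add' := fun a b => by simp only [map_add, lsum_add] } : _ →+ M))
  refine (lsum_terms (r.whiskRight h) c φ).trans (Eq.trans ?_ (h1.symm.trans ?_))
  · refine Chain.sumSplits_congr _ fun Z c₁ c' => Chain.sumSplits_congr _ fun W c₂ c₃ => ?_
    refine (lsum_blocks_comp f h c₁ (φ := fun y => lsum ((g.comp h).blocks (c₃.sgn p)) fun z =>
      φ (y.append (.cons (r.whiskerRight h c₂) z)))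
      (MultiFun.lsum_mem _ _ fun z => MultiFun.postpend hφ (.cons (r.whiskerRight h c₂) z))).trans ?_
    refine lsum_congr fun y _ => ?_
    refine Eq.trans (lsum_congr fun y' _ => lsum_blocks_comp g h _
      (φ := fun z => φ (y'.append (.cons (r.whiskerRight h c₂) z)))
      (MultiFun.prepend_append_cons hφ y' _)) ?_
    exact lsum_comm _ _ _
  · simp only [AddMonoidHom.coe_mk, ZeroHom.coe_mk, MultiFun.slot_apply]
    rw [lsum_terms]
    refine Chain.sumSplits_congr _ fun Z c₁ c' => Chain.sumSplits_congr _ fun W c₂ c₃ =>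
      lsum_congr fun y _ => ?_
    simp only [lsum_blocks_append_cons h, lsum_sumSplits]
    exact Chain.sumSplits_congr _ fun U y₁ y₂ => (lsum_blocks_sumSplits g (c₃.sgn p)
      fun _ z₁ z₂ => lsum (h.blocks y₁) fun y' => lsum (h.blocks z₂) fun z' =>
        φ (y'.append (.cons (h.app (y₂.append (.cons (r.app c₂) z₁))) z'))).symm

theorem IsNatural.whiskRight {r : Coder f g (-1)} (hr : r.IsNatural) {h : CocatHom B C}
    (hf : f.IsAInfFunctor) (hg : g.IsAInfFunctor) (hh : h.IsAInfFunctor) :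
    (r.whiskRight h).IsNatural := by
  intro X Y c
  have h1 := (hr.isChainMap hf hg _).comm (h.app_multilinear _ _) c
  have h2 : ∀ {X Y : B.Obj} (c : Chain B.toGradedQuiver X Y),
    lsum (h.blocks c) C.b = lsum (B.bTerms c) h.app := fun c => hh _ _ c
  refine (congrArg (fun a : C.shom (h.obj (f.obj X)) (h.obj (g.obj Y)) => a - koszul (-1) •
    lsum (A.bTerms c) fun z => lsum (r.terms z) h.app) (lsum_whiskRight_terms r h c
    (C.b_multilinear _ _))).trans ?_
  simp only [h2]
  exact sub_eq_zero.mpr h1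

end Right

section Left

variable (h : CocatHom A B) {f g : CocatHom B C} {p : ℤ} (r : Coder f g p)

/-- The coderivation `hr`. -/
def whiskLeft : Coder (h.comp f) (h.comp g) p where
  app := whiskerLeft h r
  app_multilinear _ _ := lsum_blocks_multilinear h (r.app_multilinear _ _)
  app_degree _ _ hc := lsum_mem fun z hz => r.app_degree _ _ (h.blocks_degree hc z hz)

/-- A cut of the `h`-blocks comes from a cut of the chain: the outer pieces give the blocks of `hf`
and `hg`, the middle one a component of `hr`. -/
theorem lsum_whiskLeft_terms {X Y : A.Obj} (c : Chain A.toGradedQuiver X Y)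
    {φ : Chain C.toGradedQuiver (f.obj (h.obj X)) (g.obj (h.obj Y)) → M}
    (hφ : φ ∈ MultiFun C.toGradedQuiver _ _ M) :
    lsum ((whiskLeft h r).terms c) φ = lsum (h.blocks c) fun z => lsum (r.terms z) φ := by
  refine (lsum_terms (whiskLeft h r) c φ).trans ?_
  simp only [lsum_terms, lsum_blocks_sumSplits, lsum_sumSplits]
  refine Chain.sumSplits_congr _ fun Z c₁ c' => Chain.sumSplits_congr _ fun W c₂ c₃ => ?_
  refine (lsum_blocks_comp h f c₁ (φ := fun y => lsum ((h.comp g).blocks (c₃.sgn p)) fun z =>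
      φ (y.append (.cons (whiskerLeft h r c₂) z)))
      (MultiFun.lsum_mem _ _ fun z => MultiFun.postpend hφ (.cons (whiskerLeft h r c₂) z))).trans ?_
  refine lsum_congr fun y _ => ?_
  have h1 : ∀ y' : Chain C.toGradedQuiver (f.obj (h.obj X)) (f.obj (h.obj Z)), (lsum ((h.comp g).blocks (c₃.sgn p)) fun z =>
      φ (y'.append (.cons (whiskerLeft h r c₂) z))) =
      lsum (h.blocks c₂) fun x => lsum (h.blocks c₃) fun z => lsum (g.blocks (z.sgn p)) fun z' =>
        φ (y'.append (.cons (r.app x) z')) := by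
    intro y'
    refine (lsum_blocks_comp h g _ (φ := fun z => φ (y'.append (.cons (whiskerLeft h r c₂) z)))
      (MultiFun.prepend_append_cons hφ y' _)).trans ?_
    rw [lsum_blocks_sgn]
    have h2 : ∀ z', φ (y'.append (.cons (whiskerLeft h r c₂) z')) =
        lsum (h.blocks c₂) fun x => φ (y'.append (.cons (r.app x) z')) := fun z' =>
      map_lsum (MultiFun.slot hφ y' z').toAddMonoidHom _ _
    refine (lsum_congr fun z _ => (lsum_congr fun z' _ => h2 z').trans (lsum_comm _ _ _)).trans ?_
    exact lsum_comm _ _ _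
  refine (lsum_congr fun y' _ => h1 y').trans ?_
  rw [lsum_comm]
  refine lsum_congr fun x _ => ?_
  rw [lsum_comm]

theorem IsNatural.whiskLeft {r : Coder f g (-1)} (hr : r.IsNatural) {h : CocatHom A B}
    (hh : h.IsAInfFunctor) : (Coder.whiskLeft h r).IsNatural := by
  intro X Y c
  refine (congrArg₂ (fun a b : C.shom (f.obj (h.obj X)) (g.obj (h.obj Y)) => a - koszul (-1) • b)
    (lsum_whiskLeft_terms h r c (C.b_multilinear _ _))
    (hh.lsum_comm c (r.app_multilinear _ _)).symm).trans ?_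
  rw [← lsum_zsmul, ← lsum_sub]
  exact (lsum_congr fun z _ => hr z).trans (lsum_zero _)

end Left

end Coder

end AInf
end

noncomputable section

namespace AInf

open scoped TensorProduct DirectSum

variable {k : Type w} [CommRing k]

variable {A : PreAInfCat.{w, u₁, v₁} k} {B : PreAInfCat.{w, u₂, v₂} k}
  {C : PreAInfCat.{w, u₃, v₃} k}

/-! ### Twisted derivations of the tensor coalgebra -/

section DerTerms

variable {Q : GradedQuiver.{w, u, v} k} (L h : ∀ X Y : Q.Obj, Q.shom X Y →ₗ[k] Q.shom X Y)

/-- The terms of `∑ (x₁ ⊗ ⋯ ⊗ xₙ)(L^{⊗r} ⊗ h ⊗ 1^{⊗t})`, for `h` of odd degree. -/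
def derTerms : ∀ {X Y : Q.Obj}, Chain Q X Y → List (Chain Q X Y)
  | _, _, .nil _ => []
  | _, _, .cons x c => .cons (h _ _ x) (c.sgn 1) :: (derTerms c).map (.cons (L _ _ x))

variable {M : Type*} [AddCommGroup M]

@[simp] theorem lsum_derTerms_nil (X : Q.Obj) (φ : Chain Q X X → M) :
    lsum (derTerms L h (.nil X)) φ = 0 := rfl

@[simp] theorem lsum_derTerms_cons {X Y Z : Q.Obj} (x : Q.shom X Y) (c : Chain Q Y Z)
    (φ : Chain Q X Z → M) : lsum (derTerms L h (.cons x c)) φ =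
      φ (.cons (h _ _ x) (c.sgn 1)) + lsum (derTerms L h c) fun z => φ (.cons (L _ _ x) z) := by
  simp [derTerms, lsum_map]

theorem length_of_mem_derTerms {X Y : Q.Obj} {c : Chain Q X Y} :
    ∀ z ∈ derTerms L h c, z.length = c.length := by
  induction c with
  | nil => simp [derTerms]
  | cons x c ih =>
    intro z hz
    simp only [derTerms, List.mem_cons, List.mem_map] at hz
    rcases hz with rfl | ⟨y, hy, rfl⟩
    · simp
    · simp [ih y hy]

variable {L h}

theorem degree_of_mem_derTerms {e : ℤ} (hL : ∀ X Y d, ∀ x ∈ Q.grade X Y d, L X Y x ∈ Q.grade X Y d)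
    (hh : ∀ X Y d, ∀ x ∈ Q.grade X Y d, h X Y x ∈ Q.grade X Y (d + e)) {X Y : Q.Obj}
    {c : Chain Q X Y} {d : ℤ} (hc : c.HasDegree d) :
    ∀ z ∈ derTerms L h c, z.HasDegree (d + e) := by
  induction hc with
  | nil => simp [derTerms]
  | @cons X Y Z x c d d' hx hc ih =>
    intro z hz
    simp only [derTerms, List.mem_cons, List.mem_map] at hz
    rcases hz with rfl | ⟨y, hy, rfl⟩
    · rw [add_right_comm]
      exact .cons (hh _ _ _ _ hx) (hc.sgn 1)
    · rw [add_assoc]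
      exact .cons (hL _ _ _ _ hx) (ih y hy)

theorem lsum_derTerms_sgn (hL : ∀ X Y x, L X Y (Q.sgn 1 X Y x) = Q.sgn 1 X Y (L X Y x))
    (hh : ∀ X Y x, h X Y (Q.sgn 1 X Y x) = -Q.sgn 1 X Y (h X Y x)) [Module k M] {X Y : Q.Obj}
    {φ : Chain Q X Y → M} (hφ : φ ∈ MultiFun Q X Y M) (c : Chain Q X Y) :
    lsum (derTerms L h (c.sgn 1)) φ = -lsum (derTerms L h c) fun z => φ (z.sgn 1) := by
  induction c with
  | nil => simp
  | cons x c ih =>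
    rw [Chain.sgn_cons, lsum_derTerms_cons, lsum_derTerms_cons, hh,
      ih (MultiFun.prepend_cons hφ _), neg_add]
    congr 1
    · exact map_neg (MultiFun.slot hφ (.nil _) ((c.sgn 1).sgn 1)) _
    · simp only [hL, Chain.sgn_cons]

theorem lsum_derTerms_multilinear [Module k M] {X Y : Q.Obj}
    {φ : Chain Q X Y → M} (hφ : φ ∈ MultiFun Q X Y M) :
    (fun c => lsum (derTerms L h c) φ) ∈ MultiFun Q X Y M := by
  intro Z W p q a x y
  induction p with
  | nil =>
    simp only [Chain.nil_append, lsum_derTerms_cons]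
    have h1 := (MultiFun.slot hφ (.nil _) (q.sgn 1))
    have h2 : ∀ z, φ (.cons (L _ _ (a • x + y)) z) =
        a • φ (.cons (L _ _ x) z) + φ (.cons (L _ _ y) z) := fun z => by
      rw [map_add, map_smul]; exact hφ (.nil _) z a _ _
    have h3 : φ (.cons (h _ _ (a • x + y)) (q.sgn 1)) =
        a • φ (.cons (h _ _ x) (q.sgn 1)) + φ (.cons (h _ _ y) (q.sgn 1)) := by
      rw [map_add, map_smul]; exact hφ (.nil _) _ a _ _
    simp only [h2, h3, lsum, sum_map_smul_add, smul_add]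
    abel
  | cons z p ih =>
    simp only [Chain.cons_append, lsum_derTerms_cons]
    have h1 := MultiFun.sgn (MultiFun.prepend_cons hφ (h _ _ z)) 1 p q a x y
    simp only at h1
    have h2 := ih (MultiFun.prepend_cons hφ (L _ _ z)) x y
    simp only at h2
    rw [h1, h2, smul_add]
    abel

end DerTerms

/-- The differential `b₁` as a linear map. -/
def PreAInfCat.b₁L (A : PreAInfCat.{w, u, v} k) (X Y : A.Obj) : A.shom X Y →ₗ[k] A.shom X Y :=
  MultiFun.slot (A.b_multilinear X Y) (.nil X) (.nil Y)

theorem PreAInfCat.b₁L_mem (A : PreAInfCat.{w, u, v} k) (X Y : A.Obj) (d : ℤ) (x : A.shom X Y)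
    (hx : x ∈ A.grade X Y d) : A.b₁L X Y x ∈ A.grade X Y (d + 1) :=
  A.b_degree _ _ (.single hx)

theorem PreAInfCat.b₁L_sgn (A : PreAInfCat.{w, u, v} k) (X Y : A.Obj) (x : A.shom X Y) :
    A.b₁L X Y (A.sgn 1 X Y x) = -A.sgn 1 X Y (A.b₁L X Y x) := by
  have := b_sgn 1 (Chain.single x)
  rw [koszul_one, neg_one_smul] at this
  exact this

/-- This is the component of `b² = 0` on one letter; the terms with an empty argument of `b` vanish
because `b₀ = 0`. -/
theorem PreAInfCat.IsAInfCat.b₁L_b₁L (hA : A.IsAInfCat) {X Y : A.Obj} (x : A.shom X Y) :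
    A.b₁L X Y (A.b₁L X Y x) = 0 := by
  have h : lsum (A.bTerms (.single x)) A.b = 0 := hA X Y (.single x)
  rw [lsum_bTerms] at h
  have h0 : A.b (.cons (0 : A.shom X X) (.single (A.sgn 1 X Y x))) = 0 :=
    MultiFun.cons_zero (A.b_multilinear X Y) _
  have h2 : A.b (.cons x (.single (0 : A.shom Y Y))) = 0 :=
    MultiFun.slot_zero (A.b_multilinear X Y) (.single x) (.nil Y)
  simp only [Chain.single] at h0 h2
  have h3 : A.b (.single (A.b (.single x))) = 0 := by
    simpa [Chain.single, A.b_nil, h0, h2] using h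
  exact h3

/-- The terms of `∑ (x₁ ⊗ ⋯ ⊗ xₙ)(1^{⊗r} ⊗ b₁ ⊗ 1^{⊗t})`. -/
abbrev PreAInfCat.dTerms (A : PreAInfCat.{w, u, v} k) {X Y : A.Obj}
    (c : Chain A.toGradedQuiver X Y) : List (Chain A.toGradedQuiver X Y) :=
  derTerms (fun _ _ => LinearMap.id) A.b₁L c

section DTerms

variable {M : Type*} [AddCommGroup M] [Module k M]

/-- Applications of `b₁` to two different letters cancel by sign, and on a single letter `b₁² = 0`.
-/
theorem lsum_dTerms_dTerms (hA : A.IsAInfCat) {X Y : A.Obj} (c : Chain A.toGradedQuiver X Y)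
    {φ : Chain A.toGradedQuiver X Y → M} (hφ : φ ∈ MultiFun A.toGradedQuiver X Y M) :
    (lsum (A.dTerms c) fun z => lsum (A.dTerms z) φ) = 0 := by
  induction c with
  | nil => rfl
  | cons x c ih =>
    simp only [lsum_derTerms_cons, lsum_add, LinearMap.id_apply]
    rw [ih (MultiFun.prepend_cons hφ x), hA.b₁L_b₁L, MultiFun.cons_zero hφ,
      lsum_derTerms_sgn (L := fun _ _ => LinearMap.id) (fun _ _ _ => rfl) A.b₁L_sgn
        (MultiFun.prepend_cons hφ _)]
    simp

/-- On the shortest chains for which `φ` does not vanish only `b₁` contributes. -/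
theorem lsum_bTerms_eq_dTerms {X Y : A.Obj} (c : Chain A.toGradedQuiver X Y)
    {φ : Chain A.toGradedQuiver X Y → M} (hφ : φ ∈ MultiFun A.toGradedQuiver X Y M)
    (h : ∀ z, z.length < c.length → φ z = 0) : lsum (A.bTerms c) φ = lsum (A.dTerms c) φ := by
  induction c with
  | nil =>
    rw [lsum_bTerms]
    simp [A.b_nil]
    exact MultiFun.cons_zero hφ _
  | @cons X Y Z x c ih =>
    have ih' := ih (MultiFun.prepend_cons hφ x) fun z hz => h _ (by simpa using hz)
    rw [lsum_bTerms] at ih'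
    rw [lsum_bTerms, Chain.sumSplits_cons, lsum_derTerms_cons, LinearMap.id_apply, ← ih',
      Chain.sumSplits_cons, A.b_nil]
    simp only [Chain.nil_append, Chain.cons_append]
    rw [MultiFun.cons_zero hφ, zero_add, Chain.sumSplits_eq_left]
    · rfl
    · intro W p q hp hpq
      refine h _ ?_
      subst hpq
      simp
      omega

end DTerms

end AInf
end

noncomputable section

namespace AInf

open scoped TensorProduct DirectSum

variable {k : Type w} [CommRing k]

variable {A : PreAInfCat.{w, u₁, v₁} k} {B : PreAInfCat.{w, u₂, v₂} k}
  {C : PreAInfCat.{w, u₃, v₃} k}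

/-! ### Multilinear homogeneous components and their differential -/

section Components

variable {φ ψ : A.Obj → B.Obj}

/-- The components are multilinear and homogeneous of degree `p`. -/
structure IsHom (u : Components A B φ ψ) (p : ℤ) : Prop where
  multilinear : ∀ X Y, (fun c => u c) ∈ MultiFun A.toGradedQuiver X Y (B.shom (φ X) (ψ Y))
  degree : ∀ {X Y : A.Obj} (c : Chain A.toGradedQuiver X Y) (d : ℤ), c.HasDegree d →
    u c ∈ B.grade (φ X) (ψ Y) (d + p)

theorem IsHom.sub {u u' : Components A B φ ψ} {p : ℤ} (hu : IsHom u p) (hu' : IsHom u' p) :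
    IsHom (u - u') p where
  multilinear X Y := sub_mem (hu.multilinear X Y) (hu'.multilinear X Y)
  degree c d hc := sub_mem (hu.degree c d hc) (hu'.degree c d hc)

theorem IsHom.zero (p : ℤ) : IsHom (0 : Components A B φ ψ) p where
  multilinear _ _ := zero_mem _
  degree _ _ _ := zero_mem _

theorem Coder.isHom {f g : CocatHom A B} {p : ℤ} (r : Coder f g p) : IsHom r.app p :=
  ⟨r.app_multilinear, r.app_degree⟩

/-- The coderivation with given components. -/
def IsHom.coder {f g : CocatHom A B} {p : ℤ} {u : Components A B f.obj g.obj} (hu : IsHom u p) :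
    Coder f g p := ⟨u, hu.multilinear, hu.degree⟩

/-- The differential of components with respect to `b₁` only. -/
def linDiff (p : ℤ) (u : Components A B φ ψ) : Components A B φ ψ := fun _ _ c =>
  B.b₁L _ _ (u c) - koszul p • lsum (A.dTerms c) fun z => u z

theorem linDiff_def (p : ℤ) (u : Components A B φ ψ) {X Y : A.Obj}
    (c : Chain A.toGradedQuiver X Y) : linDiff p u c =
      B.b₁L _ _ (u c) - koszul p • lsum (A.dTerms c) fun z => u z := rfl

theorem IsHom.linDiff {u : Components A B φ ψ} {p : ℤ} (hu : IsHom u p) :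
    IsHom (linDiff p u) (p + 1) where
  multilinear X Y := sub_mem (MultiFun.comp_linear (hu.multilinear X Y) (B.b₁L _ _))
    (zsmul_mem (lsum_derTerms_multilinear (hu.multilinear X Y)) _)
  degree c d hc := by
    refine sub_mem ?_ (zsmul_mem (lsum_mem fun z hz => ?_) _)
    · rw [← add_assoc]
      exact B.b₁L_mem _ _ _ _ (hu.degree c d hc)
    · rw [add_comm p, ← add_assoc]
      exact hu.degree z _ (degree_of_mem_derTerms (fun _ _ _ _ h => h) A.b₁L_mem hc z hz)

theorem linDiff_sub (p : ℤ) (u u' : Components A B φ ψ) {X Y : A.Obj}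
    (c : Chain A.toGradedQuiver X Y) :
    linDiff p (u - u') c = linDiff p u c - linDiff p u' c := by
  simp only [linDiff_def, Pi.sub_apply, map_sub, lsum_sub, smul_sub]
  abel

/-- A Hom complex: the differentials of source and target square to zero, and the mixed terms cancel
by sign. -/
theorem IsHom.linDiff_linDiff {u : Components A B φ ψ} {p : ℤ} (hu : IsHom u p)
    (hA : A.IsAInfCat) (hB : B.IsAInfCat) {X Y : A.Obj} (c : Chain A.toGradedQuiver X Y) :
    AInf.linDiff (p + 1) (AInf.linDiff p u) c = 0 := by
  have h1 : (lsum (A.dTerms c) fun z => B.b₁L _ _ (u z)) =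
    B.b₁L _ _ (lsum (A.dTerms c) fun z => u z) := (map_lsum (B.b₁L _ _).toAddMonoidHom _ _).symm
  simp only [linDiff_def, map_sub, map_zsmul, lsum_sub, lsum_zsmul, h1]
  rw [lsum_dTerms_dTerms hA c (hu.multilinear X Y), hB.b₁L_b₁L, koszul_add]
  simp

end Components

/-! ### Retractions of the complexes of morphisms -/

/-- Homogeneous projections `P` of the complexes `s𝒜(X, Y)`, homotopic to the identity, such that
the images of the `P` are closed under all operations. -/
structure Retract (A : PreAInfCat.{w, u, v} k) where
  P : ∀ X Y : A.Obj, A.shom X Y →ₗ[k] A.shom X Y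
  H : ∀ X Y : A.Obj, A.shom X Y →ₗ[k] A.shom X Y
  P_mem : ∀ X Y d, ∀ x ∈ A.grade X Y d, P X Y x ∈ A.grade X Y d
  H_mem : ∀ X Y d, ∀ x ∈ A.grade X Y d, H X Y x ∈ A.grade X Y (d + -1)
  homotopy : ∀ X Y x, A.b₁L X Y (H X Y x) + H X Y (A.b₁L X Y x) = x - P X Y x
  H_P : ∀ X Y x, H X Y (P X Y x) = 0
  P_b : ∀ {X Y : A.Obj} (c : Chain A.toGradedQuiver X Y),
    P X Y (A.b (Chain.map (fun X => X) (fun X Y => P X Y) c)) =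
      A.b (Chain.map (fun X => X) (fun X Y => P X Y) c)

namespace Retract

variable (R : Retract A)

/-- The projection applied to all elements of a chain. -/
def proj {X Y : A.Obj} (c : Chain A.toGradedQuiver X Y) : Chain A.toGradedQuiver X Y :=
  Chain.map (fun X => X) (fun X Y => R.P X Y) c

@[simp] theorem proj_nil (X : A.Obj) : R.proj (.nil X) = .nil X := rfl

@[simp] theorem proj_cons {X Y Z : A.Obj} (x : A.shom X Y) (c : Chain A.toGradedQuiver Y Z) :
    R.proj (.cons x c) = .cons (R.P X Y x) (R.proj c) := rfl

theorem proj_append {X Y Z : A.Obj} (c : Chain A.toGradedQuiver X Y)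
    (d : Chain A.toGradedQuiver Y Z) : R.proj (c.append d) = (R.proj c).append (R.proj d) :=
  Chain.map_append _ _ c d

theorem P_sgn (p : ℤ) (X Y : A.Obj) (x : A.shom X Y) :
    R.P X Y (A.sgn p X Y x) = A.sgn p X Y (R.P X Y x) := by
  have := GradedQuiver.map_sgn (Q := A.toGradedQuiver) (R := A.toGradedQuiver) (R.P X Y) 0
    (fun d x hx => by simpa using R.P_mem X Y d x hx) p x
  simpa using this

theorem H_sgn (X Y : A.Obj) (x : A.shom X Y) :
    R.H X Y (A.sgn 1 X Y x) = -A.sgn 1 X Y (R.H X Y x) := by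
  have := GradedQuiver.map_sgn (Q := A.toGradedQuiver) (R := A.toGradedQuiver) (R.H X Y) (-1)
    (R.H_mem X Y) 1 x
  simpa [koszul_neg] using this

theorem proj_sgn (p : ℤ) {X Y : A.Obj} (c : Chain A.toGradedQuiver X Y) :
    R.proj (c.sgn p) = (R.proj c).sgn p := by
  induction c with
  | nil => rfl
  | cons x c ih => simp [ih, R.P_sgn]

/-- Composing the homotopy identity with `b₁` on either side computes `b₁Hb₁` in two ways. -/
theorem b₁L_P (hA : A.IsAInfCat) (X Y : A.Obj) (x : A.shom X Y) :
    A.b₁L X Y (R.P X Y x) = R.P X Y (A.b₁L X Y x) := by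
  have h1 := R.homotopy X Y (A.b₁L X Y x)
  have h2 := congrArg (A.b₁L X Y) (R.homotopy X Y x)
  rw [hA.b₁L_b₁L, map_zero, add_zero] at h1
  rw [map_add, hA.b₁L_b₁L, zero_add, map_sub, h1] at h2
  exact (sub_right_injective h2).symm

/-- The terms of the homotopy between the identity and the projection of `Ts𝒜`. -/
abbrev kTerms {X Y : A.Obj} (c : Chain A.toGradedQuiver X Y) : List (Chain A.toGradedQuiver X Y) :=
  derTerms R.P R.H c

section

variable {M : Type*} [AddCommGroup M] [Module k M] {X Y : A.Obj}
  {φ : Chain A.toGradedQuiver X Y → M}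

/-- The usual homotopy on a tensor power: the sum of `P ⊗ ⋯ ⊗ P ⊗ H ⊗ 1 ⊗ ⋯ ⊗ 1` over the position
of `H` telescopes from the identity to `P ⊗ ⋯ ⊗ P`, since `P` commutes with `b₁`. -/
theorem lsum_dTerms_kTerms (hA : A.IsAInfCat) (hφ : φ ∈ MultiFun A.toGradedQuiver X Y M)
    (c : Chain A.toGradedQuiver X Y) : (lsum (R.kTerms c) fun z => lsum (A.dTerms z) φ) +
      (lsum (A.dTerms c) fun z => lsum (R.kTerms z) φ) = φ c - φ (R.proj c) := by
  induction c with
  | nil => simp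
  | @cons X Y Z x c ih =>
    have h1 := lsum_derTerms_sgn (L := R.P) (R.P_sgn 1) R.H_sgn
      (MultiFun.prepend_cons hφ (R.P _ _ (A.b₁L X Y x))) c
    have h2 := lsum_derTerms_sgn (L := fun _ _ => LinearMap.id) (fun _ _ _ => rfl) A.b₁L_sgn
      (MultiFun.prepend_cons hφ (R.H X Y x)) c
    have h3 := ih (MultiFun.prepend_cons hφ (R.P X Y x))
    have e1 : (c.sgn 1).sgn 1 = c := by rw [Chain.sgn_sgn]; exact Chain.sgn_even ⟨1, rfl⟩ c
    have h4 : φ (.cons (A.b₁L X Y (R.H X Y x)) c) + φ (.cons (R.H X Y (A.b₁L X Y x)) c) =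
        φ (.cons x c) - φ (.cons (R.P X Y x) c) := by
      have := congrArg (MultiFun.slot hφ (.nil _) c) (R.homotopy X Y x)
      rw [map_add, map_sub] at this
      exact this
    simp only [lsum_derTerms_cons, lsum_add, LinearMap.id_apply, e1, R.b₁L_P hA, R.proj_cons]
    rw [h1, h2]
    rw [eq_sub_iff_add_eq] at h3 h4 ⊢
    rw [← h4, ← h3]
    abel

/-- In every term `H` meets a letter of the form `P x`, and `HP = 0`. This is what keeps later
corrections from disturbing prescribed values. -/
theorem lsum_kTerms_proj (hφ : φ ∈ MultiFun A.toGradedQuiver X Y M)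
    (c : Chain A.toGradedQuiver X Y) : lsum (R.kTerms (R.proj c)) φ = 0 := by
  induction c with
  | nil => rfl
  | cons x c ih =>
    rw [R.proj_cons, lsum_derTerms_cons, R.H_P, MultiFun.cons_zero hφ,
      ih (MultiFun.prepend_cons hφ _), add_zero]

end

section

variable {M : Type*} [AddCommGroup M] {X Y : A.Obj} {φ : Chain A.toGradedQuiver X Y → M}

theorem lsum_dTerms_proj (hA : A.IsAInfCat) (c : Chain A.toGradedQuiver X Y) :
    lsum (A.dTerms (R.proj c)) φ = lsum (A.dTerms c) fun z => φ (R.proj z) := by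
  induction c with
  | nil => rfl
  | cons x c ih =>
    simp only [R.proj_cons, lsum_derTerms_cons, ih, LinearMap.id_apply, R.b₁L_P hA, R.proj_sgn]

/-- By `P_b` the output of `b` on projected letters is again a projected letter, so `b` restricts to
projected chains. -/
theorem lsum_bTerms_proj (c : Chain A.toGradedQuiver X Y) :
    lsum (A.bTerms (R.proj c)) φ = c.sumSplits fun _ p c' => c'.sumSplits fun _ m q =>
      φ (R.proj (p.append (.cons (A.b (R.proj m)) (q.sgn 1)))) := by
  rw [lsum_bTerms, proj, Chain.sumSplits_map]
  simp only [Chain.sumSplits_map]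
  refine Chain.sumSplits_congr _ fun Z p c' => Chain.sumSplits_congr _ fun W m q => ?_
  rw [R.proj_append, R.proj_cons, R.proj_sgn]
  exact congrArg (fun y => φ ((R.proj p).append (.cons y ((R.proj q).sgn 1)))) (R.P_b m).symm

end

variable {φ ψ : A.Obj → B.Obj}

/-- The homotopy operator on components of degree `p`. -/
def homotopyOp (p : ℤ) (u : Components A B φ ψ) : Components A B φ ψ := fun _ _ c =>
  koszul p • lsum (R.kTerms c) fun z => u z

theorem homotopyOp_def (p : ℤ) (u : Components A B φ ψ) {X Y : A.Obj}
    (c : Chain A.toGradedQuiver X Y) :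
    R.homotopyOp p u c = koszul p • lsum (R.kTerms c) fun z => u z := rfl

theorem isHom_homotopyOp {u : Components A B φ ψ} {p : ℤ} (hu : IsHom u (p + 1)) :
    IsHom (R.homotopyOp (p + 1) u) p where
  multilinear X Y := zsmul_mem (lsum_derTerms_multilinear (hu.multilinear X Y)) _
  degree c d hc := by
    refine zsmul_mem (lsum_mem fun z hz => ?_) _
    have := hu.degree z _ (degree_of_mem_derTerms R.P_mem R.H_mem hc z hz)
    rwa [show d + -1 + (p + 1) = d + p by ring] at this

/-- The tensor homotopy, transposed to the Hom complex, is a homotopy between the identity and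
precomposition with the projection. -/
theorem linDiff_homotopyOp (hA : A.IsAInfCat) {u : Components A B φ ψ} {p : ℤ}
    (hu : IsHom u (p + 1)) {X Y : A.Obj} (c : Chain A.toGradedQuiver X Y) :
    linDiff p (R.homotopyOp (p + 1) u) c + R.homotopyOp (p + 1 + 1) (linDiff (p + 1) u) c =
      u c - u (R.proj c) := by
  rw [← R.lsum_dTerms_kTerms hA (hu.multilinear X Y) c]
  have h1 : (lsum (R.kTerms c) fun z => B.b₁L _ _ (u z)) =
    B.b₁L _ _ (lsum (R.kTerms c) fun z => u z) := (map_lsum (B.b₁L _ _).toAddMonoidHom _ _).symm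
  simp only [linDiff_def, homotopyOp_def, map_zsmul, lsum_sub, lsum_zsmul, h1, smul_sub,
    smul_smul]
  have e1 : koszul p * koszul (p + 1) = -1 := by
    rw [koszul_add, ← mul_assoc, koszul_mul_self, koszul_one, one_mul]
  have e2 : koszul (p + 1 + 1) * koszul (p + 1) = -1 := by
    rw [koszul_add (p + 1) 1, koszul_one, mul_right_comm, koszul_mul_self, one_mul]
  have e3 : koszul (p + 1 + 1) = -koszul (p + 1) := by
    rw [koszul_add (p + 1) 1, koszul_one, mul_neg_one]
  rw [e1, e2, e3]
  simp only [neg_smul, one_smul]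
  abel

theorem homotopyOp_proj {u : Components A B φ ψ} (p : ℤ) {q : ℤ} (hu : IsHom u q) {X Y : A.Obj}
    (c : Chain A.toGradedQuiver X Y) : R.homotopyOp p u (R.proj c) = 0 := by
  rw [homotopyOp_def, R.lsum_kTerms_proj (hu.multilinear X Y), smul_zero]

theorem linDiff_proj (hA : A.IsAInfCat) (u : Components A B φ ψ) (p : ℤ) {X Y : A.Obj}
    (c : Chain A.toGradedQuiver X Y) : linDiff p u (R.proj c) =
      B.b₁L _ _ (u (R.proj c)) - koszul p • lsum (A.dTerms c) fun z => u (R.proj z) := by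
  rw [linDiff_def, R.lsum_dTerms_proj hA]

theorem homotopyOp_congr {u u' : Components A B φ ψ} (p : ℤ) {X Y : A.Obj}
    {c : Chain A.toGradedQuiver X Y} (h : ∀ z : Chain A.toGradedQuiver X Y,
      z.length = c.length → u z = u' z) : R.homotopyOp p u c = R.homotopyOp p u' c := by
  rw [homotopyOp_def, homotopyOp_def]
  exact congrArg _ (lsum_congr fun z hz => h z (length_of_mem_derTerms _ _ z hz))

end Retract

end AInf
end

noncomputable section

namespace AInf

open scoped TensorProduct DirectSum

variable {k : Type w} [CommRing k]

variable {A : PreAInfCat.{w, u₁, v₁} k} {B : PreAInfCat.{w, u₂, v₂} k}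
  {C : PreAInfCat.{w, u₃, v₃} k}

/-! ### Fixed points -/

/-- The families of components agree on chains of length less than `n`. -/
def AgreeBelow {φ ψ : A.Obj → B.Obj} (n : ℕ) (u u' : Components A B φ ψ) : Prop :=
  ∀ ⦃X Y : A.Obj⦄ (c : Chain A.toGradedQuiver X Y), c.length < n → u c = u' c

/-- Since `T` improves agreement by one length, its iterates stabilise on each length, and the
stable values form a fixed point. The hypothesis `hlim` says that `Good` can be tested on
truncations, which is all that the limit offers. -/
theorem exists_fixedPoint {φ ψ : A.Obj → B.Obj} (Good : Components A B φ ψ → Prop)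
    (T : {u // Good u} → {u // Good u}) (u₀ : {u // Good u})
    (hT : ∀ n (u u' : {u // Good u}), AgreeBelow n u.1 u'.1 → AgreeBelow (n + 1) (T u).1 (T u').1)
    (hlim : ∀ u, (∀ n, ∃ u', Good u' ∧ AgreeBelow n u u') → Good u) : ∃ u, T u = u := by
  let r : ℕ → {u // Good u} := fun n => T^[n] u₀
  have hr : ∀ n, r (n + 1) = T (r n) := fun n => Function.iterate_succ_apply' T n u₀
  have h1 : ∀ n, AgreeBelow n (r n).1 (r (n + 1)).1 := by
    intro n
    induction n with
    | zero => exact fun X Y c hc => absurd hc (Nat.not_lt_zero _)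
    | succ n ih => rw [hr n, hr (n + 1)]; exact hT n _ _ ih
  have h2 : ∀ m n, AgreeBelow n (r n).1 (r (n + m)).1 := by
    intro m n
    induction m with
    | zero => exact fun X Y c _ => rfl
    | succ m ih => exact fun X Y c hc => (ih c hc).trans (h1 (n + m) c (by omega))
  -- The iterates agree on `c` from the index `c.length + 1` on, the first one strictly above its
  -- length.
  let u : Components A B φ ψ := fun X Y c => (r (c.length + 1)).1 c
  have h3 : ∀ n, AgreeBelow n u (r n).1 := by
    intro n X Y c hc
    have := h2 (n - (c.length + 1)) (c.length + 1) c (by omega)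
    rwa [show c.length + 1 + (n - (c.length + 1)) = n by omega] at this
  have hu : Good u := hlim u fun n => ⟨_, (r n).2, h3 n⟩
  refine ⟨⟨u, hu⟩, Subtype.ext ?_⟩
  funext X Y c
  have h4 := hT (c.length + 1) ⟨u, hu⟩ (r (c.length + 1)) (h3 _) c (by omega)
  rw [h4, ← hr]
  exact (h3 (c.length + 2) c (by omega)).symm

theorem IsHom.of_agreeBelow {φ ψ : A.Obj → B.Obj} {u : Components A B φ ψ} {p : ℤ}
    (h : ∀ n, ∃ u' : Components A B φ ψ, IsHom u' p ∧ AgreeBelow n u u') : IsHom u p where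
  multilinear X Y := by
    intro Z W c d a x y
    -- With the letter inserted the chain has length `c.length + d.length + 1`, and agreement
    -- requires a strictly larger bound.
    obtain ⟨u', hu', hn⟩ := h (c.length + d.length + 2)
    have := hu'.multilinear X Y c d a x y
    simp only at this ⊢
    rw [hn _ (by simp; omega), hn _ (by simp; omega), hn _ (by simp; omega), this]
  degree c d hc := by
    obtain ⟨u', hu', hn⟩ := h (c.length + 1)
    rw [hn c (by omega)]
    exact hu'.degree c d hc

/-! ### Differences of coderivations -/

namespace Coder

variable {f g : CocatHom A B} {p : ℤ}

/-- The difference of two coderivations. -/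
def sub (r q : Coder f g p) : Coder f g p := (r.isHom.sub q.isHom).coder

theorem sub_app (r q : Coder f g p) {X Y : A.Obj} (c : Chain A.toGradedQuiver X Y) :
    (r.sub q).app c = r.app c - q.app c := rfl

theorem sub_B₁ (r q : Coder f g p) {X Y : A.Obj} (c : Chain A.toGradedQuiver X Y) :
    (r.sub q).B₁ c = r.B₁ c - q.B₁ c := by
  have h : lsum ((r.sub q).terms c) B.b = lsum (r.terms c) B.b - lsum (q.terms c) B.b := by
    simp only [lsum_terms, ← Chain.sumSplits_sub, ← lsum_sub]
    exact Chain.sumSplits_congr _ fun Z c₁ c' => Chain.sumSplits_congr _ fun W c₂ c₃ =>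
      lsum_congr fun y _ => lsum_congr fun z _ =>
        map_sub (MultiFun.slot (B.b_multilinear _ _) y z) _ _
  simp only [B₁_eq, h, sub_app, lsum_sub, smul_sub]
  abel

/-- On the shortest chains for which `r` does not vanish only the differentials `b₁` contribute to
`rB₁`. -/
theorem B₁_eq_linDiff (r : Coder f g p) {X Y : A.Obj} (c : Chain A.toGradedQuiver X Y)
    (h : ∀ {Z W : A.Obj} (z : Chain A.toGradedQuiver Z W), z.length < c.length → r.app z = 0) :
    r.B₁ c = linDiff p r.app c := by
  have h0 : ∀ {X Z W Y : B.Obj} (y : Chain B.toGradedQuiver X Z) (z : Chain B.toGradedQuiver W Y),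
    B.b (y.append (.cons 0 z)) = 0 := fun y z => MultiFun.slot_zero (B.b_multilinear _ _) y z
  rw [B₁_eq, linDiff_def, lsum_bTerms_eq_dTerms c (r.app_multilinear X Y) fun z hz => h z hz,
    lsum_terms]
  congr 1
  rw [Chain.sumSplits_eq_left]
  · rw [Chain.sumSplits_eq_right]
    · simp only [Chain.sgn_nil, lsum_blocks_nil]
      rfl
    · intro Z p q hq hc
      subst hc
      simp only [h p (by simp; omega), h0, lsum_zero]
  · intro Z p q hp hc
    rw [Chain.sumSplits_congr' (G' := fun _ _ _ => 0), Chain.sumSplits_zero]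
    intro W a b hab
    subst hab
    subst hc
    simp only [h a (by simp; omega), h0, lsum_zero]

/-- On a projected chain every argument of `r` occurring in `rB₁` is projected as well, so all terms
vanish. -/
theorem B₁_proj (R : Retract A) (r : Coder f g p)
    (h : ∀ {X Y : A.Obj} (c : Chain A.toGradedQuiver X Y), r.app (R.proj c) = 0) {X Y : A.Obj}
    (c : Chain A.toGradedQuiver X Y) : r.B₁ (R.proj c) = 0 := by
  have h0 : ∀ {X Z W Y : B.Obj} (y : Chain B.toGradedQuiver X Z) (z : Chain B.toGradedQuiver W Y),
    B.b (y.append (.cons 0 z)) = 0 := fun y z => MultiFun.slot_zero (B.b_multilinear _ _) y z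
  rw [B₁_eq, lsum_terms, R.lsum_bTerms_proj]
  simp only [h, Chain.sumSplits_zero, smul_zero, sub_zero]
  rw [Retract.proj, Chain.sumSplits_map]
  simp only [Chain.sumSplits_map]
  have h1 : ∀ {X Y : A.Obj} (c : Chain A.toGradedQuiver X Y),
    r.app (Chain.map (fun X => X) (fun X Y => R.P X Y) c) = 0 := h
  simp only [h1, h0, lsum_zero, Chain.sumSplits_zero]

/-- A family which is a `B₁`-cycle and is determined by its lowest term vanishes. -/
theorem app_eq_zero (R : Retract A) (r : Coder f g p) (q : ℤ)
    (hr : ∀ {X Y : A.Obj} (c : Chain A.toGradedQuiver X Y), r.B₁ c = 0)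
    (h : ∀ {X Y : A.Obj} (c : Chain A.toGradedQuiver X Y),
      r.app c = R.homotopyOp q (linDiff p r.app) c) {X Y : A.Obj}
    (c : Chain A.toGradedQuiver X Y) : r.app c = 0 := by
  induction hn : c.length using Nat.strong_induction_on generalizing X Y with
  | _ n ih =>
    subst hn
    -- The homotopy operator preserves length. By induction `r` vanishes on shorter chains, so on
    -- chains of this length `linDiff` of `r` is `rB₁`, which is zero.
    rw [h, R.homotopyOp_congr (u' := 0) q, R.homotopyOp_def]
    · simp
    · intro z hz
      rw [← r.B₁_eq_linDiff z fun y hy => ih _ (by omega) y rfl, hr]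
      rfl

end Coder

/-! ### Lifting problems for a retraction -/

namespace Retract

variable (R : Retract A)

/-- Cycles which vanish on the image of the projection are boundaries of families which vanish
there. -/
theorem exists_coder (hA : A.IsAInfCat) (hB : B.IsAInfCat) {f g : CocatHom A B}
    (hf : f.IsAInfFunctor) (hg : g.IsAInfFunctor) {p : ℤ} (u : Coder f g (p + 1))
    (hu : ∀ {X Y : A.Obj} (c : Chain A.toGradedQuiver X Y), u.B₁ c = 0)
    (h0 : ∀ {X Y : A.Obj} (c : Chain A.toGradedQuiver X Y), u.app (R.proj c) = 0) :
    ∃ v : Coder f g p,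
      (∀ {X Y : A.Obj} (c : Chain A.toGradedQuiver X Y), v.app (R.proj c) = 0) ∧
      ∀ {X Y : A.Obj} (c : Chain A.toGradedQuiver X Y), v.B₁ c = u.app c := by
  let Good : Components A B f.obj g.obj → Prop := fun v => IsHom v p ∧
    ∀ (X Y : A.Obj) (c : Chain A.toGradedQuiver X Y), v (R.proj c) = 0
  -- The equation `vB₁ = u` reads `linDiff v = s v`, where `s v` on a chain depends only on the
  -- values of `v` on shorter chains.
  let s : {v // Good v} → Components A B f.obj g.obj := fun v =>
    u.app - (v.2.1.coder.B₁ - linDiff p v.1)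
  have hs : ∀ v, IsHom (s v) (p + 1) := fun v =>
    u.isHom.sub (v.2.1.coder.d.isHom.sub v.2.1.linDiff)
  -- Solve `linDiff v = s v` by the homotopy operator, whose values vanish on projected chains.
  let T : {v // Good v} → {v // Good v} := fun v =>
    ⟨R.homotopyOp (p + 1) (s v), R.isHom_homotopyOp (hs v),
      fun X Y c => R.homotopyOp_proj _ (hs v) c⟩
  obtain ⟨v, hv⟩ : ∃ v, T v = v := by
    refine exists_fixedPoint Good T ⟨0, IsHom.zero p, fun _ _ _ => rfl⟩ ?_ ?_
    · intro n v v' h X Y c hc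
      refine R.homotopyOp_congr _ fun z hz => ?_
      have h1 := (v.2.1.coder.sub v'.2.1.coder).B₁_eq_linDiff z fun y hy =>
        sub_eq_zero.mpr (h y (by omega))
      rw [Coder.sub_B₁] at h1
      have h2 := linDiff_sub p v.1 v'.1 z
      have h3 : v.2.1.coder.B₁ z - v'.2.1.coder.B₁ z = linDiff p v.1 z - linDiff p v'.1 z :=
        h1.trans h2
      show u.app z - (v.2.1.coder.B₁ z - linDiff p v.1 z) =
        u.app z - (v'.2.1.coder.B₁ z - linDiff p v'.1 z)
      rw [sub_eq_sub_iff_add_eq_add] at h3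
      congr 1
      rw [sub_eq_sub_iff_add_eq_add, h3, add_comm]
    · intro v h
      refine ⟨IsHom.of_agreeBelow fun n => ?_, fun X Y c => ?_⟩
      · obtain ⟨v', hv', h'⟩ := h n
        exact ⟨v', hv'.1, h'⟩
      · obtain ⟨v', hv', h'⟩ := h ((R.proj c).length + 1)
        rw [h' _ (by omega), hv'.2]
  have hv' : ∀ {X Y : A.Obj} (c : Chain A.toGradedQuiver X Y),
      R.homotopyOp (p + 1) (s v) c = v.1 c := fun c => by
    have := congrArg (fun v : {v // Good v} => v.1 c) hv
    exact this
  have hz : ∀ {X Y : A.Obj} (c : Chain A.toGradedQuiver X Y), v.2.1.coder.app (R.proj c) = 0 :=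
    fun c => v.2.2 _ _ c
  refine ⟨v.2.1.coder, hz, fun c => sub_eq_zero.mp ?_⟩
  -- The error `w = vB₁ - u` is a cycle with `w = K(linDiff w)`, where `K` is the homotopy operator.
  -- To see the latter, apply the homotopy identity to `s v`, using `K(s v) = v`, `linDiff² = 0` and
  -- the vanishing of `s v` on projected chains.
  refine (v.2.1.coder.d.sub u).app_eq_zero R (p + 1 + 1) (fun c => ?_) (fun {X Y} c => ?_) c
  · rw [Coder.sub_B₁, hu, Coder.d_B₁ _ hA hB hf hg, sub_zero]
  · have h1 := R.linDiff_homotopyOp hA (hs v) c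
    have h2 : linDiff p (R.homotopyOp (p + 1) (s v)) c = linDiff p v.1 c := by
      rw [show R.homotopyOp (p + 1) (s v) = v.1 from congrArg Subtype.val hv]
    have h3 : s v (R.proj c) = 0 := by
      show u.app (R.proj c) - (v.2.1.coder.B₁ (R.proj c) - linDiff p v.1 (R.proj c)) = 0
      rw [h0, Coder.B₁_proj R _ hz, R.linDiff_proj hA, v.2.2]
      simp [v.2.2]
    have h4 : ∀ z : Chain A.toGradedQuiver X Y, linDiff (p + 1) (s v) z =
        - linDiff (p + 1) (v.2.1.coder.d.sub u).app z := by
      intro z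
      have e1 := linDiff_sub (p + 1) u.app (fun _ _ c => v.2.1.coder.B₁ c - linDiff p v.1 c) z
      have e2 := linDiff_sub (p + 1) (fun _ _ c => v.2.1.coder.B₁ c) (linDiff p v.1) z
      have e3 := linDiff_sub (p + 1) (fun _ _ c => v.2.1.coder.B₁ c) u.app z
      have e4 := v.2.1.linDiff_linDiff hA hB z
      rw [e4, sub_zero] at e2
      refine e1.trans ?_
      refine (congrArg (fun a => linDiff (p + 1) u.app z - a) e2).trans ?_
      refine Eq.trans ?_ (congrArg Neg.neg e3.symm)
      abel
    have h5 : R.homotopyOp (p + 1 + 1) (linDiff (p + 1) (s v)) c =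
        -R.homotopyOp (p + 1 + 1) (linDiff (p + 1) (v.2.1.coder.d.sub u).app) c := by
      rw [R.homotopyOp_congr (u' := -linDiff (p + 1) (v.2.1.coder.d.sub u).app) _ fun z _ => h4 z,
        R.homotopyOp_def, R.homotopyOp_def, ← smul_neg]
      congr 1
      exact (map_lsum (-AddMonoidHom.id _) _ _).symm
    rw [h2, h3, h5, sub_zero] at h1
    have h6 : s v c = u.app c - (v.2.1.coder.B₁ c - linDiff p v.1 c) := rfl
    rw [h6] at h1
    show v.2.1.coder.B₁ c - u.app c = _
    rw [← sub_eq_zero] at h1 ⊢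
    rw [← h1]
    abel

end Retract

end AInf
end

noncomputable section

namespace AInf

open scoped TensorProduct DirectSum

variable {k : Type w} [CommRing k]

variable {A : PreAInfCat.{w, u₁, v₁} k} {B : PreAInfCat.{w, u₂, v₂} k}
  {C : PreAInfCat.{w, u₃, v₃} k}

/-! ### Functors with prescribed values on the image of a retraction -/

theorem idApp_eq_zero {X Y : A.Obj} (c : Chain A.toGradedQuiver X Y) (h : c.length ≠ 1) :
    CocatHom.idApp A c = 0 := by
  cases c with
  | nil => rfl
  | cons x c =>
    cases c with
    | nil => exact absurd rfl h
    | cons y c => rfl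

/-- The cocategory homomorphism with given components. -/
def IsHom.cocatHom {o : A.Obj → B.Obj} {F : Components A B o o} (hF : IsHom F 0)
    (h0 : ∀ X, F (.nil X) = 0) : CocatHom A B where
  obj := o
  app c := F c
  app_multilinear := hF.multilinear
  app_nil := h0
  app_degree c d hc := by simpa using hF.degree c d hc

/-- The components of the defect of a cocategory homomorphism. -/
def IsHom.defect {o : A.Obj → B.Obj} {F : Components A B o o} (hF : IsHom F 0)
    (h0 : ∀ X, F (.nil X) = 0) : Components A B o o :=
  fun _ _ c => (hF.cocatHom h0).defect.app c

theorem IsHom.isHom_defect {o : A.Obj → B.Obj} {F : Components A B o o} (hF : IsHom F 0)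
    (h0 : ∀ X, F (.nil X) = 0) : IsHom (hF.defect h0) 1 :=
  (hF.cocatHom h0).defect.isHom

section

variable {o : A.Obj → B.Obj} {F F' : Components A B o o} (hF : IsHom F 0)
  (h0 : ∀ X, F (.nil X) = 0) (hF' : IsHom F' 0) (h0' : ∀ X, F' (.nil X) = 0)

theorem lsum_blocks_congr {M : Type*} [AddCommGroup M] {X Y : A.Obj}
    (c : Chain A.toGradedQuiver X Y)
    (h : ∀ {Z W : A.Obj} (z : Chain A.toGradedQuiver Z W), z.length ≤ c.length → F z = F' z)
    (φ : Chain B.toGradedQuiver (o X) (o Y) → M) :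
    lsum ((hF.cocatHom h0).blocks c) φ = lsum ((hF'.cocatHom h0').blocks c) φ := by
  induction c using Chain.suffix_induction with
  | nil => exact (lsum_blocks_nil _ _ _).trans (lsum_blocks_nil (hF'.cocatHom h0') _ _).symm
  | @cons X Z Y x c ih =>
    refine (lsum_blocks_cons (hF.cocatHom h0) x c φ).trans
      (Eq.trans ?_ (lsum_blocks_cons (hF'.cocatHom h0') x c φ).symm)
    refine Chain.sumSplits_congr' _ fun W p q hpq => ?_
    subst hpq
    have h1 : (hF.cocatHom h0).app (.cons x p) = (hF'.cocatHom h0').app (.cons x p) :=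
      h (.cons x p) (by simp)
    rw [h1]
    exact ih W p q rfl (fun z hz => h z (by simp; omega)) _

/-- The value of `F` on the longest chain enters the defect only linearly: as a single block
followed by `b₁`, and through the terms of `bf` in which `b` is `b₁`. Subtracting `linDiff` leaves
an expression in the values on shorter chains. -/
theorem defect_sub_linDiff_congr {X Y : A.Obj} (c : Chain A.toGradedQuiver X Y)
    (h : ∀ {Z W : A.Obj} (z : Chain A.toGradedQuiver Z W), z.length < c.length → F z = F' z) :
    hF.defect h0 c - linDiff 0 F c = hF'.defect h0' c - linDiff 0 F' c := by
  have h1 := lsum_bTerms_eq_dTerms c ((hF.sub hF').multilinear X Y)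
    fun z hz => sub_eq_zero.mpr (h z hz)
  simp only [Pi.sub_apply, lsum_sub] at h1
  have h2 : lsum (M := B.shom (o X) (o Y)) ((hF.cocatHom h0).blocks c) B.b -
      lsum (M := B.shom (o X) (o Y)) ((hF'.cocatHom h0').blocks c) B.b =
      B.b₁L _ _ (F c) - B.b₁L _ _ (F' c) := by
    cases c with
    | nil =>
      rw [h0, h0', sub_self]
      exact sub_eq_zero.mpr
        ((lsum_blocks_nil _ _ _).trans (lsum_blocks_nil (hF'.cocatHom h0') _ _).symm)
    | cons x c =>
      refine (congrArg₂ (· - ·) (lsum_blocks_cons (hF.cocatHom h0) x c _)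
        (lsum_blocks_cons (hF'.cocatHom h0') x c _)).trans ?_
      rw [← Chain.sumSplits_sub, Chain.sumSplits_eq_right]
      · exact congrArg₂ (· - ·) (lsum_blocks_nil _ _ _) (lsum_blocks_nil (hF'.cocatHom h0') _ _)
      · intro W p q hq hpq
        subst hpq
        have h3 : (hF.cocatHom h0).app (.cons x p) = (hF'.cocatHom h0').app (.cons x p) :=
          h (.cons x p) (by simp; omega)
        rw [h3, sub_eq_zero]
        exact lsum_blocks_congr hF h0 hF' h0' q (fun z hz => h z (by simp; omega)) _
  have h3 : hF.defect h0 c - hF'.defect h0' c =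
      (B.b₁L _ _ (F c) - B.b₁L _ _ (F' c)) -
        (lsum (A.bTerms c) (fun z => F z) - lsum (A.bTerms c) fun z => F' z) := by
    rw [← h2]
    show (_ - _) - (_ - _) = (_ - _) - (_ - _)
    rw [sub_sub_sub_comm]
    rfl
  rw [sub_eq_sub_iff_sub_eq_sub, h3, h1, linDiff_def, linDiff_def, koszul_zero, one_smul, one_smul,
    sub_sub_sub_comm]

end

theorem lsum_bTerms_linear_idApp {X Y : A.Obj} {M : Type*} [AddCommGroup M] [Module k M]
    (ρ : A.shom X Y →ₗ[k] M) (c : Chain A.toGradedQuiver X Y) :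
    (lsum (A.bTerms c) fun z => ρ (CocatHom.idApp A z)) = ρ (A.b c) := by
  rw [← lsum_bTerms_id_app c]
  exact (map_lsum ρ.toAddMonoidHom _ _).symm

namespace Retract

variable (R : Retract A)

/-- On projected chains `f` kills every block with more than one letter, so only the cut into
letters contributes. -/
theorem lsum_blocks_proj {f : CocatHom A B}
    {ρ : ∀ X Y, A.shom X Y →ₗ[k] B.shom (f.obj X) (f.obj Y)}
    (h : ∀ {X Y : A.Obj} (c : Chain A.toGradedQuiver X Y),
      f.app (R.proj c) = ρ X Y (CocatHom.idApp A c)) {M : Type*} [AddCommGroup M] [Module k M]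
    {X Y : A.Obj} (c : Chain A.toGradedQuiver X Y)
    {φ : Chain B.toGradedQuiver (f.obj X) (f.obj Y) → M} (hφ : φ ∈ MultiFun B.toGradedQuiver _ _ M) :
    lsum (f.blocks (R.proj c)) φ = φ (Chain.map f.obj (fun X Y => ρ X Y) c) := by
  induction c with
  | nil => exact lsum_blocks_nil _ _ _
  | @cons X Y Z x c ih =>
    rw [R.proj_cons, lsum_blocks_cons, Retract.proj, Chain.sumSplits_map, Chain.sumSplits_eq_left]
    · have h1 : f.app (R.proj (.single x)) = ρ X Y x := h (.single x)
      refine (ih (MultiFun.prepend_cons hφ (f.app (R.proj (.single x))))).trans ?_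
      rw [h1]
      rfl
    · intro W p q hp _
      have h1 : f.app (R.proj (.cons x p)) = 0 := by
        rw [h, idApp_eq_zero _ (by simpa using hp), map_zero]
      refine (lsum_congr fun y _ => ?_).trans (lsum_zero _)
      refine Eq.trans (congrArg (fun a => φ (.cons a y)) h1) (MultiFun.cons_zero hφ y)

/-- An `A∞`-functor which is strict on the image of the projection. -/
theorem exists_functor (hA : A.IsAInfCat) (hB : B.IsAInfCat) (o : A.Obj → B.Obj)
    (ρ : ∀ X Y, A.shom X Y →ₗ[k] B.shom (o X) (o Y))
    (ρ_mem : ∀ X Y d, ∀ x ∈ A.grade X Y d, ρ X Y x ∈ B.grade (o X) (o Y) d)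
    (ρ_P : ∀ X Y x, ρ X Y (R.P X Y x) = ρ X Y x)
    (ρ_b : ∀ {X Y : A.Obj} (c : Chain A.toGradedQuiver X Y),
      ρ X Y (A.b (R.proj c)) = B.b (Chain.map o (fun X Y => ρ X Y) c)) :
    ∃ (F : Components A B o o) (hF : IsHom F 0) (h0 : ∀ X, F (.nil X) = 0),
      (hF.cocatHom h0).IsAInfFunctor ∧
      ∀ {X Y : A.Obj} (c : Chain A.toGradedQuiver X Y),
        F (R.proj c) = ρ X Y (CocatHom.idApp A c) := by
  let ρ' : Components A B o o := fun X Y c => ρ X Y (CocatHom.idApp A c)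
  have hρ : IsHom ρ' 0 := by
    refine ⟨fun X Y => MultiFun.comp_linear ((CocatHom.id A).app_multilinear X Y) (ρ X Y),
      fun c d hc => ?_⟩
    rw [add_zero]
    exact ρ_mem _ _ _ _ ((CocatHom.id A).app_degree c d hc)
  -- This is `ρ_b` on one letter, with `P` removed by means of `ρ_P`.
  have hb : ∀ X Y x, ρ X Y (A.b₁L X Y x) = B.b₁L _ _ (ρ X Y x) := by
    intro X Y x
    have h1 : ρ X Y (A.b₁L X Y (R.P X Y x)) = B.b₁L _ _ (ρ X Y x) := ρ_b (.single x)
    rwa [R.b₁L_P hA, ρ_P] at h1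
  have hρd : ∀ {X Y : A.Obj} (c : Chain A.toGradedQuiver X Y), linDiff 0 ρ' c = 0 := by
    intro X Y c
    rw [linDiff_def, koszul_zero, one_smul, sub_eq_zero]
    show B.b₁L _ _ (ρ X Y _) = lsum _ fun z => ρ X Y _
    by_cases hc : c.length = 1
    · cases c with
      | nil => simp at hc
      | cons x c =>
        cases c with
        | nil => simpa [CocatHom.idApp] using (hb _ _ x).symm
        | cons y c => simp at hc
    · rw [idApp_eq_zero c hc, map_zero, map_zero]
      refine ((lsum_congr fun z hz => ?_).trans (lsum_zero _)).symm
      rw [idApp_eq_zero z (by rwa [length_of_mem_derTerms _ _ z hz]), map_zero]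
  have hidP : ∀ {X Y : A.Obj} (c : Chain A.toGradedQuiver X Y),
      ρ X Y (CocatHom.idApp A (R.proj c)) = ρ X Y (CocatHom.idApp A c) := by
    intro X Y c
    by_cases hc : c.length = 1
    · cases c with
      | nil => simp at hc
      | cons x c =>
        cases c with
        | nil => exact ρ_P _ _ x
        | cons y c => simp at hc
    · rw [idApp_eq_zero c hc, idApp_eq_zero (R.proj c) (by rwa [proj, Chain.length_map])]
  let Good : Components A B o o → Prop := fun F => IsHom F 0 ∧ (∀ X, F (.nil X) = 0) ∧
    ∀ (X Y : A.Obj) (c : Chain A.toGradedQuiver X Y), F (R.proj c) = ρ' c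
  let s : {F // Good F} → Components A B o o := fun F =>
    F.2.1.defect F.2.2.1 - linDiff 0 F.1
  have hs : ∀ F, IsHom (s F) (0 + 1) := fun F =>
    (F.2.1.isHom_defect F.2.2.1).sub F.2.1.linDiff
  -- A vanishing defect means `linDiff F = -s F`. As `linDiff ρ' = 0`, the candidate is `ρ'`
  -- corrected by the homotopy operator, which leaves the values on projected chains unchanged.
  let T : {F // Good F} → {F // Good F} := fun F =>
    ⟨ρ' - R.homotopyOp (0 + 1) (s F), hρ.sub (R.isHom_homotopyOp (hs F)),
      fun X => by
        show ρ X X 0 - _ • (0 : B.shom _ _) = 0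
        rw [map_zero, smul_zero, sub_zero],
      fun X Y c => by
        show ρ' (R.proj c) - R.homotopyOp _ (s F) (R.proj c) = _
        rw [R.homotopyOp_proj _ (hs F), sub_zero]
        exact hidP c⟩
  obtain ⟨F, hF⟩ : ∃ F, T F = F := by
    refine exists_fixedPoint Good T ⟨ρ', hρ, fun X => map_zero _, fun X Y c => hidP c⟩ ?_ ?_
    · intro n F F' h X Y c hc
      show ρ' c - _ = ρ' c - _
      rw [R.homotopyOp_congr _ fun z hz => ?_]
      exact defect_sub_linDiff_congr F.2.1 F.2.2.1 F'.2.1 F'.2.2.1 z fun {_ _} y hy => h y (by omega)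
    · intro F h
      refine ⟨IsHom.of_agreeBelow fun n => ?_, fun X => ?_, fun X Y c => ?_⟩
      · obtain ⟨F', hF', h'⟩ := h n
        exact ⟨F', hF'.1, h'⟩
      · obtain ⟨F', hF', h'⟩ := h 1
        rw [h' _ (by simp), hF'.2.1]
      · obtain ⟨F', hF', h'⟩ := h ((R.proj c).length + 1)
        rw [h' _ (by omega), hF'.2.2]
  have hP : ∀ {X Y : A.Obj} (c : Chain A.toGradedQuiver X Y),
      F.1 (R.proj c) = ρ X Y (CocatHom.idApp A c) := fun c => F.2.2.2 _ _ c
  refine ⟨F.1, F.2.1, F.2.2.1, ?_, hP⟩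
  set f := F.2.1.cocatHom F.2.2.1 with hf
  -- On projected chains `F` is strict with first component `ρ`, so the defect vanishes there by
  -- `ρ_b`.
  have hΩP : ∀ {X Y : A.Obj} (c : Chain A.toGradedQuiver X Y), f.defect.app (R.proj c) = 0 := by
    intro X Y c
    have h1 := R.lsum_blocks_proj (f := f) (ρ := ρ) hP c (B.b_multilinear _ _)
    rw [CocatHom.defect_app, R.lsum_bTerms_proj, sub_eq_zero]
    refine h1.trans ?_
    have h3 := lsum_bTerms_linear_idApp (ρ X Y) (R.proj c)
    rw [R.lsum_bTerms_proj, ρ_b] at h3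
    refine h3.symm.trans ?_
    refine Chain.sumSplits_congr _ fun Z p c' => Chain.sumSplits_congr _ fun W m q => ?_
    exact (hidP _).trans (hP _).symm
  -- The defect is a `B₁`-cycle. The homotopy identity for `s F`, together with the fixed point
  -- equation, shows that it equals the homotopy operator applied to its own `linDiff`.
  have hΩ : ∀ {X Y : A.Obj} (c : Chain A.toGradedQuiver X Y), f.defect.app c = 0 := by
    intro X Y c
    refine f.defect.app_eq_zero R (0 + 1 + 1) (fun c => f.defect_B₁ hA hB c) (fun {X Y} c => ?_) c
    have h1 := R.linDiff_homotopyOp hA (hs F) c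
    have h2 : linDiff 0 (R.homotopyOp (0 + 1) (s F)) c = - linDiff 0 F.1 c := by
      have e := congrArg (fun u => linDiff 0 u c) (congrArg Subtype.val hF)
      have e2 := linDiff_sub 0 ρ' (R.homotopyOp (0 + 1) (s F)) c
      rw [hρd, zero_sub] at e2
      rw [← e, eq_neg_iff_add_eq_zero]
      exact add_eq_zero_iff_eq_neg.mpr (by rw [e2]; simp)
    have h3 : s F (R.proj c) = 0 := by
      show F.2.1.defect F.2.2.1 (R.proj c) - linDiff 0 F.1 (R.proj c) = 0
      rw [show F.2.1.defect F.2.2.1 (R.proj c) = 0 from hΩP c, R.linDiff_proj hA, zero_sub, neg_eq_zero]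
      simp only [hP]
      exact hρd c
    have h4 : ∀ z : Chain A.toGradedQuiver X Y,
        linDiff (0 + 1) (s F) z = linDiff 1 (F.2.1.defect F.2.2.1) z := by
      intro z
      have e1 := linDiff_sub (0 + 1) (F.2.1.defect F.2.2.1) (linDiff 0 F.1) z
      rw [F.2.1.linDiff_linDiff hA hB z, sub_zero] at e1
      exact e1
    rw [h2, h3, R.homotopyOp_congr _ fun z _ => h4 z, sub_zero] at h1
    have h6 : s F c = F.2.1.defect F.2.2.1 c - linDiff 0 F.1 c := rfl
    rw [h6] at h1
    rw [eq_sub_iff_add_eq] at h1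
    show F.2.1.defect F.2.2.1 c = R.homotopyOp (0 + 1 + 1) (linDiff 1 (F.2.1.defect F.2.2.1)) c
    rw [← sub_eq_zero] at h1 ⊢
    rw [← neg_eq_zero, ← h1]
    abel
  exact fun X Y c => sub_eq_zero.mp (hΩ c)

end Retract

end AInf
end

noncomputable section

namespace AInf

open scoped TensorProduct DirectSum

variable {k : Type w} [CommRing k]

/-! ### Transformations determined on the image of a retraction -/

theorem Chain.map_map {Q : GradedQuiver.{w, u₁, v₁} k} {R : GradedQuiver.{w, u₂, v₂} k}
    {S : GradedQuiver.{w, u₃, v₃} k} (φ : Q.Obj → R.Obj)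
    (g : ∀ X Y, Q.shom X Y → R.shom (φ X) (φ Y)) (ψ : R.Obj → S.Obj)
    (h : ∀ X Y, R.shom X Y → S.shom (ψ X) (ψ Y)) {X Y : Q.Obj} (c : Chain Q X Y) :
    Chain.map ψ h (Chain.map φ g c) =
      Chain.map (R := S) (fun X => ψ (φ X)) (fun X Y x => h _ _ (g X Y x)) c := by
  induction c with
  | nil => rfl
  | cons x c ih => simp [Chain.map, ih]

variable {D : PreAInfCat.{w, u₁, v₁} k} {E : PreAInfCat.{w, u₂, v₂} k}
  {B : PreAInfCat.{w, u₃, v₃} k}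

/-- A strict `A∞`-functor, given by its first component. -/
structure IsStrict (l : E.Obj → B.Obj) (τ : ∀ X Y, E.shom X Y →ₗ[k] B.shom (l X) (l Y)) :
    Prop where
  mem : ∀ X Y d, ∀ x ∈ E.grade X Y d, τ X Y x ∈ B.grade (l X) (l Y) d
  b : ∀ {X Y : E.Obj} (c : Chain E.toGradedQuiver X Y),
    τ X Y (E.b c) = B.b (Chain.map l (fun X Y => τ X Y) c)

/-- A map of complexes which factors through the projection of a retraction and which is strictly
compatible with the operations on the image of the projection. -/
structure Retract.StrictOn (R : Retract D) (s : D.Obj → E.Obj)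
    (σ : ∀ X Y, D.shom X Y →ₗ[k] E.shom (s X) (s Y)) : Prop where
  mem : ∀ X Y d, ∀ x ∈ D.grade X Y d, σ X Y x ∈ E.grade (s X) (s Y) d
  P : ∀ X Y x, σ X Y (R.P X Y x) = σ X Y x
  b : ∀ {X Y : D.Obj} (c : Chain D.toGradedQuiver X Y),
    σ X Y (D.b (R.proj c)) = E.b (Chain.map s (fun X Y => σ X Y) c)

/-- Components of a cocategory homomorphism which is given by `στ` on the image of a projection. -/
structure Over (R : Retract D) {s : D.Obj → E.Obj}
    (σ : ∀ X Y, D.shom X Y →ₗ[k] E.shom (s X) (s Y)) {l : E.Obj → B.Obj}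
    (τ : ∀ X Y, E.shom X Y →ₗ[k] B.shom (l X) (l Y))
    (F : Components D B (fun X => l (s X)) (fun X => l (s X))) : Prop where
  isHom : IsHom F 0
  nil : ∀ X, F (.nil X) = 0
  proj : ∀ {X Y : D.Obj} (c : Chain D.toGradedQuiver X Y),
    F (R.proj c) = τ _ _ (σ _ _ (CocatHom.idApp D c))

section

variable {R : Retract D} {s : D.Obj → E.Obj}
  {σ : ∀ X Y, D.shom X Y →ₗ[k] E.shom (s X) (s Y)} {l : E.Obj → B.Obj}
  {τ : ∀ X Y, E.shom X Y →ₗ[k] B.shom (l X) (l Y)}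
  {F G K : Components D B (fun X => l (s X)) (fun X => l (s X))}

/-- The cocategory homomorphism with components `F`. -/
def Over.cocat (hF : Over R σ τ F) : CocatHom D B := hF.isHom.cocatHom hF.nil

variable {M : Type*} [AddCommGroup M] [Module k M] (hσ : R.StrictOn s σ) (hτ : IsStrict l τ)
  (hF : Over R σ τ F) (hG : Over R σ τ G) (hK : Over R σ τ K)

include hσ in
theorem Retract.StrictOn.map_sgn (p : ℤ) {X Y : D.Obj} (c : Chain D.toGradedQuiver X Y) :
    Chain.map s (fun X Y => σ X Y) (c.sgn p) = (Chain.map s (fun X Y => σ X Y) c).sgn p :=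
  Chain.map_sgn s σ hσ.mem p c

include hσ in
theorem Retract.StrictOn.map_proj {X Y : D.Obj} (c : Chain D.toGradedQuiver X Y) :
    Chain.map s (fun X Y => σ X Y) (R.proj c) = Chain.map s (fun X Y => σ X Y) c := by
  induction c with
  | nil => rfl
  | cons x c ih => simp [Chain.map, ih, hσ.P]

theorem Over.lsum_blocks_proj {X Y : D.Obj} (c : Chain D.toGradedQuiver X Y)
    {φ : Chain B.toGradedQuiver (l (s X)) (l (s Y)) → M} (hφ : φ ∈ MultiFun B.toGradedQuiver _ _ M) :
    lsum (hF.cocat.blocks (R.proj c)) φ =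
      φ (Chain.map l (fun X Y => τ X Y) (Chain.map s (fun X Y => σ X Y) c)) := by
  refine (R.lsum_blocks_proj (f := hF.cocat) (ρ := fun X Y => τ (s X) (s Y) ∘ₗ σ X Y)
    (fun c => hF.proj c) c hφ).trans ?_
  rw [Chain.map_map]
  rfl

-- On projected chains all data are transported from `E`: letters by `σ`, outputs by `τ`, and the
-- functor corresponds to the identity of `E`. Extensions of transported components are then the
-- transported extensions.
include hσ in
theorem Over.lsum_extTerms_proj (p : ℤ) {u : Components D B (fun X => l (s X)) (fun X => l (s X))}
    {S : ListMap D B (fun X => l (s X)) (fun X => l (s X))}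
    {u' : Components E E (fun X => X) (fun X => X)}
    {S' : ListMap E E (fun X => X) (fun X => X)}
    (hu : ∀ {X Y : D.Obj} (c : Chain D.toGradedQuiver X Y),
      u (R.proj c) = τ _ _ (u' (Chain.map s (fun X Y => σ X Y) c)))
    (hS : ∀ {X Y : D.Obj} (c : Chain D.toGradedQuiver X Y)
      {φ : Chain B.toGradedQuiver (l (s X)) (l (s Y)) → M}, φ ∈ MultiFun B.toGradedQuiver _ _ M →
      lsum (S (R.proj c)) φ = lsum (S' (Chain.map s (fun X Y => σ X Y) c)) fun z =>
        φ (Chain.map l (fun X Y => τ X Y) z))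
    {X Y : D.Obj} (c : Chain D.toGradedQuiver X Y)
    {φ : Chain B.toGradedQuiver (l (s X)) (l (s Y)) → M} (hφ : φ ∈ MultiFun B.toGradedQuiver _ _ M) :
    lsum (extTerms hF.cocat u S p (R.proj c)) φ =
      lsum (extTerms (CocatHom.id E) u' S' p (Chain.map s (fun X Y => σ X Y) c)) fun z =>
        φ (Chain.map l (fun X Y => τ X Y) z) := by
  refine (lsum_extTerms hF.cocat u S p (R.proj c) φ).trans
    (Eq.trans ?_ (lsum_extTerms (CocatHom.id E) u' S' p (Chain.map s (fun X Y => σ X Y) c) _).symm)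
  rw [Retract.proj, Chain.sumSplits_map, Chain.sumSplits_map]
  refine Chain.sumSplits_congr _ fun Z c₁ c' => ?_
  rw [Chain.sumSplits_map, Chain.sumSplits_map]
  refine Chain.sumSplits_congr _ fun W c₂ c₃ => ?_
  have h1 : ((Chain.map (fun X => X) (fun X Y => R.P X Y) c₃).sgn p) = R.proj (c₃.sgn p) :=
    (R.proj_sgn p c₃).symm
  rw [h1, ← hσ.map_sgn p c₃]
  refine (hF.lsum_blocks_proj c₁ (φ := fun y => lsum (S (R.proj (c₃.sgn p))) fun z =>
    φ (y.append (.cons (u (R.proj c₂)) z)))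
    (MultiFun.lsum_mem _ _ fun z => MultiFun.postpend hφ (.cons (u (R.proj c₂)) z))).trans ?_
  refine (hS (c₃.sgn p) (MultiFun.prepend_append_cons hφ _ _)).trans ?_
  have hφ' : (fun z : Chain E.toGradedQuiver (s X) (s Y) => φ (Chain.map l (fun X Y => τ X Y) z)) ∈
      MultiFun E.toGradedQuiver (s X) (s Y) M := MultiFun.comp_map l τ hφ
  refine Eq.trans ?_ (lsum_blocks_id (A := E) (Chain.map s (fun X Y => σ X Y) c₁)
    (φ := fun y => lsum (S' (Chain.map s (fun X Y => σ X Y) (c₃.sgn p))) fun z =>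
      φ (Chain.map l (fun X Y => τ X Y)
        (y.append (.cons (u' (Chain.map s (fun X Y => σ X Y) c₂)) z))))
    (MultiFun.lsum_mem _ _ fun z => MultiFun.postpend hφ' (.cons _ z))).symm
  refine lsum_congr fun z _ => ?_
  rw [hu, Chain.map_append]
  rfl

include hσ in
theorem Over.lsum_bTerms_proj {N : Type*} [AddCommGroup N] {X Y : D.Obj}
    (c : Chain D.toGradedQuiver X Y)
    {φ : Chain D.toGradedQuiver X Y → N} {ψ : Chain E.toGradedQuiver (s X) (s Y) → N}
    (h : ∀ z, φ (R.proj z) = ψ (Chain.map s (fun X Y => σ X Y) z)) :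
    lsum (D.bTerms (R.proj c)) φ = lsum (E.bTerms (Chain.map s (fun X Y => σ X Y) c)) ψ := by
  rw [R.lsum_bTerms_proj, lsum_bTerms, Chain.sumSplits_map]
  refine Chain.sumSplits_congr _ fun Z c₁ c' => ?_
  rw [Chain.sumSplits_map]
  refine Chain.sumSplits_congr _ fun W c₂ c₃ => ?_
  rw [h, Chain.map_append, ← hσ.b, ← hσ.map_sgn]
  rfl

variable {hF hG hK}

section Coder

variable {p p' : ℤ} {v : Coder hF.cocat hG.cocat p} {w : Coder (CocatHom.id E) (CocatHom.id E) p}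
  (hv : ∀ {X Y : D.Obj} (c : Chain D.toGradedQuiver X Y),
    v.app (R.proj c) = τ (s X) (s Y) (w.app (Chain.map s (fun X Y => σ X Y) c)))
  {v' : Coder hG.cocat hK.cocat p'} {w' : Coder (CocatHom.id E) (CocatHom.id E) p'}
  (hv' : ∀ {X Y : D.Obj} (c : Chain D.toGradedQuiver X Y),
    v'.app (R.proj c) = τ (s X) (s Y) (w'.app (Chain.map s (fun X Y => σ X Y) c)))

include hσ hv in
theorem Over.lsum_terms_proj {X Y : D.Obj} (c : Chain D.toGradedQuiver X Y)
    {φ : Chain B.toGradedQuiver (l (s X)) (l (s Y)) → M} (hφ : φ ∈ MultiFun B.toGradedQuiver _ _ M) :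
    lsum (v.terms (R.proj c)) φ = lsum (w.terms (Chain.map s (fun X Y => σ X Y) c)) fun z =>
      φ (Chain.map l (fun X Y => τ X Y) z) :=
  hF.lsum_extTerms_proj hσ p (u := v.app) (S := fun _ _ c => hG.cocat.blocks c) (u' := w.app)
    (S' := fun _ _ c => (CocatHom.id E).blocks c) hv
    (fun c φ hφ => (hG.lsum_blocks_proj c hφ).trans (lsum_blocks_id (A := E) _
      (φ := fun z => φ (Chain.map l (fun X Y => τ X Y) z)) (MultiFun.comp_map l τ hφ)).symm) c hφ

include hσ hv hv' in
theorem Over.lsum_thetaTerms_proj {X Y : D.Obj} (c : Chain D.toGradedQuiver X Y)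
    {φ : Chain B.toGradedQuiver (l (s X)) (l (s Y)) → M} (hφ : φ ∈ MultiFun B.toGradedQuiver _ _ M) :
    lsum (v.thetaTerms v' (R.proj c)) φ =
      lsum (w.thetaTerms w' (Chain.map s (fun X Y => σ X Y) c)) fun z =>
        φ (Chain.map l (fun X Y => τ X Y) z) :=
  hF.lsum_extTerms_proj hσ p (u := v.app) (S := fun _ _ c => v'.terms c) (u' := w.app)
    (S' := fun _ _ c => w'.terms c) hv
    (fun c _ hφ => Over.lsum_terms_proj hσ hv' c hφ) c hφ

-- Since `σ` and `τ` respect the operations strictly, values prescribed by `w` on projected chains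
-- lead to a differential prescribed there by `wB₁`.
include hσ hτ hv in
theorem Over.B₁_proj {X Y : D.Obj} (c : Chain D.toGradedQuiver X Y) :
    v.B₁ (R.proj c) = τ (s X) (s Y) (w.B₁ (Chain.map s (fun X Y => σ X Y) c)) := by
  have h1 : lsum (v.terms (R.proj c)) B.b =
      τ (s X) (s Y) (lsum (w.terms (Chain.map s (fun X Y => σ X Y) c)) E.b) := by
    refine (Over.lsum_terms_proj hσ hv c (B.b_multilinear _ _)).trans ?_
    refine Eq.trans ?_ (map_lsum (τ (s X) (s Y)).toAddMonoidHom _ _).symm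
    exact lsum_congr fun z _ => (hτ.b z).symm
  have h2 : (lsum (D.bTerms (R.proj c)) fun z => v.app z) =
      τ (s X) (s Y) (lsum (E.bTerms (Chain.map s (fun X Y => σ X Y) c)) fun z => w.app z) := by
    refine (Over.lsum_bTerms_proj hσ c (φ := fun z => v.app z)
      (ψ := fun z => τ (s X) (s Y) (w.app z)) fun z => hv z).trans ?_
    exact (map_lsum (τ (s X) (s Y)).toAddMonoidHom _ _).symm
  refine (congrArg₂ (fun a b : B.shom (l (s X)) (l (s Y)) => a - koszul p • b) h1 h2).trans ?_
  refine Eq.symm ((map_sub (τ (s X) (s Y)) _ _).trans (congrArg _ ?_))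
  exact map_zsmul (τ (s X) (s Y)) _ _

include hσ hτ hv hv' in
theorem Over.B₂_proj {X Y : D.Obj} (c : Chain D.toGradedQuiver X Y) :
    v.B₂ v' (R.proj c) = τ (s X) (s Y) (w.B₂ w' (Chain.map s (fun X Y => σ X Y) c)) := by
  refine (Over.lsum_thetaTerms_proj hσ hv hv' c (B.b_multilinear _ _)).trans ?_
  refine Eq.trans ?_ (map_lsum (τ (s X) (s Y)).toAddMonoidHom _ _).symm
  exact lsum_congr fun z _ => (hτ.b z).symm

end Coder

/-- The coderivation with components `(σ ⊗ ⋯ ⊗ σ)wτ`. -/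
def Over.pull (hF : Over R σ τ F) (hG : Over R σ τ G) (hσ : R.StrictOn s σ) (hτ : IsStrict l τ)
    {p : ℤ} (w : Coder (CocatHom.id E) (CocatHom.id E) p) : Coder hF.cocat hG.cocat p where
  app X Y c := τ (s X) (s Y) (w.app (Chain.map s (fun X Y => σ X Y) c))
  app_multilinear X Y := MultiFun.comp_map (Q := D.toGradedQuiver) (R := E.toGradedQuiver) s σ
    (MultiFun.comp_linear (w.app_multilinear (s X) (s Y)) (τ (s X) (s Y)))
  app_degree _ _ hc := hτ.mem _ _ _ _ (w.app_degree _ _ (hc.map hσ.mem))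

include hσ in
theorem Over.pull_proj {p : ℤ} (w : Coder (CocatHom.id E) (CocatHom.id E) p) {X Y : D.Obj}
    (c : Chain D.toGradedQuiver X Y) : (hF.pull hG hσ hτ w).app (R.proj c) =
      τ (s X) (s Y) (w.app (Chain.map s (fun X Y => σ X Y) c)) := by
  show τ (s X) (s Y) (w.app (Chain.map s (fun X Y => σ X Y) (R.proj c))) = _
  rw [hσ.map_proj]

/-- A natural transformation of the identity of `ℰ` lifts to a natural transformation. -/
theorem Over.exists_lift (hD : D.IsAInfCat) (hB : B.IsAInfCat) (hF : Over R σ τ F)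
    (hG : Over R σ τ G) (hF' : hF.cocat.IsAInfFunctor) (hG' : hG.cocat.IsAInfFunctor)
    (hσ : R.StrictOn s σ) (hτ : IsStrict l τ) {w : Coder (CocatHom.id E) (CocatHom.id E) (-1)}
    (hw : w.IsNatural) : ∃ r : Coder hF.cocat hG.cocat (-1), r.IsNatural ∧
      ∀ {X Y : D.Obj} (c : Chain D.toGradedQuiver X Y),
        r.app (R.proj c) = τ (s X) (s Y) (w.app (Chain.map s (fun X Y => σ X Y) c)) := by
  have h1 := fun {X Y : D.Obj} (c : Chain D.toGradedQuiver X Y) =>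
    Over.pull_proj (hF := hF) (hG := hG) hσ hτ w c
  -- The pulled back coderivation has the right values on projected chains but need not be natural.
  -- Its differential is a cycle which vanishes there, so it is removed by a correction which
  -- vanishes there too.
  obtain ⟨v, hv, hv'⟩ := R.exists_coder hD hB hF' hG' (hF.pull hG hσ hτ w).d
    (Coder.d_B₁ _ hD hB hF' hG') fun c => by
      rw [Coder.d_app, Over.B₁_proj hσ hτ h1, hw]
      exact map_zero (τ _ _)
  refine ⟨(hF.pull hG hσ hτ w).sub v, fun X Y c => ?_, fun c => ?_⟩
  · rw [Coder.sub_B₁, hv', Coder.d_app, sub_self]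
  · rw [Coder.sub_app, hv, sub_zero, h1]

/-- Natural transformations whose restrictions come from equivalent transformations of the identity
are equivalent. -/
theorem Over.transEquiv (hD : D.IsAInfCat) (hB : B.IsAInfCat) (hF : Over R σ τ F)
    (hG : Over R σ τ G) (hF' : hF.cocat.IsAInfFunctor) (hG' : hG.cocat.IsAInfFunctor)
    (hσ : R.StrictOn s σ) (hτ : IsStrict l τ) {r q : Coder hF.cocat hG.cocat (-1)}
    (hr : r.IsNatural) (hq : q.IsNatural)
    {r' q' : Components E E (fun X => X) (fun X => X)}
    (hr' : ∀ {X Y : D.Obj} (c : Chain D.toGradedQuiver X Y),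
      r.app (R.proj c) = τ (s X) (s Y) (r' (Chain.map s (fun X Y => σ X Y) c)))
    (hq' : ∀ {X Y : D.Obj} (c : Chain D.toGradedQuiver X Y),
      q.app (R.proj c) = τ (s X) (s Y) (q' (Chain.map s (fun X Y => σ X Y) c)))
    (h : TransEquiv (CocatHom.id E) (CocatHom.id E) r' q') :
    TransEquiv hF.cocat hG.cocat r.app q.app := by
  obtain ⟨w, hw⟩ := h
  have h1 := fun {X Y : D.Obj} (c : Chain D.toGradedQuiver X Y) =>
    Over.pull_proj (hF := hF) (hG := hG) hσ hτ w c
  let x : Coder hF.cocat hG.cocat (-2) := hF.pull hG hσ hτ w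
  -- The pulled back homotopy `x` bounds `r - q` on projected chains only. The discrepancy `u` is a
  -- cycle vanishing on them, hence the differential of a correction of `x`.
  let u : Coder hF.cocat hG.cocat (-2 + 1) := x.d.sub (r.sub q)
  have h2 : ∀ {X Y : D.Obj} (c : Chain D.toGradedQuiver X Y), u.B₁ c = 0 := fun c => by
    have e1 : x.d.B₁ c = 0 := Coder.d_B₁ _ hD hB hF' hG' c
    have e2 : (r.sub q).B₁ c = 0 := by rw [Coder.sub_B₁, hr, hq, sub_self]
    exact (Coder.sub_B₁ x.d (r.sub q) c).trans ((congrArg₂ (· - ·) e1 e2).trans (sub_self 0))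
  have h3 : ∀ {X Y : D.Obj} (c : Chain D.toGradedQuiver X Y), u.app (R.proj c) = 0 :=
    fun {X Y} c => by
      show x.B₁ (R.proj c) - (r.app (R.proj c) - q.app (R.proj c)) = 0
      have e : r' (Chain.map s (fun X Y => σ X Y) c) - q' (Chain.map s (fun X Y => σ X Y) c) =
        w.B₁ (Chain.map s (fun X Y => σ X Y) c) := hw _
      rw [Over.B₁_proj hσ hτ h1, hr', hq', ← e]
      exact sub_eq_zero.mpr (map_sub (τ (s X) (s Y)) _ _)
  obtain ⟨v, hv, hv'⟩ := R.exists_coder hD hB hF' hG' u h2 h3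
  refine ⟨x.sub v, fun X Y c => ?_⟩
  rw [Coder.sub_B₁, hv']
  exact (sub_sub_cancel (x.B₁ c) (r.app c - q.app c)).symm

end

end AInf
end

noncomputable section

namespace AInf

open scoped TensorProduct DirectSum

variable {k : Type w} [CommRing k]

variable {A : PreAInfCat.{w, u₁, v₁} k} {B : PreAInfCat.{w, u₂, v₂} k}
  {C : PreAInfCat.{w, u₃, v₃} k}

/-! ### Units and homotopy invertibility -/

namespace CocatHom

theorem isHom (f : CocatHom A B) :
    IsHom (φ := f.obj) (ψ := f.obj) (fun _ _ c => f.app c) 0 where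
  multilinear := f.app_multilinear
  degree c d hc := by simpa using f.app_degree c d hc

theorem id_comp (f : CocatHom A B) : (CocatHom.id A).comp f = f := by
  obtain ⟨o, F, h1, h2, h3⟩ := f
  simp only [comp, CocatHom.mk.injEq]
  refine ⟨rfl, heq_of_eq ?_⟩
  funext X Y c
  exact lsum_blocks_id c (h1 X Y)

theorem comp_id (f : CocatHom A B) : f.comp (CocatHom.id B) = f := by
  obtain ⟨o, F, h1, h2, h3⟩ := f
  simp only [comp, CocatHom.mk.injEq]
  refine ⟨rfl, heq_of_eq ?_⟩
  funext X Y c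
  let f : CocatHom A B := ⟨o, F, h1, h2, h3⟩
  show lsum (f.blocks c) (CocatHom.idApp B) = F c
  cases c with
  | nil => exact (lsum_blocks_nil f X (CocatHom.idApp B)).trans (h2 X).symm
  | cons x c =>
    rw [lsum_blocks_cons, Chain.sumSplits_eq_right]
    · exact lsum_blocks_nil f _ _
    · intro Z p q hq _
      cases q with
      | nil => simp at hq
      | cons y q =>
        rw [lsum_blocks_cons]
        exact (Chain.sumSplits_congr _ fun _ _ _ => lsum_zero _).trans (Chain.sumSplits_zero _)

end CocatHom

namespace Coder

/-- Whiskering yields coderivations over composites with an identity functor, which have to be moved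
to the functor itself; heterogeneous equality records that the components do not change. -/
theorem exists_natural_of_eq {f f' g g' : CocatHom A B} (hf : f = f') (hg : g = g')
    {r : Coder f g (-1)} (hr : r.IsNatural) :
    ∃ r' : Coder f' g' (-1), r'.IsNatural ∧ HEq r'.app r.app := by
  subst hf hg
  exact ⟨r, hr, HEq.rfl⟩

/-- Projection to one-letter chains recovers the component, because every other term carries at
least one further block. -/
theorem lsum_terms_idApp {f g : CocatHom A B} {p : ℤ} (r : Coder f g p) {X Y : A.Obj}
    (c : Chain A.toGradedQuiver X Y) : lsum (r.terms c) (CocatHom.idApp B) = r.app c := by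
  rw [lsum_terms, Chain.sumSplits_eq_left]
  · rw [Chain.sumSplits_eq_right]
    · simp only [Chain.sgn_nil, lsum_blocks_nil]
      rfl
    · intro Z p' q hq _
      cases q with
      | nil => simp at hq
      | cons x q =>
        simp only [Chain.sgn_cons, lsum_blocks_cons, lsum_blocks_nil]
        exact (Chain.sumSplits_congr _ fun _ _ _ => lsum_zero _).trans (Chain.sumSplits_zero _)
  · intro Z p' q hp _
    rw [Chain.sumSplits_congr (G' := fun _ _ _ => 0), Chain.sumSplits_zero]
    intro W a b
    refine (lsum_congr fun y hy => (lsum_congr fun z _ => ?_).trans (lsum_zero _)).trans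
      (lsum_zero _)
    refine idApp_eq_zero _ ?_
    cases p' with
    | nil => simp at hp
    | cons x p' =>
      -- A nonempty chain is cut into at least one block, so together with the letter of `r` the
      -- length exceeds one.
      have : ∀ {X Y Z : A.Obj} (p : Chain A.toGradedQuiver X Y) (c : Chain A.toGradedQuiver Y Z),
          ∀ y ∈ f.blocksFrom p c, y.length ≠ 0 := by
        intro X Y Z p c
        induction c generalizing X with
        | nil => simp [CocatHom.blocksFrom, Chain.single]
        | cons x c ih =>
          intro y hy
          simp only [CocatHom.blocksFrom, List.mem_append, List.mem_map] at hy
          rcases hy with hy | ⟨z, _, rfl⟩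
          · exact ih _ y hy
          · simp
      have h := this _ _ y hy
      simp
      omega

/-- The zero coderivation is written as a difference so that additivity of `B₁` gives the claim. -/
theorem zero_B₁ {f g : CocatHom A B} (p : ℤ) {X Y : A.Obj} (c : Chain A.toGradedQuiver X Y) :
    (((IsHom.zero p).coder : Coder f g p).sub (IsHom.zero p).coder).B₁ c = 0 := by
  rw [sub_B₁, sub_self]

end Coder

theorem TransEquiv.of_eq {f g : CocatHom A B} {r q : Components A B f.obj g.obj} (h : r = q) :
    TransEquiv f g r q :=
  ⟨_, fun X Y c => by rw [h, sub_self, Coder.zero_B₁ (-2)]⟩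

/-- This is the component of `b² = 0` on two letters; the sign operator on `y` comes from `b₁`
passing it. -/
theorem PreAInfCat.IsAInfCat.b₁_b₂ (hA : A.IsAInfCat) {X Y Z : A.Obj} (x : A.shom X Y)
    (y : A.shom Y Z) : A.b₁L _ _ (A.b (.cons x (.single y))) +
      A.b (.cons (A.b₁L _ _ x) (.single (A.sgn 1 Y Z y))) +
      A.b (.cons x (.single (A.b₁L _ _ y))) = 0 := by
  have h : lsum (A.bTerms (.cons x (.single y))) A.b = 0 := hA _ _ _
  rw [lsum_bTerms] at h
  have h0 : ∀ {X Z W Y : A.Obj} (y : Chain A.toGradedQuiver X Z) (z : Chain A.toGradedQuiver W Y),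
    A.b (y.append (.cons 0 z)) = 0 := fun y z => MultiFun.slot_zero (A.b_multilinear _ _) y z
  have h1 := h0 (.nil X) (.cons (A.sgn 1 _ _ x) (.single (A.sgn 1 _ _ y)))
  have h2 := h0 (.single x) (.single (A.sgn 1 _ _ y))
  have h3 := h0 (.cons x (.single y)) (.nil Z)
  simp only [Chain.single, Chain.cons_append, Chain.nil_append] at h1 h2 h3
  simp [Chain.single, A.b_nil, h1, h2, h3] at h
  rw [← h]
  have e1 : A.b₁L _ _ (A.b (.cons x (.single y))) = A.b (.single (A.b (.cons x (.single y)))) := rfl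
  have e2 : A.b₁L _ _ x = A.b (.single x) := rfl
  have e3 : A.b₁L _ _ y = A.b (.single y) := rfl
  rw [e1, e2, e3]
  simp only [Chain.single]
  abel

/-- Naturality on the empty chain involves no other component. -/
theorem Coder.IsNatural.b₁_app_nil {f g : CocatHom A B} {r : Coder f g (-1)} (hr : r.IsNatural)
    (X : A.Obj) : B.b₁L _ _ (r.app (.nil X)) = 0 := by
  have h := r.B₁_eq_linDiff (.nil X) fun z hz => absurd hz (Nat.not_lt_zero _)
  rw [hr, linDiff_def] at h
  simpa using h.symm

section Units

variable {X Y : A.Obj}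

/-- The map `(e ⊗ 1)b₂`. -/
def leftMul (e : A.shom X X) (Y : A.Obj) : A.shom X Y →ₗ[k] A.shom X Y :=
  MultiFun.slot (A.b_multilinear X Y) (.single e) (.nil Y) ∘ₗ A.sgn (-1) X Y

/-- The map `(1 ⊗ e)b₂`. -/
def rightMul (X : A.Obj) (e : A.shom Y Y) : A.shom X Y →ₗ[k] A.shom X Y :=
  MultiFun.slot (A.b_multilinear X Y) (.nil X) (.single e)

theorem leftMul_apply (e : A.shom X X) (x : A.shom X Y) :
    leftMul e Y x = A.b (.cons e (.single (A.sgn (-1) X Y x))) := rfl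

theorem leftMul_mem {e : A.shom X X} (he : e ∈ A.grade X X (-1)) :
    HasMapDegree A 0 (leftMul e Y) := by
  intro d x hx
  have := A.b_degree _ _ (.cons he (.single (A.sgn_mem (-1) hx)))
  rwa [show -1 + d + 1 = d + 0 by ring] at this

theorem rightMul_mem {e : A.shom Y Y} (he : e ∈ A.grade Y Y (-1)) :
    HasMapDegree A 0 (rightMul X e) := by
  intro d x hx
  have := A.b_degree _ _ (.cons hx (.single he))
  rwa [show d + -1 + 1 = d + 0 by ring] at this

theorem b₁_leftMul (hA : A.IsAInfCat) {e : A.shom X X} (he : A.b₁L X X e = 0) (x : A.shom X Y) :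
    A.b₁L X Y (leftMul e Y x) = leftMul e Y (A.b₁L X Y x) := by
  have h1 := hA.b₁_b₂ e (A.sgn (-1) X Y x)
  have h2 : A.b₁L X Y (A.sgn (-1) X Y x) = -A.sgn (-1) X Y (A.b₁L X Y x) := by
    have := b_sgn (-1) (Chain.single x)
    rw [koszul_neg, koszul_one, neg_one_smul] at this
    exact this
  have h3 : A.b (.cons e (.single (-A.sgn (-1) X Y (A.b₁L X Y x)))) =
      -A.b (.cons e (.single (A.sgn (-1) X Y (A.b₁L X Y x)))) :=
    map_neg (MultiFun.slot (A.b_multilinear X Y) (.single e) (.nil Y)) _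
  rw [he, MultiFun.cons_zero (A.b_multilinear X Y), h2, h3, add_zero, ← sub_eq_add_neg,
    sub_eq_zero] at h1
  exact h1

theorem b₁_rightMul (hA : A.IsAInfCat) {e : A.shom Y Y} (he : A.b₁L Y Y e = 0)
    (he' : e ∈ A.grade Y Y (-1)) (x : A.shom X Y) :
    A.b₁L X Y (rightMul X e x) = rightMul X e (A.b₁L X Y x) := by
  have h1 := hA.b₁_b₂ x e
  have h2 : A.sgn 1 Y Y e = -e := by
    have := A.sgn_of_mem 1 he'
    simpa [koszul_neg] using this
  have h3 : A.b (.cons (A.b₁L X Y x) (.single (-e))) = -A.b (.cons (A.b₁L X Y x) (.single e)) :=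
    map_neg (MultiFun.slot (A.b_multilinear X Y) (.single (A.b₁L X Y x)) (.nil Y)) _
  have h4 : A.b (.cons x (.single (0 : A.shom Y Y))) = 0 :=
    MultiFun.slot_zero (A.b_multilinear X Y) (.single x) (.nil Y)
  rw [he, h2, h3, h4, add_zero, ← sub_eq_add_neg, sub_eq_zero] at h1
  exact h1

end Units

/-- Homotopy invertibility is inherited along a strong deformation retraction. -/
theorem IsHomotopyInvertible.of_retract {R : Retract A} {X Y : A.Obj} {X' Y' : B.Obj}
    {j : B.shom X' Y' →ₗ[k] A.shom X Y} {σ : A.shom X Y →ₗ[k] B.shom X' Y'}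
    (hj : ∀ d, ∀ x ∈ B.grade X' Y' d, j x ∈ A.grade X Y d)
    (hσ : ∀ d, ∀ x ∈ A.grade X Y d, σ x ∈ B.grade X' Y' d)
    (jb : ∀ x, A.b₁L X Y (j x) = j (B.b₁L X' Y' x))
    (σb : ∀ x, B.b₁L X' Y' (σ x) = σ (A.b₁L X Y x))
    (hP : ∀ x, R.P X Y x = j (σ x)) (hσj : ∀ x, σ (j x) = x)
    {Φ : A.shom X Y →ₗ[k] A.shom X Y} {Ψ : B.shom X' Y' → B.shom X' Y'}
    (hΦ : HasMapDegree A 0 Φ) (Φb : ∀ x, A.b₁L X Y (Φ x) = Φ (A.b₁L X Y x))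
    (hΦΨ : ∀ x, Φ (j x) = j (Ψ x)) (h : IsHomotopyInvertible B Ψ) :
    IsHomotopyInvertible A (fun x => Φ x) := by
  obtain ⟨ψ, h, h', hψd, hhd, hhd', ψb, hψ, hψ'⟩ := h
  have ψb' : ∀ x, B.b₁L X' Y' (ψ x) = ψ (B.b₁L X' Y' x) := ψb
  have hH : ∀ x, x = j (σ x) + (A.b₁L X Y (R.H X Y x) + R.H X Y (A.b₁L X Y x)) := fun x => by
    rw [R.homotopy, hP]; abel
  have hH' : ∀ x, j (σ x) = x - (A.b₁L X Y (R.H X Y x) + R.H X Y (A.b₁L X Y x)) := fun x => by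
    rw [R.homotopy, hP]; abel
  -- The inverse is `ψ` transported along the retraction. The homotopies combine those for `ψ` with
  -- `R.H`, which relates the identity to `jσ`; the extra summand in the first arises because there
  -- `x` must be replaced by `jσx` inside `Φ`.
  refine ⟨j ∘ₗ ψ ∘ₗ σ, j ∘ₗ h ∘ₗ σ - R.H X Y + j ∘ₗ ψ ∘ₗ σ ∘ₗ Φ ∘ₗ R.H X Y,
    j ∘ₗ h' ∘ₗ σ - R.H X Y, ?_, ?_, ?_, ?_, ?_, ?_⟩
  · intro d x hx
    have := hψd _ _ (hσ _ _ hx)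
    exact hj _ _ this
  · intro d x hx
    refine add_mem (sub_mem (hj _ _ (hhd _ _ (hσ _ _ hx))) (R.H_mem _ _ _ _ hx)) ?_
    have := hj _ _ (hψd _ _ (hσ _ _ (hΦ _ _ (R.H_mem _ _ _ _ hx))))
    simpa using this
  · intro d x hx
    exact sub_mem (hj _ _ (hhd' _ _ (hσ _ _ hx))) (R.H_mem _ _ _ _ hx)
  · intro x
    show A.b₁L X Y (j (ψ (σ x))) = j (ψ (σ (A.b₁L X Y x)))
    rw [jb, ψb', σb]
  · intro x
    show j (ψ (σ (Φ x))) = x + A.b₁L X Y (j (h (σ x)) - R.H X Y x + j (ψ (σ (Φ (R.H X Y x))))) +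
      (j (h (σ (A.b₁L X Y x))) - R.H X Y (A.b₁L X Y x) +
        j (ψ (σ (Φ (R.H X Y (A.b₁L X Y x))))))
    have e1 : j (ψ (σ (Φ x))) = j (ψ (Ψ (σ x))) + (A.b₁L X Y (j (ψ (σ (Φ (R.H X Y x))))) +
        j (ψ (σ (Φ (R.H X Y (A.b₁L X Y x)))))) := by
      conv_lhs => rw [hH x]
      simp only [map_add, hΦΨ, hσj]
      rw [jb, ψb', σb, Φb]
    have e2 : j (ψ (Ψ (σ x))) = j (σ x) + A.b₁L X Y (j (h (σ x))) + j (h (σ (A.b₁L X Y x))) := by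
      rw [hψ, map_add, map_add]
      have : A.b₁L X Y (j (h (σ x))) = j (B.b₁ (h (σ x))) := jb _
      rw [this, ← σb]
      rfl
    rw [e1, e2, hH', map_add, map_sub]
    abel
  · intro x
    show Φ (j (ψ (σ x))) = x + A.b₁L X Y (j (h' (σ x)) - R.H X Y x) +
      (j (h' (σ (A.b₁L X Y x))) - R.H X Y (A.b₁L X Y x))
    have e2 : j (Ψ (ψ (σ x))) = j (σ x) + A.b₁L X Y (j (h' (σ x))) + j (h' (σ (A.b₁L X Y x))) := by
      rw [hψ', map_add, map_add]
      have : A.b₁L X Y (j (h' (σ x))) = j (B.b₁ (h' (σ x))) := jb _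
      rw [this, ← σb]
      rfl
    rw [hΦΨ, e2, hH', map_sub]
    abel

end AInf
end

noncomputable section

namespace AInf

open scoped TensorProduct DirectSum

variable {k : Type w} [CommRing k]

/-! ### The `A∞`-category of an associative multiplication and a differential -/

section Bar

variable (R : GradedQuiver.{w, u, v} k)
  (μ : ∀ X Y Z : R.Obj, R.shom X Y →ₗ[k] R.shom Y Z →ₗ[k] R.shom X Z)
  (β : ∀ X Y : R.Obj, R.shom X Y →ₗ[k] R.shom X Y)
  (hμ : ∀ {X Y Z : R.Obj} {d e : ℤ} {x : R.shom X Y} {y : R.shom Y Z}, x ∈ R.grade X Y d →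
    y ∈ R.grade Y Z e → μ X Y Z x y ∈ R.grade X Z (d + e))
  (hβ : ∀ {X Y : R.Obj} {d : ℤ} {x : R.shom X Y}, x ∈ R.grade X Y d →
    β X Y x ∈ R.grade X Y (d + 1))

/-- The quiver `R` with the operations obtained from `μ` and `β`. -/
@[reducible] def barCat : PreAInfCat.{w, u, v} k where
  toGradedQuiver := R
  b := barB R μ β
  b_multilinear := barB_multilinear R μ β
  b_nil _ := rfl
  b_degree _ _ hc := barB_mem hμ hβ hc

variable {R}

/-- The product of all elements of a chain. -/
def chainProd : ∀ {X Y : R.Obj}, Chain R X Y → R.shom X Y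
  | _, _, .nil _ => 0
  | _, _, .cons x (.nil _) => x
  | _, _, .cons x (.cons y c) => μ _ _ _ x (chainProd (.cons y c))

theorem chainProd_cons_append_cons {X Y Z W V : R.Obj} (x : R.shom X Y) (p : Chain R Y Z)
    (y : R.shom Z W) (q : Chain R W V) : chainProd μ (.cons x (p.append (.cons y q))) =
      μ _ _ _ x (chainProd μ (p.append (.cons y q))) := by
  cases p <;> rfl

theorem chainProd_multilinear (X Y : R.Obj) :
    (chainProd μ : Chain R X Y → R.shom X Y) ∈ MultiFun R X Y (R.shom X Y) := by
  intro Z W p q a x y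
  induction p with
  | nil => cases q <;> simp [chainProd]
  | cons z p ih =>
    simp only [Chain.cons_append, chainProd_cons_append_cons, ih, map_add, map_smul]

variable {μ}

theorem chainProd_cons_mul
    (assoc : ∀ {X Y Z W : R.Obj} (x : R.shom X Y) (y : R.shom Y Z) (z : R.shom Z W),
      μ _ _ _ (μ _ _ _ x y) z = μ _ _ _ x (μ _ _ _ y z)) {X Y Z W : R.Obj} (x : R.shom X Y)
    (y : R.shom Y Z) (c : Chain R Z W) :
    chainProd μ (.cons (μ _ _ _ x y) c) = chainProd μ (.cons x (.cons y c)) := by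
  cases c with
  | nil => rfl
  | cons z c => exact assoc _ _ _

variable {β}

/-- By definition `barB` of `w W` is `barRight` of `w W` minus `w` times `barRight` of `W`, so the
sum over the left end of the segment telescopes. -/
theorem sumSplits_chainProd_barB
    (assoc : ∀ {X Y Z W : R.Obj} (x : R.shom X Y) (y : R.shom Y Z) (z : R.shom Z W),
      μ _ _ _ (μ _ _ _ x y) z = μ _ _ _ x (μ _ _ _ y z)) {X Y Z : R.Obj} (c : Chain R X Y)
    (q : Chain R Y Z) :
    (c.sumSplits fun _ p m => chainProd μ (p.append (.cons (barB R μ β m) q))) =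
      chainProd μ (.cons (barRight R μ β c) q) := by
  induction c with
  | nil => simp [barB, barRight]
  | @cons X Y Z w W ih =>
    rw [Chain.sumSplits_cons]
    simp only [Chain.nil_append, Chain.cons_append, chainProd_cons_append_cons]
    have h1 := map_sub (MultiFun.slot (chainProd_multilinear μ X _) (.nil X) q)
      (barRight R μ β (.cons w W)) (μ _ _ _ w (barRight R μ β W))
    have h2 := chainProd_cons_mul assoc w (barRight R μ β W) q
    have h3 := (Chain.map_sumSplits (μ _ _ _ w).toAddMonoidHom W
      (fun _ p m => chainProd μ (p.append (.cons (barB R μ β m) q)))).symm.trans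
      (congrArg (μ _ _ _ w) (ih q))
    refine (congrArg₂ (· + ·) h1 h3).trans ?_
    refine (congrArg (_ + ·) (show μ _ _ _ w (chainProd μ (.cons (barRight R μ β W) q)) =
      chainProd μ (.cons (μ _ _ _ w (barRight R μ β W)) q) from h2.symm)).trans ?_
    exact sub_add_cancel _ _

/-- Each `barTail` is the difference between applying `β` after and before multiplication by the
last factor, so the sum over the right end telescopes to `β` of the whole product. -/
theorem sumSplits_chainProd_barTail
    (assoc : ∀ {X Y Z W : R.Obj} (x : R.shom X Y) (y : R.shom Y Z) (z : R.shom Z W),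
      μ _ _ _ (μ _ _ _ x y) z = μ _ _ _ x (μ _ _ _ y z)) {X Y Z : R.Obj} (a : R.shom X Z)
    (W : Chain R Z Y) :
    (chainProd μ (.cons (β _ _ a) (W.sgn 1)) + W.sumSplits fun _ W' q =>
      chainProd μ (.cons (barTail R μ β X W' a) (q.sgn 1))) = β _ _ (chainProd μ (.cons a W)) := by
  have zero : ∀ {X Y Z : R.Obj} (c : Chain R Y Z), chainProd μ (.cons (0 : R.shom X Y) c) = 0 :=
    fun c => MultiFun.cons_zero (chainProd_multilinear μ _ _) c
  induction W with
  | nil => simp [barTail, zero, chainProd]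
  | @cons Z V Y w W ih =>
    have h1 := ih (μ _ _ _ a w)
    have h2 := chainProd_cons_mul assoc (β _ _ a) (R.sgn 1 _ _ w) (W.sgn 1)
    have h3 := map_sub (MultiFun.slot (chainProd_multilinear μ X _) (.nil X) (W.sgn 1))
      (β _ _ (μ _ _ _ a w)) (μ _ _ _ (β _ _ a) (R.sgn 1 _ _ w))
    simp only [MultiFun.slot_apply, Chain.nil_append] at h3
    rw [chainProd_cons_mul assoc] at h1
    rw [← h1, Chain.sumSplits_cons, Chain.sgn_cons, ← h2]
    cases W with
    | nil =>
      simp only [barTail, Chain.sumSplits_nil, LinearMap.sub_apply, LinearMap.comp_apply,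
        LinearMap.flip_apply, LinearMap.zero_apply, zero, Chain.sgn_nil, add_zero, zero_add]
      exact (congrArg (_ + ·) h3).trans (add_sub_cancel _ _)
    | cons v W =>
      simp only [Chain.sumSplits_cons, barTail, LinearMap.sub_apply, LinearMap.comp_apply,
        LinearMap.flip_apply, LinearMap.zero_apply, zero, h3]
      abel

/-- The product map carries `b̄` to `β`: telescoping at the left end and then at the right end
leaves one term. As the product of a single letter is that letter, this identity determines the
operations `b̄ₙ` recursively. -/
theorem lsum_bTerms_chainProd
    (assoc : ∀ {X Y Z W : R.Obj} (x : R.shom X Y) (y : R.shom Y Z) (z : R.shom Z W),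
      μ _ _ _ (μ _ _ _ x y) z = μ _ _ _ x (μ _ _ _ y z)) {X Y : R.Obj} (c : Chain R X Y) :
    lsum ((barCat R μ β hμ hβ).bTerms c) (chainProd μ) = β _ _ (chainProd μ c) := by
  rw [lsum_bTerms]
  refine (Chain.sumSplits_assoc c fun _ _ p m q =>
    chainProd μ (p.append (.cons (barB R μ β m) (q.sgn 1)))).symm.trans ?_
  refine (Chain.sumSplits_congr c fun _ p q =>
    sumSplits_chainProd_barB assoc p (q.sgn 1)).trans ?_
  have zero : ∀ {X Y Z : R.Obj} (c : Chain R Y Z), chainProd μ (.cons (0 : R.shom X Y) c) = 0 :=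
    fun c => MultiFun.cons_zero (chainProd_multilinear μ _ _) c
  cases c with
  | nil => simp [barRight, chainProd]
  | cons a W =>
    rw [← sumSplits_chainProd_barTail assoc, Chain.sumSplits_cons]
    cases W with
    | nil => simp [barRight, barTail, zero]
    | cons v W => simp [barRight, barTail, zero]

/-- The operations obtained from an associative multiplication and a differential form an
`A∞`-category. -/
theorem barCat_isAInfCat
    (assoc : ∀ {X Y Z W : R.Obj} (x : R.shom X Y) (y : R.shom Y Z) (z : R.shom Z W),
      μ _ _ _ (μ _ _ _ x y) z = μ _ _ _ x (μ _ _ _ y z))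
    (ββ : ∀ {X Y : R.Obj} (x : R.shom X Y), β _ _ (β _ _ x) = 0) :
    (barCat R μ β hμ hβ).IsAInfCat := by
  suffices H : ∀ (n : ℕ) (X Y : R.Obj) (c : Chain R X Y), c.length = n →
      lsum ((barCat R μ β hμ hβ).bTerms c) (barB R μ β) = 0 from
    fun X Y c => H _ X Y c rfl
  intro n
  induction n using Nat.strong_induction_on with
  | _ n ih =>
  intro X Y c hc
  -- The product map turns `b̄²` into `β² = 0`. Since `b̄²` is extended from its components and
  -- these vanish on shorter chains, only the component on the whole chain is left, and the product
  -- map does not change a single letter.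
  have h1 : lsum ((barCat R μ β hμ hβ).bTerms c) (fun c' =>
      lsum ((barCat R μ β hμ hβ).bTerms c') (chainProd μ)) = 0 := by
    simp only [lsum_bTerms_chainProd hμ hβ assoc]
    have h2 := map_lsum (β X Y).toAddMonoidHom ((barCat R μ β hμ hβ).bTerms c) (chainProd μ)
    refine h2.symm.trans ?_
    refine (congrArg (β X Y) (lsum_bTerms_chainProd hμ hβ assoc c)).trans (ββ _)
  have h3 := (lsum_bTerms_bTerms (barCat R μ β hμ hβ) c (chainProd_multilinear μ X Y)).symm.trans h1
  have zero : ∀ {X Y Z V : R.Obj} (p : Chain R X Y) (c : Chain R Z V),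
      chainProd μ (p.append (.cons (0 : R.shom Y Z) c)) = 0 :=
    fun p c => MultiFun.slot_zero (chainProd_multilinear μ _ _) p c
  rw [Chain.sumSplits_eq_left c _ fun Z p q hp e => ?_] at h3
  · rw [Chain.sumSplits_eq_right c _ fun Z p q hq e => ?_] at h3
    · exact h3
    · have hl := congrArg Chain.length e
      rw [Chain.length_append] at hl
      have := ih p.length (by omega) _ _ p rfl
      refine (congrArg (fun x => chainProd μ (Chain.append (.nil X) (.cons x q))) this).trans ?_
      exact zero _ _
  · refine (Chain.sumSplits_congr' q fun W r s e' => ?_).trans (Chain.sumSplits_zero q)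
    have hl := congrArg Chain.length e
    have hl' := congrArg Chain.length e'
    rw [Chain.length_append] at hl hl'
    have := ih r.length (by omega) _ _ r rfl
    refine (congrArg (fun x => chainProd μ (Chain.append p (.cons x s))) this).trans ?_
    exact zero _ _

end Bar

end AInf
end

noncomputable section

namespace AInf

open scoped TensorProduct DirectSum

variable {k : Type w} [CommRing k]

/-! ### Pure tensors -/

section Pure

variable {Q : GradedQuiver.{w, u, v} k} {F : Set Q.Obj}

theorem consT_incl {X Z Y : Q.Obj} (x : Q.shom X Z) (l : List Q.Obj) (u : tens Q Y l Z) :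
    consT X Z Y x (tensorIncl (F := Set.univ) l (fun Z _ => Set.mem_univ Z) u) =
      tensorIncl (X := X) (Y := Y) (F := Set.univ) (Z :: l) (fun Z _ => Set.mem_univ Z)
        (x ⊗ₜ[k] u : Q.shom X Z ⊗[k] tens Q Y l Z) := by
  rw [consT, LinearMap.flip_apply]
  exact LinearMap.congr_fun
    (tensorLift_incl (F := Set.univ) _ l (fun Z _ => Set.mem_univ Z) u) x

theorem TensorHom.induction {X Y : Q.Obj} (S : Submodule k (TensorHom Q F X Y))
    (h : ∀ l hl u, tensorIncl (X := X) (Y := Y) (F := F) l hl u ∈ S) (x : TensorHom Q F X Y) :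
    x ∈ S := by
  classical
  induction x using DirectSum.induction_on with
  | zero => exact zero_mem _
  | add x y hx hy => exact add_mem hx hy
  | of i x => exact h i.1 i.2 x

/-- The sources of all elements of the chain belong to `F`. -/
def Chain.SrcIn (F : Set Q.Obj) : ∀ {X Y : Q.Obj}, Chain Q X Y → Prop
  | _, _, .nil _ => True
  | X, _, .cons _ c => X ∈ F ∧ SrcIn F c

/-- The intermediate objects of the chain belong to `F`. -/
def Chain.MidIn (F : Set Q.Obj) : ∀ {X Y : Q.Obj}, Chain Q X Y → Prop
  | _, _, .nil _ => True
  | _, _, .cons _ c => SrcIn F c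

/-- Membership of the listed objects in `F` becomes the condition `SrcIn` on the tail of the chain,
so one induction serves both `T⁺s𝒞` and its direct summand. -/
theorem tensorIncl_induction : ∀ (l : List Q.Obj) (_ : ∀ Z ∈ l, Z ∈ F) {X Y : Q.Obj}
    (S : Submodule k (TensorHom Q Set.univ X Y))
    (_ : ∀ Z (x : Q.shom X Z) (c : Chain Q Z Y), c.SrcIn F → pureT (.cons x c) ∈ S)
    (u : tens Q Y l X), tensorIncl (F := Set.univ) l (fun Z _ => Set.mem_univ Z) u ∈ S
  | [], _, X, Y, S, h, u => h Y u (.nil Y) trivial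
  | Z :: l, hl, X, Y, S, h, u => by
    change Q.shom X Z ⊗[k] tens Q Y l Z at u
    induction u using TensorProduct.induction_on with
    | zero => exact (map_zero (tensorIncl (X := X) (Y := Y) (F := Set.univ) (Z :: l)
        fun Z _ => Set.mem_univ Z)).symm ▸ zero_mem S
    | add a b ha hb => exact (map_add (tensorIncl (X := X) (Y := Y) (F := Set.univ) (Z :: l)
        fun Z _ => Set.mem_univ Z) a b).symm ▸ add_mem ha hb
    | tmul x u =>
      rw [← consT_incl]
      refine tensorIncl_induction l (fun W hW => hl W (by simp [hW])) (S.comap (consT X Z Y x))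
        (fun W y c hc => ?_) u
      exact h Z x (.cons y c) ⟨hl Z (by simp), hc⟩

/-- The pure tensors span `T⁺s𝒞`. -/
theorem pureT_induction {X Y : Q.Obj} (S : Submodule k (TensorHom Q Set.univ X Y))
    (h : ∀ Z (x : Q.shom X Z) (c : Chain Q Z Y), pureT (.cons x c) ∈ S)
    (x : TensorHom Q Set.univ X Y) : x ∈ S :=
  TensorHom.induction S (fun l _ u => tensorIncl_induction (F := Set.univ) l (fun Z _ => Set.mem_univ Z) S
    (fun Z x c _ => h Z x c) u) x

theorem liftT_consT {M : Type v₁} [AddCommGroup M] [Module k M] {X Z Y : Q.Obj}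
    (φ : MultiFun Q X Y M) (x : Q.shom X Z) (u : TensorHom Q Set.univ Z Y) :
    liftT φ (consT X Z Y x u) = liftT (MultiFun.curry X Y Z φ x) u := by
  refine TensorHom.induction
    (LinearMap.eqLocus (liftT φ ∘ₗ consT X Z Y x) (liftT (MultiFun.curry X Y Z φ x)))
    (fun l _ u => ?_) u
  refine (congrArg (liftT φ) (consT_incl x l u)).trans ?_
  refine (tensorLift_incl (X := X) (F := Set.univ) _ (Z :: l) (fun Z _ => Set.mem_univ Z)
    (x ⊗ₜ[k] u : Q.shom X Z ⊗[k] tens Q Y l Z)).trans ?_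
  exact (tensorLift_incl (F := Set.univ) (fun l _ => liftTens M Y l Z (MultiFun.curry X Y Z φ x)) l
    (fun Z _ => Set.mem_univ Z) u).symm

theorem liftT_pureT {M : Type v₁} [AddCommGroup M] [Module k M] {X Z Y : Q.Obj}
    (φ : MultiFun Q X Y M) (x : Q.shom X Z) (c : Chain Q Z Y) :
    liftT φ (pureT (.cons x c)) = φ.1 (.cons x c) := by
  induction c generalizing X with
  | nil =>
    rw [liftT]
    exact tensorLift_incl _ _ _ _
  | cons y c ih => exact (liftT_consT _ _ _).trans (ih _ y)

theorem mulT_consT {X Z W Y : Q.Obj} (x : Q.shom X Z) (u : TensorHom Q Set.univ Z W)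
    (t : TensorHom Q Set.univ W Y) : mulT (consT X Z W x u) t = consT X Z Y x (mulT u t) := by
  refine TensorHom.induction
    (LinearMap.eqLocus (mulT.flip t ∘ₗ consT X Z W x) (consT X Z Y x ∘ₗ mulT.flip t))
    (fun l _ u => ?_) u
  change mulT (consT X Z W x (tensorIncl l _ u)) t = consT X Z Y x (mulT (tensorIncl l _ u) t)
  have h₁ := LinearMap.congr_fun (tensorLift_incl (X := X) (F := Set.univ)
    (fun l _ => mulTens W Y l X) (Z :: l) (fun Z _ => Set.mem_univ Z)
    (x ⊗ₜ[k] u : Q.shom X Z ⊗[k] tens Q W l Z)) t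
  have h₂ := LinearMap.congr_fun (tensorLift_incl (X := Z) (F := Set.univ)
    (fun l _ => mulTens W Y l Z) l (fun Z _ => Set.mem_univ Z) u) t
  refine (congrArg (fun v => mulT v t) (consT_incl x l u)).trans ?_
  exact h₁.trans (congrArg (consT X Z Y x) h₂).symm

theorem mulT_ofLetter {X Z Y : Q.Obj} (x : Q.shom X Z) (t : TensorHom Q Set.univ Z Y) :
    mulT (ofLetter Set.univ X Z x) t = consT X Z Y x t := by
  exact LinearMap.congr_fun (tensorLift_incl (X := X) (F := Set.univ)
    (fun l _ => mulTens Z Y l X) [] (fun Z _ => Set.mem_univ Z) x) t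

theorem mulT_pureT {X Z W V Y : Q.Obj} (x : Q.shom X Z) (c : Chain Q Z W) (y : Q.shom W V)
    (d : Chain Q V Y) : mulT (pureT (.cons x c)) (pureT (.cons y d)) =
      pureT (.cons x (c.append (.cons y d))) := by
  induction c generalizing X with
  | nil => exact mulT_ofLetter _ _
  | cons z c ih => exact (mulT_consT _ _ _).trans (congrArg (consT _ _ _ x) (ih z y))

/-- Pure tensors span, and on them both sides are concatenation. -/
theorem mulT_assoc {X Y Z W : Q.Obj} (x : TensorHom Q Set.univ X Y) (y : TensorHom Q Set.univ Y Z)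
    (z : TensorHom Q Set.univ Z W) : mulT (mulT x y) z = mulT x (mulT y z) := by
  refine pureT_induction (LinearMap.eqLocus ((mulT.flip z) ∘ₗ (mulT.flip y)) (mulT.flip (mulT y z)))
    (fun _ a p => ?_) x
  refine pureT_induction (LinearMap.eqLocus ((mulT.flip z) ∘ₗ (mulT (pureT (.cons a p))))
    (mulT (pureT (.cons a p)) ∘ₗ mulT.flip z)) (fun _ b q => ?_) y
  refine pureT_induction (LinearMap.eqLocus (mulT (mulT (pureT (.cons a p)) (pureT (.cons b q))))
    (mulT (pureT (.cons a p)) ∘ₗ mulT (pureT (.cons b q)))) (fun _ c r => ?_) z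
  change mulT (mulT (pureT (.cons a p)) (pureT (.cons b q))) (pureT (.cons c r)) =
    mulT (pureT (.cons a p)) (mulT (pureT (.cons b q)) (pureT (.cons c r)))
  rw [mulT_pureT, mulT_pureT, mulT_pureT, mulT_pureT, Chain.append_assoc, Chain.cons_append]

theorem pureT_sgn (p : ℤ) {X Y : Q.Obj} (c : Chain Q X Y) :
    pureT (c.sgn p) = (TPlus Q).sgn p X Y (pureT c) := by
  have h := MultiFun.app_sgn (R := TPlus Q) (pureT_mem_multiFun X Y) 0
    (fun c d hc => by rw [add_zero]; exact pureT_mem hc) p c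
  rw [mul_zero, koszul_zero, one_smul] at h
  exact h

theorem toTPlus_incl {X Y : Q.Obj} (l : List Q.Obj) (hl : ∀ Z ∈ l, Z ∈ F) (u : tens Q Y l X) :
    toTPlus F X Y (tensorIncl l hl u) = tensorIncl l (fun Z _ => Set.mem_univ Z) u :=
  tensorLift_incl _ _ _ _

theorem ofTPlus_incl {X Y : Q.Obj} (l : List Q.Obj) (hl : ∀ Z ∈ l, Z ∈ F) (u : tens Q Y l X) :
    ofTPlus F X Y (tensorIncl l (fun Z _ => Set.mem_univ Z) u) = tensorIncl l hl u := by
  classical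
  refine (tensorLift_incl (F := Set.univ) _ l (fun Z _ => Set.mem_univ Z) u).trans ?_
  rw [dif_pos hl]

@[simp] theorem ofTPlus_toTPlus {X Y : Q.Obj} (x : TensorHom Q F X Y) :
    ofTPlus F X Y (toTPlus F X Y x) = x := by
  refine TensorHom.induction
    (LinearMap.eqLocus (ofTPlus F X Y ∘ₗ toTPlus F X Y) LinearMap.id) (fun l hl u => ?_) x
  exact (congrArg (ofTPlus F X Y) (toTPlus_incl l hl u)).trans (ofTPlus_incl l hl u)

theorem toTPlus_ofLetter {X Y : Q.Obj} (x : Q.shom X Y) :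
    toTPlus F X Y (ofLetter F X Y x) = ofLetter Set.univ X Y x :=
  toTPlus_incl (X := X) [] _ x

theorem exists_tensorIncl {X Z Y : Q.Obj} (x : Q.shom X Z) (c : Chain Q Z Y) (hc : c.SrcIn F) :
    ∃ (l : List Q.Obj) (_ : ∀ Z ∈ l, Z ∈ F) (u : tens Q Y l X),
      pureT (.cons x c) = tensorIncl l (fun Z _ => Set.mem_univ Z) u := by
  induction c generalizing X with
  | nil => exact ⟨[], by simp, x, rfl⟩
  | @cons Z W Y y c ih =>
    obtain ⟨l, hl, u, hu⟩ := ih y hc.2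
    refine ⟨Z :: l, fun V hV => ?_, x ⊗ₜ[k] u, ?_⟩
    · rcases List.mem_cons.mp hV with rfl | hV
      exacts [hc.1, hl V hV]
    · exact (congrArg (consT X Z Y x) hu).trans (consT_incl x l u)

variable (F) in
/-- The pure tensor of a chain, projected to the direct summand. -/
def pureF {X Y : Q.Obj} (c : Chain Q X Y) : TensorHom Q F X Y := ofTPlus F X Y (pureT c)

/-- A pure tensor with intermediate objects in `F` already lies in the summand, so projecting it
loses nothing. -/
theorem toTPlus_pureF {X Y : Q.Obj} {c : Chain Q X Y} (hc : c.MidIn F) :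
    toTPlus F X Y (pureF F c) = pureT c := by
  cases c with
  | nil => exact (congrArg _ (map_zero (ofTPlus F X X))).trans (map_zero (toTPlus F X X))
  | cons x c =>
    obtain ⟨l, hl, u, hu⟩ := exists_tensorIncl x c hc
    rw [pureF, hu, ofTPlus_incl l hl, toTPlus_incl]

theorem pureF_mem {X Y : Q.Obj} {c : Chain Q X Y} {d : ℤ} (hc : c.HasDegree d) :
    pureF F c ∈ (tensorQuiver Q F).grade X Y d :=
  ofTPlus_mem (pureT_mem hc)

theorem pureF_mem_multiFun (X Y : Q.Obj) :
    (pureF F : Chain Q X Y → TensorHom Q F X Y) ∈ MultiFun Q X Y (TensorHom Q F X Y) :=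
  MultiFun.comp_linear (pureT_mem_multiFun X Y) (ofTPlus F X Y)

theorem pureF_single {X Y : Q.Obj} (x : Q.shom X Y) : pureF F (.single x) = ofLetter F X Y x := by
  rw [← ofTPlus_toTPlus (ofLetter F X Y x), toTPlus_ofLetter]
  rfl

/-- The pure tensors of chains with intermediate objects in `F` span the direct summand. -/
theorem pureF_induction {X Y : Q.Obj} (S : Submodule k (TensorHom Q F X Y))
    (h : ∀ Z (x : Q.shom X Z) (c : Chain Q Z Y), c.SrcIn F → pureF F (.cons x c) ∈ S)
    (x : TensorHom Q F X Y) : x ∈ S := by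
  refine TensorHom.induction S (fun l hl u => ?_) x
  rw [← ofTPlus_incl l hl]
  exact tensorIncl_induction l hl (S.comap (ofTPlus F X Y)) h u

end Pure

/-! ### The differential of `T⁺s𝒞` -/

section Differential

variable (A : PreAInfCat.{w, u, v} k)

theorem bT_pureT {X Y : A.Obj} (c : Chain A.toGradedQuiver X Y) :
    bT A X Y (pureT c) = lsum (A.bTerms c) pureT := by
  cases c with
  | nil =>
    refine (map_zero (bT A X X)).trans ?_
    simp [lsum_bTerms, A.b_nil, pureT]
  | cons x c => exact liftT_pureT _ _ _

variable {A}

theorem bT_bT (hA : A.IsAInfCat) {X Y : A.Obj} (x : TensorHom A.toGradedQuiver Set.univ X Y) :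
    bT A X Y (bT A X Y x) = 0 := by
  refine pureT_induction (LinearMap.ker (bT A X Y ∘ₗ bT A X Y)) (fun Z x c => ?_) x
  change bT A X Y (bT A X Y _) = 0
  rw [bT_pureT]
  refine (map_lsum (bT A X Y).toAddMonoidHom _ _).trans ?_
  refine (lsum_congr fun z _ => bT_pureT A z).trans ?_
  exact hA.lsum_bTerms_bTerms _ (pureT_mem_multiFun X Y)

/-- `T⁺s𝒞` with the operations `b̄ₙ` is an `A∞`-category. -/
theorem barCat_TPlus_isAInfCat (hA : A.IsAInfCat) :
    (barCat (TPlus A.toGradedQuiver) (fun _ _ _ => mulT) (bT A) mulT_mem (bT_mem A)).IsAInfCat :=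
  barCat_isAInfCat _ _ mulT_assoc (bT_bT hA)

end Differential

end AInf
end

noncomputable section

namespace AInf

open scoped TensorProduct DirectSum

variable {k : Type w} [CommRing k]

/-! ### The operations of the quotient -/

section Strict

variable {E : PreAInfCat.{w, u₂, v₂} k} {B : PreAInfCat.{w, u₃, v₃} k} {l : E.Obj → B.Obj}
  {τ : ∀ X Y, E.shom X Y →ₗ[k] B.shom (l X) (l Y)}

theorem IsStrict.lsum_bTerms {M : Type*} [AddCommGroup M] (hτ : IsStrict l τ) {X Y : E.Obj}
    (c : Chain E.toGradedQuiver X Y) (φ : Chain B.toGradedQuiver (l X) (l Y) → M) :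
    lsum (B.bTerms (Chain.map l (fun X Y => τ X Y) c)) φ =
      lsum (E.bTerms c) fun z => φ (Chain.map l (fun X Y => τ X Y) z) := by
  rw [AInf.lsum_bTerms, AInf.lsum_bTerms, Chain.sumSplits_map]
  refine Chain.sumSplits_congr _ fun Z p c' => ?_
  rw [Chain.sumSplits_map]
  refine Chain.sumSplits_congr _ fun W m q => ?_
  rw [Chain.map_append, Chain.map, hτ.b, Chain.map_sgn l τ hτ.mem]

/-- A strict map carries the sum that has to vanish to the corresponding sum in `B`; injectivity
brings the conclusion back. -/
theorem IsStrict.isAInfCat (hτ : IsStrict l τ) (inj : ∀ X Y x, τ X Y x = 0 → x = 0)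
    (hB : B.IsAInfCat) : E.IsAInfCat := fun X Y c => inj X Y _ <| by
  refine (map_lsum (τ X Y).toAddMonoidHom (E.bTerms c) E.b).trans ?_
  refine (lsum_congr fun z _ => hτ.b z).trans ?_
  exact (hτ.lsum_bTerms c B.b).symm.trans (hB _ _ _)

end Strict

theorem Chain.sumSplits_mem {Q : GradedQuiver.{w, u, v} k} {M : Type*} [AddCommGroup M] [Module k M]
    (S : Submodule k M) {X Y : Q.Obj} (c : Chain Q X Y) (G : ∀ Z, Chain Q X Z → Chain Q Z Y → M)
    (h : ∀ Z p q, p.append q = c → G Z p q ∈ S) : c.sumSplits G ∈ S := by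
  induction c with
  | nil => simpa using h _ (.nil _) (.nil _) rfl
  | cons x c ih =>
    rw [Chain.sumSplits_cons]
    refine add_mem (h _ _ _ rfl) (ih _ fun Z p q e => h _ _ _ ?_)
    rw [Chain.cons_append, e]

section SrcIn

variable {Q : GradedQuiver.{w, u, v} k} {F : Set Q.Obj}

theorem Chain.srcIn_append {X Y Z : Q.Obj} (p : Chain Q X Y) (q : Chain Q Y Z) :
    (p.append q).SrcIn F ↔ p.SrcIn F ∧ q.SrcIn F := by
  induction p with
  | nil => simp [Chain.SrcIn]
  | cons x p ih => simp [Chain.SrcIn, ih, and_assoc]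

/-- Replacing an end of a chain does not create new intermediate objects. -/
theorem Chain.MidIn.replace {X Z W V U Y : Q.Obj} {p : Chain Q X Z} {q : Chain Q Z W}
    {z : Q.shom W V} (h : (p.append (q.append (.single z))).MidIn F) (y : Q.shom Z U)
    {r : Chain Q U Y} (hr : r.SrcIn F) : (p.append (.cons y r)).MidIn F := by
  cases p with
  | nil => exact hr
  | cons x p =>
    have h' := (Chain.srcIn_append p _).mp h
    refine (Chain.srcIn_append p _).mpr ⟨h'.1, ?_, hr⟩
    cases q with
    | nil => exact h'.2.1
    | cons => exact h'.2.1

theorem mulT_pureT_append {X Z W V U Y : Q.Obj} (p : Chain Q X Z) (y : Q.shom Z W)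
    (q : Chain Q W V) (x : Q.shom V U) (r : Chain Q U Y) :
    mulT (pureT (p.append (.cons y q))) (pureT (.cons x r)) =
      pureT (p.append (.cons y (q.append (.cons x r)))) := by
  cases p with
  | nil => exact mulT_pureT _ _ _ _
  | cons z p =>
    refine (mulT_pureT z _ x r).trans ?_
    rw [Chain.append_assoc]
    rfl

end SrcIn

section Quotient

variable {A : PreAInfCat.{w, u, v} k} {F : Set A.Obj}

/-- Multiplying `b(y)` by `x z` produces the terms of `b(y x z)` in which `b` stays to the left of
`x`. Their removal leaves the terms in which `b` meets `x` or acts to its right. -/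
theorem bT_pureT_append_cons {X Z W Y : A.Obj} (y : Chain A.toGradedQuiver X Z) (x : A.shom Z W)
    (z : Chain A.toGradedQuiver W Y) :
    bT A X Y (pureT (y.append (.cons x z))) -
        mulT (bT A X Z (pureT y)) ((TPlus A.toGradedQuiver).sgn 1 Z Y (pureT (.cons x z))) =
      midSum pureT y x z + lsum (A.bTerms z) fun z' => pureT (y.append (.cons x z')) := by
  rw [bT_pureT, bT_pureT, lsum_bTerms_append_cons, ← pureT_sgn, add_assoc, sub_eq_iff_eq_add,
    add_comm]
  congr 1
  rw [lsum_bTerms, lsum_bTerms]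
  refine Eq.symm ((Chain.map_sumSplits (mulT.flip (pureT (Chain.sgn 1 (.cons x z)))).toAddMonoidHom
    _ _).trans ?_)
  refine Chain.sumSplits_congr _ fun V p c' => ?_
  refine (Chain.map_sumSplits (mulT.flip (pureT (Chain.sgn 1 (.cons x z)))).toAddMonoidHom
    _ _).trans ?_
  refine Chain.sumSplits_congr _ fun U m q => ?_
  refine (mulT_pureT_append p (A.b m) (q.sgn 1) (A.sgn 1 _ _ x) (z.sgn 1)).trans ?_
  rw [Chain.append_assoc, Chain.cons_append]

/-- The operation `b̄` on `a'z ⊗ u ⊗ xv'`. -/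
theorem bar_pureT {X Z Z' W W' Y : A.Obj} (a : Chain A.toGradedQuiver X Z) (z : A.shom Z Z')
    (u : Chain A.toGradedQuiver Z' W) (x : A.shom W W') (v : Chain A.toGradedQuiver W' Y) :
    (bT A X Y (pureT (a.append (.cons z (u.append (.cons x v))))) -
        mulT (bT A X W (pureT (a.append (.cons z u))))
          ((TPlus A.toGradedQuiver).sgn 1 W Y (pureT (.cons x v)))) -
      mulT (pureT (a.append (.single z))) (bT A Z' Y (pureT (u.append (.cons x v))) -
        mulT (bT A Z' W (pureT u)) ((TPlus A.toGradedQuiver).sgn 1 W Y (pureT (.cons x v)))) =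
      a.sumSplits fun _ p q => v.sumSplits fun _ v₁ v₂ =>
        pureT (p.append (.cons (A.b (q.append (.cons z (u.append (.cons x v₁))))) (v₂.sgn 1))) := by
  have h := bT_pureT_append_cons (a.append (.cons z u)) x v
  rw [Chain.append_assoc, Chain.cons_append] at h
  rw [h, bT_pureT_append_cons, map_add]
  -- The product of `a z` with the corresponding difference for `u x v` consists of the terms in
  -- which `b` starts to the right of `z`. Subtracting it leaves those in which `b` starts at `z` or
  -- earlier and reaches at least `x`.
  have h1 : mulT (pureT (a.append (.single z)))
      (lsum (A.bTerms v) fun z' => pureT (u.append (.cons x z'))) =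
      lsum (A.bTerms v) fun z' => pureT ((a.append (.cons z u)).append (.cons x z')) := by
    refine (map_lsum (mulT (pureT (a.append (.single z)))).toAddMonoidHom _ _).trans ?_
    refine lsum_congr fun z' _ => ?_
    rw [Chain.append_assoc]
    cases u with
    | nil => exact mulT_pureT_append a z (.nil _) x z'
    | cons y u => exact mulT_pureT_append a z (.nil _) y (u.append (.cons x z'))
  have h2 : mulT (pureT (a.append (.single z))) (midSum pureT u x v) =
      u.sumSplits fun _ y₁ y₂ => v.sumSplits fun _ z₁ z₂ => pureT ((a.append (.cons z y₁)).append
        (.cons (A.b (y₂.append (.cons x z₁))) (z₂.sgn 1))) := by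
    refine (Chain.map_sumSplits (mulT (pureT (a.append (.single z)))).toAddMonoidHom _ _).trans ?_
    refine Chain.sumSplits_congr _ fun V y₁ y₂ => ?_
    refine (Chain.map_sumSplits (mulT (pureT (a.append (.single z)))).toAddMonoidHom _ _).trans ?_
    refine Chain.sumSplits_congr _ fun V' z₁ z₂ => ?_
    rw [Chain.append_assoc]
    cases y₁ with
    | nil => exact mulT_pureT_append a z (.nil _) _ _
    | cons y y₁ => exact mulT_pureT_append a z (.nil _) y _
  rw [h1, h2, add_sub_add_right_eq_sub, midSum, Chain.sumSplits_append_cons, add_sub_cancel_right]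
  simp only [Chain.append_assoc, Chain.cons_append]

/-- Only the last factor is treated separately by `barTail`; all factors before it are simply
multiplied into `a`. -/
theorem barTail_append_single {R : GradedQuiver.{w, u, v} k}
    {μ : ∀ X Y Z : R.Obj, R.shom X Y →ₗ[k] R.shom Y Z →ₗ[k] R.shom X Z}
    {β : ∀ X Y : R.Obj, R.shom X Y →ₗ[k] R.shom X Y}
    (assoc : ∀ {X Y Z W : R.Obj} (x : R.shom X Y) (y : R.shom Y Z) (z : R.shom Z W),
      μ _ _ _ (μ _ _ _ x y) z = μ _ _ _ x (μ _ _ _ y z)) {X Z W Y : R.Obj} (a : R.shom X Z)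
    (U : Chain R Z W) (v : R.shom W Y) :
    barTail R μ β X (U.append (.single v)) a =
      β _ _ (μ _ _ _ (chainProd μ (.cons a U)) v) -
        μ _ _ _ (β _ _ (chainProd μ (.cons a U))) (R.sgn 1 _ _ v) := by
  induction U with
  | nil => rfl
  | cons w U ih =>
    rw [← chainProd_cons_mul assoc, ← ih]
    cases U <;> rfl

theorem chainProd_append_single {R : GradedQuiver.{w, u, v} k}
    {μ : ∀ X Y Z : R.Obj, R.shom X Y →ₗ[k] R.shom Y Z →ₗ[k] R.shom X Z}
    (assoc : ∀ {X Y Z W : R.Obj} (x : R.shom X Y) (y : R.shom Y Z) (z : R.shom Z W),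
      μ _ _ _ (μ _ _ _ x y) z = μ _ _ _ x (μ _ _ _ y z)) {X Z W Y : R.Obj} (a : R.shom X Z)
    (U : Chain R Z W) (v : R.shom W Y) :
    chainProd μ (.cons a (U.append (.single v))) = μ _ _ _ (chainProd μ (.cons a U)) v := by
  induction U generalizing X with
  | nil => rfl
  | cons w U ih =>
    rw [← chainProd_cons_mul assoc a w U, ← ih, chainProd_cons_mul assoc]
    rfl

theorem Chain.exists_append_single {Q : GradedQuiver.{w, u, v} k} {X Z Y : Q.Obj} (x : Q.shom X Z)
    (c : Chain Q Z Y) : ∃ (W : Q.Obj) (p : Chain Q X W) (y : Q.shom W Y),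
      Chain.cons x c = p.append (.single y) := by
  induction c generalizing X with
  | nil => exact ⟨_, .nil _, x, rfl⟩
  | cons z c ih =>
    obtain ⟨W, p, y, h⟩ := ih z
    exact ⟨W, .cons x p, y, congrArg (Chain.cons x) h⟩

/-- For three or more factors the operation depends on the middle ones only through their product,
as the formula with `μ⁽ⁿ⁾` shows. -/
theorem barT_append_single {X Z W Y : A.Obj} (a : TensorHom A.toGradedQuiver Set.univ X Z)
    {V : A.Obj} (t : TensorHom A.toGradedQuiver Set.univ Z V)
    (U : Chain (TPlus A.toGradedQuiver) V W)
    (v : TensorHom A.toGradedQuiver Set.univ W Y) :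
    barT A X Y (Chain.cons (Q := TPlus A.toGradedQuiver) a (.cons t (U.append (.single v)))) =
      (bT A X Y (mulT (mulT a (chainProd (fun _ _ _ => mulT) (Chain.cons (Q := TPlus A.toGradedQuiver) t U))) v) -
        mulT (bT A X W (mulT a (chainProd (fun _ _ _ => mulT) (Chain.cons (Q := TPlus A.toGradedQuiver) t U))))
          ((TPlus A.toGradedQuiver).sgn 1 W Y v)) -
      mulT a (bT A Z Y (mulT (chainProd (fun _ _ _ => mulT) (Chain.cons (Q := TPlus A.toGradedQuiver) t U)) v) -
        mulT (bT A Z W (chainProd (fun _ _ _ => mulT) (Chain.cons (Q := TPlus A.toGradedQuiver) t U)))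
          ((TPlus A.toGradedQuiver).sgn 1 W Y v)) := by
  have h1 := barTail_append_single (R := TPlus A.toGradedQuiver) (μ := fun _ _ _ => mulT)
    (β := bT A) mulT_assoc a (.cons t U) v
  have h2 := barTail_append_single (R := TPlus A.toGradedQuiver) (μ := fun _ _ _ => mulT)
    (β := bT A) mulT_assoc t U v
  have h3 := chainProd_append_single (R := TPlus A.toGradedQuiver) (μ := fun _ _ _ => mulT)
    mulT_assoc t U v
  refine congrArg₂ (· - ·) h1 (congrArg (mulT a) ?_)
  exact (barRight_cons_append (TPlus A.toGradedQuiver) (fun _ _ _ => mulT) (bT A) t U v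
    (Chain.nil (Q := TPlus A.toGradedQuiver) Y)).trans h2

theorem barT_single {X Y : A.Obj} (w : TensorHom A.toGradedQuiver Set.univ X Y) :
    barT A X Y (Chain.single (Q := TPlus A.toGradedQuiver) w) = bT A X Y w :=
  (congrArg (bT A X Y w - ·) (map_zero (mulT w))).trans (sub_zero _)

theorem mulT_pureT_single {X Z W V Y : A.Obj} (a : Chain A.toGradedQuiver X Z) (z : A.shom Z W)
    (y : A.shom W V) (u : Chain A.toGradedQuiver V Y) :
    mulT (pureT (a.append (.single z))) (pureT (.cons y u)) =
      pureT (a.append (.cons z (.cons y u))) :=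
  mulT_pureT_append a z (.nil _) y u

theorem bar_pureT_cons {X Z Z' W W' Y V : A.Obj} (a : Chain A.toGradedQuiver X Z) (z : A.shom Z Z')
    (y : A.shom Z' V) (u : Chain A.toGradedQuiver V W) (x : A.shom W W')
    (v : Chain A.toGradedQuiver W' Y) :
    (bT A X Y (mulT (mulT (pureT (a.append (.single z))) (pureT (.cons y u))) (pureT (.cons x v))) -
        mulT (bT A X W (mulT (pureT (a.append (.single z))) (pureT (.cons y u))))
          ((TPlus A.toGradedQuiver).sgn 1 W Y (pureT (.cons x v)))) -
      mulT (pureT (a.append (.single z))) (bT A Z' Y (mulT (pureT (.cons y u)) (pureT (.cons x v))) -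
        mulT (bT A Z' W (pureT (.cons y u)))
          ((TPlus A.toGradedQuiver).sgn 1 W Y (pureT (.cons x v)))) =
      a.sumSplits fun _ p q => v.sumSplits fun _ v₁ v₂ => pureT (p.append
        (.cons (A.b (q.append (.cons z (.cons y (u.append (.cons x v₁)))))) (v₂.sgn 1))) := by
  refine Eq.trans ?_ (bar_pureT a z (.cons y u) x v)
  rw [mulT_pureT_single, mulT_pureT]
  rw [show a.append (.cons z (.cons y u)) = (a.append (.single z)).append (.cons y u) from
    (Chain.append_assoc a (.single z) (.cons y u)).symm,
    mulT_pureT_append (a.append (.single z)) y u x v, Chain.append_assoc]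
  rfl

/-- With two factors there is no middle product. It is represented by the empty chain, whose pure
tensor is zero by convention, in accordance with `μ⁽⁰⁾ = 0`. -/
theorem barT_pureT_two {X Z W W' Y : A.Obj} (a : Chain A.toGradedQuiver X Z) (z : A.shom Z W)
    (x : A.shom W W') (v : Chain A.toGradedQuiver W' Y) :
    barT A X Y (Chain.cons (Q := TPlus A.toGradedQuiver) (pureT (a.append (.single z)))
        (.single (pureT (.cons x v)))) =
      a.sumSplits fun _ p q => v.sumSplits fun _ v₁ v₂ => pureT (p.append
        (.cons (A.b (q.append (.cons z (.cons x v₁)))) (v₂.sgn 1))) := by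
  refine Eq.trans ?_ (bar_pureT a z (.nil W) x v)
  refine congrArg₂ (· - ·) ?_ ?_
  · refine congrArg (fun s => bT A X Y s - _) ?_
    exact mulT_pureT_single a z x v
  · refine congrArg (mulT (pureT (a.append (.single z)))) ?_
    refine (sub_zero _).symm.trans (congrArg (bT A W Y (pureT (.cons x v)) - ·) ?_)
    refine Eq.symm ((congrArg (mulT · _) (map_zero (bT A W W))).trans ?_)
    exact LinearMap.congr_fun (map_zero mulT) _

theorem Chain.srcIn_sgn {Q : GradedQuiver.{w, u, v} k} {F : Set Q.Obj} (p : ℤ) {X Y : Q.Obj}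
    {c : Chain Q X Y} (hc : c.SrcIn F) : (c.sgn p).SrcIn F := by
  induction c with
  | nil => trivial
  | cons x c ih => exact ⟨hc.1, ih hc.2⟩

theorem pureT_mem_range {X Y : A.Obj} {c : Chain A.toGradedQuiver X Y} (hc : c.MidIn F) :
    pureT c ∈ LinearMap.range (toTPlus F X Y) :=
  ⟨pureF F c, toTPlus_pureF hc⟩

/-- Applying `b` to a segment only removes intermediate objects. An empty segment would instead
repeat an object, possibly an endpoint outside `F`, but `b₀ = 0`. -/
theorem bT_mem_range {X Y : A.Obj} (w : TensorHom A.toGradedQuiver F X Y) :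
    bT A X Y (toTPlus F X Y w) ∈ LinearMap.range (toTPlus F X Y) := by
  refine pureF_induction ((LinearMap.range (toTPlus F X Y)).comap
    (bT A X Y ∘ₗ toTPlus F X Y)) (fun Z x c hc => ?_) w
  change bT A X Y (toTPlus F X Y (pureF F (.cons x c))) ∈ LinearMap.range (toTPlus F X Y)
  rw [toTPlus_pureF (c := .cons x c) hc, bT_pureT, lsum_bTerms]
  refine Chain.sumSplits_mem _ _ _ fun W p c' e => Chain.sumSplits_mem _ _ _ fun V m q e' => ?_
  subst e'
  have hc' : (p.append (m.append q)).MidIn F := e ▸ hc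
  cases m with
  | nil =>
    rw [A.b_nil, MultiFun.slot_zero (pureT_mem_multiFun X Y)]
    exact zero_mem _
  | cons y m =>
    refine pureT_mem_range ?_
    cases p with
    | nil => exact Chain.srcIn_sgn 1 ((Chain.srcIn_append m q).mp hc').2
    | cons x p =>
      have h := (Chain.srcIn_append p _).mp hc'
      exact (Chain.srcIn_append p _).mpr ⟨h.1, h.2.1,
        Chain.srcIn_sgn 1 ((Chain.srcIn_append m q).mp h.2.2).2⟩

/-- Every surviving `b` covers the middle factor entirely, so its objects disappear. This is why `t`
may be any tensor and only the outer factors have to lie in the summand. -/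
theorem bar_mem_range {X Z W Y : A.Obj} (a : TensorHom A.toGradedQuiver F X Z)
    (t : TensorHom A.toGradedQuiver Set.univ Z W) (v : TensorHom A.toGradedQuiver F W Y) :
    (bT A X Y (mulT (mulT (toTPlus F X Z a) t) (toTPlus F W Y v)) -
        mulT (bT A X W (mulT (toTPlus F X Z a) t))
          ((TPlus A.toGradedQuiver).sgn 1 W Y (toTPlus F W Y v))) -
      mulT (toTPlus F X Z a) (bT A Z Y (mulT t (toTPlus F W Y v)) -
        mulT (bT A Z W t) ((TPlus A.toGradedQuiver).sgn 1 W Y (toTPlus F W Y v))) ∈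
      LinearMap.range (toTPlus F X Y) := by
  let σ := (TPlus A.toGradedQuiver).sgn 1 W Y
  refine pureF_induction ((LinearMap.range (toTPlus F X Y)).comap
    ((bT A X Y ∘ₗ mulT.flip (toTPlus F W Y v) ∘ₗ mulT.flip t ∘ₗ toTPlus F X Z -
      mulT.flip (σ (toTPlus F W Y v)) ∘ₗ bT A X W ∘ₗ mulT.flip t ∘ₗ toTPlus F X Z) -
      mulT.flip (bT A Z Y (mulT t (toTPlus F W Y v)) -
        mulT (bT A Z W t) (σ (toTPlus F W Y v))) ∘ₗ toTPlus F X Z)) (fun Z' x c hc => ?_) a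
  change (bT A X Y (mulT (mulT (toTPlus F X Z (pureF F (.cons x c))) t) (toTPlus F W Y v)) - _) -
    _ ∈ LinearMap.range (toTPlus F X Y)
  refine pureF_induction ((LinearMap.range (toTPlus F X Y)).comap
    ((bT A X Y ∘ₗ mulT (mulT (toTPlus F X Z (pureF F (.cons x c))) t) ∘ₗ toTPlus F W Y -
      mulT (bT A X W (mulT (toTPlus F X Z (pureF F (.cons x c))) t)) ∘ₗ σ ∘ₗ toTPlus F W Y) -
      mulT (toTPlus F X Z (pureF F (.cons x c))) ∘ₗ (bT A Z Y ∘ₗ mulT t ∘ₗ toTPlus F W Y -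
        mulT (bT A Z W t) ∘ₗ σ ∘ₗ toTPlus F W Y))) (fun W' y d hd => ?_) v
  refine pureT_induction ((LinearMap.range (toTPlus F X Y)).comap
    ((bT A X Y ∘ₗ mulT.flip (toTPlus F W Y (pureF F (.cons y d))) ∘ₗ
        mulT (toTPlus F X Z (pureF F (.cons x c))) -
      mulT.flip (σ (toTPlus F W Y (pureF F (.cons y d)))) ∘ₗ bT A X W ∘ₗ
        mulT (toTPlus F X Z (pureF F (.cons x c)))) -
      mulT (toTPlus F X Z (pureF F (.cons x c))) ∘ₗ
        (bT A Z Y ∘ₗ mulT.flip (toTPlus F W Y (pureF F (.cons y d))) -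
        mulT.flip (σ (toTPlus F W Y (pureF F (.cons y d)))) ∘ₗ bT A Z W)))
    (fun V z u => ?_) t
  rw [toTPlus_pureF (c := .cons x c) hc, toTPlus_pureF (c := .cons y d) hd]
  obtain ⟨V', p, x', e⟩ := Chain.exists_append_single x c
  have hp : (p.append (.single x')).MidIn F := e ▸ hc
  rw [e]
  refine (congrArg (· ∈ LinearMap.range (toTPlus F X Y)) (bar_pureT_cons p x' z u y d)).mpr ?_
  refine Chain.sumSplits_mem _ _ _ fun U r s e => Chain.sumSplits_mem _ _ _ fun U' d₁ d₂ e' => ?_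
  subst e e'
  rw [Chain.append_assoc] at hp
  exact pureT_mem_range (hp.replace _ (Chain.srcIn_sgn 1 ((Chain.srcIn_append _ _).mp hd).2))

theorem barT_two_mem_range {X Z Y : A.Obj} (a : TensorHom A.toGradedQuiver F X Z)
    (v : TensorHom A.toGradedQuiver F Z Y) :
    barT A X Y (Chain.cons (Q := TPlus A.toGradedQuiver) (toTPlus F X Z a)
      (.single (toTPlus F Z Y v))) ∈ LinearMap.range (toTPlus F X Y) := by
  have hm := barB_multilinear (TPlus A.toGradedQuiver) (fun _ _ _ => mulT) (bT A) X Y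
  refine pureF_induction ((LinearMap.range (toTPlus F X Y)).comap
    (MultiFun.slot hm (.nil _) (.single (toTPlus F Z Y v)) ∘ₗ toTPlus F X Z))
    (fun Z' x c hc => ?_) a
  refine pureF_induction ((LinearMap.range (toTPlus F X Y)).comap
    (MultiFun.slot hm (.single (toTPlus F X Z (pureF F (.cons x c)))) (.nil _) ∘ₗ toTPlus F Z Y))
    (fun W' y d hd => ?_) v
  change barT A X Y (Chain.cons (Q := TPlus A.toGradedQuiver) (toTPlus F X Z (pureF F (.cons x c)))
      (.single (toTPlus F Z Y (pureF F (.cons y d))))) ∈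
    LinearMap.range (toTPlus F X Y)
  rw [toTPlus_pureF (c := .cons x c) hc, toTPlus_pureF (c := .cons y d) hd]
  obtain ⟨V', p, x', e⟩ := Chain.exists_append_single x c
  have hp : (p.append (.single x')).MidIn F := e ▸ hc
  rw [e, barT_pureT_two]
  refine Chain.sumSplits_mem _ _ _ fun U r s e => Chain.sumSplits_mem _ _ _ fun U' d₁ d₂ e' => ?_
  subst e e'
  rw [Chain.append_assoc] at hp
  exact pureT_mem_range (hp.replace _ (Chain.srcIn_sgn 1 ((Chain.srcIn_append _ _).mp hd).2))

theorem barT_mem_range {X Y : (tensorQuiver A.toGradedQuiver F).Obj} (W : Chain (tensorQuiver A.toGradedQuiver F) X Y) :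
    barT A X Y (Chain.map (Q := tensorQuiver A.toGradedQuiver F) (R := TPlus A.toGradedQuiver)
      (fun X => X) (fun X Y => toTPlus F X Y) W) ∈ LinearMap.range (toTPlus F X Y) := by
  cases W with
  | nil => exact zero_mem _
  | cons a W =>
    cases W with
    | nil => exact (congrArg (· ∈ LinearMap.range (toTPlus F X Y))
        (barT_single (toTPlus F X Y a))).mpr (bT_mem_range a)
    | cons w W =>
      obtain ⟨V, U, v, e⟩ := Chain.exists_append_single (Q := tensorQuiver A.toGradedQuiver F) w W
      rw [e]
      cases U with
      | nil => exact barT_two_mem_range a v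
      | cons t U =>
        rw [Chain.map, Chain.map_append]
        have h := bar_mem_range a (chainProd (fun _ _ _ => mulT) (Chain.cons
          (Q := TPlus A.toGradedQuiver) (toTPlus F _ _ t) (Chain.map
            (Q := tensorQuiver A.toGradedQuiver F) (R := TPlus A.toGradedQuiver)
            (fun X => X) (fun X Y => toTPlus F X Y) U))) v
        rw [← barT_append_single] at h
        exact h

/-- The operations `b̄` preserve the direct summand `sD(𝒞|ℬ) ⊆ T⁺s𝒞`. -/
theorem toTPlus_b {X Y : A.Obj} (W : Chain (tensorQuiver A.toGradedQuiver F) X Y) :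
    toTPlus F X Y ((quotientD A F).b W) = barT A X Y (Chain.map
      (Q := tensorQuiver A.toGradedQuiver F) (R := TPlus A.toGradedQuiver) (fun X => X)
      (fun X Y => toTPlus F X Y) W) := by
  obtain ⟨y, hy⟩ := barT_mem_range W
  have h : (quotientD A F).b W = y := (congrArg (ofTPlus F X Y) hy.symm).trans (ofTPlus_toTPlus y)
  rw [h, hy]

theorem toTPlus_injective {X Y : A.Obj} {x y : TensorHom A.toGradedQuiver F X Y}
    (h : toTPlus F X Y x = toTPlus F X Y y) : x = y := by
  rw [← ofTPlus_toTPlus x, h, ofTPlus_toTPlus]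

variable (F) in
theorem toTPlus_isStrict : IsStrict (E := quotientD A F)
    (B := barCat (TPlus A.toGradedQuiver) (fun _ _ _ => mulT) (bT A) mulT_mem (bT_mem A))
    (fun X => X) (toTPlus F) where
  mem _ _ _ _ hx := toTPlus_mem hx
  b c := toTPlus_b c

variable (F) in
theorem quotientD_isAInfCat (hA : A.IsAInfCat) : (quotientD A F).IsAInfCat :=
  (toTPlus_isStrict F).isAInfCat (fun _ _ _ hx => toTPlus_injective (hx.trans (map_zero _).symm))
    (barCat_TPlus_isAInfCat hA)

theorem chainProd_letters {X Z Y : A.Obj} (x : A.shom X Z) (c : Chain A.toGradedQuiver Z Y) :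
    chainProd (fun _ _ _ => mulT) (Chain.map (Q := A.toGradedQuiver) (R := TPlus A.toGradedQuiver)
      (fun X => X) (fun X Y => ofLetter Set.univ X Y) (.cons x c)) = pureT (.cons x c) := by
  induction c generalizing X with
  | nil => rfl
  | cons y c ih => exact (mulT_ofLetter _ _).trans (congrArg (consT _ _ _ x) (ih y))

/-- When every factor is a letter, nothing lies outside the segment that `b` is bound to cover, so
only the full operation of `𝒞` remains. -/
theorem barT_letters {X Y : A.Obj} (c : Chain A.toGradedQuiver X Y) :
    barT A X Y (Chain.map (Q := A.toGradedQuiver) (R := TPlus A.toGradedQuiver) (fun X => X)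
      (fun X Y => ofLetter Set.univ X Y) c) = ofLetter Set.univ X Y (A.b c) := by
  cases c with
  | nil => exact ((congrArg (ofLetter Set.univ X X) (A.b_nil X)).trans (map_zero _)).symm
  | cons z c =>
    cases c with
    | nil =>
      refine (barT_single _).trans ((bT_pureT A (.single z)).trans ?_)
      rw [lsum_bTerms]
      have h0 : pureT (Chain.cons (0 : A.shom X X) (.single (A.sgn 1 _ _ z))) = 0 :=
        MultiFun.cons_zero (pureT_mem_multiFun _ _) _
      simp only [Chain.single] at h0
      simp [Chain.single, A.b_nil, h0, pureT]
    | cons w c =>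
      obtain ⟨V, U, v, e⟩ := Chain.exists_append_single w c
      rw [e]
      cases U with
      | nil =>
        refine (barT_pureT_two (.nil X) z v (.nil Y)).trans ?_
        simp only [Chain.sumSplits_nil]
        rfl
      | cons t U =>
        rw [Chain.map, Chain.map_append]
        refine (barT_append_single _ _ _ _).trans ?_
        have h := chainProd_letters t U
        rw [Chain.map] at h
        rw [h]
        refine (bar_pureT_cons (.nil X) z t U v (.nil Y)).trans ?_
        simp only [Chain.sumSplits_nil]
        rfl

variable (F) in
/-- The embedding of `𝒞` into the quotient is strict. -/
theorem ofLetter_isStrict : IsStrict (E := A) (B := quotientD A F) (fun X => X) (ofLetter F) where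
  mem _ _ _ _ hx := ofLetter_mem hx
  b {X Y} c := by
    refine toTPlus_injective ((toTPlus_ofLetter _).trans ?_)
    refine (barT_letters c).symm.trans (Eq.trans ?_ (toTPlus_b _).symm)
    refine congrArg (barT A X Y) ?_
    refine Eq.trans ?_ (Chain.map_map (Q := A.toGradedQuiver)
      (R := tensorQuiver A.toGradedQuiver F) (S := TPlus A.toGradedQuiver) (fun X => X)
      (fun X Y => ofLetter F X Y) (fun X => X) (fun X Y => toTPlus F X Y) c).symm
    simp only [toTPlus_ofLetter]

end Quotient

end AInf
end

noncomputable section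

namespace AInf

open scoped TensorProduct DirectSum

variable {k : Type w} [CommRing k]

/-! ### Contractions -/

/-- Complexes of morphisms to a contractible object are contractible. -/
theorem PreAInfCat.IsUnital.exists_contraction {A : PreAInfCat.{w, u, v} k} (hA : A.IsUnital)
    {F : Set A.Obj} (hF : A.IsContractibleOn F) :
    ∃ h : ∀ X Y, A.shom X Y →ₗ[k] A.shom X Y,
      (∀ X Y d, ∀ x ∈ A.grade X Y d, h X Y x ∈ A.grade X Y (d + -1)) ∧
      ∀ X, ∀ Y ∈ F, ∀ x, A.b₁L X Y (h X Y x) + h X Y (A.b₁L X Y x) = x := by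
  suffices H : ∀ X Y, ∃ h : A.shom X Y →ₗ[k] A.shom X Y,
      (∀ d, ∀ x ∈ A.grade X Y d, h x ∈ A.grade X Y (d + -1)) ∧
      (Y ∈ F → ∀ x, A.b₁L X Y (h x) + h (A.b₁L X Y x) = x) by
    choose h h1 h2 using H
    exact ⟨h, h1, h2⟩
  intro X Y
  by_cases hY : Y ∈ F
  swap
  · exact ⟨0, fun _ _ _ => zero_mem _, fun h => absurd h hY⟩
  obtain ⟨hA, i, hi⟩ := hA
  obtain ⟨g, hg, hg'⟩ := hF Y hY Y hY
  obtain ⟨ι, hι, hιb, ψ, h, -, hψ, hh, -, ψb, ψφ, -⟩ : ∃ ι : A.shom Y Y, ι ∈ A.grade Y Y (0 + -1) ∧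
      A.b₁L Y Y ι = 0 ∧ IsHomotopyInvertible A fun x : A.shom X Y => A.b (.cons x (.single ι)) :=
    ⟨i.app (.nil Y), i.app_degree _ 0 (.nil Y), hi.natural.b₁_app_nil Y,
      hi.right X Y⟩
  rw [zero_add] at hι
  -- As `ι` is a cycle in a contractible complex, it is the boundary of `e`.
  let e := g ι
  have he : e ∈ A.grade Y Y (-2) := by
    have := hg _ _ hι
    rwa [show (-1 + -1 : ℤ) = -2 by norm_num] at this
  have heb : A.b₁L Y Y e = ι := by
    have h1 := hg' ι
    have h2 : A.b₁ ι = 0 := hιb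
    rw [h2, map_zero, add_zero] at h1
    exact h1
  have hes : A.sgn 1 Y Y e = e := by
    rw [A.sgn_of_mem 1 he, koszul_even (by decide), one_smul]
  -- Hence right multiplication by `ι` is null-homotopic, by right multiplication with `e` up to
  -- sign.
  have key : ∀ x, A.b (.cons x (.single ι)) =
      -(A.b₁L X Y (rightMul X e x) + rightMul X e (A.b₁L X Y x)) := by
    intro x
    have h1 := hA.b₁_b₂ x e
    rw [hes, heb] at h1
    rw [eq_neg_iff_add_eq_zero, add_comm]
    exact h1
  have ψb' : ∀ x, A.b₁L X Y (ψ x) = ψ (A.b₁L X Y x) := ψb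
  have ψφ' : ∀ x, ψ (A.b (.cons x (.single ι))) =
    x + A.b₁L X Y (h x) + h (A.b₁L X Y x) := ψφ
  -- The composite of `ψ` with multiplication by `ι` is null-homotopic through `ψ` after `rightMul X
  -- e`, and `h` accounts for its difference from the identity.
  refine ⟨-(ψ ∘ₗ rightMul X e + h), fun d x hx => ?_, fun _ x => ?_⟩
  · refine neg_mem (add_mem ?_ (hh d x hx))
    have h1 := A.b_degree _ _ (.cons hx (.single he))
    have h2 := hψ _ _ h1
    rwa [show d + -2 + 1 + 0 = d + -1 by ring] at h2
  · have h1 := ψφ' x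
    rw [key, map_neg, map_add, ← ψb'] at h1
    simp only [LinearMap.neg_apply, LinearMap.add_apply, LinearMap.comp_apply, map_neg, map_add]
    have h2 : x = -(A.b₁L X Y (ψ (rightMul X e x)) + ψ (rightMul X e (A.b₁L X Y x))) -
        A.b₁L X Y (h x) - h (A.b₁L X Y x) := by
      rw [h1]; abel
    conv_rhs => rw [h2]
    abel

/-! ### The homotopy on tensors -/

section HeadHomotopy

variable {A : PreAInfCat.{w, u, v} k} (h : ∀ X Y, A.shom X Y →ₗ[k] A.shom X Y)

/-- The tensor `(x₁ ⊗ ⋯ ⊗ xₙ)(h ⊗ 1^{⊗(n-1)})` if `n ≥ 2`. -/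
def headTerm : ∀ {X Y : A.Obj}, Chain A.toGradedQuiver X Y → TensorHom A.toGradedQuiver Set.univ X Y
  | _, _, .nil _ => 0
  | _, _, .cons _ (.nil _) => 0
  | _, _, .cons x (.cons y c) => pureT (.cons (h _ _ x) (Chain.sgn 1 (.cons y c)))

theorem headTerm_cons_append {X Y Z W V : A.Obj} (z : A.shom X Y) (p : Chain A.toGradedQuiver Y Z)
    (x : A.shom Z W) (q : Chain A.toGradedQuiver W V) :
    headTerm h (.cons z (p.append (.cons x q))) =
      pureT (.cons (h _ _ z) ((p.append (.cons x q)).sgn 1)) := by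
  cases p <;> rfl

theorem headTerm_multilinear (X Y : A.Obj) : (headTerm h : Chain A.toGradedQuiver X Y → _) ∈
    MultiFun A.toGradedQuiver X Y (TensorHom A.toGradedQuiver Set.univ X Y) := by
  intro Z W p q a x y
  cases p with
  | nil =>
    cases q with
    | nil => simp [headTerm]
    | cons z q =>
      simp only [Chain.nil_append, headTerm, map_add, map_smul]
      exact pureT_mem_multiFun X Y (.nil X) _ a _ _
  | cons z p =>
    simp only [Chain.cons_append, headTerm_cons_append]
    exact MultiFun.sgn (MultiFun.prepend_cons (pureT_mem_multiFun X Y) (h _ _ z)) 1 p q a x y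

theorem headTerm_mem {h : ∀ X Y, A.shom X Y →ₗ[k] A.shom X Y}
    (hh : ∀ X Y d, ∀ x ∈ A.grade X Y d, h X Y x ∈ A.grade X Y (d + -1)) {X Y : A.Obj}
    {c : Chain A.toGradedQuiver X Y} {d : ℤ} (hc : c.HasDegree d) :
    headTerm h c ∈ (TPlus A.toGradedQuiver).grade X Y (d + -1) := by
  cases hc with
  | nil => exact zero_mem _
  | @cons _ _ _ x c d e hx hc =>
    cases hc with
    | nil => exact zero_mem _
    | cons hy hc =>
      have := pureT_mem (.cons (hh _ _ _ _ hx) ((Chain.HasDegree.cons hy hc).sgn 1))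
      rwa [add_right_comm] at this

/-- The map `(x₁ ⊗ ⋯ ⊗ xₙ) ↦ (x₁ ⊗ ⋯ ⊗ xₙ)(h ⊗ 1^{⊗(n-1)})`, `n ≥ 2`, on `T⁺s𝒞`. -/
def headT (X Y : A.Obj) : TensorHom A.toGradedQuiver Set.univ X Y →ₗ[k]
    TensorHom A.toGradedQuiver Set.univ X Y :=
  liftT ⟨headTerm h, headTerm_multilinear h X Y⟩

theorem headT_pureT {X Y : A.Obj} (c : Chain A.toGradedQuiver X Y) :
    headT h X Y (pureT c) = headTerm h c := by
  cases c with
  | nil => exact map_zero (headT h X X)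
  | cons x c => exact liftT_pureT _ x c

/-- The terms in which `b` starts at the first letter are separated from those behind it; an empty
segment in front contributes nothing because `b₀ = 0`. -/
theorem lsum_bTerms_cons {M : Type*} [AddCommGroup M] [Module k M] {X Y Z : A.Obj}
    (x : A.shom X Z) (c : Chain A.toGradedQuiver Z Y) {φ : Chain A.toGradedQuiver X Y → M}
    (hφ : φ ∈ MultiFun A.toGradedQuiver X Y M) :
    lsum (A.bTerms (.cons x c)) φ =
      (c.sumSplits fun _ m q => φ (.cons (A.b (.cons x m)) (q.sgn 1))) +
      lsum (A.bTerms c) fun z => φ (.cons x z) := by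
  rw [lsum_bTerms, lsum_bTerms, Chain.sumSplits_cons, Chain.sumSplits_cons, A.b_nil]
  simp only [Chain.nil_append, Chain.cons_append]
  rw [MultiFun.cons_zero hφ, zero_add]

/-- The homotopy between the identity and a map decreasing the length of tensors. -/
theorem bT_headT {X Z W Y : A.Obj} (x : A.shom X Z) (y : A.shom Z W)
    (c : Chain A.toGradedQuiver W Y)
    (hx : A.b₁L X Z (h X Z x) + h X Z (A.b₁L X Z x) = x) :
    bT A X Y (headT h X Y (pureT (.cons x (.cons y c)))) +
        headT h X Y (bT A X Y (pureT (.cons x (.cons y c)))) =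
      pureT (.cons x (.cons y c)) + c.sumSplits fun _ m q =>
        (pureT (.cons (A.b (.cons (h X Z x) (.cons (A.sgn 1 _ _ y) (m.sgn 1)))) q) +
        headTerm h (.cons (A.b (.cons x (.cons y m))) (q.sgn 1))) := by
  have hm := headTerm_multilinear h X Y
  have ss : ∀ {X Y : A.Obj} (q : Chain A.toGradedQuiver X Y), (q.sgn 1).sgn 1 = q := fun q => by
    rw [Chain.sgn_sgn]; exact Chain.sgn_even ⟨1, rfl⟩ q
  have h1 : bT A X Y (headT h X Y (pureT (.cons x (.cons y c)))) =
      (Chain.sumSplits (.cons y c) fun _ m q => pureT (.cons (A.b (.cons (h X Z x) (m.sgn 1))) q)) -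
      lsum (A.bTerms (.cons y c)) fun z => pureT (.cons (h X Z x) (z.sgn 1)) := by
    rw [headT_pureT]
    refine (bT_pureT A (.cons (h X Z x) (Chain.sgn 1 (.cons y c)))).trans ?_
    rw [lsum_bTerms_cons _ _ (pureT_mem_multiFun X Y), Chain.sumSplits_sgn,
      lsum_bTerms_sgn 1 (MultiFun.prepend_cons (pureT_mem_multiFun X Y) (h X Z x)), koszul_one,
      neg_one_smul, ← sub_eq_add_neg]
    simp only [ss]
  -- The terms in which `b` stays behind the first letter occur here with the sign opposite to that
  -- in `h1`, since `h` is odd, and they will cancel.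
  have h2 : headT h X Y (bT A X Y (pureT (.cons x (.cons y c)))) =
      (Chain.sumSplits (.cons y c) fun _ m q => headTerm h (.cons (A.b (.cons x m)) (q.sgn 1))) +
      lsum (A.bTerms (.cons y c)) fun z => pureT (.cons (h X Z x) (z.sgn 1)) := by
    rw [bT_pureT]
    refine (map_lsum (headT h X Y).toAddMonoidHom _ _).trans ?_
    refine (lsum_congr fun z _ => headT_pureT h z).trans ?_
    rw [lsum_bTerms_cons _ _ hm]
    congr 1
    rw [lsum_bTerms, lsum_bTerms]
    refine Chain.sumSplits_congr _ fun _ p c' => Chain.sumSplits_congr _ fun _ m q => ?_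
    exact headTerm_cons_append h x p (A.b m) (q.sgn 1)
  -- The terms in which `b` acts on the first letter alone are the two halves of the contraction
  -- identity and return the original word.
  have h3 : pureT (.cons (A.b₁L X Z (h X Z x)) (.cons y c)) +
      pureT (.cons (h X Z (A.b₁L X Z x)) (.cons y c)) = pureT (.cons x (.cons y c)) := by
    refine (map_add (MultiFun.slot (pureT_mem_multiFun X Y) (.nil X) (.cons y c)) _ _).symm.trans ?_
    rw [hx]
    rfl
  have h4 : headTerm h (.cons (A.b₁L X Z x) (Chain.sgn 1 (.cons y c))) =
      pureT (.cons (h X Z (A.b₁L X Z x)) (.cons y c)) := by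
    refine Eq.trans ?_ (congrArg (fun q => pureT (.cons (h X Z (A.b₁L X Z x)) q))
      (ss (.cons y c)))
    rfl
  rw [h1, h2, Chain.sumSplits_cons, Chain.sumSplits_cons, Chain.sumSplits_add, ← h3, ← h4]
  simp only [Chain.sgn_nil, Chain.sgn_cons]
  rw [show A.b (.cons (h X Z x) (.nil Z)) = A.b₁L X Z (h X Z x) from rfl,
    show A.b (.cons x (.nil Z)) = A.b₁L X Z x from rfl]
  abel

end HeadHomotopy

end AInf
end

noncomputable section

namespace AInf

open scoped TensorProduct DirectSum

variable {k : Type w} [CommRing k]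

/-! ### The retraction of the quotient onto the original category -/

section Words

variable {A : PreAInfCat.{w, u, v} k} {F : Set A.Obj}

variable (F) in
/-- The differential of the quotient. -/
def dF (X Y : A.Obj) : Module.End k (TensorHom A.toGradedQuiver F X Y) :=
  ofTPlus F X Y ∘ₗ bT A X Y ∘ₗ toTPlus F X Y

theorem quotientD_b₁L {X Y : A.Obj} (w : TensorHom A.toGradedQuiver F X Y) :
    (quotientD A F).b₁L X Y w = dF F X Y w :=
  congrArg (ofTPlus F X Y) (barT_single (toTPlus F X Y w))

theorem toTPlus_dF {X Y : A.Obj} (w : TensorHom A.toGradedQuiver F X Y) :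
    toTPlus F X Y (dF F X Y w) = bT A X Y (toTPlus F X Y w) := by
  obtain ⟨y, hy⟩ := bT_mem_range w
  rw [dF, LinearMap.comp_apply, LinearMap.comp_apply, ← hy, ofTPlus_toTPlus]

theorem dF_dF (hA : A.IsAInfCat) {X Y : A.Obj} (w : TensorHom A.toGradedQuiver F X Y) :
    dF F X Y (dF F X Y w) = 0 := by
  refine toTPlus_injective ?_
  rw [toTPlus_dF, toTPlus_dF, bT_bT hA, map_zero]

theorem dF_pureF {X Y : A.Obj} {c : Chain A.toGradedQuiver X Y} (hc : c.MidIn F) :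
    dF F X Y (pureF F c) = lsum (A.bTerms c) (pureF F) := by
  rw [dF, LinearMap.comp_apply, LinearMap.comp_apply, toTPlus_pureF hc, bT_pureT]
  exact map_lsum (ofTPlus F X Y).toAddMonoidHom _ _

variable (F) in
/-- The span of the words with at most `m` letters. -/
def words (m : ℕ) (X Y : A.Obj) : Submodule k (TensorHom A.toGradedQuiver F X Y) :=
  Submodule.span k {w | ∃ (Z : A.Obj) (x : A.shom X Z) (c : Chain A.toGradedQuiver Z Y),
    c.SrcIn F ∧ c.length < m ∧ pureF F (.cons x c) = w}

theorem pureF_mem_words {m : ℕ} {X Z Y : A.Obj} (x : A.shom X Z) {c : Chain A.toGradedQuiver Z Y}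
    (hc : c.SrcIn F) (hm : c.length < m) : pureF F (.cons x c) ∈ words F m X Y :=
  Submodule.subset_span ⟨Z, x, c, hc, hm, rfl⟩

theorem words_induction {m : ℕ} {X Y : A.Obj}
    (S : Submodule k (TensorHom A.toGradedQuiver F X Y))
    (h : ∀ Z (x : A.shom X Z) (c : Chain A.toGradedQuiver Z Y), c.SrcIn F → c.length < m →
      pureF F (.cons x c) ∈ S) {w : TensorHom A.toGradedQuiver F X Y} (hw : w ∈ words F m X Y) :
    w ∈ S := by
  refine (Submodule.span_le.mpr ?_ : words F m X Y ≤ S) hw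
  rintro _ ⟨Z, x, c, hc, hm, rfl⟩
  exact h Z x c hc hm

theorem exists_ofLetter {X Y : A.Obj} {w : TensorHom A.toGradedQuiver F X Y}
    (hw : w ∈ words F 1 X Y) : w ∈ LinearMap.range (ofLetter F X Y) := by
  refine words_induction _ (fun Z x c _ hm => ?_) hw
  cases c with
  | nil => exact ⟨x, (pureF_single x).symm⟩
  | cons y c => simp at hm

theorem ofLetter_mem_words {m : ℕ} {X Y : A.Obj} (x : A.shom X Y) :
    ofLetter F X Y x ∈ words F (m + 1) X Y := by
  rw [← pureF_single x]
  exact pureF_mem_words (c := .nil Y) x trivial (by simp)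

theorem dF_ofLetter {X Y : A.Obj} (x : A.shom X Y) :
    dF F X Y (ofLetter F X Y x) = ofLetter F X Y (A.b₁L X Y x) :=
  (quotientD_b₁L _).symm.trans ((ofLetter_isStrict F).b (.single x)).symm

/-- A nonempty segment is replaced by one letter, so words never become longer. -/
theorem dF_mem_words {m : ℕ} {X Y : A.Obj} {w : TensorHom A.toGradedQuiver F X Y}
    (hw : w ∈ words F m X Y) : dF F X Y w ∈ words F m X Y := by
  refine words_induction ((words F m X Y).comap (dF F X Y)) (fun Z x c hc hm => ?_) hw
  change dF F X Y (pureF F (.cons x c)) ∈ words F m X Y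
  rw [dF_pureF (c := .cons x c) hc, lsum_bTerms_cons _ _ (pureF_mem_multiFun X Y), lsum_bTerms]
  refine add_mem (Chain.sumSplits_mem _ _ _ fun W m q e => ?_)
    (Chain.sumSplits_mem _ _ _ fun W p c' e => Chain.sumSplits_mem _ _ _ fun V m q e' => ?_)
  · subst e
    simp only [Chain.length_append] at hm
    exact pureF_mem_words _ (Chain.srcIn_sgn 1 ((Chain.srcIn_append m q).mp hc).2)
      (by rw [Chain.length_sgn]; omega)
  · subst e e'
    cases m with
    | nil =>
      rw [A.b_nil]
      rw [MultiFun.slot_zero (MultiFun.prepend_cons (pureF_mem_multiFun X Y) x)]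
      exact zero_mem _
    | cons y m =>
      simp only [Chain.length_append, Chain.length_cons] at hm
      have h1 := (Chain.srcIn_append p _).mp hc
      have h2 := (Chain.srcIn_append _ q).mp h1.2
      refine pureF_mem_words _ ((Chain.srcIn_append p _).mpr ⟨h1.1, h1.2.1,
        Chain.srcIn_sgn 1 h2.2⟩) ?_
      simp only [Chain.length_append, Chain.length_cons, Chain.length_sgn]
      omega

variable (F) (h : ∀ X Y, A.shom X Y →ₗ[k] A.shom X Y)

/-- The homotopy on the quotient. -/
def headF (X Y : A.Obj) : Module.End k (TensorHom A.toGradedQuiver F X Y) :=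
  ofTPlus F X Y ∘ₗ headT h X Y ∘ₗ toTPlus F X Y

/-- A map homotopic to the identity which shortens words. -/
def shorten (X Y : A.Obj) : Module.End k (TensorHom A.toGradedQuiver F X Y) :=
  1 - (dF F X Y * headF F h X Y + headF F h X Y * dF F X Y)

theorem shorten_apply {X Y : A.Obj} (w : TensorHom A.toGradedQuiver F X Y) :
    shorten F h X Y w = w - (dF F X Y (headF F h X Y w) + headF F h X Y (dF F X Y w)) := by
  rw [shorten, LinearMap.sub_apply, LinearMap.add_apply, Module.End.mul_apply,
    Module.End.mul_apply, Module.End.one_apply]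

variable {F}

theorem headF_pureF {X Y : A.Obj} {c : Chain A.toGradedQuiver X Y} (hc : c.MidIn F) :
    headF F h X Y (pureF F c) = ofTPlus F X Y (headTerm h c) := by
  rw [headF, LinearMap.comp_apply, LinearMap.comp_apply, toTPlus_pureF hc, headT_pureT]

theorem headF_ofLetter {X Y : A.Obj} (x : A.shom X Y) : headF F h X Y (ofLetter F X Y x) = 0 := by
  rw [← pureF_single x, headF_pureF (c := .single x) h trivial]
  exact map_zero _

theorem ofTPlus_headTerm_mem {m : ℕ} {X Z Y : A.Obj} (x : A.shom X Z)
    {c : Chain A.toGradedQuiver Z Y} (hc : c.SrcIn F) (hm : c.length < m) :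
    ofTPlus F X Y (headTerm h (.cons x c)) ∈ words F m X Y := by
  cases c with
  | nil => exact (congrArg (· ∈ words F m X Z) (map_zero (ofTPlus F X Z))).mpr (zero_mem _)
  | cons y c =>
    exact pureF_mem_words (c := Chain.sgn 1 (.cons y c)) (h _ _ x) (Chain.srcIn_sgn 1 hc)
      (by rwa [Chain.length_sgn])

theorem headTerm_mem_range {X Y : A.Obj} {c : Chain A.toGradedQuiver X Y} (hc : c.MidIn F) :
    headTerm h c ∈ LinearMap.range (toTPlus F X Y) := by
  cases c with
  | nil => exact zero_mem _
  | cons x c =>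
    cases c with
    | nil => exact zero_mem _
    | cons y c =>
      exact pureT_mem_range (c := .cons (h _ _ x) (Chain.sgn 1 (.cons y c))) (Chain.srcIn_sgn 1 hc)

theorem shorten_ofLetter {X Y : A.Obj} (x : A.shom X Y) :
    shorten F h X Y (ofLetter F X Y x) = ofLetter F X Y x := by
  rw [shorten_apply, headF_ofLetter, dF_ofLetter, headF_ofLetter, map_zero, add_zero, sub_zero]

variable {h} (hc : ∀ X, ∀ Y ∈ F, ∀ x, A.b₁L X Y (h X Y x) + h X Y (A.b₁L X Y x) = x)

include hc

/-- The target of the first letter is an intermediate object of the word, hence lies in `F`, and the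
contraction identity is available for that letter. -/
theorem shorten_pureF {X Z W Y : A.Obj} (x : A.shom X Z) (y : A.shom Z W)
    (c : Chain A.toGradedQuiver W Y) (hZ : (Chain.cons y c).SrcIn F) :
    shorten F h X Y (pureF F (.cons x (.cons y c))) = - c.sumSplits fun _ m q =>
        (pureF F (.cons (A.b (.cons (h X Z x) (.cons (A.sgn 1 _ _ y) (m.sgn 1)))) q) +
        ofTPlus F X Y (headTerm h (.cons (A.b (.cons x (.cons y m))) (q.sgn 1)))) := by
  have hw : (Chain.cons x (.cons y c)).MidIn F := hZ
  have h1 : dF F X Y (headF F h X Y (pureF F (.cons x (.cons y c)))) =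
      ofTPlus F X Y (bT A X Y (headT h X Y (pureT (.cons x (.cons y c))))) := by
    obtain ⟨t, ht⟩ := headTerm_mem_range h hw
    rw [headF_pureF h hw, headT_pureT, ← ht, ofTPlus_toTPlus]
    rfl
  have h2 : headF F h X Y (dF F X Y (pureF F (.cons x (.cons y c)))) =
      ofTPlus F X Y (headT h X Y (bT A X Y (pureT (.cons x (.cons y c))))) := by
    rw [headF, LinearMap.comp_apply, LinearMap.comp_apply, toTPlus_dF, toTPlus_pureF hw]
  rw [shorten_apply, h1, h2, ← map_add, bT_headT h x y c (hc X Z hZ.1 x), map_add]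
  refine (sub_add_cancel_left _ _).trans (congrArg Neg.neg ?_)
  refine (Chain.map_sumSplits (ofTPlus F X Y).toAddMonoidHom _ _).trans ?_
  exact Chain.sumSplits_congr _ fun _ m q => map_add (ofTPlus F X Y) _ _

/-- In each surviving term `b` has merged at least the first two letters; words of one letter are
fixed. -/
theorem shorten_mem_words {m : ℕ} {X Y : A.Obj} {w : TensorHom A.toGradedQuiver F X Y}
    (hw : w ∈ words F (m + 2) X Y) : shorten F h X Y w ∈ words F (m + 1) X Y := by
  refine words_induction ((words F (m + 1) X Y).comap (shorten F h X Y)) (fun Z x c hZ hm => ?_) hw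
  change shorten F h X Y (pureF F (.cons x c)) ∈ words F (m + 1) X Y
  cases c with
  | nil =>
    have h1 := pureF_single (F := F) x
    rw [Chain.single] at h1
    rw [h1, shorten_ofLetter]
    exact ofLetter_mem_words x
  | cons y c =>
    rw [shorten_pureF hc x y c hZ]
    refine neg_mem (Chain.sumSplits_mem _ _ _ fun V n q e => add_mem ?_ ?_)
    · subst e
      simp only [Chain.length_cons, Chain.length_append] at hm
      exact pureF_mem_words _ ((Chain.srcIn_append n q).mp hZ.2).2 (by omega)
    · subst e
      simp only [Chain.length_cons, Chain.length_append] at hm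
      exact ofTPlus_headTerm_mem h _ (Chain.srcIn_sgn 1 ((Chain.srcIn_append n q).mp hZ.2).2)
        (by rw [Chain.length_sgn]; omega)

theorem shorten_pow_mem_words {m : ℕ} {X Y : A.Obj} {w : TensorHom A.toGradedQuiver F X Y}
    (hw : w ∈ words F (m + 1) X Y) : (shorten F h X Y ^ m) w ∈ words F 1 X Y := by
  induction m generalizing w with
  | zero => exact hw
  | succ m ih =>
    rw [pow_succ, Module.End.mul_apply]
    exact ih (shorten_mem_words hc hw)

omit hc in
theorem shorten_pow_eq_self (n : ℕ) {X Y : A.Obj} {w : TensorHom A.toGradedQuiver F X Y}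
    (hw : w ∈ words F 1 X Y) : (shorten F h X Y ^ n) w = w := by
  obtain ⟨x, rfl⟩ := exists_ofLetter hw
  induction n with
  | zero => rfl
  | succ n ih => rw [pow_succ, Module.End.mul_apply, shorten_ofLetter, ih]

/-- After `m` steps only letters are left, and further steps fix them. -/
theorem shorten_pow_eq {m n : ℕ} (hmn : m ≤ n) {X Y : A.Obj}
    {w : TensorHom A.toGradedQuiver F X Y} (hw : w ∈ words F (m + 1) X Y) :
    (shorten F h X Y ^ n) w = (shorten F h X Y ^ m) w := by
  obtain ⟨j, rfl⟩ := Nat.exists_eq_add_of_le' hmn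
  rw [pow_add, Module.End.mul_apply, shorten_pow_eq_self j (shorten_pow_mem_words hc hw)]

end Words

end AInf
end

/-! ### The projection and the homotopy obtained by iterated shortening. -/

noncomputable section

namespace AInf

open scoped TensorProduct DirectSum

variable {k : Type w} [CommRing k]

section Retraction

variable {A : PreAInfCat.{w, u, v} k} {F : Set A.Obj} (h : ∀ X Y, A.shom X Y →ₗ[k] A.shom X Y)

/-- A linear operator depending on the length, applied to a pure tensor, is multilinear. -/
theorem lengthwise_multilinear {M : Type*} [AddCommGroup M] [Module k M] {X Y : A.Obj}
    (T : ℕ → TensorHom A.toGradedQuiver F X Y →ₗ[k] M) :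
    (fun c : Chain A.toGradedQuiver X Y => T c.length (pureF F c)) ∈
      MultiFun A.toGradedQuiver X Y M := by
  intro Z W p q a x y
  simp only [Chain.length_append, Chain.length_cons]
  exact MultiFun.comp_linear (pureF_mem_multiFun X Y) (T (p.length + (q.length + 1))) p q a x y

/-- The map which is `T n` on words of length `n`. -/
def lengthwise {M : Type v₁} [AddCommGroup M] [Module k M] {X Y : A.Obj}
    (T : ℕ → TensorHom A.toGradedQuiver F X Y →ₗ[k] M) :
    TensorHom A.toGradedQuiver F X Y →ₗ[k] M :=
  liftT ⟨_, lengthwise_multilinear T⟩ ∘ₗ toTPlus F X Y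

theorem lengthwise_pureF {M : Type v₁} [AddCommGroup M] [Module k M] {X Z Y : A.Obj}
    (T : ℕ → TensorHom A.toGradedQuiver F X Y →ₗ[k] M) (x : A.shom X Z)
    {c : Chain A.toGradedQuiver Z Y} (hc : c.SrcIn F) :
    lengthwise T (pureF F (.cons x c)) = T (c.length + 1) (pureF F (.cons x c)) := by
  rw [lengthwise, LinearMap.comp_apply, toTPlus_pureF (c := .cons x c) hc]
  exact liftT_pureT _ x c

/-- The hypothesis `hT` makes the operators constant from the length of a word on, so any upper
bound for the length may take its place. -/
theorem lengthwise_words {M : Type v₁} [AddCommGroup M] [Module k M] {X Y : A.Obj}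
    (T : ℕ → TensorHom A.toGradedQuiver F X Y →ₗ[k] M)
    (hT : ∀ m n w, m < n → w ∈ words F (m + 1) X Y → T n w = T (m + 1) w) {m : ℕ}
    {w : TensorHom A.toGradedQuiver F X Y} (hw : w ∈ words F m X Y) : lengthwise T w = T m w := by
  refine words_induction (LinearMap.eqLocus (lengthwise T) (T m)) (fun Z x c hc hm => ?_) hw
  exact (lengthwise_pureF T x hc).trans (hT _ _ _ hm (pureF_mem_words x hc (by omega))).symm

theorem lengthwise_mem {M : Type v₁} [AddCommGroup M] [Module k M] {X Y : A.Obj}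
    (T : ℕ → TensorHom A.toGradedQuiver F X Y →ₗ[k] M) {S : Submodule k M} {d : ℤ}
    (hT : ∀ n, ∀ w ∈ (tensorQuiver A.toGradedQuiver F).grade X Y d, T n w ∈ S)
    {w : TensorHom A.toGradedQuiver F X Y}
    (hw : w ∈ (tensorQuiver A.toGradedQuiver F).grade X Y d) : lengthwise T w ∈ S :=
  liftT_mem (fun _ hc => hT _ _ (pureF_mem hc)) (toTPlus_mem hw)

variable (F) in
/-- The projection of the quotient onto the words with one letter. -/
def projF (X Y : A.Obj) : TensorHom A.toGradedQuiver F X Y →ₗ[k] TensorHom A.toGradedQuiver F X Y :=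
  lengthwise fun n => shorten F h X Y ^ n

variable (F) in
/-- The homotopy between the identity of the quotient and the projection. -/
def homF (X Y : A.Obj) : TensorHom A.toGradedQuiver F X Y →ₗ[k] TensorHom A.toGradedQuiver F X Y :=
  lengthwise fun n => ∑ i ∈ Finset.range n, headF F h X Y * shorten F h X Y ^ i

variable {h} (hh : ∀ X Y d, ∀ x ∈ A.grade X Y d, h X Y x ∈ A.grade X Y (d + -1))
  (hc : ∀ X, ∀ Y ∈ F, ∀ x, A.b₁L X Y (h X Y x) + h X Y (A.b₁L X Y x) = x)

section

include hc

theorem projF_words {m : ℕ} {X Y : A.Obj} {w : TensorHom A.toGradedQuiver F X Y}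
    (hw : w ∈ words F m X Y) : projF F h X Y w = (shorten F h X Y ^ m) w :=
  lengthwise_words _ (fun m n w hmn hw => by
    rw [shorten_pow_eq hc (by omega : m ≤ n) hw, shorten_pow_eq hc (by omega : m ≤ m + 1) hw]) hw

/-- By then the word has been shortened to letters, which `headF` annihilates; thus the sum defining
the homotopy may be prolonged freely. -/
theorem headF_shorten_pow {m n : ℕ} (hmn : m ≤ n) {X Y : A.Obj}
    {w : TensorHom A.toGradedQuiver F X Y} (hw : w ∈ words F (m + 1) X Y) :
    headF F h X Y ((shorten F h X Y ^ n) w) = 0 := by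
  rw [shorten_pow_eq hc hmn hw]
  obtain ⟨x, hx⟩ := exists_ofLetter (shorten_pow_mem_words hc hw)
  rw [← hx, headF_ofLetter]

theorem homF_words {m : ℕ} {X Y : A.Obj} {w : TensorHom A.toGradedQuiver F X Y}
    (hw : w ∈ words F m X Y) : homF F h X Y w =
      ∑ i ∈ Finset.range m, headF F h X Y ((shorten F h X Y ^ i) w) := by
  refine (lengthwise_words _ (fun m n w hmn hw => ?_) hw).trans ?_
  · simp only [LinearMap.sum_apply, Module.End.mul_apply]
    refine (Finset.sum_subset (Finset.range_subset_range.mpr hmn) fun i _ hi => ?_).symm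
    rw [Finset.mem_range] at hi
    exact headF_shorten_pow hc (by omega) hw
  · simp only [LinearMap.sum_apply, Module.End.mul_apply]

theorem projF_mem_words {X Y : A.Obj} (w : TensorHom A.toGradedQuiver F X Y) :
    projF F h X Y w ∈ words F 1 X Y := by
  refine pureF_induction ((words F 1 X Y).comap (projF F h X Y)) (fun Z x c hZ => ?_) w
  change projF F h X Y (pureF F (.cons x c)) ∈ words F 1 X Y
  have hw : pureF F (.cons x c) ∈ words F (c.length + 1) X Y := pureF_mem_words x hZ (by omega)
  rw [projF_words hc hw, shorten_pow_eq hc (by omega : c.length ≤ c.length + 1) hw]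
  exact shorten_pow_mem_words hc hw

end

theorem dF_shorten (hA : A.IsAInfCat) {X Y : A.Obj} (w : TensorHom A.toGradedQuiver F X Y) :
    shorten F h X Y (dF F X Y w) = dF F X Y (shorten F h X Y w) := by
  rw [shorten_apply, shorten_apply, dF_dF hA, map_zero, add_zero, map_sub, map_add, dF_dF hA,
    zero_add]

theorem dF_shorten_pow (hA : A.IsAInfCat) (n : ℕ) {X Y : A.Obj}
    (w : TensorHom A.toGradedQuiver F X Y) :
    (shorten F h X Y ^ n) (dF F X Y w) = dF F X Y ((shorten F h X Y ^ n) w) := by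
  induction n generalizing w with
  | zero => rfl
  | succ n ih => rw [pow_succ, Module.End.mul_apply, Module.End.mul_apply, dF_shorten hA, ih]

-- Write `d`, `h`, `s` for `dF`, `headF`, `shorten`. Since `dh + hd = 1 - s` and `s` commutes with
-- `d`, the sum of `(dh + hd)sⁱ` over `i < n` telescopes to `1 - sⁿ`.
include hc in
theorem homF_homotopy (hA : A.IsAInfCat) {X Y : A.Obj} (w : TensorHom A.toGradedQuiver F X Y) :
    dF F X Y (homF F h X Y w) + homF F h X Y (dF F X Y w) = w - projF F h X Y w := by
  refine pureF_induction (LinearMap.eqLocus (dF F X Y ∘ₗ homF F h X Y + homF F h X Y ∘ₗ dF F X Y)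
    (LinearMap.id - projF F h X Y)) (fun Z x c hZ => ?_) w
  change dF F X Y (homF F h X Y (pureF F (.cons x c))) +
    homF F h X Y (dF F X Y (pureF F (.cons x c))) =
    pureF F (.cons x c) - projF F h X Y (pureF F (.cons x c))
  have hw : pureF F (.cons x c) ∈ words F (c.length + 1) X Y := pureF_mem_words x hZ (by omega)
  rw [homF_words hc hw, homF_words hc (dF_mem_words hw), projF_words hc hw, map_sum,
    ← Finset.sum_add_distrib]
  refine Eq.trans ?_ (Finset.sum_range_sub' (fun i => (shorten F h X Y ^ i) (pureF F (.cons x c)))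
    (c.length + 1))
  refine Finset.sum_congr rfl fun i _ => ?_
  rw [dF_shorten_pow hA, pow_succ', Module.End.mul_apply, shorten_apply, sub_sub_cancel]

include hh in
theorem headF_mem {X Y : A.Obj} {d : ℤ} {w : TensorHom A.toGradedQuiver F X Y}
    (hw : w ∈ (tensorQuiver A.toGradedQuiver F).grade X Y d) :
    headF F h X Y w ∈ (tensorQuiver A.toGradedQuiver F).grade X Y (d + -1) :=
  ofTPlus_mem (liftT_mem (fun _ hc => headTerm_mem hh hc) (toTPlus_mem hw))

theorem dF_mem {X Y : A.Obj} {d : ℤ} {w : TensorHom A.toGradedQuiver F X Y}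
    (hw : w ∈ (tensorQuiver A.toGradedQuiver F).grade X Y d) :
    dF F X Y w ∈ (tensorQuiver A.toGradedQuiver F).grade X Y (d + 1) :=
  ofTPlus_mem (bT_mem A (toTPlus_mem hw))

include hh in
theorem shorten_pow_mem (n : ℕ) {X Y : A.Obj} {d : ℤ} {w : TensorHom A.toGradedQuiver F X Y}
    (hw : w ∈ (tensorQuiver A.toGradedQuiver F).grade X Y d) :
    (shorten F h X Y ^ n) w ∈ (tensorQuiver A.toGradedQuiver F).grade X Y d := by
  induction n generalizing w with
  | zero => exact hw
  | succ n ih =>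
    rw [pow_succ, Module.End.mul_apply]
    refine ih ?_
    rw [shorten_apply]
    have h1 := dF_mem (headF_mem hh hw)
    have h2 := headF_mem hh (dF_mem hw)
    rw [neg_add_cancel_right] at h1
    rw [add_neg_cancel_right] at h2
    exact sub_mem hw (add_mem h1 h2)

include hc in
theorem projF_projF {X Y : A.Obj} (w : TensorHom A.toGradedQuiver F X Y) :
    projF F h X Y (projF F h X Y w) = projF F h X Y w := by
  have hw := projF_mem_words hc w
  rw [projF_words hc hw, shorten_pow_eq_self 1 hw]

include hc in
theorem projF_ofLetter {X Y : A.Obj} (x : A.shom X Y) :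
    projF F h X Y (ofLetter F X Y x) = ofLetter F X Y x := by
  rw [projF_words hc (ofLetter_mem_words (m := 0) x), shorten_pow_eq_self 1 (ofLetter_mem_words x)]

variable (F) in
/-- The projection of the quotient onto the words with one letter, as a map to the original
category. -/
def letterF (h : ∀ X Y, A.shom X Y →ₗ[k] A.shom X Y) (X Y : A.Obj) :
    TensorHom A.toGradedQuiver F X Y →ₗ[k] A.shom X Y :=
  (liftT ⟨_, (CocatHom.id A).app_multilinear X Y⟩ ∘ₗ toTPlus F X Y) ∘ₗ projF F h X Y

include hc in
theorem letterF_ofLetter {X Y : A.Obj} (x : A.shom X Y) :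
    letterF F h X Y (ofLetter F X Y x) = x := by
  rw [letterF, LinearMap.comp_apply, projF_ofLetter hc, LinearMap.comp_apply, toTPlus_ofLetter]
  exact liftT_pureT _ x (.nil Y)

include hc in
theorem letterF_projF {X Y : A.Obj} (w : TensorHom A.toGradedQuiver F X Y) :
    letterF F h X Y (projF F h X Y w) = letterF F h X Y w :=
  congrArg (liftT ⟨_, (CocatHom.id A).app_multilinear X Y⟩ ∘ₗ toTPlus F X Y) (projF_projF hc w)

include hc in
theorem ofLetter_letterF {X Y : A.Obj} (w : TensorHom A.toGradedQuiver F X Y) :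
    ofLetter F X Y (letterF F h X Y w) = projF F h X Y w := by
  obtain ⟨x, hx⟩ := exists_ofLetter (projF_mem_words hc w)
  have h1 : letterF F h X Y w = letterF F h X Y (ofLetter F X Y x) := by
    rw [hx, letterF_projF hc]
  rw [h1, letterF_ofLetter hc, hx]

include hh in
theorem projF_mem {X Y : A.Obj} {d : ℤ} {w : TensorHom A.toGradedQuiver F X Y}
    (hw : w ∈ (tensorQuiver A.toGradedQuiver F).grade X Y d) :
    projF F h X Y w ∈ (tensorQuiver A.toGradedQuiver F).grade X Y d :=
  lengthwise_mem _ (fun n _ hw => shorten_pow_mem hh n hw) hw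

include hh in
theorem homF_mem {X Y : A.Obj} {d : ℤ} {w : TensorHom A.toGradedQuiver F X Y}
    (hw : w ∈ (tensorQuiver A.toGradedQuiver F).grade X Y d) :
    homF F h X Y w ∈ (tensorQuiver A.toGradedQuiver F).grade X Y (d + -1) :=
  lengthwise_mem _ (fun n w hw => by
    rw [LinearMap.sum_apply]
    exact sum_mem fun i _ => headF_mem hh (shorten_pow_mem hh i hw)) hw

include hh in
theorem letterF_mem {X Y : A.Obj} {d : ℤ} {w : TensorHom A.toGradedQuiver F X Y}
    (hw : w ∈ (tensorQuiver A.toGradedQuiver F).grade X Y d) :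
    letterF F h X Y w ∈ A.grade X Y d :=
  liftT_mem (fun c hc => (CocatHom.id A).app_degree c d hc) (toTPlus_mem (projF_mem hh hw))

include hc in
theorem map_projF {X Y : A.Obj} (c : Chain (tensorQuiver A.toGradedQuiver F) X Y) :
    Chain.map (Q := tensorQuiver A.toGradedQuiver F) (R := tensorQuiver A.toGradedQuiver F)
        (fun X => X) (fun X Y => projF F h X Y) c =
      Chain.map (Q := A.toGradedQuiver) (R := tensorQuiver A.toGradedQuiver F) (fun X => X)
        (fun X Y => ofLetter F X Y) (Chain.map (Q := tensorQuiver A.toGradedQuiver F)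
          (R := A.toGradedQuiver) (fun X => X) (fun X Y => letterF F h X Y) c) := by
  refine Eq.trans ?_ (Chain.map_map (Q := tensorQuiver A.toGradedQuiver F) (R := A.toGradedQuiver)
    (S := tensorQuiver A.toGradedQuiver F) (fun X => X) (fun X Y => letterF F h X Y) (fun X => X)
    (fun X Y => ofLetter F X Y) c).symm
  simp only [ofLetter_letterF hc]

-- Projected arguments are letters, and the embedding of letters is strict, so the operations of the
-- quotient on them are those of `𝒞`.
include hc in
theorem quotientD_b_map_projF {X Y : A.Obj} (c : Chain (tensorQuiver A.toGradedQuiver F) X Y) :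
    (quotientD A F).b (Chain.map (Q := tensorQuiver A.toGradedQuiver F)
        (R := tensorQuiver A.toGradedQuiver F) (fun X => X) (fun X Y => projF F h X Y) c) =
      ofLetter F X Y (A.b (Chain.map (Q := tensorQuiver A.toGradedQuiver F)
        (R := A.toGradedQuiver) (fun X => X) (fun X Y => letterF F h X Y) c)) :=
  (congrArg (fun c : Chain (tensorQuiver A.toGradedQuiver F) X Y => (quotientD A F).b c)
    (map_projF hc c)).trans ((ofLetter_isStrict F).b _).symm

/-- The strong deformation retraction of the quotient onto the original category. -/
def retractD (hA : A.IsAInfCat) : Retract (quotientD A F) where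
  P := projF F h
  H := homF F h
  P_mem _ _ _ _ hw := projF_mem hh hw
  H_mem _ _ _ _ hw := homF_mem hh hw
  homotopy X Y w := by
    refine Eq.trans ?_ (homF_homotopy hc hA w)
    exact congrArg₂ (fun a b : TensorHom A.toGradedQuiver F X Y => a + b) (quotientD_b₁L _)
      (congrArg (homF F h X Y) (quotientD_b₁L w))
  -- A projected element is a letter, so only the summand `i = 0` of the homotopy is present, and
  -- `headF` kills letters.
  H_P X Y w := by
    have hw := projF_mem_words hc w
    obtain ⟨x, hx⟩ := exists_ofLetter hw
    refine (homF_words hc hw).trans ?_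
    rw [Finset.sum_range_one, pow_zero, Module.End.one_apply, ← hx]
    exact headF_ofLetter h x
  P_b {X Y} c := (congrArg (projF F h X Y) (quotientD_b_map_projF hc c)).trans
    ((projF_ofLetter hc _).trans (quotientD_b_map_projF hc c).symm)

theorem letterF_strictOn (hA : A.IsAInfCat) :
    (retractD hh hc hA).StrictOn (E := A) (fun X => X) (letterF F h) where
  mem _ _ _ _ hw := letterF_mem hh hw
  P _ _ w := letterF_projF hc w
  b {X Y} c := (congrArg (letterF F h X Y) (quotientD_b_map_projF hc c)).trans
    (letterF_ofLetter hc _)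

end Retraction

end AInf
end

noncomputable section

namespace AInf

open scoped TensorProduct DirectSum

variable {k : Type w} [CommRing k]

/-! ### Strict functors -/

section Strict

variable {A : PreAInfCat.{w, u₁, v₁} k} {B : PreAInfCat.{w, u₂, v₂} k}

theorem idApp_map (l : A.Obj → B.Obj) (τ : ∀ X Y, A.shom X Y →ₗ[k] B.shom (l X) (l Y)) {X Y : A.Obj}
    (c : Chain A.toGradedQuiver X Y) :
    CocatHom.idApp B (Chain.map l (fun X Y => τ X Y) c) = τ X Y (CocatHom.idApp A c) := by
  cases c with
  | nil => exact (map_zero (τ _ _)).symm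
  | cons x c =>
    cases c with
    | nil => rfl
    | cons y c => exact (map_zero (τ _ _)).symm

theorem Chain.map_id {Q : GradedQuiver.{w, u, v} k} {X Y : Q.Obj} (c : Chain Q X Y) :
    Chain.map (fun X => X) (fun _ _ x => x) c = c := by
  induction c with
  | nil => rfl
  | cons x c ih => exact congrArg (Chain.cons x) ih

theorem Chain.map_map_self {Q : GradedQuiver.{w, u₁, v₁} k} {R : GradedQuiver.{w, u₂, v₂} k}
    {φ : Q.Obj → R.Obj} {g : ∀ X Y, Q.shom X Y → R.shom (φ X) (φ Y)}
    {p : ∀ X Y, R.shom X Y → R.shom X Y} (hp : ∀ X Y x, p _ _ (g X Y x) = g X Y x) {X Y : Q.Obj}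
    (c : Chain Q X Y) : Chain.map (fun X => X) p (Chain.map φ g c) = Chain.map φ g c := by
  induction c with
  | nil => rfl
  | cons x c ih => exact congrArg₂ Chain.cons (hp _ _ x) ih

/-- The second quiver is built on the object type of `Q` itself, so that going there and back gives
a chain of the same type without transport. -/
theorem Chain.map_leftInverse {Q : GradedQuiver.{w, u, v₁} k} {S : Q.Obj → Q.Obj → Type v₂}
    [∀ X Y, AddCommGroup (S X Y)] [∀ X Y, Module k (S X Y)] {gr} {hgr}
    {g : ∀ X Y, Q.shom X Y → S X Y} {p : ∀ X Y, S X Y → Q.shom X Y}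
    (hp : ∀ X Y x, p X Y (g X Y x) = x) {X Y : Q.Obj} (c : Chain Q X Y) :
    Chain.map (Q := ⟨Q.Obj, S, gr, hgr⟩) (R := Q) (fun X => X) p
      (Chain.map (Q := Q) (R := ⟨Q.Obj, S, gr, hgr⟩) (fun X => X) g c) = c := by
  induction c with
  | nil => rfl
  | cons x c ih => exact congrArg₂ Chain.cons (hp _ _ x) ih

theorem isStrict_id (A : PreAInfCat.{w, u, v} k) :
    IsStrict (E := A) (B := A) (fun X => X) (fun _ _ => LinearMap.id) where
  mem _ _ _ _ hx := hx
  b c := congrArg A.b (Chain.map_id c).symm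

/-- The trivial retraction. -/
def Retract.refl (A : PreAInfCat.{w, u, v} k) : Retract A where
  P _ _ := LinearMap.id
  H _ _ := 0
  P_mem _ _ _ _ hx := hx
  H_mem _ _ _ _ _ := zero_mem _
  homotopy X Y x := by simp
  H_P _ _ _ := rfl
  P_b _ := rfl

theorem Retract.proj_refl {X Y : A.Obj} (c : Chain A.toGradedQuiver X Y) :
    (Retract.refl A).proj c = c := Chain.map_id c

/-- A strict functor is strict on the image of the trivial retraction, so the computation for
projected chains applies to all chains. -/
theorem CocatHom.lsum_blocks_linear {f : CocatHom A B}
    {τ : ∀ X Y, A.shom X Y →ₗ[k] B.shom (f.obj X) (f.obj Y)}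
    (hf : ∀ {X Y : A.Obj} (c : Chain A.toGradedQuiver X Y), f.app c = τ X Y (CocatHom.idApp A c))
    {M : Type*} [AddCommGroup M] [Module k M] {X Y : A.Obj} (c : Chain A.toGradedQuiver X Y)
    {φ : Chain B.toGradedQuiver (f.obj X) (f.obj Y) → M} (hφ : φ ∈ MultiFun B.toGradedQuiver _ _ M) :
    lsum (f.blocks c) φ = φ (Chain.map f.obj (fun X Y => τ X Y) c) := by
  have h := (Retract.refl A).lsum_blocks_proj (f := f) (ρ := τ)
    (fun c => by rw [Retract.proj_refl]; exact hf c) c hφ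
  rwa [Retract.proj_refl] at h

theorem CocatHom.isAInfFunctor_of_isStrict {f : CocatHom A B}
    {τ : ∀ X Y, A.shom X Y →ₗ[k] B.shom (f.obj X) (f.obj Y)} (hτ : IsStrict f.obj τ)
    (hf : ∀ {X Y : A.Obj} (c : Chain A.toGradedQuiver X Y), f.app c = τ X Y (CocatHom.idApp A c)) :
    f.IsAInfFunctor := by
  intro X Y c
  refine (CocatHom.lsum_blocks_linear hf c (B.b_multilinear _ _)).trans ((hτ.b c).symm.trans ?_)
  refine (lsum_bTerms_linear_idApp (τ X Y) c).symm.trans ?_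
  exact lsum_congr fun z _ => (hf z).symm

end Strict


section Strict

variable {D : PreAInfCat.{w, u₁, v₁} k} {E : PreAInfCat.{w, u₂, v₂} k}
  {B : PreAInfCat.{w, u₃, v₃} k} {l : E.Obj → B.Obj}
  {τ : ∀ X Y, E.shom X Y →ₗ[k] B.shom (l X) (l Y)} (hτ : IsStrict l τ) {R : Retract D}
  {s : D.Obj → E.Obj} {σ : ∀ X Y, D.shom X Y →ₗ[k] E.shom (s X) (s Y)} (hσ : R.StrictOn s σ)

include hτ in
theorem IsStrict.b₁L {X Y : E.Obj} (x : E.shom X Y) :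
    B.b₁L (l X) (l Y) (τ X Y x) = τ X Y (E.b₁L X Y x) :=
  (hτ.b (.single x)).symm

include hτ in
theorem IsStrict.sgn (p : ℤ) {X Y : E.Obj} (x : E.shom X Y) :
    B.sgn p (l X) (l Y) (τ X Y x) = τ X Y (E.sgn p X Y x) := by
  refine ((GradedQuiver.map_sgn (τ X Y) 0 (fun d x hx => ?_) p x).trans ?_).symm
  · rw [add_zero]
    exact hτ.mem _ _ _ _ hx
  · rw [mul_zero, koszul_zero, one_smul]

include hτ in
theorem IsStrict.leftMul {X Y : E.Obj} (e : E.shom X X) (x : E.shom X Y) :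
    leftMul (τ X X e) (l Y) (τ X Y x) =
      τ X Y (E.b (.cons e (.single (E.sgn (-1) X Y x)))) := by
  rw [hτ.b, leftMul_apply, hτ.sgn]
  rfl

include hτ in
theorem IsStrict.rightMul {X Y : E.Obj} (e : E.shom Y Y) (x : E.shom X Y) :
    rightMul (l X) (τ Y Y e) (τ X Y x) = τ X Y (E.b (.cons x (.single e))) := by
  rw [hτ.b]
  rfl

include hσ in
theorem Retract.StrictOn.b₁L (hD : D.IsAInfCat) {X Y : D.Obj} (x : D.shom X Y) :
    E.b₁L (s X) (s Y) (σ X Y x) = σ X Y (D.b₁L X Y x) := by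
  refine (hσ.b (.single x)).symm.trans ?_
  refine (congrArg (σ X Y) (R.b₁L_P hD X Y x)).trans ?_
  exact hσ.P _ _ _

end Strict

theorem TransEquiv.whiskerLeft_id {A : PreAInfCat.{w, u₁, v₁} k} {B : PreAInfCat.{w, u₂, v₂} k}
    {f g : CocatHom A B} (r : Coder f g (-1)) :
    Coder.whiskerLeft (CocatHom.id A) r = r.app := by
  funext X Y c
  exact lsum_blocks_id c (r.app_multilinear X Y)

/-- The strict functor with first component `τ`. -/
def IsStrict.cocat {A : PreAInfCat.{w, u₁, v₁} k} {B : PreAInfCat.{w, u₂, v₂} k} {l : A.Obj → B.Obj}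
    {τ : ∀ X Y, A.shom X Y →ₗ[k] B.shom (l X) (l Y)} (hτ : IsStrict l τ) : CocatHom A B where
  obj := l
  app {X Y} c := τ X Y (CocatHom.idApp A c)
  app_multilinear X Y := MultiFun.comp_linear ((CocatHom.id A).app_multilinear X Y) (τ X Y)
  app_nil X := map_zero (τ X X)
  app_degree c d hc := hτ.mem _ _ _ _ ((CocatHom.id A).app_degree c d hc)

/-! ### Strict embeddings which are deformation retracts -/

/-- An `A∞`-structure (without the equation `b² = 0`) with given set of objects. -/
structure AInfOps (k : Type w) [CommRing k] (O : Type u) where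
  shom : O → O → Type v
  [instAddCommGroup : ∀ X Y, AddCommGroup (shom X Y)]
  [instModule : ∀ X Y, Module k (shom X Y)]
  grade : ∀ X Y, ℤ → Submodule k (shom X Y)
  isInternal : ∀ X Y, DirectSum.IsInternal (grade X Y)
  b : ∀ {X Y : O}, Chain (GradedQuiver.mk O shom grade isInternal) X Y → shom X Y
  b_multilinear : ∀ X Y, (b : Chain (GradedQuiver.mk O shom grade isInternal) X Y → shom X Y) ∈
    MultiFun (GradedQuiver.mk O shom grade isInternal) X Y (shom X Y)
  b_nil : ∀ X, b (.nil X) = 0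
  b_degree : ∀ {X Y : O} (c : Chain (GradedQuiver.mk O shom grade isInternal) X Y) (d : ℤ),
    c.HasDegree d → b c ∈ grade X Y (d + 1)

attribute [instance] AInfOps.instAddCommGroup AInfOps.instModule

/-- The underlying quiver with coderivation. -/
abbrev AInfOps.cat {O : Type u} (D : AInfOps.{w, u, v} k O) : PreAInfCat.{w, u, v} k where
  Obj := O
  shom := D.shom
  grade := D.grade
  isInternal := D.isInternal
  b := D.b
  b_multilinear := D.b_multilinear
  b_nil := D.b_nil
  b_degree := D.b_degree

section Deformation

variable {A : PreAInfCat.{w, u, v} k} {D : AInfOps.{w, u, v₁} k A.Obj}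

/-- The data of a strict embedding `j`, identical on objects, whose image is the image of the
projection of a retraction. -/
structure StrictEmbedding (R : Retract D.cat) (j : ∀ X Y, A.shom X Y →ₗ[k] D.shom X Y)
    (σ : ∀ X Y, D.shom X Y →ₗ[k] A.shom X Y) : Prop where
  isStrict : IsStrict (E := A) (B := D.cat) (fun X => X) j
  strictOn : R.StrictOn (E := A) (fun X => X) σ
  σ_j : ∀ X Y x, σ X Y (j X Y x) = x
  j_σ : ∀ X Y x, j X Y (σ X Y x) = R.P X Y x

variable {R : Retract D.cat} {j : ∀ X Y, A.shom X Y →ₗ[k] D.shom X Y}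
  {σ : ∀ X Y, D.shom X Y →ₗ[k] A.shom X Y}
  (hj : StrictEmbedding R j σ)

namespace StrictEmbedding

/-- The chain of images under `j`. -/
abbrev jMap (j : ∀ X Y, A.shom X Y →ₗ[k] D.shom X Y) {X Y : A.Obj} (c : Chain A.toGradedQuiver X Y) :
    Chain D.cat.toGradedQuiver X Y :=
  Chain.map (Q := A.toGradedQuiver) (R := D.cat.toGradedQuiver) (fun X => X) (fun X Y => j X Y) c

/-- The chain of images under `σ`. -/
abbrev σMap (σ : ∀ X Y, D.shom X Y →ₗ[k] A.shom X Y) {X Y : A.Obj}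
    (c : Chain D.cat.toGradedQuiver X Y) : Chain A.toGradedQuiver X Y :=
  Chain.map (Q := D.cat.toGradedQuiver) (R := A.toGradedQuiver) (fun X => X) (fun X Y => σ X Y) c

theorem isAInfFunctor : (hj.isStrict.cocat).IsAInfFunctor :=
  CocatHom.isAInfFunctor_of_isStrict hj.isStrict fun _ => rfl

theorem lsum_blocks {M : Type*} [AddCommGroup M] [Module k M] {X Y : A.Obj}
    (c : Chain A.toGradedQuiver X Y) {φ : Chain D.cat.toGradedQuiver X Y → M}
    (hφ : φ ∈ MultiFun D.cat.toGradedQuiver X Y M) :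
    lsum (hj.isStrict.cocat.blocks c) φ = φ (jMap j c) :=
  CocatHom.lsum_blocks_linear (f := hj.isStrict.cocat) (τ := j) (fun _ => rfl) c hφ

include hj in
theorem proj_map {X Y : A.Obj} (c : Chain A.toGradedQuiver X Y) : R.proj (jMap j c) = jMap j c :=
  Chain.map_map_self (Q := A.toGradedQuiver) (R := D.cat.toGradedQuiver)
    (fun X Y x => by rw [← hj.j_σ, hj.σ_j]) c

include hj in
theorem map_map {X Y : A.Obj} (c : Chain A.toGradedQuiver X Y) : σMap σ (jMap j c) = c :=
  Chain.map_leftInverse (Q := A.toGradedQuiver) hj.σ_j c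

-- The identity functor is strict, and on the image of the projection it is `jσ` because `jσ = P`.
include hj in
theorem over_id : Over R (B := D.cat) σ (l := fun X => X) j fun _ _ c => CocatHom.idApp D.cat c where
  isHom := (CocatHom.id D.cat).isHom
  nil _ := rfl
  proj c := (idApp_map (A := D.cat) (B := D.cat) (fun X => X) R.P c).trans (hj.j_σ _ _ _).symm

include hj in
theorem exists_over (hA : A.IsAInfCat) (hD : D.cat.IsAInfCat) :
    ∃ (G : Components D.cat A (fun X => X) (fun X => X))
      (hG : Over R σ (l := fun X => X) (fun _ _ => LinearMap.id) G), hG.cocat.IsAInfFunctor := by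
  obtain ⟨G, hG, h0, hG', hp⟩ := R.exists_functor hD hA (fun X => X) σ hj.strictOn.mem
    hj.strictOn.P hj.strictOn.b
  exact ⟨G, ⟨hG, h0, hp⟩, hG'⟩

variable {G : Components D.cat A (fun X => X) (fun X => X)}
  (hG : Over R σ (l := fun X => X) (fun _ _ => LinearMap.id) G)

theorem lsum_blocks_over {M : Type*} [AddCommGroup M] [Module k M] {X Y : A.Obj}
    (c : Chain D.cat.toGradedQuiver X Y) {φ : Chain A.toGradedQuiver X Y → M}
    (hφ : φ ∈ MultiFun A.toGradedQuiver X Y M) :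
    lsum (hG.cocat.blocks (R.proj c)) φ = φ (σMap σ c) :=
  (hG.lsum_blocks_proj c hφ).trans (congrArg φ (Chain.map_id _))

/-- `G` is given by `σ` on projected chains, so after `j` it is given by `jσ`, exactly like the
identity. This common restriction is what makes the two functors comparable. -/
theorem over_comp : Over R (B := D.cat) σ (l := fun X => X) j
    fun _ _ c => (hG.cocat.comp hj.isStrict.cocat).app c where
  isHom := (hG.cocat.comp hj.isStrict.cocat).isHom
  nil := (hG.cocat.comp hj.isStrict.cocat).app_nil
  proj {X Y} c := (lsum_blocks_over hG c (hj.isStrict.cocat.app_multilinear X Y)).trans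
    (congrArg (j X Y) (idApp_map (A := D.cat) (B := A) (fun X => X) σ c))

include hj hG in
theorem app_map {X Y : A.Obj} (c : Chain A.toGradedQuiver X Y) : G (jMap j c) = CocatHom.idApp A c := by
  rw [← hj.proj_map, hG.proj]
  refine (idApp_map (A := D.cat) (B := A) (fun X => X) σ (jMap j c)).symm.trans ?_
  exact congrArg (CocatHom.idApp A) (hj.map_map c)

/-- The image of `j` consists of projected chains, where `G` is prescribed exactly and not only up
to homotopy; with `σj = 1` this gives an equality of functors. -/
theorem cocat_comp : hj.isStrict.cocat.comp hG.cocat = CocatHom.id A := by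
  refine (CocatHom.mk.injEq ..).mpr ⟨rfl, heq_of_eq ?_⟩
  funext X Y c
  exact (hj.lsum_blocks c (hG.cocat.app_multilinear X Y)).trans (hj.app_map hG c)

end StrictEmbedding

end Deformation

end AInf
end

noncomputable section

namespace AInf

open scoped TensorProduct DirectSum

variable {k : Type w} [CommRing k]

/-! ### Units and the quasi-inverse functor -/

section Deformation

variable {A : PreAInfCat.{w, u, v} k} {D : AInfOps.{w, u, v₁} k A.Obj}
  {R : Retract D.cat} {j : ∀ X Y, A.shom X Y →ₗ[k] D.shom X Y}
  {σ : ∀ X Y, D.shom X Y →ₗ[k] A.shom X Y} (hj : StrictEmbedding R j σ)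
  (hA : A.IsAInfCat) (hD : D.cat.IsAInfCat) {i : Coder (CocatHom.id A) (CocatHom.id A) (-1)}
  (hi : IsUnitTransformation i)

namespace StrictEmbedding

include hj hD in
theorem isHomotopyInvertible {X Y : A.Obj} {Φ : D.cat.shom X Y →ₗ[k] D.cat.shom X Y}
    {Ψ : A.shom X Y → A.shom X Y} (hΦ : HasMapDegree D.cat (X := X) (Y := Y) 0 Φ)
    (Φb : ∀ x, D.cat.b₁L X Y (Φ x) = Φ (D.cat.b₁L X Y x))
    (hΦΨ : ∀ x, Φ (j X Y x) = j X Y (Ψ x)) (H : IsHomotopyInvertible A Ψ) :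
    IsHomotopyInvertible D.cat (X := X) (Y := Y) (fun x => Φ x) :=
  IsHomotopyInvertible.of_retract (A := D.cat) (R := R) (X := X) (Y := Y) (j := j X Y) (σ := σ X Y)
    (hj.isStrict.mem X Y) (hj.strictOn.mem X Y) (fun x => hj.isStrict.b₁L x)
    (fun x => hj.strictOn.b₁L hD x) (fun x => (hj.j_σ X Y x).symm) (hj.σ_j X Y) hΦ Φb hΦΨ H

-- The unit of `A` lifts from projected chains to a natural transformation. It is idempotent up to
-- equivalence because its restriction is, and multiplication by its value at an object is homotopy
-- invertible because on the image of `j` it is multiplication by the unit of `A`.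
include hj hD hi in
theorem exists_unitTransformation : ∃ i' : Coder (CocatHom.id D.cat) (CocatHom.id D.cat) (-1),
    IsUnitTransformation i' ∧ ∀ {X Y : A.Obj} (c : Chain D.cat.toGradedQuiver X Y),
      i'.app (R.proj c) = j X Y (i.app (σMap σ c)) := by
  have hid : (CocatHom.id D.cat).IsAInfFunctor := CocatHom.isAInfFunctor_id
  obtain ⟨i', hi', hp⟩ := Over.exists_lift hD hD hj.over_id hj.over_id hid hid hj.strictOn
    hj.isStrict hi.natural
  have hnil : ∀ X : A.Obj, i'.app (.nil (Q := D.cat.toGradedQuiver) X) = j X X (i.app (.nil X)) :=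
    fun X => hp (.nil (Q := D.cat.toGradedQuiver) X)
  have hmem : ∀ X : A.Obj, i'.app (.nil (Q := D.cat.toGradedQuiver) X) ∈ D.cat.grade X X (-1) :=
    fun X => by
      have := i'.app_degree _ _ (.nil (Q := D.cat.toGradedQuiver) X)
      rwa [zero_add] at this
  have hb : ∀ X : A.Obj, D.cat.b₁L X X (i'.app (.nil (Q := D.cat.toGradedQuiver) X)) = 0 :=
    fun X => hi'.b₁_app_nil X
  refine ⟨i', ⟨hi', ?_, fun X Y => ?_, fun X Y => ?_⟩, hp⟩
  · exact Over.transEquiv hD hD hj.over_id hj.over_id hid hid hj.strictOn hj.isStrict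
      (r := i'.mul i') (q := i') (Coder.IsNatural.mul hi' hi' hD hid hid hid) hi'
      (fun c => Over.B₂_proj (hF := hj.over_id) (hG := hj.over_id) (hK := hj.over_id) hj.strictOn
        hj.isStrict hp hp c) hp hi.idempotent
  · refine hj.isHomotopyInvertible hD (Φ := leftMul (A := D.cat) (i'.app (.nil X)) Y)
      (leftMul_mem (hmem X)) (fun x => b₁_leftMul hD (hb X) x) (fun x => ?_) (hi.left X Y)
    rw [hnil]
    exact hj.isStrict.leftMul (i.app (.nil (Q := A.toGradedQuiver) X)) x
  · refine hj.isHomotopyInvertible hD (Φ := rightMul (A := D.cat) X (i'.app (.nil Y)))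
      (rightMul_mem (hmem Y)) (fun x => b₁_rightMul hD (hb Y) (hmem Y) x) (fun x => ?_)
      (hi.right X Y)
    rw [hnil]
    exact hj.isStrict.rightMul (i.app (.nil (Q := A.toGradedQuiver) Y)) x

variable {i' : Coder (CocatHom.id D.cat) (CocatHom.id D.cat) (-1)} (hi' : IsUnitTransformation i')
  (hp : ∀ {X Y : A.Obj} (c : Chain D.cat.toGradedQuiver X Y),
    i'.app (R.proj c) = j X Y (i.app (σMap σ c)))

include hj hp in
theorem unit_app_map {X Y : A.Obj} (c : Chain A.toGradedQuiver X Y) :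
    i'.app (jMap j c) = j X Y (i.app c) := by
  rw [← hj.proj_map, hp]
  exact congrArg (fun c => j X Y (i.app c)) (hj.map_map c)

-- The two whiskered transformations coincide exactly: on chains from `A` the lifted unit is `j` of
-- the unit.
include hA hD hi hi' hp in
theorem isUnitalFunctor : hj.isStrict.cocat.IsUnitalFunctor := by
  refine ⟨hA, hD, hj.isAInfFunctor, i, i', hi, hi', TransEquiv.of_eq ?_⟩
  funext X Y c
  refine Eq.trans ?_ (hj.lsum_blocks c (i'.app_multilinear X Y)).symm
  refine Eq.trans ?_ (hj.unit_app_map hp c).symm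
  refine (map_lsum (j X Y).toAddMonoidHom _ _).symm.trans ?_
  exact congrArg (j X Y) (i.lsum_terms_idApp c)

theorem isomorphic_id {C : PreAInfCat.{w, u, v} k} {i : Coder (CocatHom.id C) (CocatHom.id C) (-1)}
    (hi : IsUnitTransformation i) : (CocatHom.id C).Isomorphic (CocatHom.id C) := by
  refine ⟨i, i, i, hi, hi.natural, hi.natural, ?_, ?_⟩ <;>
  · rw [TransEquiv.whiskerLeft_id]
    exact hi.idempotent

variable {G : Components D.cat A (fun X => X) (fun X => X)}
  (hG : Over R σ (l := fun X => X) (fun _ _ => LinearMap.id) G) (hG' : hG.cocat.IsAInfFunctor)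

-- Both whiskered transformations are natural and restrict to the unit of `A` on projected chains,
-- which decides their equivalence.
include hj hA hD hi hi' hp hG' in
theorem isUnitalFunctor_over : hG.cocat.IsUnitalFunctor := by
  refine ⟨hD, hA, hG', i', i, hi', hi, ?_⟩
  have hid : (CocatHom.id D.cat).IsAInfFunctor := CocatHom.isAInfFunctor_id
  obtain ⟨r, hr, er⟩ := Coder.exists_natural_of_eq (CocatHom.id_comp hG.cocat)
    (CocatHom.id_comp hG.cocat) (Coder.IsNatural.whiskRight hi'.natural hid hid hG')
  obtain ⟨q, hq, eq⟩ := Coder.exists_natural_of_eq (CocatHom.comp_id hG.cocat)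
    (CocatHom.comp_id hG.cocat) (Coder.IsNatural.whiskLeft hi.natural hG')
  have er' : r.app = i'.whiskerRight hG.cocat := eq_of_heq er
  have eq' : q.app = Coder.whiskerLeft hG.cocat i := eq_of_heq eq
  have h1 : TransEquiv (CocatHom.id A) (CocatHom.id A) i.app i.app := TransEquiv.of_eq rfl
  have h2 := Over.transEquiv hD hA hG hG hG' hG' hj.strictOn (isStrict_id A) hr hq (r' := i.app)
    (q' := i.app) (fun {X Y} c => ?_) (fun {X Y} c => ?_) h1
  · rw [er', eq'] at h2
    exact h2
  · rw [er']
    refine (Over.lsum_terms_proj (hF := hj.over_id) (hG := hj.over_id) (v := i') (w := i)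
      hj.strictOn hp c (hG.cocat.app_multilinear X Y)).trans ?_
    refine Eq.trans (lsum_congr fun z _ => hj.app_map hG z) ?_
    exact i.lsum_terms_idApp _
  · rw [eq']
    exact lsum_blocks_over hG c (i.app_multilinear X Y)

-- The composite and the identity have the same restriction to projected chains, so the unit `i` of
-- `A` lifts to transformations in both directions. Their products restrict to `(i ⊗ i)B₂`, the
-- identities of the two functors restrict to `i`, and `(i ⊗ i)B₂ ≡ i`.
include hD hi hi' hp hG' in
theorem isomorphic_comp : (hG.cocat.comp hj.isStrict.cocat).Isomorphic (CocatHom.id D.cat) := by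
  have hid : (CocatHom.id D.cat).IsAInfFunctor := CocatHom.isAInfFunctor_id
  have hf : (hG.cocat.comp hj.isStrict.cocat).IsAInfFunctor := hG'.comp hj.isAInfFunctor
  have hO := hj.over_comp hG
  obtain ⟨r, hr, er⟩ := Over.exists_lift hD hD hO hj.over_id hf hid hj.strictOn
    hj.isStrict hi.natural
  obtain ⟨q, hq, eq⟩ := Over.exists_lift hD hD hj.over_id hO hid hf hj.strictOn
    hj.isStrict hi.natural
  refine ⟨i', r, q, hi', hr, hq, ?_, ?_⟩
  · obtain ⟨t, ht, et⟩ := Coder.exists_natural_of_eq (CocatHom.comp_id _)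
      (CocatHom.comp_id _) (Coder.IsNatural.whiskLeft hi'.natural hf)
    have et' : t.app = Coder.whiskerLeft (hG.cocat.comp hj.isStrict.cocat) i' := eq_of_heq et
    have h2 := Over.transEquiv hD hD hO hO hf hf hj.strictOn hj.isStrict (r := r.mul q) (q := t)
      (Coder.IsNatural.mul hr hq hD hf hid hf) ht (r' := i.B₂ i) (q' := i.app)
      (fun c => Over.B₂_proj (hF := hO) (hG := hj.over_id) (hK := hO) hj.strictOn
        hj.isStrict er eq c) (fun {X Y} c => ?_) hi.idempotent
    · rw [et'] at h2
      exact h2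
    · rw [et']
      refine (hO.lsum_blocks_proj c (i'.app_multilinear X Y)).trans ?_
      exact hj.unit_app_map hp _
  · rw [TransEquiv.whiskerLeft_id]
    exact Over.transEquiv hD hD hj.over_id hj.over_id hid hid hj.strictOn hj.isStrict
      (r := q.mul r) (q := i') (Coder.IsNatural.mul hq hr hD hid hf hid) hi'.natural
      (fun c => Over.B₂_proj (hF := hj.over_id) (hG := hO) (hK := hj.over_id) hj.strictOn
        hj.isStrict eq er c) hp hi.idempotent

include hA hD hi in
/-- A strict embedding whose image is a strong deformation retract has a strict left inverse which
is a quasi-inverse. -/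
theorem exists_quasiInverse : D.cat.IsUnital ∧ ∃ π : CocatHom D.cat A,
    IsQuasiInverse hj.isStrict.cocat π ∧ IsQuasiInverse π hj.isStrict.cocat ∧
    hj.isStrict.cocat.comp π = CocatHom.id A := by
  obtain ⟨i', hi', hp⟩ := hj.exists_unitTransformation hD hi
  obtain ⟨G, hG, hG'⟩ := hj.exists_over hA hD
  have h1 := hj.isUnitalFunctor hA hD hi hi' hp
  have h2 := hj.isUnitalFunctor_over hA hD hi hi' hp hG hG'
  have h3 := hj.cocat_comp hG
  have h4 : (hj.isStrict.cocat.comp hG.cocat).Isomorphic (CocatHom.id A) := by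
    rw [h3]
    exact isomorphic_id hi
  have h5 := hj.isomorphic_comp hD hi hi' hp hG hG'
  exact ⟨⟨hD, i', hi'⟩, hG.cocat, ⟨h1, h2, h4, h5⟩, ⟨h2, h1, h5, h4⟩, h3⟩

end StrictEmbedding

end Deformation

/-! ### The quotient by a contractible subcategory -/

section Quotient

variable {A : PreAInfCat.{w, u, v} k} {F : Set A.Obj}
  {h : ∀ X Y, A.shom X Y →ₗ[k] A.shom X Y}
  (hh : ∀ X Y d, ∀ x ∈ A.grade X Y d, h X Y x ∈ A.grade X Y (d + -1))
  (hc : ∀ X, ∀ Y ∈ F, ∀ x, A.b₁L X Y (h X Y x) + h X Y (A.b₁L X Y x) = x)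
  (hA : A.IsAInfCat)

/-- The operations of the quotient. -/
@[reducible] def quotientOps (A : PreAInfCat.{w, u, v} k) (F : Set A.Obj) : AInfOps k A.Obj where
  shom := TensorHom A.toGradedQuiver F
  grade := (tensorQuiver A.toGradedQuiver F).grade
  isInternal := (tensorQuiver A.toGradedQuiver F).isInternal
  b := (quotientD A F).b
  b_multilinear := (quotientD A F).b_multilinear
  b_nil := (quotientD A F).b_nil
  b_degree := (quotientD A F).b_degree

/-- The retraction of the quotient to one-letter words. -/
def retractOps : Retract (quotientOps A F).cat := retractD hh hc hA

theorem ofLetter_isStrict_ops : IsStrict (E := A) (B := (quotientOps A F).cat) (fun X => X)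
    (ofLetter F) := ofLetter_isStrict F

theorem letterF_strictOn_ops :
    (retractOps hh hc hA).StrictOn (E := A) (fun X => X) (letterF F h) :=
  letterF_strictOn hh hc hA

theorem ofLetter_letterF_ops (X Y : A.Obj) (w : TensorHom A.toGradedQuiver F X Y) :
    ofLetter F X Y (letterF F h X Y w) = (retractOps hh hc hA).P X Y w :=
  ofLetter_letterF hc w

theorem strictEmbedding_ofLetter :
    StrictEmbedding (D := quotientOps A F) (retractOps hh hc hA) (ofLetter F) (letterF F h) where
  isStrict := ofLetter_isStrict_ops
  strictOn := letterF_strictOn_ops hh hc hA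
  σ_j X Y x := by
    have := letterF_ofLetter (F := F) hc x
    with_reducible_and_instances exact this
  j_σ := ofLetter_letterF_ops hh hc hA

theorem quotientD_quasiInverse (hA : A.IsUnital) (hF : A.IsContractibleOn F) :
    (quotientD A F).IsUnital ∧ ∃ π : CocatHom (quotientD A F) A,
      IsQuasiInverse (embeddingD A F) π ∧ IsQuasiInverse π (embeddingD A F) ∧
      (embeddingD A F).comp π = CocatHom.id A := by
  obtain ⟨h, hh, hc⟩ := hA.exists_contraction hF
  obtain ⟨hA, i, hi⟩ := hA
  exact (strictEmbedding_ofLetter hh hc hA).exists_quasiInverse hA (quotientD_isAInfCat F hA) hi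

end Quotient

end AInf
end

/-! ### The proposition. -/

theorem mainTheorem7 {k : Type w} [CommRing k] (E : AInf.PreAInfCat.{w, u, v} k)
    (hE : E.IsUnital) (F : Set E.Obj) (hF : E.IsContractibleOn F) :
    (AInf.quotientD E F).IsUnital ∧
    (∃ π : AInf.CocatHom (AInf.quotientD E F) E,
      π.IsUnitalFunctor ∧
      AInf.IsQuasiInverse (AInf.embeddingD E F) π ∧
      (AInf.embeddingD E F).comp π = AInf.CocatHom.id E) ∧
    AInf.AInfEquivalent (AInf.quotientD E F) E := by
  obtain ⟨hD, π, h1, h2, h3⟩ := AInf.quotientD_quasiInverse hE hF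
  -- The equivalence runs from the quotient to `E`, so it uses the quasi-inverse relation with `π`
  -- in the first place.
  exact ⟨hD, ⟨π, h1.unital_right, h1, h3⟩, π, _, h2⟩
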